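/- **Setting.** Let $U\subset\mathbb R^2$ be open, $I\subset\mathbb R$ an open interval, $v_0\in I$, $G>0$, $\Lambda\in\mathbb R$, and let $n\ge 2$. Consider smooth four-dimensional Lorentzian metrics $g$ of signature $(-,+,+,+)$ on open sets $\mathcal M'\subset\mathbb R^4$ with coordinates $(x^1,x^2,v,r)$, where $\mathcal M'$ is made of radial segments starting on the horizon patch $\mathcal H=\{r=0,\ x\in U,\ v\in I\}\subset\mathcal M'$, such that: * (matter) $R_{ab}-\tfrac12 R\,g_{ab}+\Lambda g_{ab}=8\pi G\,T_{ab}$ for an arbitrary $T_{ab}$; * (non-expanding horizon) $\mathcal H$ is a null hypersurface with null normal $\ell=\partial_v$; $q^{AB}\partial_v q_{AB}=0$ on $\mathcal H$, where $q_{AB}=g_{AB}|_{\mathcal H}$; for every future-oriented null vector $X$ tangent to $\mathcal H$ the vector $-T^a{}_bX^b$ is causal and future oriented (or zero); and $\nabla_\ell\ell=\kappa\,\ell$ on $\mathcal H$ with a constant $\kappa$ (the surface gravity); * (Bondi-like coordinates) $n=-\partial_r$ satisfies $\nabla_nn=0$ on $\mathcal M'$, and on $\mathcal H$ it is null and its covector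 pulls back to $-dv$; * (adapted frame) $(e_1,e_2,e_3,e_4)=(m,\bar m,n,\ell)$ is a smooth null frame on $\mathcal M'$ whose only non-zero products are $g(m,\bar m)=1$, $g(n,\ell)=-1$; it is parallel along $n$; on $\mathcal H$, $\ell=\partial_v$, and $m=m^A\partial_A$ is tangent to the slices $v=\mathrm{const}$ and Lie dragged by $\ell$. Put $\mu=g(\bar m,\nabla_m n)$, $\lambda=g(\bar m,\nabla_{\bar m}n)$, $\pi=g(\bar m,\nabla_\ell n)$, $\Phi_{11}=-\frac14(R_{n\ell}+R_{m\bar m})$, $\Phi_{20}=-\frac12R_{\bar m\bar m}$, $\Phi_{21}=-\frac12R_{n\bar m}$, $\Phi_{22}=-\frac12R_{nn}$, $\Psi_4=-C_{n\bar mn\bar m}$, with $R_{ab}$, $R$, $C_{abcd}$ the Ricci tensor, the Ricci scalar and the Weyl tensor. **Data of order $n$:** 1. the constant $\kappa$; 2. on the slice $\{v=v_0,\ r=0\}$: $m^A$, $\pi$, $\mu$, $\lambda$, and $\partial_r^k\Psi_4$ for $0\le k\le n-2$; 3. on all of $\mathcal H$: $\Phi_{11}$; $\partial_r^k\Phi_{21}$,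 $\partial_r^k\Phi_{22}$, $\partial_r^kR$ for $0\le k\le n-2$; and $\partial_r^k\Phi_{20}$ for $0\le k\le n-1$. **Theorem.** (a) The data determine the frame to order $n$: if two such spacetime neighbourhoods (over the same $U,I$) have the same data, then at every point of $\mathcal H$ all coordinate components of $\partial_r^ke_1,\dots,\partial_r^ke_4$, $0\le k\le n$, agree. (b) The data are free: let $\kappa\in\mathbb R$ and smooth functions in the places of all other items of the data be given, with those for $\mu,\Phi_{11},\partial_r^k\Phi_{22},\partial_r^kR$ real, with $m$, $\bar m$ linearly independent at each point, and with $\frac14R-2\Phi_{11}\ge\Lambda$ on $\mathcal H$ (the energy condition). Then there is such a spacetime neighbourhood with exactly these data. -/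

import Mathlib

open scoped ContDiff ComplexConjugate

noncomputable section

namespace NEH

/-- Points of a Bondi-like coordinate patch; the coordinates `0, 1, 2, 3` are `x¹, x², v, r`. -/
abbrev Pt := Fin 4 → ℝ

/-- The coordinate derivative `∂ᵢ f`. -/
def pd {F : Type*} [NormedAddCommGroup F] [NormedSpace ℝ F] (i : Fin 4) (f : Pt → F) : Pt → F :=
  fun p => fderiv ℝ f p (Pi.single i 1)

/-- The iterated radial derivative `∂ᵣᵏ f`. -/
def dr {F : Type*} [NormedAddCommGroup F] [NormedSpace ℝ F] (k : ℕ) (f : Pt → F) : Pt → F :=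
  (pd 3)^[k] f

/-- The point of the horizon `r = 0` with coordinates `(x, v)`. -/
def hpt (x : Fin 2 → ℝ) (v : ℝ) : Pt := ![x 0, x 1, v, 0]

/-- The inclusion of the indices `A = 0, 1` of the coordinates `x^A`. -/
def ix : Fin 2 → Fin 4 := ![0, 1]

/-! ### Curvature of a metric given by its coordinate components -/

abbrev Field2 := Pt → Matrix (Fin 4) (Fin 4) ℝ

/-- Christoffel symbols `Γᵃ_{bc}`. -/
def chr (g : Field2) (a b c : Fin 4) : Pt → ℝ := fun p =>
  (1 / 2) * ∑ d, (g p)⁻¹ a d *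
    (pd b (fun q => g q d c) p + pd c (fun q => g q d b) p - pd d (fun q => g q b c) p)

/-- The Riemann tensor `Rᵃ_{bcd}`. -/
def riemUp (g : Field2) (a b c d : Fin 4) : Pt → ℝ := fun p =>
  pd c (chr g a d b) p - pd d (chr g a c b) p
    + ∑ e, (chr g a c e p * chr g e d b p - chr g a d e p * chr g e c b p)

/-- The Riemann tensor `R_{abcd}`. -/
def riem (g : Field2) (a b c d : Fin 4) : Pt → ℝ := fun p => ∑ e, g p a e * riemUp g e b c d p

/-- The Ricci tensor `R_{ab} = Rᶜ_{acb}`. -/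
def ric (g : Field2) : Field2 := fun p => Matrix.of fun a b => ∑ c, riemUp g c a c b p

/-- The Ricci scalar. -/
def scal (g : Field2) : Pt → ℝ := fun p => ∑ a, ∑ b, (g p)⁻¹ a b * ric g p a b

/-- The Weyl tensor `C_{abcd}` of a four-dimensional metric. -/
def weyl (g : Field2) (a b c d : Fin 4) : Pt → ℝ := fun p =>
  riem g a b c d p
    - (1 / 2) * (g p a c * ric g p b d - g p b c * ric g p a d
        + g p b d * ric g p a c - g p a d * ric g p b c)
    + (1 / 6) * scal g p * (g p a c * g p b d - g p a d * g p b c)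

/-- The complex bilinear extension of a real bilinear form. -/
def bil (B : Matrix (Fin 4) (Fin 4) ℝ) (u w : Fin 4 → ℂ) : ℂ :=
  ∑ i, ∑ j, (B i j : ℂ) * u i * w j

/-- The covariant derivative `(∇_u w)` of a complex vector field. -/
def cov (g : Field2) (u w : Pt → Fin 4 → ℂ) : Pt → Fin 4 → ℂ := fun p a =>
  ∑ b, u p b * (pd b (fun q => w q a) p + ∑ c, (chr g a b c p : ℂ) * w p c)

/-- The symmetric matrix `B` has signature `(-,+,+,+)`. -/
def IsLorentz (B : Matrix (Fin 4) (Fin 4) ℝ) : Prop :=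
  B.IsSymm ∧ ∃ P : Matrix (Fin 4) (Fin 4) ℝ, IsUnit P.det ∧
    P.transpose * B * P = Matrix.diagonal ![-1, 1, 1, 1]

/-- Causal (possibly zero) vectors in the time orientation of the timelike vector `u`. -/
def FutureCausal (B : Matrix (Fin 4) (Fin 4) ℝ) (u w : Fin 4 → ℝ) : Prop :=
  (∑ i, ∑ j, B i j * w i * w j) ≤ 0 ∧ (∑ i, ∑ j, B i j * w i * u j) ≤ 0

/-! ### A neighbourhood of a horizon in Bondi-like coordinates, with its null frame -/

/-- The fields on a coordinate neighbourhood `dom` of the horizon: the metric `g`, the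
energy-momentum tensor `T`, and the frame vectors `m` (complex) and `ℓ` (real). The two other
frame vectors are `m̄` and `n = -∂ᵣ`. -/
structure Nbhd where
  dom : Set Pt
  g : Field2
  T : Field2
  m : Pt → Fin 4 → ℂ
  l : Pt → Fin 4 → ℝ

/-- The coordinate vector field `∂_v`. -/
def dv : Pt → Fin 4 → ℂ := fun _ => Pi.single 2 1

/-- The vector field `n = -∂ᵣ`. -/
def nvec : Pt → Fin 4 → ℂ := fun _ => Pi.single 3 (-1)

namespace Nbhd

/-- The field `m̄`. -/
def mbar (S : Nbhd) : Pt → Fin 4 → ℂ := fun p i => conj (S.m p i)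

/-- The field `ℓ` as a complex vector field. -/
def lc (S : Nbhd) : Pt → Fin 4 → ℂ := fun p i => (S.l p i : ℂ)

/-- The frame `(e₁, e₂, e₃, e₄) = (m, m̄, n, ℓ)`. -/
def frame (S : Nbhd) : Fin 4 → Pt → Fin 4 → ℂ := ![S.m, S.mbar, nvec, S.lc]

/-! The spin coefficients of `Γ₂₃ = μ e¹ + λ e² + ν e³ + π e⁴`, where
`Γ_{αβ}(X) = g(e_α, ∇_X e_β)`. -/

def npMu (S : Nbhd) : Pt → ℂ := fun p => bil (S.g p) (S.mbar p) (cov S.g S.m nvec p)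
def npLam (S : Nbhd) : Pt → ℂ := fun p => bil (S.g p) (S.mbar p) (cov S.g S.mbar nvec p)
def npPi (S : Nbhd) : Pt → ℂ := fun p => bil (S.g p) (S.mbar p) (cov S.g S.lc nvec p)

/-! The Newman-Penrose components of the Ricci and Weyl tensors. -/

def Phi11 (S : Nbhd) : Pt → ℂ := fun p =>
  -(1 / 4) * (bil (ric S.g p) (S.lc p) (nvec p) + bil (ric S.g p) (S.m p) (S.mbar p))
def Phi20 (S : Nbhd) : Pt → ℂ := fun p => -(1 / 2) * bil (ric S.g p) (S.mbar p) (S.mbar p)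
def Phi21 (S : Nbhd) : Pt → ℂ := fun p => -(1 / 2) * bil (ric S.g p) (nvec p) (S.mbar p)
def Phi22 (S : Nbhd) : Pt → ℂ := fun p => -(1 / 2) * bil (ric S.g p) (nvec p) (nvec p)
def Psi4 (S : Nbhd) : Pt → ℂ := fun p => -∑ a, ∑ b, ∑ c, ∑ d,
  (weyl S.g a b c d p : ℂ) * nvec p a * S.mbar p b * nvec p c * S.mbar p d

/-- `dom` carries a smooth Lorentzian metric that solves the Einstein equations with cosmological
constant `Lam` and energy-momentum tensor `T`, and is made of radial segments that start
on the horizon `{(x, v, 0) | x ∈ U, v ∈ I}`. -/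
structure IsSpacetime (U : Set (Fin 2 → ℝ)) (I : Set ℝ) (G Lam : ℝ) (S : Nbhd) : Prop where
  isOpen : IsOpen S.dom
  horizon_mem : ∀ x ∈ U, ∀ v ∈ I, hpt x v ∈ S.dom
  radial : ∀ p ∈ S.dom, ![p 0, p 1] ∈ U ∧ p 2 ∈ I ∧
    ∀ t ∈ Set.Icc (0 : ℝ) 1, ![p 0, p 1, p 2, t * p 3] ∈ S.dom
  smooth : ∀ a b, ContDiffOn ℝ ∞ (fun p => S.g p a b) S.dom
  lorentz : ∀ p ∈ S.dom, IsLorentz (S.g p)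
  einstein : ∀ p ∈ S.dom,
    ric S.g p - (scal S.g p / 2) • S.g p + Lam • S.g p = (8 * Real.pi * G) • S.T p

/-- The hypersurface `r = 0` is a null hypersurface with null normal `∂_v`, it is non-expanding,
the stronger energy condition holds on it, and `∂_v` has the constant surface gravity `kappa`.
A null vector tangent to the horizon is a multiple of `∂_v`, and the expansion of a multiple
`f ∂_v` is `f` times that of `∂_v`. The time orientation is the one in which `∂_v`, hence also
the timelike vector `∂_v - ∂ᵣ`, is future oriented; the opposite choice gives the
same energy condition. -/
structure IsHorizon (U : Set (Fin 2 → ℝ)) (I : Set ℝ) (kappa : ℝ) (S : Nbhd) : Prop where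
  null : ∀ x ∈ U, ∀ v ∈ I, ∀ i : Fin 4, i ≠ 3 → S.g (hpt x v) 2 i = 0
  nonexpanding : ∀ x ∈ U, ∀ v ∈ I,
    ∑ A : Fin 2, ∑ B : Fin 2, ((S.g (hpt x v)).submatrix ix ix)⁻¹ A B *
      pd 2 (fun q => S.g q (ix A) (ix B)) (hpt x v) = 0
  energy : ∀ x ∈ U, ∀ v ∈ I, ∀ X : Fin 4 → ℝ, X 3 = 0 →
    (∑ i, ∑ j, S.g (hpt x v) i j * X i * X j) = 0 →
    FutureCausal (S.g (hpt x v)) ![0, 0, 1, -1] X →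
    FutureCausal (S.g (hpt x v)) ![0, 0, 1, -1]
      (-((S.g (hpt x v))⁻¹.mulVec ((S.T (hpt x v)).mulVec X)))
  surfaceGravity : ∀ x ∈ U, ∀ v ∈ I,
    cov S.g dv dv (hpt x v) = fun i => (kappa : ℂ) * dv (hpt x v) i

/-- The coordinates are Bondi-like: `n = -∂ᵣ` is null and its covector pulls back to `-dv` on the
horizon (first field), and it is parallel along itself (second field). The remaining conditions,
`n(r) = -1`, `n(v) = n(x^A) = 0`, `∂_v v = 1`, `∂_v x^A = 0`, hold by construction. -/
structure IsBondi (U : Set (Fin 2 → ℝ)) (I : Set ℝ) (S : Nbhd) : Prop where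
  onHorizon : ∀ x ∈ U, ∀ v ∈ I, ∀ i : Fin 4, S.g (hpt x v) 3 i = if i = 2 then 1 else 0
  geodesic : ∀ p ∈ S.dom, cov S.g nvec nvec p = 0

/-- The frame `(m, m̄, n, ℓ)` is a Newman-Penrose null frame, it is parallel along `n`, and on
the horizon `ℓ = ∂_v` and `m` is tangent to the slices `v = const` and Lie dragged by `ℓ`. -/
structure IsAdapted (U : Set (Fin 2 → ℝ)) (I : Set ℝ) (S : Nbhd) : Prop where
  smooth_m : ∀ i, ContDiffOn ℝ ∞ (fun p => S.m p i) S.dom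
  smooth_l : ∀ i, ContDiffOn ℝ ∞ (fun p => S.l p i) S.dom
  mm : ∀ p ∈ S.dom, bil (S.g p) (S.m p) (S.m p) = 0
  mmbar : ∀ p ∈ S.dom, bil (S.g p) (S.m p) (S.mbar p) = 1
  mn : ∀ p ∈ S.dom, bil (S.g p) (S.m p) (nvec p) = 0
  ml : ∀ p ∈ S.dom, bil (S.g p) (S.m p) (S.lc p) = 0
  ll : ∀ p ∈ S.dom, bil (S.g p) (S.lc p) (S.lc p) = 0
  nl : ∀ p ∈ S.dom, bil (S.g p) (nvec p) (S.lc p) = -1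
  l_horizon : ∀ x ∈ U, ∀ v ∈ I, S.lc (hpt x v) = dv (hpt x v)
  m_tangent : ∀ x ∈ U, ∀ v ∈ I, S.m (hpt x v) 2 = 0 ∧ S.m (hpt x v) 3 = 0
  m_dragged : ∀ x ∈ U, ∀ v ∈ I, ∀ i, pd 2 (fun q => S.m q i) (hpt x v) = 0
  parallel_m : ∀ p ∈ S.dom, cov S.g nvec S.m p = 0
  parallel_l : ∀ p ∈ S.dom, cov S.g nvec S.lc p = 0

/-- A neighbourhood of a non-expanding horizon with surface gravity `kappa`, in Bondi-like
coordinates, with its adapted frame. -/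
structure IsNEHNbhd (U : Set (Fin 2 → ℝ)) (I : Set ℝ) (G Lam kappa : ℝ) (S : Nbhd) : Prop where
  spacetime : S.IsSpacetime U I G Lam
  horizon : S.IsHorizon U I kappa
  bondi : S.IsBondi U I
  adapted : S.IsAdapted U I

end Nbhd

/-! ### The data -/

/-- The data: the surface gravity; on the slice `m^A, π, μ, λ` and the functions `∂ᵣᵏΨ₄`; on the
horizon `Φ₁₁` and the functions `∂ᵣᵏΦ₂₁, ∂ᵣᵏΦ₂₂, ∂ᵣᵏR, ∂ᵣᵏΦ₂₀`. The index `k` is the argument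
in `ℕ`. -/
structure Data where
  kappa : ℝ
  m : (Fin 2 → ℝ) → Fin 2 → ℂ
  pi : (Fin 2 → ℝ) → ℂ
  mu : (Fin 2 → ℝ) → ℝ
  lam : (Fin 2 → ℝ) → ℂ
  psi4 : ℕ → (Fin 2 → ℝ) → ℂ
  phi11 : (Fin 2 → ℝ) × ℝ → ℝ
  phi21 : ℕ → (Fin 2 → ℝ) × ℝ → ℂ
  phi22 : ℕ → (Fin 2 → ℝ) × ℝ → ℝ
  scal : ℕ → (Fin 2 → ℝ) × ℝ → ℝ
  phi20 : ℕ → (Fin 2 → ℝ) × ℝ → ℂ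

/-- `S` is a neighbourhood of a non-expanding horizon whose data, with `k ≤ n - 2` (and
`k ≤ n - 1` for `∂ᵣᵏΦ₂₀`) and with the slice `v = v₀`, are `D`. -/
structure Realizes (U : Set (Fin 2 → ℝ)) (I : Set ℝ) (G Lam v₀ : ℝ) (n : ℕ)
    (D : Data) (S : Nbhd) : Prop where
  neh : S.IsNEHNbhd U I G Lam D.kappa
  m : ∀ x ∈ U, ∀ A, S.m (hpt x v₀) (ix A) = D.m x A
  pi : ∀ x ∈ U, S.npPi (hpt x v₀) = D.pi x
  mu : ∀ x ∈ U, S.npMu (hpt x v₀) = D.mu x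
  lam : ∀ x ∈ U, S.npLam (hpt x v₀) = D.lam x
  psi4 : ∀ k, k + 2 ≤ n → ∀ x ∈ U, dr k S.Psi4 (hpt x v₀) = D.psi4 k x
  phi11 : ∀ x ∈ U, ∀ v ∈ I, S.Phi11 (hpt x v) = D.phi11 (x, v)
  phi21 : ∀ k, k + 2 ≤ n → ∀ x ∈ U, ∀ v ∈ I, dr k S.Phi21 (hpt x v) = D.phi21 k (x, v)
  phi22 : ∀ k, k + 2 ≤ n → ∀ x ∈ U, ∀ v ∈ I, dr k S.Phi22 (hpt x v) = D.phi22 k (x, v)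
  scal : ∀ k, k + 2 ≤ n → ∀ x ∈ U, ∀ v ∈ I, dr k (NEH.scal S.g) (hpt x v) = D.scal k (x, v)
  phi20 : ∀ k, k + 1 ≤ n → ∀ x ∈ U, ∀ v ∈ I, dr k S.Phi20 (hpt x v) = D.phi20 k (x, v)

/-- The data are smooth, `m` and `m̄` are linearly independent over `ℂ` at each point of the slice,
and `R/4 - 2 Φ₁₁ = R(m, m̄) ≥ Lam`, which is the stronger energy condition on the horizon. -/
structure Data.IsAdmissible (U : Set (Fin 2 → ℝ)) (I : Set ℝ) (Lam : ℝ) (D : Data) : Prop where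
  m : ContDiffOn ℝ ∞ D.m U
  m_indep : ∀ x ∈ U, (D.m x 0 * conj (D.m x 1)).im ≠ 0
  pi : ContDiffOn ℝ ∞ D.pi U
  mu : ContDiffOn ℝ ∞ D.mu U
  lam : ContDiffOn ℝ ∞ D.lam U
  psi4 : ∀ k, ContDiffOn ℝ ∞ (D.psi4 k) U
  phi11 : ContDiffOn ℝ ∞ D.phi11 (U ×ˢ I)
  phi21 : ∀ k, ContDiffOn ℝ ∞ (D.phi21 k) (U ×ˢ I)
  phi22 : ∀ k, ContDiffOn ℝ ∞ (D.phi22 k) (U ×ˢ I)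
  scal : ∀ k, ContDiffOn ℝ ∞ (D.scal k) (U ×ˢ I)
  phi20 : ∀ k, ContDiffOn ℝ ∞ (D.phi20 k) (U ×ˢ I)
  energy : ∀ x ∈ U, ∀ v ∈ I, Lam ≤ D.scal 0 (x, v) / 4 - 2 * D.phi11 (x, v)

end NEH

end

/-! On the horizon `ℓ = ∂_v` and `m` is dragged along `∂_v`, so the metric there is fixed by `m^A`
on one slice. In the Bondi-like gauge `g_{3i} = δ_{i2}` holds everywhere, and the unknowns are
`g_{AB}`, `g_{2A}`, `g_{22}`. The theorem concerns their radial Taylor coefficients, and both halves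
rest on one question: how does the curvature on the horizon depend on the highest coefficient that
enters it?

Let two such metrics differ by `δg`. If `δg` vanishes below order `k + 2` and `X = ∂_r^{k+2} δg`,
then on the horizon `∂_r^k` of the differences of `Φ₂₂`, `Φ₂₁`, `R`, `Ψ₄` are `½ X(m, m̄)`, `¼
X(∂_v, m̄)`, `X(∂_v, ∂_v)`, `½ X(m̄, m̄)` (`phi22_lead`, `phi21_lead`, `dScal_lead`, `psi4_lead`).
So these quantities see every part of the new coefficient algebraically. If `δg` vanishes below
order `k + 1`, the components `δg_{2a}` vanish also at order `k + 1`, and `X = ∂_r^{k+1} δg`, then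
the difference of `∂_r^k (Ric(u, w))` is `-(∂_v + (k + 1) κ) X(u, w)` for `u, w` among `m, m̄`
(`con_Ric_tangential`). The coefficient arises because `g^{33}` vanishes on the horizon with radial
slope `2κ`. Hence `Φ₂₀` obeys a linear transport equation along the null generators, and its
potential `X(m̄, m̄)` needs a value only on one slice.

Uniqueness. At order one, `∂_r g_{22} = -2κ`. The components `R_{A2}` equal `-½ ∂_v ∂_r g_{2A}` on
the horizon (`Ric_2_mem`), and the energy condition makes them zero: `R_{22}` vanishes, so the
energy current of `∂_v` has norm equal to a nonnegative multiple of `|R(m, ∂_v)|²`, which causality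
bounds by zero. Thus `π` on the slice gives `∂_r g_{2A}`. The two parts of `∂_r g_{AB}` come from
transport: the trace from `R(m, m̄) = R/4 - 2Φ₁₁` with initial value `μ`, the rest from `Φ₂₀` with
initial value `λ`. At order `k + 2` the scalars `Φ₂₂`, `Φ₂₁`, `R` give the trace, `g_{2A}` and
`g_{22}` everywhere; `Ψ₄` gives the remaining part on the slice, and `∂_r^{k+1} Φ₂₀` carries it
along the generators. Since the frame is parallel along `∂_r`, agreement of the metrics through
order `n` gives agreement of the frames through order `n`.

Existence. A metric is described by a complex coframe `w` of the two-surfaces, a shift `h` and a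
function `W`. The signature is then automatic wherever the coframe is nondegenerate, and the
parallel frame is explicit: rotate the dual frame by a phase and apply a null rotation about `n`,
each obtained from one radial integral. Starting from a configuration linear in `r` with the given
`m`, `π`, `κ`, a monomial `r^j / j!` with coefficients on the horizon is added at each order. The
difference formulas above say how each datum responds, so the coefficients are found by algebra or
by solving the transport equation. Only finitely many orders matter, hence no convergence question
arises. The tensor `T` is defined by the Einstein equation, and the energy condition reduces to
`R(m, m̄) ≥ Λ`.

The local computations take place in a commutative ring of smooth functions with four derivations,
modulo the powers-like filtration `J k` of functions that vanish to order `k` on the horizon. A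
derivative along the horizon keeps the order, `∂_r` loses one, and a factor that vanishes on the
horizon gains one. -/

namespace NEH

/-! ### Differential rings with an ideal of functions that vanish on the horizon -/

/-- A ring with four commuting derivations and an ideal that is stable under the first three of
them; `half` is the inverse of `2`. -/
structure HDiff (R : Type*) [CommRing R] where
  D : Fin 4 → Derivation ℤ R R
  comm : ∀ i j f, D i (D j f) = D j (D i f)
  I : Ideal R
  stable : ∀ i, i ≠ 3 → ∀ f ∈ I, D i f ∈ I
  half : R
  two_half : 2 * half = 1

namespace HDiff

variable {R : Type*} [CommRing R] (H : HDiff R)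

/-- `f` vanishes to order `k` on the horizon. -/
def Van : ℕ → R → Prop
  | 0, _ => True
  | k + 1, f => f ∈ H.I ∧ Van k (H.D 3 f)

theorem Van.pred {k : ℕ} : ∀ {f : R}, H.Van (k + 1) f → H.Van k f := by
  induction k with
  | zero => intro f _; trivial
  | succ k ih => intro f h; exact ⟨h.1, ih h.2⟩

theorem van_zero (k : ℕ) : H.Van k 0 := by
  induction k with
  | zero => trivial
  | succ k ih => exact ⟨H.I.zero_mem, by simpa using ih⟩

theorem Van.add {k : ℕ} : ∀ {f g : R}, H.Van k f → H.Van k g → H.Van k (f + g) := by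
  induction k with
  | zero => intro f g _ _; trivial
  | succ k ih =>
    intro f g hf hg
    exact ⟨H.I.add_mem hf.1 hg.1, by rw [map_add]; exact ih hf.2 hg.2⟩

theorem Van.mul_left {k : ℕ} : ∀ {f : R} (a : R), H.Van k f → H.Van k (a * f) := by
  induction k with
  | zero => intro f a _; trivial
  | succ k ih =>
    intro f a hf
    refine ⟨H.I.mul_mem_left a hf.1, ?_⟩
    rw [Derivation.leibniz, smul_eq_mul, smul_eq_mul]
    refine Van.add H (ih a hf.2) ?_
    rw [mul_comm]
    exact ih _ (Van.pred H hf)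

/-- The ideal of elements that vanish to order `k` on the horizon. -/
def J (k : ℕ) : Ideal R where
  carrier := {f | H.Van k f}
  add_mem' := Van.add H
  zero_mem' := H.van_zero k
  smul_mem' a _ h := Van.mul_left H a h

theorem mem_J_succ {k : ℕ} {f : R} : f ∈ H.J (k + 1) ↔ f ∈ H.I ∧ H.D 3 f ∈ H.J k := Iff.rfl

theorem mem_J_zero (f : R) : f ∈ H.J 0 := trivial

theorem mem_J_one {f : R} : f ∈ H.J 1 ↔ f ∈ H.I := ⟨fun h => h.1, fun h => ⟨h, trivial⟩⟩

theorem J_anti {a b : ℕ} (h : a ≤ b) : H.J b ≤ H.J a := by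
  induction h with
  | refl => exact le_rfl
  | step _ ih => exact fun f hf => ih (Van.pred H hf)

theorem D3_mem {k : ℕ} {f : R} (h : f ∈ H.J (k + 1)) : H.D 3 f ∈ H.J k := h.2

theorem D_mem {i : Fin 4} (hi : i ≠ 3) {k : ℕ} : ∀ {f : R}, f ∈ H.J k → H.D i f ∈ H.J k := by
  induction k with
  | zero => intro f _; trivial
  | succ k ih =>
    intro f h
    exact ⟨H.stable i hi f h.1, by rw [H.comm]; exact ih h.2⟩

theorem D_mem_pred (i : Fin 4) {k : ℕ} {f : R} (h : f ∈ H.J (k + 1)) : H.D i f ∈ H.J k := by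
  by_cases hi : i = 3
  · subst hi; exact h.2
  · exact H.J_anti (Nat.le_succ k) (H.D_mem hi h)

/-- By the Leibniz rule, a radial derivative lowers the order of exactly one factor, so induction on
`a + b` closes. -/
theorem mul_mem_J : ∀ (a b : ℕ) {f g : R}, f ∈ H.J a → g ∈ H.J b → f * g ∈ H.J (a + b) := by
  intro a b
  induction hn : a + b generalizing a b with
  | zero => intros; trivial
  | succ n ih =>
    intro f g hf hg
    rcases a with _ | a
    · have : b = n + 1 := by omega
      subst this
      exact (H.J _).mul_mem_left f hg
    rcases b with _ | b
    · have : a = n := by omega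
      subst this
      exact (H.J _).mul_mem_right g hf
    refine ⟨H.I.mul_mem_right _ hf.1, ?_⟩
    have e : H.D 3 (f * g) = f * H.D 3 g + H.D 3 f * g := by
      rw [Derivation.leibniz, smul_eq_mul, smul_eq_mul]; ring
    rw [e]
    exact (H.J n).add_mem (ih (a + 1) b (by omega) hf hg.2) (ih a (b + 1) (by omega) hf.2 hg)

/-- The source of all gains of order below: inverse metric components and connection coefficients
that vanish on the horizon make up for one lost radial derivative. -/
theorem mul_mem_J_succ {k : ℕ} {f g : R} (hf : f ∈ H.I) (hg : g ∈ H.J k) :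
    f * g ∈ H.J (k + 1) := by
  have := H.mul_mem_J 1 k (H.mem_J_one.2 hf) hg
  rwa [add_comm] at this

theorem iter_mem {k : ℕ} : ∀ {j : ℕ} {f : R}, f ∈ H.J (j + k) → (H.D 3)^[j] f ∈ H.J k := by
  intro j
  induction j with
  | zero => intro f h; simpa using h
  | succ j ih =>
    intro f h
    rw [Function.iterate_succ_apply]
    exact ih (H.D3_mem (by convert h using 2; omega))

theorem iter_mem_I {k : ℕ} {f : R} (h : f ∈ H.J (k + 1)) : (H.D 3)^[k] f ∈ H.I :=
  H.mem_J_one.1 (H.iter_mem h)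

theorem mem_J_iff {k : ℕ} : ∀ {f : R}, f ∈ H.J k ↔ ∀ i < k, (H.D 3)^[i] f ∈ H.I := by
  induction k with
  | zero => intro f; simp [mem_J_zero]
  | succ k ih =>
    intro f
    rw [mem_J_succ, ih]
    constructor
    · rintro ⟨h0, h⟩ i hi
      rcases i with _ | i
      · simpa using h0
      · simpa using h i (by omega)
    · intro h
      exact ⟨by simpa using h 0 (by omega), fun i hi => by simpa using h (i + 1) (by omega)⟩

theorem mem_J_succ' {k : ℕ} {f : R} (h : f ∈ H.J k) (h' : (H.D 3)^[k] f ∈ H.I) :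
    f ∈ H.J (k + 1) := by
  rw [mem_J_iff] at h ⊢
  intro i hi
  rcases Nat.lt_succ_iff_lt_or_eq.1 hi with h1 | rfl
  · exact h i h1
  · exact h'

theorem iter_add (k : ℕ) (f g : R) :
    (H.D 3)^[k] (f + g) = (H.D 3)^[k] f + (H.D 3)^[k] g := by
  induction k generalizing f g with
  | zero => rfl
  | succ k ih => simp only [Function.iterate_succ_apply, map_add, ih]

theorem iter_zero (k : ℕ) : (H.D 3)^[k] (0 : R) = 0 := by
  induction k with
  | zero => rfl
  | succ k ih => simpa only [Function.iterate_succ_apply, map_zero] using ih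

theorem iter_neg (k : ℕ) (f : R) : (H.D 3)^[k] (-f) = -(H.D 3)^[k] f := by
  induction k generalizing f with
  | zero => rfl
  | succ k ih => simp only [Function.iterate_succ_apply, map_neg, ih]

theorem iter_sub (k : ℕ) (f g : R) :
    (H.D 3)^[k] (f - g) = (H.D 3)^[k] f - (H.D 3)^[k] g := by
  rw [sub_eq_add_neg, iter_add, iter_neg, ← sub_eq_add_neg]

theorem iter_sum {ι : Type*} (s : Finset ι) (k : ℕ) (f : ι → R) :
    (H.D 3)^[k] (∑ i ∈ s, f i) = ∑ i ∈ s, (H.D 3)^[k] (f i) := by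
  induction k generalizing f with
  | zero => rfl
  | succ k ih => simp only [Function.iterate_succ_apply, map_sum, ih]

theorem iter_comm (i : Fin 4) (k : ℕ) (f : R) :
    (H.D 3)^[k] (H.D i f) = H.D i ((H.D 3)^[k] f) := by
  induction k generalizing f with
  | zero => rfl
  | succ k ih => simp only [Function.iterate_succ_apply, H.comm 3 i, ih]

/-- In the Leibniz expansion, every term in which a derivative hits `a` leaves fewer than `k`
derivatives on `f`, and so vanishes on the horizon. -/
theorem iter_mul {k : ℕ} : ∀ (a : R) {f : R}, f ∈ H.J k →
    (H.D 3)^[k] (a * f) - a * (H.D 3)^[k] f ∈ H.I := by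
  induction k with
  | zero => intro a f _; simp
  | succ k ih =>
    intro a f h
    simp only [Function.iterate_succ_apply]
    rw [Derivation.leibniz, smul_eq_mul, smul_eq_mul, iter_add]
    have h1 := ih a (H.D3_mem h)
    have h2 := H.iter_mem_I ((H.J (k + 1)).mul_mem_right (H.D 3 a) h)
    convert H.I.add_mem h1 h2 using 1
    ring

/-- Of the `k + 1` derivatives exactly one must hit `G` and all the others `p`; the choice of that
one gives the factor `k + 1`. With `G = g^{33}` this is the factor in the transport rate `(k + 1)
κ`. -/
theorem iter_mul_of_mem_I {k : ℕ} : ∀ {G p : R}, G ∈ H.I → p ∈ H.J k →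
    (H.D 3)^[k + 1] (G * p) - (k + 1) * H.D 3 G * (H.D 3)^[k] p ∈ H.I := by
  induction k with
  | zero =>
    intro G p hG _
    simp only [Function.iterate_succ_apply, Function.iterate_zero, id]
    rw [Derivation.leibniz, smul_eq_mul, smul_eq_mul]
    convert H.I.mul_mem_right (H.D 3 p) hG using 1
    push_cast; ring
  | succ k ih =>
    intro G p hG hp
    rw [Function.iterate_succ_apply, Derivation.leibniz, smul_eq_mul, smul_eq_mul, iter_add]
    have h1 := ih hG (H.D3_mem hp)
    have h2 := H.iter_mul (H.D 3 G) hp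
    rw [mul_comm (H.D 3 G)] at h2
    rw [← Function.iterate_succ_apply (H.D 3) k] at h1
    convert H.I.add_mem h1 h2 using 1
    push_cast; ring

theorem D_half (i : Fin 4) : H.D i H.half = 0 := by
  have h : H.D i (2 * H.half) = 0 := by rw [H.two_half]; exact (H.D i).map_one_eq_zero
  have h2 : H.D i (2 * H.half) = 2 * H.D i H.half := by
    rw [two_mul, map_add, two_mul]
  rw [h2] at h
  have := congrArg (fun x => H.half * x) h
  simp only [mul_zero, ← mul_assoc, mul_comm H.half 2, H.two_half, one_mul] at this
  exact this

theorem D_half_mul (i : Fin 4) (f : R) : H.D i (H.half * f) = H.half * H.D i f := by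
  rw [Derivation.leibniz, H.D_half, smul_zero, add_zero, smul_eq_mul]

theorem D_mul (i : Fin 4) (f g : R) : H.D i (f * g) = H.D i f * g + f * H.D i g := by
  rw [Derivation.leibniz, smul_eq_mul, smul_eq_mul]; ring

theorem iter_half_mul (k : ℕ) (f : R) :
    (H.D 3)^[k] (H.half * f) = H.half * (H.D 3)^[k] f := by
  induction k generalizing f with
  | zero => rfl
  | succ k ih => simp only [Function.iterate_succ_apply, D_half_mul, ih]

end HDiff

/-! ### Bondi-like metrics over a differential ring -/

/-- A metric `g` with inverse `gi` in Bondi-like coordinates, on a differential ring; modulo the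
ideal of the horizon it is degenerate along `∂_v`, independent of `v`, and has the surface
gravity `kap`. -/
structure Bondi {R : Type*} [CommRing R] (H : HDiff R) (kap : R) where
  g : Fin 4 → Fin 4 → R
  gi : Fin 4 → Fin 4 → R
  symm : ∀ a b, g a b = g b a
  gsymm : ∀ a b, gi a b = gi b a
  inv : ∀ a b, ∑ d, gi a d * g d b = if a = b then 1 else 0
  g3 : ∀ i, g 3 i = if i = 2 then 1 else 0
  null : ∀ i, i ≠ 3 → g 2 i ∈ H.I
  stat : ∀ a b, H.D 2 (g a b) ∈ H.I
  grav : H.D 3 (g 2 2) + 2 * kap ∈ H.I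
  kap_const : ∀ i, H.D i kap = 0

namespace Bondi

variable {R : Type*} [CommRing R] {H : HDiff R} {kap : R} (B B' : Bondi H kap)

/-- Twice the Christoffel symbols of the first kind. -/
def low (d b c : Fin 4) : R := H.D b (B.g d c) + H.D c (B.g d b) - H.D d (B.g b c)

/-- The Christoffel symbols. -/
def Gam (a b c : Fin 4) : R := H.half * ∑ d, B.gi a d * B.low d b c

/-- The Riemann tensor `Rᵃ_{bcd}`. -/
def RUp (a b c d : Fin 4) : R := H.D c (B.Gam a d b) - H.D d (B.Gam a c b)
  + ∑ e, (B.Gam a c e * B.Gam e d b - B.Gam a d e * B.Gam e c b)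

/-- The Ricci tensor. -/
def Ric (a b : Fin 4) : R := ∑ c, B.RUp c a c b

/-- The Ricci scalar. -/
def Scal : R := ∑ a, ∑ b, B.gi a b * B.Ric a b

theorem g_3 (i : Fin 4) : B.g i 3 = if i = 2 then 1 else 0 := by rw [B.symm, B.g3]

theorem D_g3 (j i : Fin 4) : H.D j (B.g 3 i) = 0 := by
  rw [B.g3]; split_ifs
  · exact (H.D j).map_one_eq_zero
  · exact map_zero _

theorem D_g_3 (j i : Fin 4) : H.D j (B.g i 3) = 0 := by rw [B.symm, B.D_g3]

theorem gi_2 (a : Fin 4) : B.gi a 2 = if a = 3 then 1 else 0 := by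
  have := B.inv a 3
  simpa [Fin.sum_univ_four, B.g_3] using this

theorem gi2 (a : Fin 4) : B.gi 2 a = if a = 3 then 1 else 0 := by rw [B.gsymm, B.gi_2]

theorem inv' (a b : Fin 4) : ∑ d, B.g a d * B.gi d b = if a = b then 1 else 0 := by
  have := B.inv b a
  rw [show (∑ d, B.g a d * B.gi d b) = ∑ d, B.gi b d * B.g d a from
    Finset.sum_congr rfl fun d _ => by rw [B.symm a d, B.gsymm d b, mul_comm], this]
  simp only [eq_comm]

/-- Row `2` of `g g⁻¹ = 1` solved for `g^{3C}`. It shows that this component vanishes on the horizon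
and inherits the order of agreement of the components `g_{2a}`. -/
theorem gi_3_eq (C : Fin 4) (hC : C ≠ 2) :
    B.gi 3 C = -(B.g 2 0 * B.gi 0 C + B.g 2 1 * B.gi 1 C + (if C = 3 then B.g 2 2 else 0)) := by
  have := B.inv' 2 C
  simp only [Fin.sum_univ_four, B.gi2, B.g_3, if_true, Ne.symm hC, if_false] at this
  split_ifs at this ⊢ <;> linear_combination this

theorem gi3_mem (C : Fin 4) (hC : C ≠ 2) : B.gi 3 C ∈ H.I := by
  rw [B.gi_3_eq C hC]
  refine H.I.neg_mem (H.I.add_mem (H.I.add_mem ?_ ?_) ?_)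
  · exact H.I.mul_mem_right _ (B.null 0 (by decide))
  · exact H.I.mul_mem_right _ (B.null 1 (by decide))
  · split_ifs
    · exact B.null 2 (by decide)
    · exact H.I.zero_mem

/-- In the expansion of `g^{33}` the products `g_{2A} g^{A3}` have two factors that vanish on the
horizon, so only `-∂_r g_{22} = 2κ` survives. -/
theorem D3_gi33 : H.D 3 (B.gi 3 3) - 2 * kap ∈ H.I := by
  have e := B.gi_3_eq 3 (by decide)
  rw [if_pos rfl] at e
  have e0 := B.gi3_mem 0 (by decide)
  have e1 := B.gi3_mem 1 (by decide)
  have n0 := B.null 0 (by decide)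
  have n1 := B.null 1 (by decide)
  rw [B.gsymm] at e0 e1
  rw [e]
  simp only [map_neg, map_add, H.D_mul]
  have h1 := H.I.mul_mem_left (H.D 3 (B.g 2 0)) e0
  have h2 := H.I.mul_mem_left (H.D 3 (B.g 2 1)) e1
  have h3 := H.I.mul_mem_right (H.D 3 (B.gi 0 3)) n0
  have h4 := H.I.mul_mem_right (H.D 3 (B.gi 1 3)) n1
  convert H.I.neg_mem (H.I.add_mem (H.I.add_mem (H.I.add_mem h1 h2) (H.I.add_mem h3 h4)) B.grav)
    using 1
  ring

theorem low_symm (d b c : Fin 4) : B.low d b c = B.low d c b := by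
  simp only [low, B.symm b c]; ring

theorem Gam_symm (a b c : Fin 4) : B.Gam a b c = B.Gam a c b := by
  simp only [Gam, B.low_symm _ b c]

theorem low_33 (d : Fin 4) : B.low d 3 3 = 0 := by
  simp [low, B.D_g3, B.D_g_3]

theorem Gam_33 (a : Fin 4) : B.Gam a 3 3 = 0 := by
  simp [Gam, B.low_33]

theorem low_3 (b c : Fin 4) : B.low 3 b c = -H.D 3 (B.g b c) := by
  simp [low, B.D_g3]

theorem Gam_2 (b c : Fin 4) : B.Gam 2 b c = -(H.half * H.D 3 (B.g b c)) := by
  simp [Gam, B.gi2, B.low_3]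

theorem Gam_23 (b : Fin 4) : B.Gam 2 3 b = 0 := by
  rw [Gam_2, D_g3, mul_zero, neg_zero]

theorem Gam_2_3 (b : Fin 4) : B.Gam 2 b 3 = 0 := by rw [Gam_symm, Gam_23]

theorem low_lower3 (d b : Fin 4) : B.low d 3 b = H.D 3 (B.g d b) - H.D d (B.g 3 b) := by
  simp [low, B.D_g_3]

theorem low_lower3' (d b : Fin 4) : B.low d 3 b = H.D 3 (B.g d b) := by
  rw [low_lower3, D_g3, sub_zero]

theorem sum_g_Gam_3 (i b : Fin 4) :
    ∑ j, B.g i j * B.Gam j b 3 = H.half * H.D 3 (B.g i b) := by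
  have : ∑ j, B.g i j * B.Gam j b 3
      = H.half * ∑ d, (∑ j, B.g i j * B.gi j d) * B.low d b 3 := by
    simp only [Gam, Fin.sum_univ_four]; ring
  rw [this]
  simp only [B.inv']
  simp [B.low_symm i b 3, B.low_lower3']

/-- The trace over the indices `0, 1`. -/
def tr (f : Fin 4 → Fin 4 → R) : R :=
  B.gi 0 0 * f 0 0 + B.gi 0 1 * f 0 1 + B.gi 1 0 * f 1 0 + B.gi 1 1 * f 1 1

/-- This is half the logarithmic derivative of the determinant. The full trace reduces to the
indices `0, 1` because `g^{2a}` is nonzero only for `a = 3`, where `g_{23}` is constant, and the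
components `g_{3b}` are constant as well. -/
theorem sum_Gam (a : Fin 4) :
    ∑ c, B.Gam c c a = H.half * B.tr fun b c => H.D a (B.g b c) := by
  simp only [Gam, low, tr, Fin.sum_univ_four, B.gi2, B.gi_2, B.D_g3, B.D_g_3]
  simp [B.gsymm 3 0, B.gsymm 3 1, B.gsymm 1 0, B.symm 1 0]
  ring

/-! #### Christoffel symbols on the horizon -/

theorem D_g2 (i j : Fin 4) (hi : i ≠ 3) : H.D i (B.g 2 j) ∈ H.I := by
  by_cases hj : j = 3
  · rw [hj, D_g_3]; exact H.I.zero_mem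
  · exact H.stable i hi _ (B.null j hj)

theorem low_mem (d b c : Fin 4) (hb : b ≠ 3) (hc : c ≠ 3) (hd : d ≠ 3)
    (h2 : d = 2 ∨ b = 2 ∨ c = 2) : B.low d b c ∈ H.I := by
  rcases h2 with rfl | rfl | rfl
  · exact H.I.sub_mem (H.I.add_mem (B.D_g2 _ _ hb) (B.D_g2 _ _ hc)) (B.stat _ _)
  · refine H.I.sub_mem (H.I.add_mem (B.stat _ _) ?_) (B.D_g2 _ _ hd)
    rw [B.symm]; exact B.D_g2 _ _ hc
  · refine H.I.sub_mem (H.I.add_mem ?_ (B.stat _ _)) ?_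
    · rw [B.symm]; exact B.D_g2 _ _ hb
    · rw [B.symm]; exact B.D_g2 _ _ hd

/-- `Γᶜ_{2b}` vanishes on the horizon for `c ∈ {0, 1}` and `b ≠ 3`. -/
theorem Gam_C2_mem (C b : Fin 4) (hC : C ≠ 2) (hC3 : C ≠ 3) (hb : b ≠ 3) :
    B.Gam C 2 b ∈ H.I := by
  refine H.I.mul_mem_left _ ?_
  simp only [Fin.sum_univ_four, B.gi_2, hC3, if_false, zero_mul, add_zero]
  refine H.I.add_mem (H.I.add_mem ?_ ?_) ?_
  · exact H.I.mul_mem_left _ (B.low_mem 0 2 b (by decide) hb (by decide) (by simp))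
  · exact H.I.mul_mem_left _ (B.low_mem 1 2 b (by decide) hb (by decide) (by simp))
  · rw [B.gsymm]; exact H.I.mul_mem_right _ (B.gi3_mem C hC)

/-- `Γ³_{bc}` vanishes on the horizon for `b, c ≠ 3`. -/
theorem Gam_3_mem (b c : Fin 4) (hb : b ≠ 3) (hc : c ≠ 3) : B.Gam 3 b c ∈ H.I := by
  refine H.I.mul_mem_left _ ?_
  simp only [Fin.sum_univ_four, B.gi_2, if_true, one_mul]
  refine H.I.add_mem (H.I.add_mem (H.I.add_mem ?_ ?_) ?_) ?_
  · exact H.I.mul_mem_right _ (B.gi3_mem 0 (by decide))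
  · exact H.I.mul_mem_right _ (B.gi3_mem 1 (by decide))
  · exact B.low_mem 2 b c hb hc (by decide) (by simp)
  · exact H.I.mul_mem_right _ (B.gi3_mem 3 (by decide))

theorem sum_Gam_2_mem : ∑ c, B.Gam c c 2 ∈ H.I := by
  rw [sum_Gam]
  refine H.I.mul_mem_left _ (H.I.add_mem (H.I.add_mem (H.I.add_mem ?_ ?_) ?_) ?_) <;>
  exact H.I.mul_mem_left _ (B.stat _ _)

theorem Gam_33b (b : Fin 4) : B.Gam 3 3 b - H.half * H.D 3 (B.g 2 b) ∈ H.I := by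
  simp only [Gam, Fin.sum_univ_four, B.gi_2, if_true, one_mul, B.low_lower3']
  have h0 := H.I.mul_mem_right (H.D 3 (B.g 0 b)) (B.gi3_mem 0 (by decide))
  have h1 := H.I.mul_mem_right (H.D 3 (B.g 1 b)) (B.gi3_mem 1 (by decide))
  have h3 := H.I.mul_mem_right (H.D 3 (B.g 3 b)) (B.gi3_mem 3 (by decide))
  convert H.I.mul_mem_left H.half (H.I.add_mem (H.I.add_mem h0 h1) h3) using 1
  ring

theorem Ric_expand (a b : Fin 4) : B.Ric a b
    = ∑ c, H.D c (B.Gam c b a) - H.D b (∑ c, B.Gam c c a)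
      + ∑ e, (∑ c, B.Gam c c e) * B.Gam e b a - ∑ c, ∑ e, B.Gam c b e * B.Gam e c a := by
  simp only [Ric, RUp, Fin.sum_univ_four, map_add]
  ring

end Bondi

/-! ### Differences and derivatives of inverse matrices over a commutative ring. -/

theorem inverse_sub {R : Type*} [CommRing R] {g gi g' gi' : Fin 4 → Fin 4 → R}
    (h1 : ∀ a b, ∑ d, g a d * gi d b = if a = b then 1 else 0)
    (h2 : ∀ a b, ∑ d, gi' a d * g' d b = if a = b then 1 else 0) (a b : Fin 4) :
    gi' a b - gi a b = -∑ c, ∑ d, gi' a c * (g' c d - g c d) * gi d b := by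
  have h3 : ∑ c, ∑ d, gi' a c * g' c d * gi d b = gi a b := by
    rw [Finset.sum_comm]
    simp_rw [← Finset.sum_mul, h2]
    simp
  have h4 : ∑ c, ∑ d, gi' a c * g c d * gi d b = gi' a b := by
    simp_rw [mul_assoc, ← Finset.mul_sum, h1]
    simp
  simp_rw [mul_sub, sub_mul, Finset.sum_sub_distrib]
  rw [h3, h4]; ring

theorem derivation_inverse {R : Type*} [CommRing R] (D : Derivation ℤ R R)
    {g gi : Fin 4 → Fin 4 → R} (h1 : ∀ a b, ∑ d, gi a d * g d b = if a = b then 1 else 0)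
    (h2 : ∀ a b, ∑ d, g a d * gi d b = if a = b then 1 else 0) (a b : Fin 4) :
    D (gi a b) = -∑ c, ∑ d, gi a c * D (g c d) * gi d b := by
  have h : ∀ d, ∑ c, (D (gi a c) * g c d + gi a c * D (g c d)) = 0 := by
    intro d
    have := congrArg D (h1 a d)
    rw [map_sum] at this
    simp_rw [Derivation.leibniz, smul_eq_mul] at this
    rw [show (∑ c, (D (gi a c) * g c d + gi a c * D (g c d)))
      = ∑ c, (gi a c * D (g c d) + g c d * D (gi a c)) from
      Finset.sum_congr rfl fun _ _ => by ring, this]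
    split_ifs
    · exact D.map_one_eq_zero
    · exact map_zero _
  have h3 : ∑ d, (∑ c, (D (gi a c) * g c d + gi a c * D (g c d))) * gi d b = 0 := by simp [h]
  have h4 : ∑ c, ∑ d, D (gi a c) * g c d * gi d b = D (gi a b) := by
    simp_rw [mul_assoc, ← Finset.mul_sum, h2]
    simp
  simp_rw [Finset.sum_mul, add_mul] at h3
  rw [Finset.sum_comm] at h3
  simp_rw [Finset.sum_add_distrib] at h3
  rw [h4] at h3
  linear_combination h3

/-! ### The Ricci components along the null generators. -/

namespace Bondi

variable {R : Type*} [CommRing R] {H : HDiff R} {kap : R} (B B' : Bondi H kap)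

theorem gi_sub (a b : Fin 4) :
    B'.gi a b - B.gi a b = -∑ c, ∑ d, B'.gi a c * (B'.g c d - B.g c d) * B.gi d b :=
  inverse_sub B.inv' B'.inv a b

theorem g_sub (a b : Fin 4) :
    B'.g a b - B.g a b = -∑ c, ∑ d, B'.g a c * (B'.gi c d - B.gi c d) * B.g d b :=
  inverse_sub B.inv B'.inv' a b

theorem D_gi (i a b : Fin 4) :
    H.D i (B.gi a b) = -∑ c, ∑ d, B.gi a c * H.D i (B.g c d) * B.gi d b :=
  derivation_inverse _ B.inv B.inv' a b

theorem D2_gi_mem (a b : Fin 4) : H.D 2 (B.gi a b) ∈ H.I := by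
  rw [D_gi]
  exact H.I.neg_mem (sum_mem fun c _ => sum_mem fun d _ =>
    H.I.mul_mem_right _ (H.I.mul_mem_left _ (B.stat _ _)))

theorem D2_sum_Gam_mem (a : Fin 4) (ha : a ≠ 3) : H.D 2 (∑ c, B.Gam c c a) ∈ H.I := by
  have key : ∀ b c, H.D 2 (B.gi b c * H.D a (B.g b c)) ∈ H.I := by
    intro b c
    rw [H.D_mul, H.comm 2 a]
    exact H.I.add_mem (H.I.mul_mem_right _ (B.D2_gi_mem _ _))
      (H.I.mul_mem_left _ (H.stable a ha _ (B.stat _ _)))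
  rw [sum_Gam, H.D_half_mul, tr]
  simp only [map_add]
  exact H.I.mul_mem_left _ (H.I.add_mem (H.I.add_mem (H.I.add_mem (key _ _) (key _ _))
    (key _ _)) (key _ _))

theorem Gam_222 : B.Gam 2 2 2 - kap ∈ H.I := by
  rw [Gam_2]
  convert H.I.neg_mem (H.I.mul_mem_left H.half B.grav) using 1
  linear_combination kap * H.two_half

theorem Gam_332 : B.Gam 3 3 2 + kap ∈ H.I := by
  have := H.I.add_mem (B.Gam_33b 2) (H.I.mul_mem_left H.half B.grav)
  convert this using 1
  linear_combination -kap * H.two_half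

/-- After expansion of `Γ³_{2a}`, the terms with `g^{30}, g^{31}` are products of two vanishing
factors, and `∂_r g_{22}` is the constant `-2κ` along the horizon. Only the slope `2κ` of `g^{33}`
against `∂_r g_{2a}` remains. -/
theorem D3_Gam_32 (a : Fin 4) (ha : a ≠ 3) :
    H.D 3 (B.Gam 3 2 a) + kap * H.D 3 (B.g 2 a) ∈ H.I := by
  have e : B.Gam 3 2 a = H.half * (B.gi 3 0 * B.low 0 2 a + B.gi 3 1 * B.low 1 2 a
      + H.D a (B.g 2 2) - B.gi 3 3 * H.D 3 (B.g 2 a)) := by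
    simp only [Gam, Fin.sum_univ_four, B.gi_2, if_true, one_mul, B.low_3]
    simp only [low]; ring
  rw [e, H.D_half_mul]
  simp only [map_add, map_sub, H.D_mul]
  have h0 : ∀ C : Fin 4, C ≠ 2 → C ≠ 3 →
      H.D 3 (B.gi 3 C) * B.low C 2 a + B.gi 3 C * H.D 3 (B.low C 2 a) ∈ H.I := fun C h2 h3 =>
    H.I.add_mem (H.I.mul_mem_left _ (B.low_mem C 2 a (by decide) ha h3 (by simp)))
      (H.I.mul_mem_right _ (B.gi3_mem C h2))
  have h1 := h0 0 (by decide) (by decide)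
  have h2 := h0 1 (by decide) (by decide)
  have h3 : H.D 3 (H.D a (B.g 2 2)) ∈ H.I := by
    have := H.stable a ha _ B.grav
    rw [map_add, two_mul, map_add, B.kap_const, add_zero, add_zero] at this
    rwa [H.comm]
  have h4 := H.I.mul_mem_right (H.D 3 (B.g 2 a)) B.D3_gi33
  have h5 := H.I.mul_mem_right (H.D 3 (H.D 3 (B.g 2 a))) (B.gi3_mem 3 (by decide))
  convert H.I.mul_mem_left H.half (H.I.sub_mem (H.I.sub_mem
    (H.I.add_mem (H.I.add_mem h1 h2) h3) h4) h5) using 1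
  linear_combination -kap * H.D 3 (B.g 2 a) * H.two_half

/-- On the horizon, `R_{a2} = -½ ∂_v ∂_r g_{2a}` for `a ≠ 3`. -/
theorem Ric_2_mem (a : Fin 4) (ha : a ≠ 3) :
    B.Ric a 2 + H.half * H.D 2 (H.D 3 (B.g 2 a)) ∈ H.I := by
  rw [Ric_expand]
  have c0 := H.stable 0 (by decide) _ (B.Gam_C2_mem 0 a (by decide) (by decide) ha)
  have c1 := H.stable 1 (by decide) _ (B.Gam_C2_mem 1 a (by decide) (by decide) ha)
  have c2 : H.D 2 (B.Gam 2 2 a) = -(H.half * H.D 2 (H.D 3 (B.g 2 a))) := by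
    rw [Gam_2, map_neg, H.D_half_mul]
  have c3 := B.D3_Gam_32 a ha
  have t := B.D2_sum_Gam_mem a ha
  have hs : ∑ e, (∑ c, B.Gam c c e) * B.Gam e 2 a ∈ H.I := by
    refine sum_mem fun e _ => ?_
    by_cases h2 : e = 2
    · subst h2; exact H.I.mul_mem_right _ B.sum_Gam_2_mem
    by_cases h3 : e = 3
    · subst h3; exact H.I.mul_mem_left _ (B.Gam_3_mem 2 a (by decide) ha)
    · exact H.I.mul_mem_left _ (B.Gam_C2_mem e a h2 h3 ha)
  -- Every product in the quadratic term has a factor that vanishes on the horizon, except for `c =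
  -- e = 2` and `c = e = 3`.
  have p : ∀ c e : Fin 4, ¬(c = 2 ∧ e = 2) → ¬(c = 3 ∧ e = 3) →
      B.Gam c 2 e * B.Gam e c a ∈ H.I := by
    intro c e h22 h33
    by_cases hc2 : c = 2
    · subst hc2
      by_cases he3 : e = 3
      · subst he3; rw [Gam_2_3, zero_mul]; exact H.I.zero_mem
      · exact H.I.mul_mem_left _ (B.Gam_C2_mem e a (fun h => h22 ⟨rfl, h⟩) he3 ha)
    by_cases hc3 : c = 3
    · subst hc3
      exact H.I.mul_mem_right _ (B.Gam_3_mem 2 e (by decide) (fun h => h33 ⟨rfl, h⟩))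
    by_cases he3 : e = 3
    · subst he3; exact H.I.mul_mem_left _ (B.Gam_3_mem c a hc3 ha)
    · exact H.I.mul_mem_right _ (B.Gam_C2_mem c e hc2 hc3 he3)
  -- The two surviving products contribute `-½ κ ∂_r g_{2a}` each. Their sum enters the Ricci tensor
  -- with a minus sign and cancels the `-κ ∂_r g_{2a}` that comes from `∂_r Γ³_{2a}`.
  have q2 : B.Gam 2 2 2 * B.Gam 2 2 a + H.half * kap * H.D 3 (B.g 2 a) ∈ H.I := by
    rw [B.Gam_2 2 a]
    convert H.I.mul_mem_right (-(H.half * H.D 3 (B.g 2 a))) B.Gam_222 using 1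
    ring
  have q3 : B.Gam 3 2 3 * B.Gam 3 3 a + H.half * kap * H.D 3 (B.g 2 a) ∈ H.I := by
    rw [B.Gam_symm 3 2 3]
    have h1 := H.I.mul_mem_right (B.Gam 3 3 a) B.Gam_332
    have h2 := H.I.mul_mem_left kap (B.Gam_33b a)
    convert H.I.sub_mem h1 h2 using 1
    ring
  have hp : (∑ c, ∑ e, B.Gam c 2 e * B.Gam e c a) + kap * H.D 3 (B.g 2 a) ∈ H.I := by
    have r : (∑ c, ∑ e, B.Gam c 2 e * B.Gam e c a)
        - B.Gam 2 2 2 * B.Gam 2 2 a - B.Gam 3 2 3 * B.Gam 3 3 a ∈ H.I := by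
      have e : (∑ c, ∑ e, B.Gam c 2 e * B.Gam e c a)
          - B.Gam 2 2 2 * B.Gam 2 2 a - B.Gam 3 2 3 * B.Gam 3 3 a
          = ∑ c, ∑ e, if (c = 2 ∧ e = 2) ∨ (c = 3 ∧ e = 3) then 0
              else B.Gam c 2 e * B.Gam e c a := by
        simp only [Fin.sum_univ_four]
        simp
        ring
      rw [e]
      refine sum_mem fun c _ => sum_mem fun e _ => ?_
      split_ifs with h
      · exact H.I.zero_mem
      · exact p c e (fun h' => h (Or.inl h')) (fun h' => h (Or.inr h'))
    convert H.I.add_mem r (H.I.add_mem q2 q3) using 1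
    linear_combination -kap * H.D 3 (B.g 2 a) * H.two_half
  have hD : (∑ c, H.D c (B.Gam c 2 a)) + H.half * H.D 2 (H.D 3 (B.g 2 a))
      + kap * H.D 3 (B.g 2 a) ∈ H.I := by
    rw [Fin.sum_univ_four, c2]
    convert H.I.add_mem (H.I.add_mem c0 c1) c3 using 1
    ring
  convert H.I.sub_mem (H.I.add_mem (H.I.sub_mem hD t) hs) hp using 1
  ring

/-- The value of `∂_r g_{22}` on the horizon is `-2κ`, and `κ` is constant, so its derivative along
`∂_v` vanishes. -/
theorem Ric_22_mem : B.Ric 2 2 ∈ H.I := by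
  have h := B.Ric_2_mem 2 (by decide)
  have h2 := H.stable 2 (by decide) _ B.grav
  rw [map_add, two_mul, map_add, B.kap_const, add_zero, add_zero] at h2
  convert H.I.sub_mem h (H.I.mul_mem_left H.half h2) using 1
  ring

/-- The only term that is not visibly symmetric is `∂_b Γ^c_{ca}`. It is a second derivative of the
logarithm of the determinant, which is checked here through `D_gi`. -/
theorem Ric_symm (a b : Fin 4) : B.Ric a b = B.Ric b a := by
  have h : H.D b (∑ c, B.Gam c c a) = H.D a (∑ c, B.Gam c c b) := by
    rw [sum_Gam, sum_Gam, H.D_half_mul, H.D_half_mul, tr, tr]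
    simp only [map_add, H.D_mul, B.D_gi, Fin.sum_univ_four, H.comm b a]
    simp [B.D_g3, B.D_g_3, B.gi_2, B.gi2, B.gsymm 1 0, B.symm 1 0]
    ring
  rw [Ric_expand, Ric_expand, h]
  simp only [B.Gam_symm _ b a, Fin.sum_univ_four]
  ring_nf
  simp only [B.Gam_symm _ b 0, B.Gam_symm _ b 1, B.Gam_symm _ b 2, B.Gam_symm _ b 3,
    B.Gam_symm _ a 0, B.Gam_symm _ a 1, B.Gam_symm _ a 2, B.Gam_symm _ a 3]
  ring

end Bondi

namespace Bondi

variable {R : Type*} [CommRing R] {H : HDiff R} {kap : R} {B B' : Bondi H kap}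

/-! ### Two metrics that agree to some order on the horizon -/

theorem dgi_mem {m : ℕ} (hg : ∀ a b, B'.g a b - B.g a b ∈ H.J m) (a b : Fin 4) :
    B'.gi a b - B.gi a b ∈ H.J m := by
  rw [gi_sub]
  exact (H.J m).neg_mem (sum_mem fun c _ => sum_mem fun d _ =>
    (H.J m).mul_mem_right _ ((H.J m).mul_mem_left _ (hg c d)))

theorem mul_sub_mem {K : Ideal R} {x x' y y' : R} (hx : x' - x ∈ K) (hy : y' - y ∈ K) :
    x' * y' - x * y ∈ K := by
  convert K.add_mem (K.mul_mem_left x' hy) (K.mul_mem_right y hx) using 1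
  ring

theorem low_sub (d b c : Fin 4) : B'.low d b c - B.low d b c
    = H.D b (B'.g d c - B.g d c) + H.D c (B'.g d b - B.g d b) - H.D d (B'.g b c - B.g b c) := by
  simp only [low, map_sub]; ring

theorem dlow_mem {k : ℕ} (hg : ∀ a b, B'.g a b - B.g a b ∈ H.J (k + 1)) (d b c : Fin 4) :
    B'.low d b c - B.low d b c ∈ H.J k := by
  rw [low_sub]
  exact (H.J k).sub_mem ((H.J k).add_mem (H.D_mem_pred _ (hg _ _)) (H.D_mem_pred _ (hg _ _)))
    (H.D_mem_pred _ (hg _ _))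

theorem dlow_mem' {m : ℕ} (hg : ∀ a b, B'.g a b - B.g a b ∈ H.J m) (d b c : Fin 4)
    (hd : d ≠ 3) (hb : b ≠ 3) (hc : c ≠ 3) : B'.low d b c - B.low d b c ∈ H.J m := by
  rw [low_sub]
  exact (H.J m).sub_mem ((H.J m).add_mem (H.D_mem hb (hg _ _)) (H.D_mem hc (hg _ _)))
    (H.D_mem hd (hg _ _))

theorem Gam_sub (a b c : Fin 4) : B'.Gam a b c - B.Gam a b c
    = H.half * ∑ d, (B'.gi a d * B'.low d b c - B.gi a d * B.low d b c) := by
  simp only [Gam, Finset.sum_sub_distrib, mul_sub]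

theorem dGam_mem {k : ℕ} (hg : ∀ a b, B'.g a b - B.g a b ∈ H.J (k + 1)) (a b c : Fin 4) :
    B'.Gam a b c - B.Gam a b c ∈ H.J k := by
  rw [Gam_sub]
  exact (H.J k).mul_mem_left _ (sum_mem fun d _ =>
    mul_sub_mem (H.J_anti (Nat.le_succ k) (dgi_mem hg a d)) (dlow_mem hg d b c))

theorem dsum_Gam {m : ℕ} (hg : ∀ a b, B'.g a b - B.g a b ∈ H.J m) (a : Fin 4) :
    (∑ c, B'.Gam c c a) - (∑ c, B.Gam c c a)
      - H.half * B.tr (fun b c => H.D a (B'.g b c - B.g b c)) ∈ H.J m := by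
  rw [sum_Gam, sum_Gam]
  have h : ∀ b c, (B'.gi b c - B.gi b c) * H.D a (B'.g b c) ∈ H.J m := fun b c =>
    (H.J m).mul_mem_right _ (dgi_mem hg b c)
  convert (H.J m).mul_mem_left H.half ((H.J m).add_mem ((H.J m).add_mem ((H.J m).add_mem
    (h 0 0) (h 0 1)) (h 1 0)) (h 1 1)) using 1
  simp only [tr, map_sub]
  ring

theorem dsum_Gam_mem {m : ℕ} (hg : ∀ a b, B'.g a b - B.g a b ∈ H.J m) (a : Fin 4) (ha : a ≠ 3) :
    (∑ c, B'.Gam c c a) - (∑ c, B.Gam c c a) ∈ H.J m := by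
  have h : ∀ b c, B.gi b c * H.D a (B'.g b c - B.g b c) ∈ H.J m := fun b c =>
    (H.J m).mul_mem_left _ (H.D_mem ha (hg b c))
  have h' := (H.J m).mul_mem_left H.half ((H.J m).add_mem ((H.J m).add_mem ((H.J m).add_mem
    (h 0 0) (h 0 1)) (h 1 0)) (h 1 1))
  convert (H.J m).add_mem (dsum_Gam hg a) h' using 1
  rw [tr]; ring

/-- Only `∂_r` of the connection can lose an order, and it enters the Ricci tensor in two places: in
the divergence, with upper index `3`, and in the gradient of the trace, when `b = 3`. -/
theorem dRic_of_Gam {m : ℕ} (hG : ∀ a b c, B'.Gam a b c - B.Gam a b c ∈ H.J m) (a b : Fin 4) :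
    B'.Ric a b - B.Ric a b - (H.D 3 (B'.Gam 3 b a - B.Gam 3 b a)
      - if b = 3 then H.D 3 ((∑ c, B'.Gam c c a) - ∑ c, B.Gam c c a) else 0) ∈ H.J m := by
  have h1 : ∀ c : Fin 4, c ≠ 3 → H.D c (B'.Gam c b a) - H.D c (B.Gam c b a) ∈ H.J m := by
    intro c hc; rw [← map_sub]; exact H.D_mem hc (hG _ _ _)
  have hS : ∀ e, (∑ c, B'.Gam c c e) - ∑ c, B.Gam c c e ∈ H.J m := by
    intro e; rw [← Finset.sum_sub_distrib]; exact sum_mem fun c _ => hG _ _ _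
  have h2 : H.D b (∑ c, B'.Gam c c a) - H.D b (∑ c, B.Gam c c a)
      - (if b = 3 then H.D 3 ((∑ c, B'.Gam c c a) - ∑ c, B.Gam c c a) else 0) ∈ H.J m := by
    rw [← map_sub]
    split_ifs with hb
    · subst hb; rw [sub_self]; exact zero_mem _
    · rw [sub_zero]; exact H.D_mem hb (hS a)
  have h3 : ∑ e, (∑ c, B'.Gam c c e) * B'.Gam e b a - ∑ e, (∑ c, B.Gam c c e) * B.Gam e b a
      ∈ H.J m := by
    rw [← Finset.sum_sub_distrib]
    exact sum_mem fun e _ => mul_sub_mem (hS e) (hG _ _ _)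
  have h4 : ∑ c, ∑ e, B'.Gam c b e * B'.Gam e c a - ∑ c, ∑ e, B.Gam c b e * B.Gam e c a
      ∈ H.J m := by
    simp_rw [← Finset.sum_sub_distrib]
    exact sum_mem fun c _ => sum_mem fun e _ => mul_sub_mem (hG _ _ _) (hG _ _ _)
  rw [Ric_expand, Ric_expand, Fin.sum_univ_four (fun c => H.D c (B'.Gam c b a)),
    Fin.sum_univ_four (fun c => H.D c (B.Gam c b a)), map_sub (H.D 3) (B'.Gam 3 b a)]
  convert (H.J m).sub_mem ((H.J m).add_mem ((H.J m).sub_mem ((H.J m).add_mem ((H.J m).add_mem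
    (h1 0 (by decide)) (h1 1 (by decide))) (h1 2 (by decide))) h2) h3) h4 using 1
  ring

/-- In `Γ³ = ½ g^{3d} (…)_d` the factors with `d ≠ 2` vanish on the horizon and recover the order
lost to a derivative. For `d = 2` the factor is `1`, and only radial derivatives of `g_{2·}` lose an
order. -/
theorem dGam_3 {k : ℕ} (hg : ∀ a b, B'.g a b - B.g a b ∈ H.J (k + 1)) (b a : Fin 4) :
    B'.Gam 3 b a - B.Gam 3 b a - H.half * ((if b = 3 then H.D 3 (B'.g 2 a - B.g 2 a) else 0)
      + if a = 3 then H.D 3 (B'.g 2 b - B.g 2 b) else 0) ∈ H.J (k + 1) := by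
  have h1 : ∀ d : Fin 4, d ≠ 2 → B'.gi 3 d * B'.low d b a - B.gi 3 d * B.low d b a
      ∈ H.J (k + 1) := by
    intro d hd
    have e1 := H.mul_mem_J_succ (B'.gi3_mem d hd) (dlow_mem hg d b a)
    have e2 := (H.J (k + 1)).mul_mem_right (B.low d b a) (dgi_mem hg 3 d)
    convert (H.J (k + 1)).add_mem e1 e2 using 1
    ring
  have hD : ∀ i x y : Fin 4, H.D i (B'.g x y - B.g x y)
      - (if i = 3 then H.D 3 (B'.g x y - B.g x y) else 0) ∈ H.J (k + 1) := by
    intro i x y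
    split_ifs with hi
    · subst hi; rw [sub_self]; exact zero_mem _
    · rw [sub_zero]; exact H.D_mem hi (hg _ _)
  have h2 : B'.low 2 b a - B.low 2 b a - ((if b = 3 then H.D 3 (B'.g 2 a - B.g 2 a) else 0)
      + if a = 3 then H.D 3 (B'.g 2 b - B.g 2 b) else 0) ∈ H.J (k + 1) := by
    rw [low_sub]
    convert (H.J (k + 1)).sub_mem ((H.J (k + 1)).add_mem (hD b 2 a) (hD a 2 b))
      (H.D_mem (i := 2) (by decide) (hg b a)) using 1
    ring
  rw [Gam_sub, Fin.sum_univ_four]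
  convert (H.J (k + 1)).mul_mem_left H.half ((H.J (k + 1)).add_mem ((H.J (k + 1)).add_mem
    ((H.J (k + 1)).add_mem (h1 0 (by decide)) (h1 1 (by decide))) h2) (h1 3 (by decide))) using 1
  simp only [B.gi_2, B'.gi_2, if_true]
  ring

/-- The leading part of the difference of two Ricci tensors. -/
theorem dRic_lead {k : ℕ} (hg : ∀ a b, B'.g a b - B.g a b ∈ H.J (k + 2)) (a b : Fin 4) :
    B'.Ric a b - B.Ric a b - H.half * ((if b = 3 then H.D 3 (H.D 3 (B'.g 2 a - B.g 2 a)) else 0)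
      + (if a = 3 then H.D 3 (H.D 3 (B'.g 2 b - B.g 2 b)) else 0)
      - (if a = 3 ∧ b = 3 then B.tr (fun c d => H.D 3 (H.D 3 (B'.g c d - B.g c d))) else 0))
      ∈ H.J (k + 1) := by
  have h1 := dRic_of_Gam (dGam_mem hg) a b
  have h2 := H.D3_mem (dGam_3 hg b a)
  have h3 : (if b = 3 then H.D 3 ((∑ c, B'.Gam c c a) - ∑ c, B.Gam c c a) else 0)
      - (if a = 3 ∧ b = 3 then
        H.half * B.tr (fun c d => H.D 3 (H.D 3 (B'.g c d - B.g c d))) else 0) ∈ H.J (k + 1) := by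
    by_cases hb : b = 3
    · by_cases ha : a = 3
      · subst ha hb
        simp only [and_self, if_true]
        have := H.D3_mem (dsum_Gam hg 3)
        rw [map_sub, H.D_half_mul] at this
        have m : ∀ c d : Fin 4, H.D 3 (B.gi c d) * H.D 3 (B'.g c d - B.g c d) ∈ H.J (k + 1) :=
          fun c d => (H.J _).mul_mem_left _ (H.D3_mem (hg c d))
        have m' := (H.J (k + 1)).mul_mem_left H.half ((H.J (k + 1)).add_mem
          ((H.J (k + 1)).add_mem ((H.J (k + 1)).add_mem (m 0 0) (m 0 1)) (m 1 0)) (m 1 1))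
        convert (H.J (k + 1)).add_mem this m' using 1
        simp only [tr, map_add, H.D_mul]
        ring
      · simp only [hb, ha, if_true, false_and, if_false, sub_zero]
        exact H.D3_mem (dsum_Gam_mem hg a ha)
    · simp [hb]
  have h4 : ∀ p : Prop, [Decidable p] → ∀ x : R, H.D 3 (if p then x else 0)
      = if p then H.D 3 x else 0 := by
    intro p _ x; split_ifs <;> simp
  rw [map_sub, H.D_half_mul, map_add, h4, h4] at h2
  convert (H.J (k + 1)).sub_mem ((H.J (k + 1)).add_mem h1 h2) h3 using 1
  have e : (if a = 3 ∧ b = 3 then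
        H.half * B.tr (fun c d => H.D 3 (H.D 3 (B'.g c d - B.g c d))) else 0)
      = H.half * (if a = 3 ∧ b = 3 then
        B.tr (fun c d => H.D 3 (H.D 3 (B'.g c d - B.g c d))) else 0) := by
    split_ifs <;> simp
  rw [e]
  ring

/-- On the horizon the inverse metric has `g^{23} = 1` and no other component with an upper index
`3`, so the leading parts of `R_{23}` and `R_{32}` are the only contributions. The tangential
components have no leading part. -/
theorem dScal_lead {k : ℕ} (hg : ∀ a b, B'.g a b - B.g a b ∈ H.J (k + 2)) :
    B'.Scal - B.Scal - H.D 3 (H.D 3 (B'.g 2 2 - B.g 2 2)) ∈ H.J (k + 1) := by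
  have hRic : ∀ a b, B'.Ric a b - B.Ric a b ∈ H.J k := by
    intro a b
    have hD : ∀ c d, H.D 3 (H.D 3 (B'.g c d - B.g c d)) ∈ H.J k := fun c d =>
      H.D3_mem (H.D3_mem (hg c d))
    have h2 : (if b = 3 then H.D 3 (H.D 3 (B'.g 2 a - B.g 2 a)) else 0)
      + (if a = 3 then H.D 3 (H.D 3 (B'.g 2 b - B.g 2 b)) else 0)
      - (if a = 3 ∧ b = 3 then B.tr (fun c d => H.D 3 (H.D 3 (B'.g c d - B.g c d))) else 0)
      ∈ H.J k := by
      refine (H.J k).sub_mem ((H.J k).add_mem ?_ ?_) ?_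
      · split_ifs
        · exact hD _ _
        · exact zero_mem _
      · split_ifs
        · exact hD _ _
        · exact zero_mem _
      · split_ifs
        · exact (H.J k).add_mem ((H.J k).add_mem ((H.J k).add_mem
            ((H.J k).mul_mem_left _ (hD _ _)) ((H.J k).mul_mem_left _ (hD _ _)))
            ((H.J k).mul_mem_left _ (hD _ _))) ((H.J k).mul_mem_left _ (hD _ _))
        · exact zero_mem _
    convert (H.J k).add_mem (H.J_anti (Nat.le_succ k) (dRic_lead hg a b))
      ((H.J k).mul_mem_left H.half h2) using 1
    ring
  have key : ∀ a b, B'.gi a b * B'.Ric a b - B.gi a b * B.Ric a b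
      - (if (a = 2 ∧ b = 3) ∨ (a = 3 ∧ b = 2) then
          H.half * H.D 3 (H.D 3 (B'.g 2 2 - B.g 2 2)) else 0) ∈ H.J (k + 1) := by
    intro a b
    have h1 := (H.J (k + 1)).mul_mem_right (B.Ric a b) (H.J_anti (Nat.le_succ (k + 1))
      (dgi_mem hg a b))
    have h2 : B'.gi a b * (B'.Ric a b - B.Ric a b) -
      (if (a = 2 ∧ b = 3) ∨ (a = 3 ∧ b = 2) then
          H.half * H.D 3 (H.D 3 (B'.g 2 2 - B.g 2 2)) else 0) ∈ H.J (k + 1) := by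
      by_cases h23 : a = 2 ∧ b = 3
      · obtain ⟨rfl, rfl⟩ := h23
        simpa [B'.gi2] using dRic_lead hg 2 3
      by_cases h32 : a = 3 ∧ b = 2
      · obtain ⟨rfl, rfl⟩ := h32
        simpa [B'.gi_2] using dRic_lead hg 3 2
      rw [if_neg (by tauto), sub_zero]
      by_cases ha2 : a = 2
      · rw [ha2, B'.gi2, if_neg (by tauto), zero_mul]; exact zero_mem _
      by_cases hb2 : b = 2
      · rw [hb2, B'.gi_2, if_neg (by tauto), zero_mul]; exact zero_mem _
      -- Here the difference of the Ricci tensors is known only to order `k`; the factor `g^{3b}`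
      -- with `b ≠ 2` supplies the missing order.
      by_cases ha3 : a = 3
      · rw [ha3]; exact H.mul_mem_J_succ (B'.gi3_mem b hb2) (hRic _ _)
      by_cases hb3 : b = 3
      · rw [hb3, B'.gsymm]; exact H.mul_mem_J_succ (B'.gi3_mem a ha2) (hRic _ _)
      refine (H.J (k + 1)).mul_mem_left _ ?_
      simpa [ha3, hb3] using dRic_lead hg a b
    convert (H.J (k + 1)).add_mem h1 h2 using 1
    ring
  have := sum_mem (S := H.J (k + 1)) (t := Finset.univ) fun a (_ : a ∈ Finset.univ) =>
    sum_mem (S := H.J (k + 1)) (t := Finset.univ) fun b (_ : b ∈ Finset.univ) => key a b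
  simp_rw [Finset.sum_sub_distrib] at this
  convert this using 1
  have e : ∑ a : Fin 4, ∑ b : Fin 4, (if (a = 2 ∧ b = 3) ∨ (a = 3 ∧ b = 2) then
          H.half * H.D 3 (H.D 3 (B'.g 2 2 - B.g 2 2)) else 0)
      = H.D 3 (H.D 3 (B'.g 2 2 - B.g 2 2)) := by
    generalize H.D 3 (H.D 3 (B'.g 2 2 - B.g 2 2)) = X
    simp only [Fin.sum_univ_four]
    simp
    linear_combination X * H.two_half
  rw [e, Scal, Scal]

end Bondi

namespace Bondi

variable {R : Type*} [CommRing R] {H : HDiff R} {kap : R} {B B' : Bondi H kap}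

/-! ### Two metrics whose difference is tangential to leading order -/

section Tangential

variable {k : ℕ} (hg : ∀ a b, B'.g a b - B.g a b ∈ H.J (k + 1))
  (hg2 : ∀ a, B'.g 2 a - B.g 2 a ∈ H.J (k + 2))

include hg in
-- With tangential lower indices a radial derivative occurs only for `d = 3`, and then it is
-- multiplied by `g^{u3}`, which vanishes on the horizon for `u ≠ 2`. So no order is lost.
theorem dGam_upper (u b c : Fin 4) (hu : u ≠ 2) (hb : b ≠ 3) (hc : c ≠ 3) :
    B'.Gam u b c - B.Gam u b c ∈ H.J (k + 1) := by
  rw [Gam_sub]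
  refine (H.J (k + 1)).mul_mem_left _ (sum_mem fun d _ => ?_)
  by_cases hd : d = 3
  · subst hd
    have e1 := H.mul_mem_J_succ (B'.gi3_mem u hu) (dlow_mem hg 3 b c)
    have e2 := (H.J (k + 1)).mul_mem_right (B.low 3 b c) (dgi_mem hg u 3)
    rw [B'.gsymm u 3] at e2 ⊢
    convert (H.J (k + 1)).add_mem e1 e2 using 1
    ring
  · exact mul_sub_mem (dgi_mem hg u d) (dlow_mem' hg d b c hd hb hc)

include hg2 in
theorem dGam_2_2 (b : Fin 4) : B'.Gam 2 2 b - B.Gam 2 2 b ∈ H.J (k + 1) := by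
  rw [Gam_2, Gam_2]
  convert (H.J (k + 1)).neg_mem ((H.J (k + 1)).mul_mem_left H.half (H.D3_mem (hg2 b))) using 1
  rw [map_sub]; ring

include hg hg2 in
-- Here `Γ^u_{3b} = ½ g^{ud} ∂_r g_{db}`. A full loss of order is avoided because the radial
-- derivative hits a component `g_{2·}`, which agrees one order better, or stands next to a
-- vanishing `g^{3d}`.
theorem dGam_u3 (u b : Fin 4) (h : u = 3 ∨ b = 2) :
    B'.Gam u 3 b - B.Gam u 3 b ∈ H.J (k + 1) := by
  rw [Gam_sub]
  refine (H.J (k + 1)).mul_mem_left _ (sum_mem fun d _ => ?_)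
  simp only [low_lower3']
  rcases h with rfl | rfl
  · by_cases hd : d = 2
    · subst hd
      refine mul_sub_mem (dgi_mem hg _ _) ?_
      rw [← map_sub]; exact H.D3_mem (hg2 b)
    · have e1 := H.mul_mem_J_succ (B'.gi3_mem d hd) (H.D3_mem (hg d b))
      have e2 := (H.J (k + 1)).mul_mem_right (H.D 3 (B.g d b)) (dgi_mem hg 3 d)
      convert (H.J (k + 1)).add_mem e1 e2 using 1
      rw [map_sub]; ring
  · refine mul_sub_mem (dgi_mem hg _ _) ?_
    rw [← map_sub, B.symm, B'.symm]; exact H.D3_mem (hg2 d)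

include hg hg2 in
theorem dgi3_mem (C : Fin 4) : B'.gi 3 C - B.gi 3 C ∈ H.J (k + 2) := by
  by_cases hC : C = 2
  · rw [hC, gi_2, gi_2, sub_self]; exact zero_mem _
  rw [gi_3_eq _ C hC, gi_3_eq _ C hC]
  have h : ∀ A : Fin 4, A ≠ 3 → B'.g 2 A * B'.gi A C - B.g 2 A * B.gi A C ∈ H.J (k + 2) := by
    intro A hA
    have e1 := H.mul_mem_J_succ (B'.null A hA) (dgi_mem hg A C)
    have e2 := (H.J (k + 2)).mul_mem_right (B.gi A C) (hg2 A)
    convert (H.J (k + 2)).add_mem e1 e2 using 1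
    ring
  have h3 : (if C = 3 then B'.g 2 2 else 0) - (if C = 3 then B.g 2 2 else 0) ∈ H.J (k + 2) := by
    split_ifs
    · exact hg2 2
    · rw [sub_self]; exact zero_mem _
  convert (H.J (k + 2)).neg_mem ((H.J (k + 2)).add_mem ((H.J (k + 2)).add_mem
    (h 0 (by decide)) (h 1 (by decide))) h3) using 1
  ring

include hg hg2 in
-- To this order the difference comes from `d = 2`, which leaves `-∂_v δg`, and from `d = 3`, which
-- leaves `-g^{33} ∂_r δg`. The second term has to be kept exactly, because one more radial
-- derivative will hit `g^{33}` and produce `κ`.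
theorem dGam_3_tangential (a b : Fin 4) (ha : a ≠ 3) (hb : b ≠ 3) :
    B'.Gam 3 b a - B.Gam 3 b a + H.half * (H.D 2 (B'.g b a - B.g b a)
      + B'.gi 3 3 * H.D 3 (B'.g b a - B.g b a)) ∈ H.J (k + 2) := by
  have h1 : ∀ d : Fin 4, d ≠ 2 → d ≠ 3 → B'.gi 3 d * B'.low d b a - B.gi 3 d * B.low d b a
      ∈ H.J (k + 2) := by
    intro d hd hd3
    have e1 := H.mul_mem_J_succ (B'.gi3_mem d hd) (dlow_mem' hg d b a hd3 hb ha)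
    have e2 := (H.J (k + 2)).mul_mem_right (B.low d b a) (dgi3_mem hg hg2 d)
    convert (H.J (k + 2)).add_mem e1 e2 using 1
    ring
  have h2 : B'.low 2 b a - B.low 2 b a + H.D 2 (B'.g b a - B.g b a) ∈ H.J (k + 2) := by
    rw [low_sub]
    convert (H.J (k + 2)).add_mem (H.D_mem hb (hg2 a)) (H.D_mem ha (hg2 b)) using 1
    ring
  have h3 := (H.J (k + 2)).mul_mem_right (B.low 3 b a) (dgi3_mem hg hg2 3)
  rw [Gam_sub, Fin.sum_univ_four]
  convert (H.J (k + 2)).mul_mem_left H.half ((H.J (k + 2)).add_mem ((H.J (k + 2)).add_mem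
    ((H.J (k + 2)).add_mem (h1 0 (by decide) (by decide)) (h1 1 (by decide) (by decide))) h2) h3)
    using 1
  simp only [B.gi_2, B'.gi_2, if_true, low_3, map_sub]
  ring

/-- Covers products in which one factor differs only at the lower order: the other factor vanishes
on the horizon and agrees to the higher order. -/
theorem mul_mem_of_vanish {m : ℕ} {x x' y y' : R} (hx : x ∈ H.I) (hx' : x' - x ∈ H.J (m + 1))
    (hy : y' - y ∈ H.J m) : x' * y' - x * y ∈ H.J (m + 1) := by
  convert (H.J (m + 1)).add_mem (H.mul_mem_J_succ hx hy) ((H.J (m + 1)).mul_mem_right y' hx')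
    using 1
  ring

include hg hg2 in
/-- The transport operator along `∂_v` that acts on the leading difference of two metrics. -/
theorem dRic_tangential (a b : Fin 4) (ha : a ≠ 3) (hb : b ≠ 3) :
    B'.Ric a b - B.Ric a b + (H.D 2 (H.D 3 (B'.g b a - B.g b a))
      + H.half * H.D 3 (B'.gi 3 3 * H.D 3 (B'.g b a - B.g b a))) ∈ H.J (k + 1) := by
  have hG := dGam_mem hg
  have hD : ∀ c : Fin 4, c ≠ 2 → c ≠ 3 → H.D c (B'.Gam c b a) - H.D c (B.Gam c b a)
      ∈ H.J (k + 1) := by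
    intro c hc hc3; rw [← map_sub]; exact H.D_mem hc3 (dGam_upper hg c b a hc hb ha)
  -- Half of the mixed term `∂_v ∂_r δg` comes from `∂_v Γ²` and half from `∂_r Γ³`; together they
  -- give coefficient `1`.
  have hD2 : H.D 2 (B'.Gam 2 b a) - H.D 2 (B.Gam 2 b a)
      = -(H.half * H.D 2 (H.D 3 (B'.g b a - B.g b a))) := by
    simp only [Gam_2, map_neg, H.D_half_mul, map_sub]; ring
  have hD3 := H.D3_mem (dGam_3_tangential hg hg2 a b ha hb)
  rw [map_add, map_sub, H.D_half_mul, map_add (H.D 3) (H.D 2 _), H.comm 3 2] at hD3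
  have hS : H.D b (∑ c, B'.Gam c c a) - H.D b (∑ c, B.Gam c c a) ∈ H.J (k + 1) := by
    rw [← map_sub]; exact H.D_mem hb (dsum_Gam_mem hg a ha)
  have h3 : ∑ e, (∑ c, B'.Gam c c e) * B'.Gam e b a - ∑ e, (∑ c, B.Gam c c e) * B.Gam e b a
      ∈ H.J (k + 1) := by
    rw [← Finset.sum_sub_distrib]
    refine sum_mem fun e _ => ?_
    by_cases he3 : e = 3
    · subst he3
      rw [mul_comm, mul_comm _ (B.Gam 3 b a)]
      refine mul_mem_of_vanish (B.Gam_3_mem b a hb ha) (dGam_upper hg 3 b a (by decide) hb ha) ?_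
      rw [← Finset.sum_sub_distrib]; exact sum_mem fun c _ => hG _ _ _
    by_cases he2 : e = 2
    · subst he2
      exact mul_mem_of_vanish B.sum_Gam_2_mem (dsum_Gam_mem hg 2 (by decide)) (hG _ _ _)
    · exact mul_sub_mem (dsum_Gam_mem hg e he3) (dGam_upper hg e b a he2 hb ha)
  -- A coefficient whose difference is known only to order `k` is always paired with one that
  -- vanishes on the horizon. The pairs `c = e = 2` and `c = e = 3` have no such partner, but there
  -- both differences have the higher order.
  have h4 : ∑ c, ∑ e, B'.Gam c b e * B'.Gam e c a - ∑ c, ∑ e, B.Gam c b e * B.Gam e c a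
      ∈ H.J (k + 1) := by
    simp_rw [← Finset.sum_sub_distrib]
    refine sum_mem fun c _ => sum_mem fun e _ => ?_
    by_cases hc3 : c = 3
    · subst hc3
      by_cases he3 : e = 3
      · subst he3
        rw [B.Gam_symm 3 b 3, B'.Gam_symm 3 b 3]
        exact mul_sub_mem (dGam_u3 hg hg2 _ _ (Or.inl rfl)) (dGam_u3 hg hg2 _ _ (Or.inl rfl))
      · exact mul_mem_of_vanish (B.Gam_3_mem b e hb he3)
          (dGam_upper hg 3 b e (by decide) hb he3) (hG _ _ _)
    by_cases hc2 : c = 2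
    · subst hc2
      by_cases he3 : e = 3
      · subst he3
        rw [Gam_2_3, Gam_2_3, zero_mul, zero_mul, sub_self]; exact zero_mem _
      by_cases he2 : e = 2
      · subst he2
        rw [B.Gam_symm 2 b 2, B'.Gam_symm 2 b 2]
        exact mul_sub_mem (dGam_2_2 hg2 _) (dGam_2_2 hg2 _)
      · rw [mul_comm, mul_comm (B.Gam 2 b e)]
        exact mul_mem_of_vanish (B.Gam_C2_mem e a he2 he3 ha)
          (dGam_upper hg e 2 a he2 (by decide) ha) (hG _ _ _)
    by_cases he3 : e = 3
    · subst he3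
      rw [mul_comm, mul_comm (B.Gam c b 3)]
      exact mul_mem_of_vanish (B.Gam_3_mem c a hc3 ha)
        (dGam_upper hg 3 c a (by decide) hc3 ha) (hG _ _ _)
    by_cases he2 : e = 2
    · subst he2
      rw [B.Gam_symm c b 2, B'.Gam_symm c b 2]
      exact mul_mem_of_vanish (B.Gam_C2_mem c b hc2 hc3 hb)
        (dGam_upper hg c 2 b hc2 (by decide) hb) (hG _ _ _)
    · exact mul_sub_mem (dGam_upper hg c b e hc2 hb he3) (dGam_upper hg e c a he2 hc3 ha)
  rw [Ric_expand, Ric_expand, Fin.sum_univ_four (fun c => H.D c (B'.Gam c b a)),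
    Fin.sum_univ_four (fun c => H.D c (B.Gam c b a))]
  convert (H.J (k + 1)).sub_mem ((H.J (k + 1)).add_mem ((H.J (k + 1)).sub_mem
    ((H.J (k + 1)).add_mem ((H.J (k + 1)).add_mem (hD 0 (by decide) (by decide))
    (hD 1 (by decide) (by decide))) hD3) hS) h3) h4 using 1
  linear_combination hD2 - H.D 2 (H.D 3 (B'.g b a - B.g b a)) * H.two_half

include hg hg2 in
-- Since `g^{33}` vanishes on the horizon with slope `2κ`, `k + 1` radial derivatives of `½ g^{33}
-- ∂_r δg` leave `(k + 1) κ ∂_r^{k+1} δg`.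
theorem dRic_tangential_iter (a b : Fin 4) (ha : a ≠ 3) (hb : b ≠ 3) :
    (H.D 3)^[k] (B'.Ric a b - B.Ric a b) + (H.D 2 ((H.D 3)^[k + 1] (B'.g b a - B.g b a))
      + (k + 1) * kap * (H.D 3)^[k + 1] (B'.g b a - B.g b a)) ∈ H.I := by
  have h := H.iter_mem_I (dRic_tangential hg hg2 a b ha hb)
  rw [H.iter_add, H.iter_add, H.iter_half_mul, H.iter_comm, ← Function.iterate_succ_apply,
    ← Function.iterate_succ_apply] at h
  have h1 := H.iter_mul_of_mem_I (B'.gi3_mem 3 (by decide)) (H.D3_mem (hg b a))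
  rw [← Function.iterate_succ_apply (H.D 3) k (B'.g b a - B.g b a)] at h1
  have h2 := H.I.mul_mem_right ((k + 1) * (H.D 3)^[k + 1] (B'.g b a - B.g b a)) B'.D3_gi33
  convert H.I.sub_mem h (H.I.mul_mem_left H.half (H.I.add_mem h1 h2)) using 1
  linear_combination -(k + 1) * kap * (H.D 3)^[k + 1] (B'.g b a - B.g b a) * H.two_half

end Tangential

end Bondi

/-! ### Null frames and Newman-Penrose components over a differential ring. -/

/-- The contraction of a bilinear form with two vectors. -/
def con {R : Type*} [CommRing R] (f : Fin 4 → Fin 4 → R) (u w : Fin 4 → R) : R :=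
  ∑ i, ∑ j, f i j * u i * w j

/-- The vector `-∂ᵣ`. -/
def nR (R : Type*) [CommRing R] : Fin 4 → R := Pi.single 3 (-1)

/-- A null frame `(M, Mb, -∂ᵣ, L)` of a Bondi-like metric that is parallel along `∂ᵣ` and
adapted to the horizon. -/
structure NPFrame {R : Type*} [CommRing R] {H : HDiff R} {kap : R} (B : Bondi H kap) where
  M : Fin 4 → R
  Mb : Fin 4 → R
  L : Fin 4 → R
  M_2 : M 2 = 0
  Mb_2 : Mb 2 = 0
  gi_eq : ∀ a b, B.gi a b = M a * Mb b + Mb a * M b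
    + ((if a = 3 then L b else 0) + if b = 3 then L a else 0)
  par_M : ∀ a, H.D 3 (M a) = -∑ b, B.Gam a 3 b * M b
  par_Mb : ∀ a, H.D 3 (Mb a) = -∑ b, B.Gam a 3 b * Mb b
  par_L : ∀ a, H.D 3 (L a) = -∑ b, B.Gam a 3 b * L b
  M_3 : M 3 ∈ H.I
  Mb_3 : Mb 3 ∈ H.I
  L_hor : ∀ a, L a - (if a = 2 then 1 else 0) ∈ H.I
  stat_M : ∀ a, H.D 2 (M a) ∈ H.I
  stat_Mb : ∀ a, H.D 2 (Mb a) ∈ H.I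

namespace NPFrame

variable {R : Type*} [CommRing R] {H : HDiff R} {kap : R} {B B' : Bondi H kap}
  (F : NPFrame B) (F' : NPFrame B')

def Phi11 : R := -(H.half * H.half) * (con B.Ric F.L (nR R) + con B.Ric F.M F.Mb)
def Phi20 : R := -H.half * con B.Ric F.Mb F.Mb
def Phi21 : R := -H.half * con B.Ric (nR R) F.Mb
def Phi22 (_F : NPFrame B) : R := -H.half * con B.Ric (nR R) (nR R)
def Psi4 : R := -∑ b, ∑ d, B.RUp 2 b 3 d * F.Mb b * F.Mb d
def npMu : R := -H.half * con (fun a b => H.D 3 (B.g a b)) F.Mb F.M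
def npLam : R := -H.half * con (fun a b => H.D 3 (B.g a b)) F.Mb F.Mb
def npPi : R := -H.half * con (fun a b => H.D 3 (B.g a b)) F.Mb F.L

theorem Phi22_eq : F.Phi22 = -H.half * B.Ric 3 3 := by
  simp [Phi22, con, nR, Fin.sum_univ_four]

theorem Phi21_eq : F.Phi21 = H.half * ∑ b, B.Ric 3 b * F.Mb b := by
  simp [Phi21, con, nR, Fin.sum_univ_four]; ring

theorem con_lead {f : Fin 4 → Fin 4 → R} {u w : Fin 4 → R} (hu : u 3 ∈ H.I) (hw : w 3 ∈ H.I)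
    (hu2 : u 2 = 0) (hw2 : w 2 = 0) :
    con f u w - (f 0 0 * u 0 * w 0 + f 0 1 * u 0 * w 1 + f 1 0 * u 1 * w 0 + f 1 1 * u 1 * w 1)
      ∈ H.I := by
  have e : con f u w
      - (f 0 0 * u 0 * w 0 + f 0 1 * u 0 * w 1 + f 1 0 * u 1 * w 0 + f 1 1 * u 1 * w 1)
      = (f 3 0 * w 0 + f 3 1 * w 1 + f 3 3 * w 3) * u 3 + (f 0 3 * u 0 + f 1 3 * u 1) * w 3 := by
    simp only [con, Fin.sum_univ_four, hu2, hw2]; ring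
  rw [e]
  exact H.I.add_mem (H.I.mul_mem_left _ hu) (H.I.mul_mem_left _ hw)

theorem tr_eq (f : Fin 4 → Fin 4 → R) (hf : f 1 0 = f 0 1) :
    B.tr f - 2 * con f F.M F.Mb ∈ H.I := by
  have h := con_lead (H := H) (f := f) F.M_3 F.Mb_3 F.M_2 F.Mb_2
  convert H.I.mul_mem_left (-2) h using 1
  simp [Bondi.tr, F.gi_eq, hf]
  ring

/-- On the horizon, `R = 2 R_{23} + 2 R(m, m̄)`. -/
theorem scal_mem : B.Scal - 2 * B.Ric 2 3 - 2 * con B.Ric F.M F.Mb ∈ H.I := by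
  have h := con_lead (H := H) (f := B.Ric) F.M_3 F.Mb_3 F.M_2 F.Mb_2
  have h0 := H.I.mul_mem_right (2 * B.Ric 0 3) (B.gi3_mem 0 (by decide))
  have h1 := H.I.mul_mem_right (2 * B.Ric 1 3) (B.gi3_mem 1 (by decide))
  have h3 := H.I.mul_mem_right (B.Ric 3 3) (B.gi3_mem 3 (by decide))
  convert H.I.add_mem (H.I.add_mem (H.I.add_mem h0 h1) h3) (H.I.mul_mem_left (-2) h) using 1
  rw [Bondi.Scal]
  simp only [Fin.sum_univ_four, B.gi_2, B.gi2, B.gsymm 0 3, B.gsymm 1 3, B.Ric_symm 3 0,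
    B.Ric_symm 3 1, B.Ric_symm 3 2, B.Ric_symm 1 0]
  simp [F.gi_eq 0 0, F.gi_eq 0 1, F.gi_eq 1 0, F.gi_eq 1 1]
  ring

/-- The component of the energy condition: `R/4 - 2 Φ₁₁ = R(m, m̄)` on the horizon. -/
theorem scal_phi11 : H.half * H.half * B.Scal - 2 * F.Phi11 - con B.Ric F.M F.Mb ∈ H.I := by
  have hs := F.scal_mem
  have hl : con B.Ric F.L (nR R) + B.Ric 2 3 ∈ H.I := by
    have m : ∀ a, (F.L a - (if a = 2 then 1 else 0)) * B.Ric a 3 ∈ H.I := fun a =>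
      H.I.mul_mem_right _ (F.L_hor a)
    convert H.I.neg_mem (H.I.add_mem (H.I.add_mem (H.I.add_mem (m 0) (m 1)) (m 2)) (m 3)) using 1
    simp [con, nR, Fin.sum_univ_four]
    ring
  convert H.I.add_mem (H.I.mul_mem_left (H.half * H.half) hs)
    (H.I.mul_mem_left (2 * H.half * H.half) hl) using 1
  rw [Phi11]
  linear_combination (con B.Ric F.M F.Mb * (2 * H.half + 1)) * H.two_half

/-- The completeness relation of the frame. -/
theorem complete (a c : Fin 4) (hc : c ≠ 2) : (if a = c then (1 : R) else 0)
    = F.M a * (∑ d, F.Mb d * B.g d c) + F.Mb a * (∑ d, F.M d * B.g d c)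
      + if a = 3 then ∑ d, F.L d * B.g d c else 0 := by
  rw [← B.inv a c]
  simp only [F.gi_eq, Fin.sum_univ_four, B.g3, hc, if_false, mul_zero, add_zero]
  by_cases ha : a = 3
  · simp [ha]; ring
  · simp [ha]; ring

/-- A covector without `3`-component is recovered from its values on `m` and `m̄` by the
completeness relation; the `ℓ` term there only meets `Y 3`. -/
theorem vec_mem {Y : Fin 4 → R} (h3 : Y 3 = 0) (h : ∑ a, Y a * F.M a ∈ H.I)
    (hb : ∑ a, Y a * F.Mb a ∈ H.I) (c : Fin 4) (hc : c ≠ 2) : Y c ∈ H.I := by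
  have e : Y c = ∑ a, Y a * (if a = c then (1 : R) else 0) := by simp
  have e2 : Y c = (∑ d, F.Mb d * B.g d c) * (∑ a, Y a * F.M a)
      + (∑ d, F.M d * B.g d c) * (∑ a, Y a * F.Mb a) := by
    rw [e]
    simp_rw [F.complete _ c hc]
    rw [Fin.sum_univ_four (fun a => Y a * F.M a), Fin.sum_univ_four (fun a => Y a * F.Mb a),
      Fin.sum_univ_four]
    simp [h3]
    ring
  rw [e2]
  exact H.I.add_mem (H.I.mul_mem_left _ h) (H.I.mul_mem_left _ hb)

/-- Apply `vec_mem` in each index. It turns the three scalar equations for `X(m, m)`, `X(m, m̄)`,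
`X(m̄, m̄)` into vanishing of the components. -/
theorem con_mem {X : Fin 4 → Fin 4 → R} (hs : ∀ a b, X a b = X b a) (h3 : ∀ b, X 3 b = 0)
    (h1 : con X F.M F.M ∈ H.I) (h2 : con X F.M F.Mb ∈ H.I) (h4 : con X F.Mb F.Mb ∈ H.I)
    (c e : Fin 4) (hc : c ≠ 2) (he : e ≠ 2) : X c e ∈ H.I := by
  refine F.vec_mem (Y := fun a => X a e) (h3 e) ?_ ?_ c hc
  · rw [show (∑ a, X a e * F.M a) = ∑ a, X e a * F.M a from
      Finset.sum_congr rfl fun a _ => by rw [hs]]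
    rw [show (∑ a, X e a * F.M a) = (fun b => ∑ a, X b a * F.M a) e from rfl]
    refine F.vec_mem (Y := fun b => ∑ a, X b a * F.M a) (by simp [h3]) ?_ ?_ e he
    · convert h1 using 1
      simp only [con, Finset.sum_mul]
      exact Finset.sum_congr rfl fun i _ => Finset.sum_congr rfl fun j _ => by ring
    · convert h2 using 1
      simp only [con, Finset.sum_mul]
      rw [Finset.sum_comm]
      exact Finset.sum_congr rfl fun i _ => Finset.sum_congr rfl fun j _ => by rw [hs j i]
  · rw [show (∑ a, X a e * F.Mb a) = ∑ a, X e a * F.Mb a from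
      Finset.sum_congr rfl fun a _ => by rw [hs]]
    rw [show (∑ a, X e a * F.Mb a) = (fun b => ∑ a, X b a * F.Mb a) e from rfl]
    refine F.vec_mem (Y := fun b => ∑ a, X b a * F.Mb a) (by simp [h3]) ?_ ?_ e he
    · convert h2 using 1
      simp only [con, Finset.sum_mul]
      exact Finset.sum_congr rfl fun i _ => Finset.sum_congr rfl fun j _ => by ring
    · convert h4 using 1
      simp only [con, Finset.sum_mul]
      exact Finset.sum_congr rfl fun i _ => Finset.sum_congr rfl fun j _ => by ring

/-- `∂_v` acts on the contraction with the frame through the components, on the horizon. -/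
theorem D2_con {X : Fin 4 → Fin 4 → R} {u w : Fin 4 → R} (hu : ∀ a, H.D 2 (u a) ∈ H.I)
    (hw : ∀ a, H.D 2 (w a) ∈ H.I) (c : R) :
    H.D 2 (con X u w) + c * con X u w - con (fun a b => H.D 2 (X a b) + c * X a b) u w ∈ H.I := by
  have : ∑ i, ∑ j, (X i j * H.D 2 (u i) * w j + X i j * u i * H.D 2 (w j)) ∈ H.I :=
    sum_mem fun i _ => sum_mem fun j _ => H.I.add_mem
      (H.I.mul_mem_right _ (H.I.mul_mem_left _ (hu i))) (H.I.mul_mem_left _ (hw j))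
  convert this using 1
  simp only [con, map_sum, H.D_mul, Finset.mul_sum, ← Finset.sum_add_distrib,
    ← Finset.sum_sub_distrib]
  exact Finset.sum_congr rfl fun i _ => Finset.sum_congr rfl fun j _ => by ring

theorem npPi_eq : F.npPi
    + H.half * (H.D 3 (B.g 2 0) * F.Mb 0 + H.D 3 (B.g 2 1) * F.Mb 1) ∈ H.I := by
  have m : ∀ a b, (F.L b - (if b = 2 then 1 else 0)) * (H.D 3 (B.g a b) * F.Mb a) ∈ H.I :=
    fun a b => H.I.mul_mem_right _ (F.L_hor b)
  have s := sum_mem (S := H.I) (t := Finset.univ) fun a (_ : a ∈ Finset.univ) =>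
    sum_mem (S := H.I) (t := Finset.univ) fun b (_ : b ∈ Finset.univ) => m a b
  convert H.I.mul_mem_left (-H.half) s using 1
  simp only [npPi, con, Fin.sum_univ_four, F.Mb_2, B.D_g3, B.symm 2 0, B.symm 2 1]
  simp
  ring

variable {F F'}

/-- The transport equation expresses `∂_r` of the difference through the difference itself and that
of the connection. Each pass therefore gains one order, and the frame ends one order better than the
connection, at the order of the metric. -/
theorem parallel_mem {m : ℕ} (hG : ∀ b c d, B'.Gam b c d - B.Gam b c d ∈ H.J m)
    {X X' : Fin 4 → R}
    (hX : ∀ a, H.D 3 (X a) = -∑ b, B.Gam a 3 b * X b)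
    (hX' : ∀ a, H.D 3 (X' a) = -∑ b, B'.Gam a 3 b * X' b)
    (h0 : ∀ a, X' a - X a ∈ H.I) (a : Fin 4) : X' a - X a ∈ H.J (m + 1) := by
  have : ∀ i ≤ m + 1, ∀ a, X' a - X a ∈ H.J i := by
    intro i
    induction i with
    | zero => intro _ a; trivial
    | succ i ih =>
      intro hi a
      refine ⟨h0 a, ?_⟩
      change H.D 3 (X' a - X a) ∈ H.J i
      rw [map_sub, hX, hX']
      have : ∑ b, (B'.Gam a 3 b * X' b - B.Gam a 3 b * X b) ∈ H.J i := sum_mem fun b _ =>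
        Bondi.mul_sub_mem (H.J_anti (by omega) (hG a 3 b)) (ih (by omega) b)
      rw [Finset.sum_sub_distrib] at this
      convert (H.J i).neg_mem this using 1
      ring
  exact this _ le_rfl a

section

variable {k : ℕ} (hM : ∀ a, F'.M a - F.M a ∈ H.I) (hMb : ∀ a, F'.Mb a - F.Mb a ∈ H.I)

include hM in
theorem dM_mem (hg : ∀ a b, B'.g a b - B.g a b ∈ H.J (k + 1)) (a : Fin 4) :
    F'.M a - F.M a ∈ H.J (k + 1) :=
  parallel_mem (Bondi.dGam_mem hg) F.par_M F'.par_M hM a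

include hMb in
theorem dMb_mem (hg : ∀ a b, B'.g a b - B.g a b ∈ H.J (k + 1)) (a : Fin 4) :
    F'.Mb a - F.Mb a ∈ H.J (k + 1) :=
  parallel_mem (Bondi.dGam_mem hg) F.par_Mb F'.par_Mb hMb a

theorem dL_mem (hg : ∀ a b, B'.g a b - B.g a b ∈ H.J (k + 1)) (a : Fin 4) :
    F'.L a - F.L a ∈ H.J (k + 1) :=
  parallel_mem (Bondi.dGam_mem hg) F.par_L F'.par_L (fun a => by
    convert H.I.sub_mem (F'.L_hor a) (F.L_hor a) using 1; ring) a

/-- `Φ₂₂` is `-½ R_{33}`, whose leading part is `-½` times the trace of `∂_r² δg`, and the trace on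
the horizon is `2 X(m, m̄)`. -/
theorem phi22_lead (hg : ∀ a b, B'.g a b - B.g a b ∈ H.J (k + 2)) :
    (H.D 3)^[k] (F'.Phi22 - F.Phi22)
      - H.half * con (fun a b => (H.D 3)^[k + 2] (B'.g a b - B.g a b)) F.M F.Mb ∈ H.I := by
  have h := H.iter_mem_I (Bondi.dRic_lead hg 3 3)
  simp only [if_true, and_self, Bondi.D_g_3, map_sub, sub_self, map_zero, zero_add, zero_sub] at h
  rw [H.iter_sub, H.iter_half_mul, H.iter_neg] at h
  have ht : (H.D 3)^[k] (B.tr fun c d => H.D 3 (H.D 3 (B'.g c d)) - H.D 3 (H.D 3 (B.g c d)))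
      - B.tr (fun c d => (H.D 3)^[k + 2] (B'.g c d - B.g c d)) ∈ H.I := by
    have m : ∀ c d, (H.D 3)^[k] (B.gi c d * H.D 3 (H.D 3 (B'.g c d - B.g c d)))
        - B.gi c d * (H.D 3)^[k + 2] (B'.g c d - B.g c d) ∈ H.I := fun c d =>
      H.iter_mul _ (H.D3_mem (H.D3_mem (hg c d)))
    simp only [Bondi.tr, H.iter_add, ← map_sub]
    convert H.I.add_mem (H.I.add_mem (H.I.add_mem (m 0 0) (m 0 1)) (m 1 0)) (m 1 1) using 1
    ring
  have hc := F.tr_eq (fun c d => (H.D 3)^[k + 2] (B'.g c d - B.g c d))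
    (by rw [B.symm, B'.symm])
  have e : F'.Phi22 - F.Phi22 = -(H.half * (B'.Ric 3 3 - B.Ric 3 3)) := by
    rw [Phi22_eq, Phi22_eq]; ring
  rw [e, H.iter_neg, H.iter_half_mul]
  convert H.I.add_mem (H.I.neg_mem (H.I.mul_mem_left H.half h))
    (H.I.mul_mem_left (H.half * H.half) (H.I.add_mem ht hc)) using 1
  linear_combination (H.half *
    con (fun a b => (H.D 3)^[k + 2] (B'.g a b - B.g a b)) F.M F.Mb) * H.two_half

theorem dRic_mem (hg : ∀ a b, B'.g a b - B.g a b ∈ H.J (k + 2)) (a b : Fin 4) :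
    B'.Ric a b - B.Ric a b ∈ H.J k := by
  have hG := Bondi.dGam_mem hg
  have hS : H.D 3 ((∑ c, B'.Gam c c a) - ∑ c, B.Gam c c a) ∈ H.J k := by
    refine H.D3_mem ?_
    rw [← Finset.sum_sub_distrib]; exact sum_mem fun c _ => hG _ _ _
  have h := H.J_anti (Nat.le_succ k) (Bondi.dRic_of_Gam hG a b)
  have h2 : (H.D 3 (B'.Gam 3 b a - B.Gam 3 b a)
      - if b = 3 then H.D 3 ((∑ c, B'.Gam c c a) - ∑ c, B.Gam c c a) else 0) ∈ H.J k := by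
    refine (H.J k).sub_mem (H.D3_mem (hG _ _ _)) ?_
    split_ifs
    · exact hS
    · exact zero_mem _
  convert (H.J k).add_mem h h2 using 1
  ring

include hMb in
-- The leading part of `R_{3A}` is `½ ∂_r² δg_{2A}`. The change of the frame is of higher order, and
-- the `R_{33}` term is multiplied by `m̄³`, which vanishes on the horizon.
theorem phi21_lead (hg : ∀ a b, B'.g a b - B.g a b ∈ H.J (k + 2)) :
    (H.D 3)^[k] (F'.Phi21 - F.Phi21)
      - H.half * H.half * ((H.D 3)^[k + 2] (B'.g 2 0 - B.g 2 0) * F.Mb 0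
        + (H.D 3)^[k + 2] (B'.g 2 1 - B.g 2 1) * F.Mb 1) ∈ H.I := by
  have hb := dMb_mem hMb hg
  have hR := dRic_mem hg
  have t : ∀ b, (H.D 3)^[k] (B'.Ric 3 b * F'.Mb b - B.Ric 3 b * F.Mb b)
      - F.Mb b * (H.D 3)^[k] (B'.Ric 3 b - B.Ric 3 b) ∈ H.I := by
    intro b
    have h1 := H.iter_mul (F.Mb b) (hR 3 b)
    have h2 := H.iter_mem_I ((H.J (k + 1)).mul_mem_left (B'.Ric 3 b)
      (H.J_anti (Nat.le_succ _) (hb b)))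
    have e : B'.Ric 3 b * F'.Mb b - B.Ric 3 b * F.Mb b
        = F.Mb b * (B'.Ric 3 b - B.Ric 3 b) + B'.Ric 3 b * (F'.Mb b - F.Mb b) := by ring
    rw [e, H.iter_add]
    convert H.I.add_mem h1 h2 using 1
    ring
  have l : ∀ A : Fin 4, A ≠ 3 → (H.D 3)^[k] (B'.Ric 3 A - B.Ric 3 A)
      - H.half * (H.D 3)^[k + 2] (B'.g 2 A - B.g 2 A) ∈ H.I := by
    intro A hA
    have := H.iter_mem_I (Bondi.dRic_lead hg 3 A)
    simp only [hA, if_false, and_false, if_true, zero_add, sub_zero] at this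
    rwa [H.iter_sub, H.iter_half_mul, ← Function.iterate_succ_apply,
      ← Function.iterate_succ_apply] at this
  have l0 := H.I.mul_mem_left (F.Mb 0) (l 0 (by decide))
  have l1 := H.I.mul_mem_left (F.Mb 1) (l 1 (by decide))
  have l3 := H.I.mul_mem_right ((H.D 3)^[k] (B'.Ric 3 3 - B.Ric 3 3)) F.Mb_3
  have e : F'.Phi21 - F.Phi21
      = H.half * ∑ b, (B'.Ric 3 b * F'.Mb b - B.Ric 3 b * F.Mb b) := by
    rw [Phi21_eq, Phi21_eq, Finset.sum_sub_distrib]; ring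
  rw [e, H.iter_half_mul, H.iter_sum, Fin.sum_univ_four]
  convert H.I.mul_mem_left H.half (H.I.add_mem (H.I.add_mem (H.I.add_mem (H.I.add_mem (t 0) (t 1))
    (t 2)) (t 3)) (H.I.add_mem (H.I.add_mem l0 l1) l3)) using 1
  rw [F.Mb_2]
  ring

include hMb in
-- In `R²_{b3d}` second radial derivatives occur only through `∂_r Γ²_{db} = -½ ∂_r² g_{db}`; the
-- products of connection coefficients are of lower order.
theorem psi4_lead (hg : ∀ a b, B'.g a b - B.g a b ∈ H.J (k + 2)) :
    (H.D 3)^[k] (F'.Psi4 - F.Psi4)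
      - H.half * con (fun a b => (H.D 3)^[k + 2] (B'.g a b - B.g a b)) F.Mb F.Mb ∈ H.I := by
  have hb : ∀ a, F'.Mb a - F.Mb a ∈ H.J (k + 1) := fun a =>
    H.J_anti (Nat.le_succ _) (dMb_mem hMb hg a)
  have hG := Bondi.dGam_mem hg
  have hR : ∀ b d, B'.RUp 2 b 3 d - B.RUp 2 b 3 d
      + H.half * H.D 3 (H.D 3 (B'.g b d - B.g b d)) ∈ H.J (k + 1) := by
    intro b d
    have hs : ∑ e, (B'.Gam 2 d e * B'.Gam e 3 b - B.Gam 2 d e * B.Gam e 3 b) ∈ H.J (k + 1) :=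
      sum_mem fun e _ => Bondi.mul_sub_mem (hG _ _ _) (hG _ _ _)
    convert (H.J (k + 1)).neg_mem hs using 1
    simp only [Bondi.RUp, Bondi.Gam_23, zero_mul, zero_sub, Finset.sum_neg_distrib, map_zero,
      sub_zero, Finset.sum_sub_distrib, B.Gam_2 d b, B'.Gam_2 d b, map_neg, H.D_half_mul, map_sub,
      B.symm d b, B'.symm d b]
    ring
  have t : ∀ b d, (H.D 3)^[k] (B'.RUp 2 b 3 d * F'.Mb b * F'.Mb d
      - B.RUp 2 b 3 d * F.Mb b * F.Mb d)
      + H.half * ((H.D 3)^[k + 2] (B'.g b d - B.g b d) * F.Mb b * F.Mb d) ∈ H.I := by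
    intro b d
    have h1 := H.iter_mem_I ((H.J (k + 1)).mul_mem_left (F.Mb b * F.Mb d) (hR b d))
    have h2 := H.iter_mem_I ((H.J (k + 1)).mul_mem_left (B'.RUp 2 b 3 d)
      (Bondi.mul_sub_mem (hb b) (hb d)))
    have h3 := H.iter_mul (H.half * (F.Mb b * F.Mb d)) (H.D3_mem (H.D3_mem (hg b d)))
    have e : B'.RUp 2 b 3 d * F'.Mb b * F'.Mb d - B.RUp 2 b 3 d * F.Mb b * F.Mb d
        = F.Mb b * F.Mb d * (B'.RUp 2 b 3 d - B.RUp 2 b 3 d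
          + H.half * H.D 3 (H.D 3 (B'.g b d - B.g b d)))
        + B'.RUp 2 b 3 d * (F'.Mb b * F'.Mb d - F.Mb b * F.Mb d)
        - H.half * (F.Mb b * F.Mb d) * H.D 3 (H.D 3 (B'.g b d - B.g b d)) := by ring
    rw [e, H.iter_sub, H.iter_add]
    rw [← Function.iterate_succ_apply (H.D 3) k, ← Function.iterate_succ_apply (H.D 3) (k + 1)]
      at h3
    convert H.I.sub_mem (H.I.add_mem h1 h2) h3 using 1
    ring
  have s := sum_mem (S := H.I) (t := Finset.univ) fun a (_ : a ∈ Finset.univ) =>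
    sum_mem (S := H.I) (t := Finset.univ) fun b (_ : b ∈ Finset.univ) => t a b
  have e : F'.Psi4 - F.Psi4 = -∑ b, ∑ d, (B'.RUp 2 b 3 d * F'.Mb b * F'.Mb d
      - B.RUp 2 b 3 d * F.Mb b * F.Mb d) := by
    simp only [Psi4, Finset.sum_sub_distrib]; ring
  rw [e, H.iter_neg]
  simp_rw [H.iter_sum]
  convert H.I.neg_mem s using 1
  simp only [Finset.sum_add_distrib, con, Finset.mul_sum]
  ring

end

/-- Data for a contraction of the Ricci tensor with two tangential frame vectors. -/
theorem con_Ric_tangential {k : ℕ} (hg : ∀ a b, B'.g a b - B.g a b ∈ H.J (k + 1))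
    (hg2 : ∀ a, B'.g 2 a - B.g 2 a ∈ H.J (k + 2)) {u u' w w' : Fin 4 → R}
    (hu2 : u 2 = 0) (hw2 : w 2 = 0) (hu3 : u 3 ∈ H.I) (hw3 : w 3 ∈ H.I)
    (hu : ∀ a, u' a - u a ∈ H.J (k + 1)) (hw : ∀ a, w' a - w a ∈ H.J (k + 1)) :
    (H.D 3)^[k] (con B'.Ric u' w' - con B.Ric u w)
      + con (fun a b => H.D 2 ((H.D 3)^[k + 1] (B'.g a b - B.g a b))
        + (k + 1) * kap * (H.D 3)^[k + 1] (B'.g a b - B.g a b)) u w ∈ H.I := by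
  set X : Fin 4 → Fin 4 → R := fun a b => H.D 2 ((H.D 3)^[k + 1] (B'.g a b - B.g a b))
        + (k + 1) * kap * (H.D 3)^[k + 1] (B'.g a b - B.g a b) with hX
  -- The `3`-components of `u` and `w` vanish on the horizon, so the differences of `R_{3a}` may be
  -- one order worse than needed.
  have hR3 : ∀ a, a ≠ 3 → a ≠ 2 → B'.Ric 3 a - B.Ric 3 a ∈ H.J k := by
    intro a ha _
    rcases k with _ | k
    · trivial
    · have h1 := Bondi.dRic_lead hg 3 a
      simp only [ha, if_false, and_false, if_true, zero_add, sub_zero] at h1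
      convert (H.J (k + 1)).add_mem h1 ((H.J (k + 1)).mul_mem_left H.half
        (H.D3_mem (H.D3_mem (hg2 a)))) using 1
      ring
  -- The difference of `R_{33}` loses two orders, and the product `u³ w³` of two vanishing factors
  -- regains both. For `k = 0` one factor is enough.
  have hR33 : u 3 * w 3 * (B'.Ric 3 3 - B.Ric 3 3) ∈ H.J (k + 1) := by
    rcases k with _ | k
    · exact H.mem_J_one.2 (H.I.mul_mem_right _ (H.I.mul_mem_right _ hu3))
    · rw [mul_assoc]
      exact H.mul_mem_J_succ hu3 (H.mul_mem_J_succ hw3 (dRic_mem hg 3 3))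
  have X0 : ∀ b, X 3 b = 0 := by
    intro b
    have : B'.g 3 b - B.g 3 b = 0 := by rw [B.g3, B'.g3, sub_self]
    simp only [hX, this, H.iter_zero, map_zero, mul_zero, add_zero]
  have X0' : ∀ b, X b 3 = 0 := by
    intro b
    have : B'.g b 3 - B.g b 3 = 0 := by rw [B.g_3, B'.g_3, sub_self]
    simp only [hX, this, H.iter_zero, map_zero, mul_zero, add_zero]
  have t : ∀ a b, (H.D 3)^[k] (u a * w b * (B'.Ric a b - B.Ric a b)) + X a b * u a * w b
      ∈ H.I := by
    intro a b
    by_cases ha2 : a = 2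
    · rw [ha2, hu2]; simp [H.iter_zero]
    by_cases hb2 : b = 2
    · rw [hb2, hw2]; simp [H.iter_zero]
    by_cases ha3 : a = 3
    · subst ha3
      rw [X0, zero_mul, zero_mul, add_zero]
      refine H.iter_mem_I ?_
      by_cases hb3 : b = 3
      · subst hb3; exact hR33
      · rw [mul_assoc]
        exact H.mul_mem_J_succ hu3 ((H.J k).mul_mem_left _ (hR3 b hb3 hb2))
    by_cases hb3 : b = 3
    · subst hb3
      rw [X0', zero_mul, zero_mul, add_zero]
      refine H.iter_mem_I ?_
      rw [mul_comm (u a), mul_assoc, B.Ric_symm, B'.Ric_symm]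
      exact H.mul_mem_J_succ hw3 ((H.J k).mul_mem_left _ (hR3 a ha3 ha2))
    have hR : B'.Ric a b - B.Ric a b ∈ H.J k := by
      have h1 := H.J_anti (Nat.le_succ k)
        (Bondi.dRic_tangential hg hg2 a b ha3 hb3)
      have h2 : H.D 2 (H.D 3 (B'.g b a - B.g b a))
          + H.half * H.D 3 (B'.gi 3 3 * H.D 3 (B'.g b a - B.g b a)) ∈ H.J k := by
        refine (H.J k).add_mem (H.D_mem (by decide) (H.D3_mem (hg b a))) ?_
        exact (H.J k).mul_mem_left _
          (H.D3_mem (H.mul_mem_J_succ (B'.gi3_mem 3 (by decide)) (H.D3_mem (hg b a))))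
      convert (H.J k).sub_mem h1 h2 using 1
      ring
    have h1 := H.iter_mul (u a * w b) hR
    have h2 := H.I.mul_mem_left (u a * w b)
      (Bondi.dRic_tangential_iter hg hg2 a b ha3 hb3)
    convert H.I.add_mem h1 h2 using 1
    simp only [hX, B.symm b a, B'.symm b a]
    ring
  have s := sum_mem (S := H.I) (t := Finset.univ) fun a (_ : a ∈ Finset.univ) =>
    sum_mem (S := H.I) (t := Finset.univ) fun b (_ : b ∈ Finset.univ) => t a b
  have s2 : ∑ a, ∑ b, B'.Ric a b * (u' a * w' b - u a * w b) ∈ H.J (k + 1) :=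
    sum_mem fun a _ => sum_mem fun b _ =>
      (H.J (k + 1)).mul_mem_left _ (Bondi.mul_sub_mem (hu a) (hw b))
  have e : con B'.Ric u' w' - con B.Ric u w = ∑ a, ∑ b, u a * w b * (B'.Ric a b - B.Ric a b)
      + ∑ a, ∑ b, B'.Ric a b * (u' a * w' b - u a * w b) := by
    simp only [con, Fin.sum_univ_four]; ring
  rw [e, H.iter_add]
  convert H.I.add_mem s (H.iter_mem_I s2) using 1
  simp_rw [H.iter_sum]
  simp only [Finset.sum_add_distrib, con]
  ring

theorem phi20_tangential {k : ℕ} (hMb : ∀ a, F'.Mb a - F.Mb a ∈ H.I)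
    (hg : ∀ a b, B'.g a b - B.g a b ∈ H.J (k + 1))
    (hg2 : ∀ a, B'.g 2 a - B.g 2 a ∈ H.J (k + 2)) :
    (H.D 3)^[k] (F'.Phi20 - F.Phi20)
      - H.half * con (fun a b => H.D 2 ((H.D 3)^[k + 1] (B'.g a b - B.g a b))
        + (k + 1) * kap * (H.D 3)^[k + 1] (B'.g a b - B.g a b)) F.Mb F.Mb ∈ H.I := by
  have h := con_Ric_tangential hg hg2 F.Mb_2 F.Mb_2 F.Mb_3 F.Mb_3 (dMb_mem hMb hg)
    (dMb_mem hMb hg)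
  have e : F'.Phi20 - F.Phi20 = -(H.half * (con B'.Ric F'.Mb F'.Mb - con B.Ric F.Mb F.Mb)) := by
    rw [Phi20, Phi20]; ring
  rw [e, H.iter_neg, H.iter_half_mul]
  convert H.I.neg_mem (H.I.mul_mem_left H.half h) using 1
  ring

end NPFrame

/-! ### Coordinate derivatives of smooth functions -/

section Calculus

variable {F : Type*} [NormedAddCommGroup F] [NormedSpace ℝ F]

theorem pd_congr {Ω : Set Pt} (hΩ : IsOpen Ω) {f g : Pt → F} (h : Set.EqOn f g Ω) (i : Fin 4)
    {p : Pt} (hp : p ∈ Ω) : pd i f p = pd i g p := by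
  unfold pd
  rw [Filter.EventuallyEq.fderiv_eq (h.eventuallyEq_of_mem (hΩ.mem_nhds hp))]

theorem pd_smooth {Ω : Set Pt} (hΩ : IsOpen Ω) {f : Pt → F} (h : ContDiffOn ℝ ∞ f Ω) (i : Fin 4) :
    ContDiffOn ℝ ∞ (pd i f) Ω :=
  (h.fderiv_of_isOpen hΩ (m := ∞) (by simp)).clm_apply contDiffOn_const

theorem differentiableAt_of_smooth {Ω : Set Pt} (hΩ : IsOpen Ω) {f : Pt → F}
    (h : ContDiffOn ℝ ∞ f Ω) {p : Pt} (hp : p ∈ Ω) : DifferentiableAt ℝ f p :=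
  (h.contDiffAt (hΩ.mem_nhds hp)).differentiableAt (by simp)

theorem pd_comm {Ω : Set Pt} (hΩ : IsOpen Ω) {f : Pt → F} (h : ContDiffOn ℝ ∞ f Ω) (i j : Fin 4)
    {p : Pt} (hp : p ∈ Ω) : pd i (pd j f) p = pd j (pd i f) p := by
  have hs : IsSymmSndFDerivAt ℝ f p :=
    (h.contDiffAt (hΩ.mem_nhds hp)).isSymmSndFDerivAt (by
      rw [minSmoothness_of_isRCLikeNormedField]; exact WithTop.coe_le_coe.2 le_top)
  have hd : DifferentiableAt ℝ (fderiv ℝ f) p :=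
    ((h.fderiv_of_isOpen hΩ (m := ∞) (by simp)).contDiffAt (hΩ.mem_nhds hp)).differentiableAt
      (by simp)
  have e : ∀ i j, pd i (pd j f) p = fderiv ℝ (fderiv ℝ f) p (Pi.single i 1) (Pi.single j 1) := by
    intro i j
    have : pd j f = fun q => fderiv ℝ f q (Pi.single j 1) := rfl
    rw [this, pd, fderiv_clm_apply hd (differentiableAt_const _)]
    simp
  rw [e, e, hs.eq]

theorem hpt_add (x : Fin 2 → ℝ) (v : ℝ) (i : Fin 4) (hi : i ≠ 3) (t : ℝ) :
    hpt x v + t • (Pi.single i 1 : Pt)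
      = hpt ![x 0 + (if i = 0 then t else 0), x 1 + (if i = 1 then t else 0)]
        (v + (if i = 2 then t else 0)) := by
  ext j
  fin_cases i <;> fin_cases j <;> simp [hpt] at hi ⊢

/-- The derivatives along the horizon depend only on the restriction to the horizon. -/
theorem pd_eq_zero_of_horizon {U : Set (Fin 2 → ℝ)} {I : Set ℝ} (hU : IsOpen U) (hI : IsOpen I)
    {f : Pt → F} (h : ∀ x ∈ U, ∀ v ∈ I, f (hpt x v) = 0) {x : Fin 2 → ℝ} (hx : x ∈ U) {v : ℝ}
    (hv : v ∈ I) (hf : DifferentiableAt ℝ f (hpt x v)) (i : Fin 4) (hi : i ≠ 3) :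
    pd i f (hpt x v) = 0 := by
  have h1 : HasLineDerivAt ℝ f (pd i f (hpt x v)) (hpt x v) (Pi.single i 1) :=
    hf.hasFDerivAt.hasLineDerivAt _
  have hc : Continuous fun t : ℝ =>
      ((![x 0 + (if i = 0 then t else 0), x 1 + (if i = 1 then t else 0)] : Fin 2 → ℝ),
        v + (if i = 2 then t else 0)) := by
    refine Continuous.prodMk (continuous_pi fun j => ?_) ?_
    · fin_cases j
      · simp only [Fin.zero_eta, Matrix.cons_val_zero]; split_ifs <;> fun_prop
      · simp only [Fin.mk_one, Matrix.cons_val_one, Matrix.cons_val_fin_one]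
        split_ifs <;> fun_prop
    · split_ifs <;> fun_prop
  have h0 : (((![x 0 + (if i = 0 then (0 : ℝ) else 0), x 1 + (if i = 1 then (0 : ℝ) else 0)] :
      Fin 2 → ℝ), v + (if i = 2 then (0 : ℝ) else 0)) : (Fin 2 → ℝ) × ℝ) ∈ U ×ˢ I := by
    have : (![x 0, x 1] : Fin 2 → ℝ) = x := by ext j; fin_cases j <;> rfl
    simp [this, hx, hv]
  have he : ∀ᶠ t in nhds (0 : ℝ), f (hpt x v + t • (Pi.single i 1 : Pt)) = 0 := by
    have := hc.continuousAt.preimage_mem_nhds ((hU.prod hI).mem_nhds h0)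
    filter_upwards [this] with t ht
    rw [hpt_add x v i hi]
    exact h _ ht.1 _ ht.2
  have h2 : HasDerivAt (fun t : ℝ => f (hpt x v + t • (Pi.single i 1 : Pt))) 0 0 :=
    (hasDerivAt_const (0 : ℝ) (0 : F)).congr_of_eventuallyEq he
  exact HasDerivAt.unique h1 h2

end Calculus

/-! ### The differential ring of smooth functions -/

/-- The smooth complex functions on an open set. -/
def smSubalgebra (Ω : TopologicalSpace.Opens Pt) : Subalgebra ℝ (Ω → ℂ) where
  carrier := {f | ∃ F : Pt → ℂ, ContDiffOn ℝ ∞ F Ω ∧ ∀ p : Ω, f p = F p}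
  mul_mem' := by
    rintro f g ⟨F, hF, hf⟩ ⟨G, hG, hg⟩
    exact ⟨fun p => F p * G p, hF.mul hG, fun p => by simp [hf, hg]⟩
  add_mem' := by
    rintro f g ⟨F, hF, hf⟩ ⟨G, hG, hg⟩
    exact ⟨fun p => F p + G p, hF.add hG, fun p => by simp [hf, hg]⟩
  algebraMap_mem' r := ⟨fun _ => (r : ℂ), contDiffOn_const, fun p => by simp⟩

/-- The ring of smooth complex functions on an open set. -/
def SmAlg (Ω : TopologicalSpace.Opens Pt) : Type := smSubalgebra Ω

namespace SmAlg

variable {Ω : TopologicalSpace.Opens Pt}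

noncomputable instance : CommRing (SmAlg Ω) := inferInstanceAs (CommRing (smSubalgebra Ω))

@[ext] theorem ext {f g : SmAlg Ω} (h : ∀ p, f.1 p = g.1 p) : f = g :=
  Subtype.ext (funext h)

/-- The values at a point. -/
noncomputable def ev (p : Ω) : SmAlg Ω →+* ℂ :=
  (Pi.evalRingHom (fun _ => ℂ) p).comp (smSubalgebra Ω).toSubring.subtype

theorem ev_apply (p : Ω) (f : SmAlg Ω) : ev p f = f.1 p := rfl

/-- The element given by a smooth function. -/
def mk (F : Pt → ℂ) (hF : ContDiffOn ℝ ∞ F Ω) : SmAlg Ω := ⟨fun p => F p, F, hF, fun _ => rfl⟩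

/-- A smooth extension of an element of the ring to the ambient space. -/
noncomputable def extd (f : SmAlg Ω) : Pt → ℂ := Classical.choose f.2

theorem extd_smooth (f : SmAlg Ω) : ContDiffOn ℝ ∞ (extd f) Ω := (Classical.choose_spec f.2).1

theorem extd_val (f : SmAlg Ω) (p : Ω) : f.1 p = (extd f) p := (Classical.choose_spec f.2).2 p

theorem extd_eqOn {f : SmAlg Ω} {F : Pt → ℂ} (h : ∀ p : Ω, f.1 p = F p) :
    Set.EqOn (extd f) F Ω := fun p hp => by rw [← extd_val f ⟨p, hp⟩, h]

/-- The coordinate derivative. -/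
noncomputable def deriv (i : Fin 4) (f : SmAlg Ω) : SmAlg Ω :=
  mk (pd i (extd f)) (pd_smooth Ω.2 (extd_smooth f) i)

/-- The derivative on an open set does not see the choice of the extension, so the chosen `extd` may
be replaced by any concrete function. -/
theorem deriv_val {f : SmAlg Ω} {F : Pt → ℂ} (h : ∀ p : Ω, f.1 p = F p) (i : Fin 4) (p : Ω) :
    (deriv i f).1 p = pd i F p :=
  pd_congr Ω.2 (extd_eqOn h) i p.2

theorem differentiableAt_extd (f : SmAlg Ω) (p : Ω) : DifferentiableAt ℝ (extd f) p :=
  differentiableAt_of_smooth Ω.2 (extd_smooth f) p.2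

/-- The coordinate derivative as a derivation. -/
noncomputable def derivation (i : Fin 4) : Derivation ℤ (SmAlg Ω) (SmAlg Ω) :=
  Derivation.mk' (AddMonoidHom.toIntLinearMap
    { toFun := deriv i
      map_zero' := by
        ext p
        have := deriv_val (f := (0 : SmAlg Ω)) (F := fun _ => 0) (fun _ => rfl) i p
        rw [this, ← ev_apply, map_zero]; simp [pd]
      map_add' := fun f g => by
        ext p
        have := deriv_val (f := f + g) (F := fun p => (extd f) p + (extd g) p)
          (fun p => by rw [← extd_val f, ← extd_val g]; rfl) i p
        rw [this]
        change _ = pd i (extd f) p + pd i (extd g) p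
        unfold pd
        rw [fderiv_fun_add (differentiableAt_extd f p) (differentiableAt_extd g p)]
        rfl })
    (fun f g => by
      ext p
      have := deriv_val (f := f * g) (F := fun p => (extd f) p * (extd g) p)
        (fun p => by rw [← extd_val f, ← extd_val g]; rfl) i p
      change (deriv i (f * g)).1 p = f.1 p * pd i (extd g) p + g.1 p * pd i (extd f) p
      rw [this, extd_val f, extd_val g]
      unfold pd
      rw [fderiv_fun_mul (differentiableAt_extd f p) (differentiableAt_extd g p)]
      simp)

theorem derivation_val {f : SmAlg Ω} {F : Pt → ℂ} (h : ∀ p : Ω, f.1 p = F p) (i : Fin 4) (p : Ω) :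
    (derivation i f).1 p = pd i F p := deriv_val h i p

theorem real_smooth {f : SmAlg Ω} {F : Pt → ℝ} (h : ∀ p : Ω, f.1 p = F p) :
    ContDiffOn ℝ ∞ F Ω := by
  have h1 : ContDiffOn ℝ ∞ (fun p => Complex.reCLM ((extd f) p)) Ω :=
    Complex.reCLM.contDiff.comp_contDiffOn (extd_smooth f)
  refine h1.congr fun p hp => ?_
  have := h ⟨p, hp⟩
  rw [extd_val f] at this
  simp [this]

theorem derivation_val_real {f : SmAlg Ω} {F : Pt → ℝ} (h : ∀ p : Ω, f.1 p = F p) (i : Fin 4)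
    (p : Ω) : (derivation i f).1 p = (pd i F p : ℝ) := by
  rw [derivation_val (F := fun p => (F p : ℂ)) h]
  have hd := differentiableAt_of_smooth Ω.2 (real_smooth h) p.2
  have := (Complex.ofRealCLM.hasFDerivAt.comp (p : Pt) hd.hasFDerivAt).fderiv
  unfold pd
  change fderiv ℝ (Complex.ofRealCLM ∘ F) p _ = _
  rw [this]
  rfl

theorem iter_val {f : SmAlg Ω} {F : Pt → ℂ} (h : ∀ p : Ω, f.1 p = F p) (k : ℕ) (p : Ω) :
    ((derivation 3)^[k] f).1 p = dr k F p := by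
  induction k generalizing f F with
  | zero => exact h p
  | succ k ih =>
    rw [Function.iterate_succ_apply, dr, Function.iterate_succ_apply]
    exact ih fun q => derivation_val h 3 q

theorem iter_val_real {f : SmAlg Ω} {F : Pt → ℝ} (h : ∀ p : Ω, f.1 p = F p) (k : ℕ) (p : Ω) :
    ((derivation 3)^[k] f).1 p = (dr k F p : ℝ) := by
  induction k generalizing f F with
  | zero => exact h p
  | succ k ih =>
    rw [Function.iterate_succ_apply, dr, Function.iterate_succ_apply]
    exact ih fun q => derivation_val_real h 3 q

theorem derivation_comm (i j : Fin 4) (f : SmAlg Ω) :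
    derivation i (derivation j f) = derivation j (derivation i f) := by
  ext p
  rw [derivation_val (derivation_val (extd_val f) j), derivation_val (derivation_val (extd_val f) i)]
  exact pd_comm Ω.2 (extd_smooth f) i j p.2

/-- The differential ring of the smooth functions on `Ω`, with the ideal of the functions that
vanish on the horizon. -/
noncomputable def hdiff (Ω : TopologicalSpace.Opens Pt) {U : Set (Fin 2 → ℝ)} {I : Set ℝ}
    (hU : IsOpen U) (hI : IsOpen I) (hΩ : ∀ x ∈ U, ∀ v ∈ I, hpt x v ∈ Ω) : HDiff (SmAlg Ω) where
  D := derivation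
  comm := derivation_comm
  I :=
    { carrier := {f | ∀ x, ∀ hx : x ∈ U, ∀ v, ∀ hv : v ∈ I, f.1 ⟨hpt x v, hΩ x hx v hv⟩ = 0}
      add_mem' := fun hf hg x hx v hv => by
        change (_ : ℂ) + _ = 0
        rw [hf x hx v hv, hg x hx v hv, add_zero]
      zero_mem' := fun _ _ _ _ => rfl
      smul_mem' := fun c f hf x hx v hv => by
        change c.1 _ * _ = (0 : ℂ)
        rw [hf x hx v hv, mul_zero] }
  stable i hi f hf x hx v hv := by
    rw [derivation_val (extd_val f)]
    refine pd_eq_zero_of_horizon hU hI (fun y hy w hw => ?_) hx hv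
      (differentiableAt_extd f ⟨_, hΩ x hx v hv⟩) i hi
    rw [← extd_val f ⟨_, hΩ y hy w hw⟩]
    exact hf y hy w hw
  half := mk (fun _ => 1 / 2) contDiffOn_const
  two_half := by
    ext p
    change (2 : ℂ) * (1 / 2) = 1
    norm_num

end SmAlg

/-! ### Passage from coordinate components to the ring of smooth functions. -/

theorem pd_conj (i : Fin 4) (f : Pt → ℂ) (p : Pt) :
    pd i (fun q => conj (f q)) p = conj (pd i f p) := by
  have := Complex.conjCLE.comp_fderiv (f := f) (x := p)
  unfold pd
  change fderiv ℝ (Complex.conjCLE ∘ f) p _ = _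
  rw [this]; rfl

theorem conj_smooth {Ω : Set Pt} {f : Pt → ℂ} (h : ContDiffOn ℝ ∞ f Ω) :
    ContDiffOn ℝ ∞ (fun p => conj (f p)) Ω :=
  Complex.conjCLE.contDiff.comp_contDiffOn h

theorem ofReal_smooth {Ω : Set Pt} {f : Pt → ℝ} (h : ContDiffOn ℝ ∞ f Ω) :
    ContDiffOn ℝ ∞ (fun p => (f p : ℂ)) Ω :=
  Complex.ofRealCLM.contDiff.comp_contDiffOn h

/-- A neighbourhood of a horizon in Bondi-like coordinates, in terms of the components of the
metric and the frame. -/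
structure Pre (U : Set (Fin 2 → ℝ)) (I : Set ℝ) (kappa : ℝ) (S : Nbhd) : Prop where
  isOpen : IsOpen S.dom
  horizon_mem : ∀ x ∈ U, ∀ v ∈ I, hpt x v ∈ S.dom
  smooth : ∀ a b, ContDiffOn ℝ ∞ (fun p => S.g p a b) S.dom
  symm : ∀ p ∈ S.dom, ∀ a b, S.g p a b = S.g p b a
  unit : ∀ p ∈ S.dom, IsUnit (S.g p).det
  g3 : ∀ p ∈ S.dom, ∀ i, S.g p 3 i = if i = 2 then 1 else 0
  null : ∀ x ∈ U, ∀ v ∈ I, ∀ i : Fin 4, i ≠ 3 → S.g (hpt x v) 2 i = 0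
  grav : ∀ x ∈ U, ∀ v ∈ I, pd 3 (fun q => S.g q 2 2) (hpt x v) = -2 * kappa
  smooth_m : ∀ i, ContDiffOn ℝ ∞ (fun p => S.m p i) S.dom
  smooth_l : ∀ i, ContDiffOn ℝ ∞ (fun p => S.l p i) S.dom
  m_2 : ∀ p ∈ S.dom, S.m p 2 = 0
  gi_eq : ∀ p ∈ S.dom, ∀ a b, (((S.g p)⁻¹ a b : ℝ) : ℂ) = S.m p a * S.mbar p b
    + S.mbar p a * S.m p b + ((if a = 3 then S.lc p b else 0) + if b = 3 then S.lc p a else 0)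
  par_m : ∀ p ∈ S.dom, ∀ a, pd 3 (fun q => S.m q a) p = -∑ b, (chr S.g a 3 b p : ℂ) * S.m p b
  par_l : ∀ p ∈ S.dom, ∀ a, pd 3 (fun q => S.lc q a) p = -∑ b, (chr S.g a 3 b p : ℂ) * S.lc p b
  m_3 : ∀ x ∈ U, ∀ v ∈ I, S.m (hpt x v) 3 = 0
  l_hor : ∀ x ∈ U, ∀ v ∈ I, ∀ a, S.lc (hpt x v) a = if a = 2 then 1 else 0
  m_dragged : ∀ x ∈ U, ∀ v ∈ I, ∀ i, pd 2 (fun q => S.m q i) (hpt x v) = 0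
  null_m : ∀ p ∈ S.dom, bil (S.g p) (S.m p) (S.m p) = 0

namespace Pre

variable {U : Set (Fin 2 → ℝ)} {I : Set ℝ} {kappa : ℝ} {S : Nbhd} (P : Pre U I kappa S)

include P in
theorem smooth_gi (a b : Fin 4) :
    ContDiffOn ℝ ∞ (fun p => (((S.g p)⁻¹ a b : ℝ) : ℂ)) S.dom := by
  have hm := P.smooth_m
  have hb : ∀ i, ContDiffOn ℝ ∞ (fun p => S.mbar p i) S.dom := fun i => conj_smooth (hm i)
  have hl : ∀ i, ContDiffOn ℝ ∞ (fun p => S.lc p i) S.dom := fun i => ofReal_smooth (P.smooth_l i)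
  refine ContDiffOn.congr ?_ fun p hp => P.gi_eq p hp a b
  refine (((hm a).mul (hb b)).add ((hb a).mul (hm b))).add (ContDiffOn.add ?_ ?_)
  · split_ifs
    · exact hl b
    · exact contDiffOn_const
  · split_ifs
    · exact hl a
    · exact contDiffOn_const

variable (Ω : TopologicalSpace.Opens Pt) (hΩS : (Ω : Set Pt) ⊆ S.dom)

/-- The metric components, as elements of the ring of smooth functions. -/
noncomputable def gR (a b : Fin 4) : SmAlg Ω :=
  SmAlg.mk (fun p => (S.g p a b : ℂ)) (ofReal_smooth ((P.smooth a b).mono hΩS))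

/-- The components of the inverse metric. -/
noncomputable def giR (a b : Fin 4) : SmAlg Ω :=
  SmAlg.mk (fun p => (((S.g p)⁻¹ a b : ℝ) : ℂ)) ((P.smooth_gi a b).mono hΩS)

/-- The components of `m`. -/
noncomputable def mR (a : Fin 4) : SmAlg Ω :=
  SmAlg.mk (fun p => S.m p a) ((P.smooth_m a).mono hΩS)

/-- The components of `m̄`. -/
noncomputable def mbR (a : Fin 4) : SmAlg Ω :=
  SmAlg.mk (fun p => S.mbar p a) (conj_smooth ((P.smooth_m a).mono hΩS))

/-- The components of `ℓ`. -/
noncomputable def lR (a : Fin 4) : SmAlg Ω :=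
  SmAlg.mk (fun p => S.lc p a) (ofReal_smooth ((P.smooth_l a).mono hΩS))

theorem ite_val (q : Prop) [Decidable q] (f : SmAlg Ω) (p : Ω) :
    (if q then f else 0).1 p = if q then f.1 p else 0 := by
  split_ifs <;> rfl

theorem one_val (q : Prop) [Decidable q] (p : Ω) :
    (if q then (1 : SmAlg Ω) else 0).1 p = if q then 1 else 0 := by
  split_ifs <;> rfl

theorem giR_gR (a b : Fin 4) :
    ∑ d, P.giR Ω hΩS a d * P.gR Ω hΩS d b = if a = b then 1 else 0 := by
  ext p
  have h := congrFun (congrFun (Matrix.nonsing_inv_mul _ (P.unit p (hΩS p.2))) a) b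
  rw [Matrix.mul_apply, Matrix.one_apply] at h
  rw [one_val, ← SmAlg.ev_apply, map_sum]
  simp_rw [map_mul]
  have h' := congrArg (fun x : ℝ => (x : ℂ)) h
  push_cast at h'
  exact h'.trans (by split_ifs <;> simp)

theorem gR_giR (a b : Fin 4) :
    ∑ d, P.gR Ω hΩS a d * P.giR Ω hΩS d b = if a = b then 1 else 0 := by
  ext p
  have h := congrFun (congrFun (Matrix.mul_nonsing_inv _ (P.unit p (hΩS p.2))) a) b
  rw [Matrix.mul_apply, Matrix.one_apply] at h
  rw [one_val, ← SmAlg.ev_apply, map_sum]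
  simp_rw [map_mul]
  have h' := congrArg (fun x : ℝ => (x : ℂ)) h
  push_cast at h'
  exact h'.trans (by split_ifs <;> simp)

theorem giR_eq (c d : Fin 4) : P.giR Ω hΩS c d = P.mR Ω hΩS c * P.mbR Ω hΩS d
    + P.mbR Ω hΩS c * P.mR Ω hΩS d
    + ((if c = 3 then P.lR Ω hΩS d else 0) + if d = 3 then P.lR Ω hΩS c else 0) := by
  ext p
  refine (P.gi_eq p (hΩS p.2) c d).trans ?_
  rw [← SmAlg.ev_apply]
  simp only [map_add, map_mul, SmAlg.ev_apply, ite_val]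
  rfl

variable (hU : IsOpen U) (hI : IsOpen I) (hΩ : ∀ x ∈ U, ∀ v ∈ I, hpt x v ∈ Ω)

theorem stat_mR (i : Fin 4) :
    (SmAlg.hdiff Ω hU hI hΩ).D 2 (P.mR Ω hΩS i) ∈ (SmAlg.hdiff Ω hU hI hΩ).I := by
  intro x hx v hv
  exact (SmAlg.deriv_val (F := fun p => S.m p i) (fun _ => rfl) 2 _).trans
    (P.m_dragged x hx v hv i)

theorem stat_mbR (i : Fin 4) :
    (SmAlg.hdiff Ω hU hI hΩ).D 2 (P.mbR Ω hΩS i) ∈ (SmAlg.hdiff Ω hU hI hΩ).I := by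
  intro x hx v hv
  refine (SmAlg.deriv_val (F := fun p => S.mbar p i) (fun _ => rfl) 2 _).trans ?_
  refine (pd_conj 2 (fun q => S.m q i) _).trans ?_
  rw [P.m_dragged x hx v hv i, map_zero]

theorem lR_hor (i : Fin 4) :
    P.lR Ω hΩS i - (if i = 2 then 1 else 0) ∈ (SmAlg.hdiff Ω hU hI hΩ).I := by
  intro x hx v hv
  have := P.l_hor x hx v hv i
  rw [← SmAlg.ev_apply, map_sub, SmAlg.ev_apply, SmAlg.ev_apply, one_val]
  exact sub_eq_zero.2 this

theorem stat_lR (i : Fin 4) :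
    (SmAlg.hdiff Ω hU hI hΩ).D 2 (P.lR Ω hΩS i) ∈ (SmAlg.hdiff Ω hU hI hΩ).I := by
  set H := SmAlg.hdiff Ω hU hI hΩ
  have := H.stable 2 (by decide) _ (P.lR_hor Ω hΩS hU hI hΩ i)
  rw [map_sub] at this
  have e : H.D 2 (if i = 2 then (1 : SmAlg Ω) else 0) = 0 := by
    split_ifs
    · exact (H.D 2).map_one_eq_zero
    · exact map_zero _
  rwa [e, sub_zero] at this

/-- The inverse metric is polynomial in the frame, and on the horizon all frame components are
constant along `∂_v`. So the inverse metric is stationary there, hence also the metric. -/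
theorem stat_gR (a b : Fin 4) :
    (SmAlg.hdiff Ω hU hI hΩ).D 2 (P.gR Ω hΩS a b) ∈ (SmAlg.hdiff Ω hU hI hΩ).I := by
  set H := SmAlg.hdiff Ω hU hI hΩ
  rw [derivation_inverse (H.D 2) (P.gR_giR Ω hΩS) (P.giR_gR Ω hΩS) a b]
  refine H.I.neg_mem (sum_mem fun c _ => sum_mem fun d _ =>
    H.I.mul_mem_right _ (H.I.mul_mem_left _ ?_))
  have hM := P.stat_mR Ω hΩS hU hI hΩ
  have hMb := P.stat_mbR Ω hΩS hU hI hΩ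
  have hL := P.stat_lR Ω hΩS hU hI hΩ
  rw [P.giR_eq]
  simp only [map_add, H.D_mul]
  have hi : ∀ (q : Prop) [Decidable q] (f : SmAlg Ω), H.D 2 f ∈ H.I →
      H.D 2 (if q then f else 0) ∈ H.I := by
    intro q _ f hf
    split_ifs
    · exact hf
    · rw [map_zero]; exact zero_mem _
  exact H.I.add_mem (H.I.add_mem
    (H.I.add_mem (H.I.mul_mem_right _ (hM c)) (H.I.mul_mem_left _ (hMb d)))
    (H.I.add_mem (H.I.mul_mem_right _ (hMb c)) (H.I.mul_mem_left _ (hM d))))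
    (H.I.add_mem (hi _ _ (hL d)) (hi _ _ (hL c)))

/-- The metric over the ring of smooth functions. -/
noncomputable def toBondi :
    Bondi (SmAlg.hdiff Ω hU hI hΩ) (SmAlg.mk (fun _ => (kappa : ℂ)) contDiffOn_const) where
  g := P.gR Ω hΩS
  gi := P.giR Ω hΩS
  symm a b := by
    ext p
    exact congrArg (fun x : ℝ => (x : ℂ)) (P.symm p (hΩS p.2) a b)
  gsymm a b := by
    rw [giR_eq, giR_eq]; ring
  inv := P.giR_gR Ω hΩS
  g3 i := by
    ext p
    rw [one_val]
    refine (congrArg (fun x : ℝ => (x : ℂ)) (P.g3 p (hΩS p.2) i)).trans ?_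
    split_ifs <;> simp
  null i hi x hx v hv :=
    (congrArg (fun x : ℝ => (x : ℂ)) (P.null x hx v hv i hi)).trans Complex.ofReal_zero
  stat := P.stat_gR Ω hΩS hU hI hΩ
  grav x hx v hv := by
    have h := P.grav x hx v hv
    have h1 : ((SmAlg.hdiff Ω hU hI hΩ).D 3 (P.gR Ω hΩS 2 2)).1 ⟨hpt x v, hΩ x hx v hv⟩
        = (pd 3 (fun q => S.g q 2 2) (hpt x v) : ℝ) :=
      SmAlg.derivation_val_real (F := fun q => S.g q 2 2) (fun _ => rfl) 3 _
    rw [← SmAlg.ev_apply, map_add, map_mul]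
    rw [← SmAlg.ev_apply] at h1
    rw [h1, h, map_ofNat]
    change _ + 2 * (kappa : ℂ) = 0
    push_cast; ring
  kap_const i := by
    ext p
    have := SmAlg.deriv_val (Ω := Ω) (f := SmAlg.mk (fun _ => (kappa : ℂ)) contDiffOn_const)
      (F := fun _ => (kappa : ℂ)) (fun _ => rfl) i p
    refine this.trans ?_
    rw [← SmAlg.ev_apply, map_zero]
    simp [pd]

theorem Gam_val (a b c : Fin 4) (p : Ω) :
    ((P.toBondi Ω hΩS hU hI hΩ).Gam a b c).1 p = (chr S.g a b c p : ℝ) := by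
  have hD : ∀ i x y, SmAlg.ev p ((SmAlg.hdiff Ω hU hI hΩ).D i ((P.toBondi Ω hΩS hU hI hΩ).g x y))
      = (pd i (fun q => S.g q x y) p : ℝ) := fun i x y =>
    SmAlg.derivation_val_real (F := fun q => S.g q x y) (fun _ => rfl) i p
  rw [← SmAlg.ev_apply, Bondi.Gam, map_mul, map_sum]
  simp only [Bondi.low, map_mul, map_add, map_sub, hD]
  rw [chr]
  push_cast
  rfl

theorem RUp_val (a b c d : Fin 4) (p : Ω) :
    ((P.toBondi Ω hΩS hU hI hΩ).RUp a b c d).1 p = (riemUp S.g a b c d p : ℝ) := by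
  have hD : ∀ i x y z, SmAlg.ev p ((SmAlg.hdiff Ω hU hI hΩ).D i
      ((P.toBondi Ω hΩS hU hI hΩ).Gam x y z)) = (pd i (chr S.g x y z) p : ℝ) := fun i x y z =>
    SmAlg.derivation_val_real (P.Gam_val Ω hΩS hU hI hΩ x y z) i p
  have hG : ∀ x y z, SmAlg.ev p ((P.toBondi Ω hΩS hU hI hΩ).Gam x y z)
      = (chr S.g x y z p : ℝ) := fun x y z => P.Gam_val Ω hΩS hU hI hΩ x y z p
  rw [← SmAlg.ev_apply, Bondi.RUp]
  simp only [map_mul, map_add, map_sub, map_sum, hD, hG]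
  rw [riemUp]
  push_cast
  rfl

theorem Ric_val (a b : Fin 4) (p : Ω) :
    ((P.toBondi Ω hΩS hU hI hΩ).Ric a b).1 p = (ric S.g p a b : ℝ) := by
  rw [← SmAlg.ev_apply, Bondi.Ric, map_sum]
  simp only [SmAlg.ev_apply, RUp_val]
  rw [ric, Matrix.of_apply]
  push_cast
  rfl

theorem Scal_val (p : Ω) :
    ((P.toBondi Ω hΩS hU hI hΩ).Scal).1 p = (scal S.g p : ℝ) := by
  rw [← SmAlg.ev_apply, Bondi.Scal, map_sum]
  simp only [map_sum, map_mul, SmAlg.ev_apply, Ric_val]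
  rw [scal]
  push_cast
  rfl

/-- The frame over the ring of smooth functions. -/
noncomputable def toFrame : NPFrame (P.toBondi Ω hΩS hU hI hΩ) where
  M := P.mR Ω hΩS
  Mb := P.mbR Ω hΩS
  L := P.lR Ω hΩS
  M_2 := by ext p; exact P.m_2 p (hΩS p.2)
  Mb_2 := by
    ext p
    exact (congrArg conj (P.m_2 p (hΩS p.2))).trans (map_zero _)
  gi_eq := P.giR_eq Ω hΩS
  par_M a := by
    ext p
    refine (SmAlg.deriv_val (F := fun p => S.m p a) (fun _ => rfl) 3 p).trans ?_
    rw [P.par_m p (hΩS p.2), ← SmAlg.ev_apply, map_neg, map_sum]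
    simp only [map_mul, SmAlg.ev_apply, Gam_val]
    rfl
  par_Mb a := by
    ext p
    refine (SmAlg.deriv_val (F := fun p => S.mbar p a) (fun _ => rfl) 3 p).trans ?_
    refine (pd_conj 3 (fun q => S.m q a) _).trans ?_
    rw [P.par_m p (hΩS p.2), ← SmAlg.ev_apply, map_neg, map_neg, map_sum, map_sum]
    simp only [map_mul, SmAlg.ev_apply, Gam_val, Complex.conj_ofReal]
    rfl
  par_L a := by
    ext p
    refine (SmAlg.deriv_val (F := fun p => S.lc p a) (fun _ => rfl) 3 p).trans ?_
    rw [P.par_l p (hΩS p.2), ← SmAlg.ev_apply, map_neg, map_sum]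
    simp only [map_mul, SmAlg.ev_apply, Gam_val]
    rfl
  M_3 x hx v hv := P.m_3 x hx v hv
  Mb_3 x hx v hv := (congrArg conj (P.m_3 x hx v hv)).trans (map_zero _)
  L_hor := P.lR_hor Ω hΩS hU hI hΩ
  stat_M := P.stat_mR Ω hΩS hU hI hΩ
  stat_Mb := P.stat_mbR Ω hΩS hU hI hΩ

theorem con_val (f : Fin 4 → Fin 4 → SmAlg Ω) (B : Pt → Matrix (Fin 4) (Fin 4) ℝ)
    (hf : ∀ a b, ∀ p : Ω, (f a b).1 p = (B p a b : ℝ)) (u w : Fin 4 → SmAlg Ω) (p : Ω) :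
    (con f u w).1 p = bil (B p) (fun i => (u i).1 p) (fun i => (w i).1 p) := by
  rw [← SmAlg.ev_apply]
  simp only [con, bil, map_sum, map_mul, SmAlg.ev_apply, hf]

theorem nR_val (p : Ω) : (fun i => (nR (SmAlg Ω) i).1 p) = nvec p := by
  ext i
  rw [← SmAlg.ev_apply]
  by_cases h : i = 3
  · subst h; simp [nR, nvec]
  · simp [nR, nvec, h]

theorem half_val (p : Ω) : (SmAlg.hdiff Ω hU hI hΩ).half.1 p = 1 / 2 := rfl

theorem Phi11_val (p : Ω) : ((P.toFrame Ω hΩS hU hI hΩ).Phi11).1 p = S.Phi11 p := by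
  rw [← SmAlg.ev_apply, NPFrame.Phi11]
  simp only [map_mul, map_add, map_neg, SmAlg.ev_apply, half_val]
  rw [con_val Ω _ _ (P.Ric_val Ω hΩS hU hI hΩ), con_val Ω _ _ (P.Ric_val Ω hΩS hU hI hΩ), nR_val]
  rw [Nbhd.Phi11]
  norm_num
  rfl

theorem Phi20_val (p : Ω) : ((P.toFrame Ω hΩS hU hI hΩ).Phi20).1 p = S.Phi20 p := by
  rw [← SmAlg.ev_apply, NPFrame.Phi20]
  simp only [map_mul, map_neg, SmAlg.ev_apply, half_val]
  rw [con_val Ω _ _ (P.Ric_val Ω hΩS hU hI hΩ)]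
  rfl

theorem Phi21_val (p : Ω) : ((P.toFrame Ω hΩS hU hI hΩ).Phi21).1 p = S.Phi21 p := by
  rw [← SmAlg.ev_apply, NPFrame.Phi21]
  simp only [map_mul, map_neg, SmAlg.ev_apply, half_val]
  rw [con_val Ω _ _ (P.Ric_val Ω hΩS hU hI hΩ), nR_val]
  rfl

theorem Phi22_val (p : Ω) : ((P.toFrame Ω hΩS hU hI hΩ).Phi22).1 p = S.Phi22 p := by
  rw [← SmAlg.ev_apply, NPFrame.Phi22]
  simp only [map_mul, map_neg, SmAlg.ev_apply, half_val]
  rw [con_val Ω _ _ (P.Ric_val Ω hΩS hU hI hΩ), nR_val]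
  rfl

/-- With `n = -∂_r` twice in the Weyl contraction, the Ricci and scalar corrections carry `g_{33} =
0`, `g_{3d} m̄^d = m̄² = 0` or `g(m̄, m̄) = 0`. So the Riemann tensor may replace the Weyl tensor,
and lowering its first index picks out `R²_{b3d}`. -/
theorem Psi4_val (p : Ω) : ((P.toFrame Ω hΩS hU hI hΩ).Psi4).1 p = S.Psi4 p := by
  have hp := hΩS p.2
  have h2 : S.mbar p 2 = 0 := (congrArg conj (P.m_2 p hp)).trans (map_zero _)
  have hn : bil (S.g p) (S.mbar p) (S.mbar p) = 0 := by
    have h := congrArg conj (P.null_m p hp)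
    simp only [bil, map_sum, map_mul, Complex.conj_ofReal, map_zero] at h
    exact h
  have g3 := P.g3 p hp
  have g_3 : ∀ i, S.g p i 3 = if i = 2 then 1 else 0 := fun i => by rw [P.symm p hp, g3]
  have hR : ∀ b d, riem S.g 3 b 3 d p = riemUp S.g 2 b 3 d p := by
    intro b d
    simp [riem, g3]
  rw [← SmAlg.ev_apply, NPFrame.Psi4]
  simp only [map_neg, map_sum, map_mul]
  simp only [SmAlg.ev_apply, RUp_val]
  have e : ∀ i, ((P.toFrame Ω hΩS hU hI hΩ).Mb i).1 p = S.mbar p i := fun _ => rfl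
  simp only [e]
  rw [Nbhd.Psi4]
  congr 1
  have hw : ∀ a b c d : Fin 4,
      (weyl S.g a b c d p : ℂ) * nvec p a * S.mbar p b * nvec p c * S.mbar p d
      = if a = 3 ∧ c = 3 then (weyl S.g 3 b 3 d p : ℂ) * S.mbar p b * S.mbar p d else 0 := by
    intro a b c d
    by_cases ha : a = 3
    · by_cases hc : c = 3
      · subst ha hc; simp [nvec]
      · simp [nvec, hc]
    · simp [nvec, ha]
  simp_rw [hw]
  have hs : ∑ a : Fin 4, ∑ b : Fin 4, ∑ c : Fin 4, ∑ d : Fin 4,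
      (if a = 3 ∧ c = 3 then (weyl S.g 3 b 3 d p : ℂ) * S.mbar p b * S.mbar p d else 0)
      = ∑ b : Fin 4, ∑ d : Fin 4, (weyl S.g 3 b 3 d p : ℂ) * S.mbar p b * S.mbar p d := by
    simp [Fin.sum_univ_four]
  rw [hs]
  have ht : ∀ b d, (weyl S.g 3 b 3 d p : ℂ) * S.mbar p b * S.mbar p d
      = (riemUp S.g 2 b 3 d p : ℂ) * S.mbar p b * S.mbar p d
        - (1 / 2) * ric S.g p 3 3 * ((S.g p b d : ℂ) * S.mbar p b * S.mbar p d) := by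
    intro b d
    by_cases hb : b = 2
    · subst hb; simp [h2]
    by_cases hd : d = 2
    · subst hd; simp [h2]
    rw [weyl, hR]
    simp only [g3, g_3, hb, hd, if_false]
    push_cast
    simp
    ring
  simp_rw [ht, Finset.sum_sub_distrib, ← Finset.mul_sum]
  rw [bil] at hn
  rw [hn, mul_zero, sub_zero]

theorem cov_n (u : Pt → Fin 4 → ℂ) (p : Pt) (a : Fin 4) :
    cov S.g u nvec p a = -∑ b, (chr S.g a b 3 p : ℂ) * u p b := by
  have h : ∀ b, pd b (fun q => nvec q a) p = 0 := by
    intro b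
    simp [pd, nvec]
  simp only [cov, h]
  rw [← Finset.sum_neg_distrib]
  refine Finset.sum_congr rfl fun b _ => ?_
  simp [Fin.sum_univ_four, nvec]
  ring

/-- The components of `n` are constant, so `∇_u n` is `-Γ^a_{b3} u^b`. Lowering the index leaves `-½
∂_r g`, which expresses `μ`, `λ` and `π` uniformly by the radial derivative of the metric. -/
theorem np_val (u : Pt → Fin 4 → ℂ) (u' : Fin 4 → SmAlg Ω) (p : Ω)
    (hu : ∀ a, (u' a).1 p = u p a) :
    (-(SmAlg.hdiff Ω hU hI hΩ).half * con (fun a b => (SmAlg.hdiff Ω hU hI hΩ).D 3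
      ((P.toBondi Ω hΩS hU hI hΩ).g a b)) (P.toFrame Ω hΩS hU hI hΩ).Mb u').1 p
      = bil (S.g p) (S.mbar p) (cov S.g u nvec p) := by
  have key : ∀ i b, SmAlg.ev p (∑ j, (P.toBondi Ω hΩS hU hI hΩ).g i j
      * (P.toBondi Ω hΩS hU hI hΩ).Gam j b 3)
      = SmAlg.ev p ((SmAlg.hdiff Ω hU hI hΩ).half *
        (SmAlg.hdiff Ω hU hI hΩ).D 3 ((P.toBondi Ω hΩS hU hI hΩ).g i b)) := by
    intro i b
    rw [Bondi.sum_g_Gam_3]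
  have key' : ∀ i b, ∑ j, (S.g p i j : ℂ) * (chr S.g j b 3 p : ℂ)
      = SmAlg.ev p ((SmAlg.hdiff Ω hU hI hΩ).half *
        (SmAlg.hdiff Ω hU hI hΩ).D 3 ((P.toBondi Ω hΩS hU hI hΩ).g i b)) := by
    intro i b
    rw [← key, map_sum]
    simp only [map_mul, SmAlg.ev_apply, Gam_val]
    rfl
  rw [← SmAlg.ev_apply]
  simp only [con, bil, map_mul, map_sum, map_neg, cov_n]
  have e : ∀ i, SmAlg.ev p ((P.toFrame Ω hΩS hU hI hΩ).Mb i) = S.mbar p i := fun _ => rfl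
  have hu' : ∀ i, SmAlg.ev p (u' i) = u p i := hu
  simp only [e, hu']
  rw [Finset.mul_sum]
  refine Finset.sum_congr rfl fun i _ => ?_
  have : ∑ j, (S.g p i j : ℂ) * S.mbar p i * -∑ b, (chr S.g j b 3 p : ℂ) * u p b
      = -∑ b, (∑ j, (S.g p i j : ℂ) * (chr S.g j b 3 p : ℂ)) * S.mbar p i * u p b := by
    simp only [Fin.sum_univ_four]; ring
  rw [this, Finset.mul_sum, ← Finset.sum_neg_distrib]
  refine Finset.sum_congr rfl fun b _ => ?_
  rw [key', map_mul]
  ring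

theorem npMu_val (p : Ω) : ((P.toFrame Ω hΩS hU hI hΩ).npMu).1 p = S.npMu p :=
  P.np_val Ω hΩS hU hI hΩ S.m _ p fun _ => rfl

theorem npLam_val (p : Ω) : ((P.toFrame Ω hΩS hU hI hΩ).npLam).1 p = S.npLam p :=
  P.np_val Ω hΩS hU hI hΩ S.mbar _ p fun _ => rfl

theorem npPi_val (p : Ω) : ((P.toFrame Ω hΩS hU hI hΩ).npPi).1 p = S.npPi p :=
  P.np_val Ω hΩS hU hI hΩ S.lc _ p fun _ => rfl

end Pre

/-! ### From the geometric definition of the neighbourhood to conditions on components. -/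

theorem bil_symm {B : Matrix (Fin 4) (Fin 4) ℝ} (hB : ∀ a b, B a b = B b a) (u w : Fin 4 → ℂ) :
    bil B u w = bil B w u := by
  rw [bil, bil, Finset.sum_comm]
  refine Finset.sum_congr rfl fun i _ => Finset.sum_congr rfl fun j _ => ?_
  rw [hB j i]; ring

theorem bil_conj (B : Matrix (Fin 4) (Fin 4) ℝ) (u w : Fin 4 → ℂ) :
    bil B (fun i => conj (u i)) (fun i => conj (w i)) = conj (bil B u w) := by
  simp only [bil, map_sum, map_mul, Complex.conj_ofReal]

theorem conj_nvec (p : Pt) : (fun i => conj (nvec p i)) = nvec p := by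
  ext i
  by_cases h : i = 3
  · subst h; simp [nvec]
  · simp [nvec, h]

theorem conj_lc (S : Nbhd) (p : Pt) : (fun i => conj (S.lc p i)) = S.lc p := by
  ext i; simp [Nbhd.lc]

theorem radial_const {F : Type*} [NormedAddCommGroup F] [NormedSpace ℝ F] {Ω : Set Pt}
    {f : Pt → F} (hΩ : IsOpen Ω) (hf : ContDiffOn ℝ ∞ f Ω)
    (h3 : ∀ p ∈ Ω, pd 3 f p = 0) {p : Pt}
    (hp : ∀ t ∈ Set.Icc (0 : ℝ) 1, ![p 0, p 1, p 2, t * p 3] ∈ Ω) :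
    f p = f (hpt ![p 0, p 1] (p 2)) := by
  have hd : ∀ t ∈ Set.Icc (0 : ℝ) 1,
      HasDerivAt (fun t : ℝ => f ![p 0, p 1, p 2, t * p 3]) 0 t := by
    intro t ht
    have h1 : HasDerivAt (fun t : ℝ => (![p 0, p 1, p 2, t * p 3] : Pt))
        (p 3 • (Pi.single 3 1 : Pt)) t := by
      rw [hasDerivAt_pi]
      intro i
      fin_cases i
      · simpa using hasDerivAt_const t (p 0)
      · simpa using hasDerivAt_const t (p 1)
      · simpa using hasDerivAt_const t (p 2)
      · simpa using (hasDerivAt_id t).mul_const (p 3)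
    have h2 := (differentiableAt_of_smooth hΩ hf (hp t ht)).hasFDerivAt.comp_hasDerivAt t h1
    have h4 := h3 _ (hp t ht)
    unfold pd at h4
    rwa [map_smul, h4, smul_zero] at h2
  have := constant_of_has_deriv_right_zero
    (fun t ht => (hd t ht).continuousAt.continuousWithinAt)
    (fun t ht => (hd t ⟨ht.1, ht.2.le⟩).hasDerivWithinAt) 1 (by simp)
  have e1 : (![p 0, p 1, p 2, 1 * p 3] : Pt) = p := by
    ext i; fin_cases i <;> simp
  have e0 : (![p 0, p 1, p 2, 0 * p 3] : Pt) = hpt ![p 0, p 1] (p 2) := by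
    ext i; fin_cases i <;> simp [hpt]
  rwa [e1, e0] at this

theorem IsLorentz.isUnit_det {B : Matrix (Fin 4) (Fin 4) ℝ} (h : IsLorentz B) : IsUnit B.det := by
  obtain ⟨-, P, hP, e⟩ := h
  have := congrArg Matrix.det e
  rw [Matrix.det_mul, Matrix.det_mul, Matrix.det_diagonal] at this
  rw [isUnit_iff_ne_zero]
  intro h0
  rw [h0] at this
  simp [Fin.prod_univ_four] at this

/-- The inverse metric in terms of a null frame. -/
theorem inverse_of_frame {B : Matrix (Fin 4) (Fin 4) ℝ} (hB : IsUnit B.det)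
    (hs : ∀ a b, B a b = B b a) {m l : Fin 4 → ℂ} (p : Pt) (hl : (fun i => conj (l i)) = l)
    (mm : bil B m m = 0) (mmb : bil B m (fun i => conj (m i)) = 1) (mn : bil B m (nvec p) = 0)
    (ml : bil B m l = 0) (ll : bil B l l = 0) (nl : bil B (nvec p) l = -1)
    (nn : bil B (nvec p) (nvec p) = 0) (a b : Fin 4) :
    ((B⁻¹ a b : ℝ) : ℂ) = m a * conj (m b) + conj (m a) * m b
      + ((if a = 3 then l b else 0) + if b = 3 then l a else 0) := by
  have bb : bil B (fun i => conj (m i)) (fun i => conj (m i)) = 0 := by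
    rw [bil_conj, mm, map_zero]
  have bn : bil B (fun i => conj (m i)) (nvec p) = 0 := by
    rw [← conj_nvec p, bil_conj, mn, map_zero]
  have bl : bil B (fun i => conj (m i)) l = 0 := by
    rw [← hl, bil_conj, ml, map_zero]
  set G : Matrix (Fin 4) (Fin 4) ℂ := B.map (fun x : ℝ => (x : ℂ)) with hG
  set e : Fin 4 → Fin 4 → ℂ := ![m, fun i => conj (m i), nvec p, l] with he
  set F : Matrix (Fin 4) (Fin 4) ℂ := Matrix.of fun i α => e α i with hF
  set η : Matrix (Fin 4) (Fin 4) ℂ := !![0, 1, 0, 0; 1, 0, 0, 0; 0, 0, 0, -1; 0, 0, -1, 0] with hη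
  have h1 : F.transpose * G * F = η := by
    have h : ∀ α β, (F.transpose * G * F) α β = bil B (e α) (e β) := by
      intro α β
      simp only [Matrix.mul_apply, Matrix.transpose_apply, bil, Finset.sum_mul, hF, hG,
        Matrix.of_apply, Matrix.map_apply]
      rw [Finset.sum_comm]
      refine Finset.sum_congr rfl fun i _ => Finset.sum_congr rfl fun j _ => ?_
      ring
    ext α β
    rw [h]
    fin_cases α <;> fin_cases β
    · exact mm
    · exact mmb
    · exact mn
    · exact ml
    · exact (bil_symm hs _ _).trans mmb
    · exact bb
    · exact bn
    · exact bl
    · exact (bil_symm hs _ _).trans mn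
    · exact (bil_symm hs _ _).trans bn
    · exact nn
    · exact nl
    · exact (bil_symm hs _ _).trans ml
    · exact (bil_symm hs _ _).trans bl
    · exact (bil_symm hs _ _).trans nl
    · exact ll
  -- The Gram matrix `η` of the frame is its own inverse, so `Fᵀ G F = η` inverts to `G⁻¹ = F η Fᵀ`.
  have h2 : η * η = 1 := by
    ext i j
    fin_cases i <;> fin_cases j <;> simp [hη, Matrix.mul_apply, Fin.sum_univ_four]
  have h3 : (F * η * F.transpose) * G = 1 := by
    have : (η * F.transpose * G) * F = 1 := by
      rw [Matrix.mul_assoc η, Matrix.mul_assoc η, h1, h2]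
    rw [_root_.mul_eq_one_comm] at this
    simpa only [Matrix.mul_assoc] using this
  have h4 : G * (B⁻¹).map (fun x : ℝ => (x : ℂ)) = 1 := by
    have := congrArg (fun M : Matrix (Fin 4) (Fin 4) ℝ => M.map Complex.ofRealHom)
      (Matrix.mul_nonsing_inv B hB)
    simp only [Matrix.map_mul, Matrix.map_one _ (map_zero _) (map_one _)] at this
    exact this
  have h5 : (B⁻¹).map (fun x : ℝ => (x : ℂ)) = F * η * F.transpose := by
    have := congrArg (fun M => (F * η * F.transpose) * M) h4
    simp only [← Matrix.mul_assoc, h3, one_mul, mul_one] at this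
    simpa only [Matrix.one_mul, Matrix.mul_one] using this
  have h6 := congrFun (congrFun h5 a) b
  rw [Matrix.map_apply] at h6
  rw [h6]
  have n3 : ∀ i, nvec p i = if i = 3 then -1 else 0 := by
    intro i
    by_cases h : i = 3
    · subst h; simp [nvec]
    · simp [nvec, h]
  simp only [Matrix.mul_apply, Fin.sum_univ_four, hη, hF, he, Matrix.transpose_apply,
    Matrix.of_apply]
  simp [n3]
  ring_nf
  split_ifs <;> ring

/-- The geodesic equation for `∂_r` gives `g_{33} = 0` and then `g_{3i}` constant along the radial
segments, with values read off on the horizon. This normal form makes the algebra work. The surface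
gravity becomes `∂_r g_{22} = -2κ` through `Γ²_{22} = κ`. -/
theorem Nbhd.IsNEHNbhd.pre {U : Set (Fin 2 → ℝ)} {I : Set ℝ} {G Lam kappa : ℝ} {S : Nbhd}
    (h : S.IsNEHNbhd U I G Lam kappa) : Pre U I kappa S := by
  obtain ⟨hs, hh, hb, ha⟩ := h
  have symm : ∀ p ∈ S.dom, ∀ a b, S.g p a b = S.g p b a := fun p hp a b =>
    (hs.lorentz p hp).1.apply b a
  have unit : ∀ p ∈ S.dom, IsUnit (S.g p).det := fun p hp => (hs.lorentz p hp).isUnit_det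
  -- Lowering the index of `Γ^a_{33} = 0`. The case `d = 3` controls `g_{33}`; once that vanishes,
  -- the other cases say that `g_{d3}` has no radial derivative.
  have geo : ∀ p ∈ S.dom, ∀ d, pd 3 (fun q => S.g q d 3) p + pd 3 (fun q => S.g q d 3) p
      - pd d (fun q => S.g q 3 3) p = 0 := by
    intro p hp d
    have hG : ∀ a, chr S.g a 3 3 p = 0 := by
      intro a
      have := congrFun (hb.geodesic p hp) a
      rw [Pre.cov_n] at this
      simpa [Fin.sum_univ_four, nvec] using this
    have e : ∑ a, S.g p d a * chr S.g a 3 3 p = (1 / 2) * ∑ c, (∑ a, S.g p d a * (S.g p)⁻¹ a c) *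
        (pd 3 (fun q => S.g q c 3) p + pd 3 (fun q => S.g q c 3) p
          - pd c (fun q => S.g q 3 3) p) := by
      simp only [chr, Fin.sum_univ_four]; ring
    simp only [hG, mul_zero, Finset.sum_const_zero] at e
    have h1 : ∀ c, ∑ a, S.g p d a * (S.g p)⁻¹ a c = if d = c then 1 else 0 := by
      intro c
      have := congrFun (congrFun (Matrix.mul_nonsing_inv _ (unit p hp)) d) c
      rwa [Matrix.mul_apply, Matrix.one_apply] at this
    simp only [h1, ite_mul, one_mul, zero_mul, Finset.sum_ite_eq, Finset.mem_univ, if_true] at e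
    linarith
  have g33 : ∀ p ∈ S.dom, S.g p 3 3 = 0 := by
    intro p hp
    obtain ⟨hx, hv, hr⟩ := hs.radial p hp
    rw [radial_const hs.isOpen (hs.smooth 3 3) (fun q hq => by linarith [geo q hq 3]) hr,
      hb.onHorizon _ hx _ hv]
    simp
  have g3 : ∀ p ∈ S.dom, ∀ i, S.g p 3 i = if i = 2 then 1 else 0 := by
    intro p hp i
    obtain ⟨hx, hv, hr⟩ := hs.radial p hp
    rw [symm p hp, radial_const (f := fun q => S.g q i 3) hs.isOpen (hs.smooth i 3)
      (fun q hq => ?_) hr, symm _ (hs.horizon_mem _ hx _ hv), hb.onHorizon _ hx _ hv]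
    have h0 : pd i (fun q => S.g q 3 3) q = 0 := by
      rw [pd_congr (g := fun _ => (0 : ℝ)) hs.isOpen g33 i hq]
      simp [pd]
    linarith [geo q hq i]
  have nn : ∀ p ∈ S.dom, bil (S.g p) (nvec p) (nvec p) = 0 := by
    intro p hp
    simp [bil, Fin.sum_univ_four, nvec, g33 p hp]
  refine ⟨hs.isOpen, hs.horizon_mem, hs.smooth, symm, unit, g3, hh.null, ?_, ha.smooth_m,
    ha.smooth_l, ?_, ?_, ?_, ?_, fun x hx v hv => (ha.m_tangent x hx v hv).2, ?_, ha.m_dragged,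
    ha.mm⟩
  · intro x hx v hv
    have hp := hs.horizon_mem x hx v hv
    have h1 := congrFun (hh.surfaceGravity x hx v hv) 2
    have h2 : cov S.g dv dv (hpt x v) 2 = chr S.g 2 2 2 (hpt x v) := by
      have : ∀ b a, pd b (fun q => dv q a) (hpt x v) = 0 := by intro b a; simp [pd, dv]
      simp only [cov, this]
      simp [dv, Fin.sum_univ_four]
    have h3 : ∀ d, (S.g (hpt x v))⁻¹ 2 d = if d = 3 then 1 else 0 := by
      intro d
      have hsym : (S.g (hpt x v))⁻¹.IsSymm := by
        rw [Matrix.IsSymm, Matrix.transpose_nonsing_inv, (hs.lorentz _ hp).1.eq]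
      have := congrFun (congrFun (Matrix.nonsing_inv_mul _ (unit _ hp)) d) 3
      rw [Matrix.mul_apply, Matrix.one_apply] at this
      have g_3 : ∀ i, S.g (hpt x v) i 3 = if i = 2 then 1 else 0 := fun i => by
        rw [symm _ hp, g3 _ hp]
      rw [hsym.apply d 2]
      simpa [g_3] using this
    have h4 : pd 2 (fun q => S.g q 3 2) (hpt x v) = 0 := by
      rw [pd_congr (g := fun _ => (1 : ℝ)) hs.isOpen (fun q hq => by simpa using g3 q hq 2) 2 hp]
      simp [pd]
    rw [h2] at h1
    have h5 : chr S.g 2 2 2 (hpt x v) = kappa := by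
      simpa [dv] using h1
    rw [chr] at h5
    simp [h3, h4] at h5
    linarith
  · intro p hp
    have := ha.mn p hp
    have g_3 : ∀ i, S.g p i 3 = if i = 2 then 1 else 0 := fun i => by rw [symm p hp, g3 p hp]
    simpa [bil, nvec, Fin.sum_univ_four, g_3] using this
  · intro p hp a b
    exact inverse_of_frame (unit p hp) (symm p hp) p (conj_lc S p) (ha.mm p hp) (ha.mmbar p hp)
      (ha.mn p hp) (ha.ml p hp) (ha.ll p hp) (ha.nl p hp) (nn p hp) a b
  · intro p hp a
    have := congrFun (ha.parallel_m p hp) a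
    simp [cov, nvec, Fin.sum_univ_four] at this
    simp only [Fin.sum_univ_four]
    linear_combination -this
  · intro p hp a
    have := congrFun (ha.parallel_l p hp) a
    simp [cov, nvec, Fin.sum_univ_four] at this
    simp only [Fin.sum_univ_four]
    linear_combination -this
  · intro x hx v hv a
    rw [ha.l_horizon x hx v hv]
    by_cases h : a = 2
    · subst h; simp [dv]
    · simp [dv, h]

/-! ### Transport along the null generators -/

theorem hasDerivAt_hpt {F : Type*} [NormedAddCommGroup F] [NormedSpace ℝ F] {f : Pt → F}
    {x : Fin 2 → ℝ} {v : ℝ} (hf : DifferentiableAt ℝ f (hpt x v)) :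
    HasDerivAt (fun w => f (hpt x w)) (pd 2 f (hpt x v)) v := by
  have h1 : HasDerivAt (fun w : ℝ => hpt x w) (Pi.single 2 1 : Pt) v := by
    rw [hasDerivAt_pi]
    intro i
    fin_cases i
    · simpa [hpt] using hasDerivAt_const v (x 0)
    · simpa [hpt] using hasDerivAt_const v (x 1)
    · simpa [hpt] using hasDerivAt_id' v
    · simpa [hpt] using hasDerivAt_const v (0 : ℝ)
  exact hf.hasFDerivAt.comp_hasDerivAt v h1

/-- The function `exp (c v) f(v)` is constant on the interval. -/
theorem transport_unique {I : Set ℝ} (hI : IsOpen I) (hI' : I.OrdConnected) {v₀ : ℝ} (hv₀ : v₀ ∈ I)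
    {f : ℝ → ℂ} {c : ℂ} (hf : ∀ v ∈ I, HasDerivAt f (-(c * f v)) v) (h0 : f v₀ = 0) :
    ∀ v ∈ I, f v = 0 := by
  have hd : ∀ v ∈ I, HasDerivAt (fun v : ℝ => Complex.exp (c * v) * f v) 0 v := by
    intro v hv
    have h1 : HasDerivAt (fun v : ℝ => Complex.exp (c * v)) (Complex.exp (c * v) * c) v := by
      have : HasDerivAt (fun v : ℝ => c * (v : ℂ)) c v := by
        simpa using (Complex.ofRealCLM.hasDerivAt (x := v)).const_mul c
      exact this.cexp
    exact (h1.mul (hf v hv)).congr_deriv (by ring)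
  intro v hv
  have hc := hI.is_const_of_deriv_eq_zero hI'.isPreconnected
    (fun w hw => (hd w hw).differentiableAt.differentiableWithinAt)
    (fun w hw => (hd w hw).deriv) hv hv₀
  simp only [h0, mul_zero] at hc
  exact (mul_eq_zero.1 hc).resolve_left (Complex.exp_ne_zero _)

namespace SmAlg

variable {Ω : TopologicalSpace.Opens Pt} {U : Set (Fin 2 → ℝ)} {I : Set ℝ} {hU : IsOpen U}
  {hI : IsOpen I} {hΩ : ∀ x ∈ U, ∀ v ∈ I, hpt x v ∈ Ω}

theorem transport_mem (hI' : I.OrdConnected) {v₀ : ℝ} (hv₀ : v₀ ∈ I) {f c : SmAlg Ω} {cv : ℂ}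
    (hc : ∀ p, c.1 p = cv) (h : (hdiff Ω hU hI hΩ).D 2 f + c * f ∈ (hdiff Ω hU hI hΩ).I)
    (h0 : ∀ x, ∀ hx : x ∈ U, f.1 ⟨hpt x v₀, hΩ x hx v₀ hv₀⟩ = 0) : f ∈ (hdiff Ω hU hI hΩ).I := by
  intro x hx v hv
  have := transport_unique hI hI' hv₀ (f := fun w => extd f (hpt x w)) (c := cv) (fun w hw => by
    have h1 := hasDerivAt_hpt (differentiableAt_extd f ⟨_, hΩ x hx w hw⟩)
    have h2 := h x hx w hw
    rw [← ev_apply, map_add, map_mul, ev_apply, ev_apply, ev_apply, hc, extd_val f] at h2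
    have h3 : ((hdiff Ω hU hI hΩ).D 2 f).1 ⟨hpt x w, hΩ x hx w hw⟩ = pd 2 (extd f) (hpt x w) :=
      deriv_val (extd_val f) 2 _
    rw [h3] at h2
    rw [← eq_neg_of_add_eq_zero_left h2]
    exact h1) (by
      have := h0 x hx
      rwa [extd_val f] at this) v hv
  rw [extd_val f]
  exact this

theorem iter_mem_of_eq {f f' : SmAlg Ω} {F F' : Pt → ℂ} (hf : ∀ p : Ω, f.1 p = F p)
    (hf' : ∀ p : Ω, f'.1 p = F' p) {k : ℕ}
    (h : ∀ x ∈ U, ∀ v ∈ I, dr k F' (hpt x v) = dr k F (hpt x v)) :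
    ((hdiff Ω hU hI hΩ).D 3)^[k] (f' - f) ∈ (hdiff Ω hU hI hΩ).I := by
  rw [HDiff.iter_sub]
  intro x hx v hv
  rw [← ev_apply, map_sub, sub_eq_zero]
  exact (iter_val hf' k ⟨_, hΩ x hx v hv⟩).trans ((h x hx v hv).trans
    (iter_val hf k ⟨_, hΩ x hx v hv⟩).symm)

theorem iter_mem_of_eq_real {f f' : SmAlg Ω} {F F' : Pt → ℝ} (hf : ∀ p : Ω, f.1 p = F p)
    (hf' : ∀ p : Ω, f'.1 p = F' p) {k : ℕ}
    (h : ∀ x ∈ U, ∀ v ∈ I, dr k F' (hpt x v) = dr k F (hpt x v)) :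
    ((hdiff Ω hU hI hΩ).D 3)^[k] (f' - f) ∈ (hdiff Ω hU hI hΩ).I := by
  rw [HDiff.iter_sub]
  intro x hx v hv
  rw [← ev_apply, map_sub, sub_eq_zero]
  exact (iter_val_real hf' k ⟨_, hΩ x hx v hv⟩).trans
    ((congrArg (fun r : ℝ => (r : ℂ)) (h x hx v hv)).trans
    (iter_val_real hf k ⟨_, hΩ x hx v hv⟩).symm)

end SmAlg

/-! ### Comparison of two neighbourhoods -/

namespace Pre

variable {U : Set (Fin 2 → ℝ)} {I : Set ℝ} {kappa : ℝ} {S S' : Nbhd} (P : Pre U I kappa S)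
  (P' : Pre U I kappa S')
  (Ω : TopologicalSpace.Opens Pt) (hΩS : (Ω : Set Pt) ⊆ S.dom) (hΩS' : (Ω : Set Pt) ⊆ S'.dom)
  (hU : IsOpen U) (hI : IsOpen I) (hΩ : ∀ x ∈ U, ∀ v ∈ I, hpt x v ∈ Ω)

/-- The leading coefficients are real, so the contraction with `m, m` need not be prescribed: it is
the conjugate of the one with `m̄, m̄`. -/
theorem con_conj {X : Fin 4 → Fin 4 → SmAlg Ω} {p : Ω} {r : Fin 4 → Fin 4 → ℝ}
    (hX : ∀ a b, (X a b).1 p = r a b) :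
    (con X (P.toFrame Ω hΩS hU hI hΩ).M (P.toFrame Ω hΩS hU hI hΩ).M).1 p
      = conj ((con X (P.toFrame Ω hΩS hU hI hΩ).Mb (P.toFrame Ω hΩS hU hI hΩ).Mb).1 p) := by
  rw [← SmAlg.ev_apply, ← SmAlg.ev_apply]
  simp only [con, map_sum, map_mul]
  refine Finset.sum_congr rfl fun i _ => Finset.sum_congr rfl fun j _ => ?_
  have h1 : ∀ a, SmAlg.ev p ((P.toFrame Ω hΩS hU hI hΩ).M a) = S.m p a := fun _ => rfl
  have h2 : ∀ a, conj (SmAlg.ev p ((P.toFrame Ω hΩS hU hI hΩ).Mb a)) = S.m p a := fun a =>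
    Complex.conj_conj _
  rw [h1, h1, h2, h2, SmAlg.ev_apply, hX, Complex.conj_ofReal]

theorem vec_conj {Y : Fin 4 → SmAlg Ω} {p : Ω} {r : Fin 4 → ℝ} (hY : ∀ a, (Y a).1 p = r a) :
    (∑ a, Y a * (P.toFrame Ω hΩS hU hI hΩ).M a).1 p
      = conj ((∑ a, Y a * (P.toFrame Ω hΩS hU hI hΩ).Mb a).1 p) := by
  rw [← SmAlg.ev_apply, ← SmAlg.ev_apply]
  simp only [map_sum, map_mul]
  refine Finset.sum_congr rfl fun i _ => ?_
  have h1 : ∀ a, SmAlg.ev p ((P.toFrame Ω hΩS hU hI hΩ).M a) = S.m p a := fun _ => rfl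
  have h2 : ∀ a, conj (SmAlg.ev p ((P.toFrame Ω hΩS hU hI hΩ).Mb a)) = S.m p a := fun a =>
    Complex.conj_conj _
  rw [h1, h2, SmAlg.ev_apply, hY, Complex.conj_ofReal]

theorem dg_val (k : ℕ) (a b : Fin 4) (p : Ω) :
    (((SmAlg.hdiff Ω hU hI hΩ).D 3)^[k] ((P'.toBondi Ω hΩS' hU hI hΩ).g a b
      - (P.toBondi Ω hΩS hU hI hΩ).g a b)).1 p
      = (dr k (fun q => S'.g q a b) p - dr k (fun q => S.g q a b) p : ℝ) := by
  rw [HDiff.iter_sub, ← SmAlg.ev_apply, map_sub]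
  push_cast
  exact congrArg₂ (· - ·) (SmAlg.iter_val_real (F := fun q => S'.g q a b) (fun _ => rfl) k p)
    (SmAlg.iter_val_real (F := fun q => S.g q a b) (fun _ => rfl) k p)

/-- The leading coefficients of the difference of two metrics that agree to order `k`. -/
noncomputable def lead (k : ℕ) (a b : Fin 4) : SmAlg Ω :=
  ((SmAlg.hdiff Ω hU hI hΩ).D 3)^[k] ((P'.toBondi Ω hΩS' hU hI hΩ).g a b
      - (P.toBondi Ω hΩS hU hI hΩ).g a b)

theorem lead_val (k : ℕ) (a b : Fin 4) (p : Ω) :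
    (lead P P' Ω hΩS hΩS' hU hI hΩ k a b).1 p
      = (dr k (fun q => S'.g q a b) p - dr k (fun q => S.g q a b) p : ℝ) :=
  dg_val P P' Ω hΩS hΩS' hU hI hΩ k a b p

theorem lead_symm (k : ℕ) (a b : Fin 4) : lead P P' Ω hΩS hΩS' hU hI hΩ k a b
    = lead P P' Ω hΩS hΩS' hU hI hΩ k b a := by
  rw [lead, lead, (P.toBondi Ω hΩS hU hI hΩ).symm a b, (P'.toBondi Ω hΩS' hU hI hΩ).symm a b]

theorem lead_3 (k : ℕ) (b : Fin 4) : lead P P' Ω hΩS hΩS' hU hI hΩ k 3 b = 0 := by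
  rw [lead, Bondi.g3, Bondi.g3, sub_self, HDiff.iter_zero]

theorem lead_con_MM {k : ℕ}
    (h : con (lead P P' Ω hΩS hΩS' hU hI hΩ k) (P.toFrame Ω hΩS hU hI hΩ).Mb
      (P.toFrame Ω hΩS hU hI hΩ).Mb ∈ (SmAlg.hdiff Ω hU hI hΩ).I) :
    con (lead P P' Ω hΩS hΩS' hU hI hΩ k) (P.toFrame Ω hΩS hU hI hΩ).M
      (P.toFrame Ω hΩS hU hI hΩ).M ∈ (SmAlg.hdiff Ω hU hI hΩ).I := by
  intro x hx v hv
  rw [P.con_conj Ω hΩS hU hI hΩ (fun a b => lead_val P P' Ω hΩS hΩS' hU hI hΩ k a b _)]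
  rw [h x hx v hv, map_zero]

theorem lead_mem {k : ℕ}
    (h : con (lead P P' Ω hΩS hΩS' hU hI hΩ k) (P.toFrame Ω hΩS hU hI hΩ).Mb
      (P.toFrame Ω hΩS hU hI hΩ).Mb ∈ (SmAlg.hdiff Ω hU hI hΩ).I)
    (h' : con (lead P P' Ω hΩS hΩS' hU hI hΩ k) (P.toFrame Ω hΩS hU hI hΩ).M
      (P.toFrame Ω hΩS hU hI hΩ).Mb ∈ (SmAlg.hdiff Ω hU hI hΩ).I) (a b : Fin 4) (ha : a ≠ 2)
    (hb : b ≠ 2) : lead P P' Ω hΩS hΩS' hU hI hΩ k a b ∈ (SmAlg.hdiff Ω hU hI hΩ).I :=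
  (P.toFrame Ω hΩS hU hI hΩ).con_mem (lead_symm P P' Ω hΩS hΩS' hU hI hΩ k)
    (lead_3 P P' Ω hΩS hΩS' hU hI hΩ k) (lead_con_MM P P' Ω hΩS hΩS' hU hI hΩ h) h' h a b ha hb

theorem lead_2_mem {k : ℕ}
    (h : lead P P' Ω hΩS hΩS' hU hI hΩ k 2 0 * (P.toFrame Ω hΩS hU hI hΩ).Mb 0
      + lead P P' Ω hΩS hΩS' hU hI hΩ k 2 1 * (P.toFrame Ω hΩS hU hI hΩ).Mb 1
        ∈ (SmAlg.hdiff Ω hU hI hΩ).I) (a : Fin 4) (ha : a ≠ 2) :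
    lead P P' Ω hΩS hΩS' hU hI hΩ k 2 a ∈ (SmAlg.hdiff Ω hU hI hΩ).I := by
  have h3 : lead P P' Ω hΩS hΩS' hU hI hΩ k 2 3 = 0 := by rw [lead_symm, lead_3]
  have h1 : ∑ a, lead P P' Ω hΩS hΩS' hU hI hΩ k 2 a * (P.toFrame Ω hΩS hU hI hΩ).Mb a
      ∈ (SmAlg.hdiff Ω hU hI hΩ).I := by
    convert h using 1
    rw [Fin.sum_univ_four, h3, NPFrame.Mb_2]; ring
  refine (P.toFrame Ω hΩS hU hI hΩ).vec_mem (Y := lead P P' Ω hΩS hΩS' hU hI hΩ k 2) h3 ?_ h1 a ha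
  intro x hx v hv
  rw [P.vec_conj Ω hΩS hU hI hΩ (fun a => lead_val P P' Ω hΩS hΩS' hU hI hΩ k 2 a _)]
  rw [h1 x hx v hv, map_zero]

/-- Uniqueness for the transport equation of a contraction of the leading coefficients. -/
theorem lead_con_transport (hI' : I.OrdConnected) {v₀ : ℝ} (hv₀ : v₀ ∈ I) {k : ℕ}
    {u w : Fin 4 → SmAlg Ω}
    (hu : ∀ a, (SmAlg.hdiff Ω hU hI hΩ).D 2 (u a) ∈ (SmAlg.hdiff Ω hU hI hΩ).I)
    (hw : ∀ a, (SmAlg.hdiff Ω hU hI hΩ).D 2 (w a) ∈ (SmAlg.hdiff Ω hU hI hΩ).I)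
    (h : con (fun a b => (SmAlg.hdiff Ω hU hI hΩ).D 2 (lead P P' Ω hΩS hΩS' hU hI hΩ (k + 1) a b)
        + ((k : SmAlg Ω) + 1) * SmAlg.mk (fun _ => (kappa : ℂ)) contDiffOn_const
          * lead P P' Ω hΩS hΩS' hU hI hΩ (k + 1) a b) u w ∈ (SmAlg.hdiff Ω hU hI hΩ).I)
    (h0 : ∀ x, ∀ hx : x ∈ U, (con (lead P P' Ω hΩS hΩS' hU hI hΩ (k + 1)) u w).1
      ⟨hpt x v₀, hΩ x hx v₀ hv₀⟩ = 0) :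
    con (lead P P' Ω hΩS hΩS' hU hI hΩ (k + 1)) u w ∈ (SmAlg.hdiff Ω hU hI hΩ).I := by
  have e := NPFrame.D2_con (X := lead P P' Ω hΩS hΩS' hU hI hΩ (k + 1)) hu hw
    (((k : SmAlg Ω) + 1) * SmAlg.mk (fun _ => (kappa : ℂ)) contDiffOn_const)
  refine SmAlg.transport_mem hI' hv₀
    (c := ((k : SmAlg Ω) + 1) * SmAlg.mk (fun _ => (kappa : ℂ)) contDiffOn_const)
    (cv := ((k : ℂ) + 1) * kappa) ?_ ?_ h0
  · intro p
    rw [← SmAlg.ev_apply, map_mul, map_add, map_natCast, map_one]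
    rfl
  · have := Ideal.add_mem _ e h
    rwa [sub_add_cancel] at this

end Pre

/-- The stronger energy condition kills the components `R_{A v}` of the Ricci tensor. -/
theorem Nbhd.IsNEHNbhd.ric_2_eq_zero {U : Set (Fin 2 → ℝ)} {I : Set ℝ} {G Lam kappa : ℝ} {S : Nbhd}
    (h : S.IsNEHNbhd U I G Lam kappa) (hG : 0 < G) (hU : IsOpen U) (hI : IsOpen I)
    {x : Fin 2 → ℝ} (hx : x ∈ U) {v : ℝ} (hv : v ∈ I) (a : Fin 4) (ha : a ≠ 3) :
    ric S.g (hpt x v) a 2 = 0 := by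
  have P := h.pre
  set p := hpt x v with hpdef
  have hp : p ∈ S.dom := P.horizon_mem x hx v hv
  have r22 : ric S.g p 2 2 = 0 := by
    have := (P.toBondi ⟨S.dom, P.isOpen⟩ le_rfl hU hI P.horizon_mem).Ric_22_mem x hx v hv
    rw [P.Ric_val ⟨S.dom, P.isOpen⟩ le_rfl hU hI P.horizon_mem] at this
    exact_mod_cast this
  set t : Fin 4 → ℝ := fun a => S.T p a 2 with ht
  have hE : ∀ a, a ≠ 3 → 8 * Real.pi * G * t a = ric S.g p a 2 := by
    intro a ha
    have := congrFun (congrFun (h.spacetime.einstein p hp) a) 2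
    simp only [Matrix.add_apply, Matrix.sub_apply, Matrix.smul_apply, smul_eq_mul] at this
    rw [P.symm p hp a 2, P.null x hx v hv a ha] at this
    simp only [ht]
    linarith
  have hc : 8 * Real.pi * G ≠ 0 := by positivity
  have t2 : t 2 = 0 := by
    have := hE 2 (by decide)
    rw [r22] at this
    exact (mul_eq_zero.1 this).resolve_left hc
  have g22 := P.null x hx v hv 2 (by decide)
  have g23 : S.g p 2 3 = 1 := by rw [P.symm p hp, P.g3 p hp]; simp
  -- The energy condition is applied to `X = ∂_v`, and only the causality of the current is used.
  -- Its norm is `g⁻¹(t, t)` for the covector `t = T(·, ∂_v)`.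
  have en := (h.horizon.energy x hx v hv (Pi.single 2 1) (by simp)
    (by simp [Fin.sum_univ_four, g22])
    ⟨by simp [Fin.sum_univ_four, g22], by
      simp [Fin.sum_univ_four, g22]
      rw [← hpdef, g23]; norm_num⟩).1
  rw [← hpdef] at en
  have hT : (S.T p).mulVec (Pi.single 2 1) = t := by
    ext a; simp [ht]
  rw [hT] at en
  have hgi : ∀ i c, ∑ j, S.g p i j * (S.g p)⁻¹ j c = if i = c then 1 else 0 := by
    intro i c
    have := congrFun (congrFun (Matrix.mul_nonsing_inv _ (P.unit p hp)) i) c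
    rwa [Matrix.mul_apply, Matrix.one_apply] at this
  have hJ : ∑ i, ∑ j, S.g p i j * (-((S.g p)⁻¹.mulVec t)) i * (-((S.g p)⁻¹.mulVec t)) j
      = ∑ i, ∑ j, (S.g p)⁻¹ i j * t i * t j := by
    have h1 : ∀ i, ∑ j, S.g p i j * ((S.g p)⁻¹.mulVec t) j = t i := by
      intro i
      have : (S.g p).mulVec ((S.g p)⁻¹.mulVec t) = t := by
        rw [Matrix.mulVec_mulVec, Matrix.mul_nonsing_inv _ (P.unit p hp), Matrix.one_mulVec]
      exact congrFun this i
    have h2 : ∀ i, ∑ j, S.g p i j * (-((S.g p)⁻¹.mulVec t)) i * (-((S.g p)⁻¹.mulVec t)) j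
        = ((S.g p)⁻¹.mulVec t) i * ∑ j, S.g p i j * ((S.g p)⁻¹.mulVec t) j := by
      intro i
      rw [Finset.mul_sum]
      refine Finset.sum_congr rfl fun j _ => ?_
      simp only [Pi.neg_apply]; ring
    simp_rw [h2, h1]
    refine Finset.sum_congr rfl fun i _ => ?_
    rw [Matrix.mulVec, dotProduct, Finset.sum_mul]
    exact Finset.sum_congr rfl fun j _ => by ring
  rw [hJ] at en
  set z : ℂ := ∑ i, S.m p i * t i with hz
  have hzb : conj z = ∑ i, S.mbar p i * t i := by
    rw [hz, map_sum]
    exact Finset.sum_congr rfl fun i _ => by rw [map_mul, Complex.conj_ofReal]; rfl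
  have l2 : ∀ a, S.lc p a = if a = 2 then 1 else 0 := P.l_hor x hx v hv
  -- On the horizon `ℓ = ∂_v`, so the `n, ℓ` part of `g⁻¹(t, t)` carries the factor `t 2 = 0`. What
  -- remains is `2 |t(m)|²`, which causality bounds above by `0`.
  have hz0 : z = 0 := by
    have e : ((∑ i, ∑ j, (S.g p)⁻¹ i j * t i * t j : ℝ) : ℂ) = 2 * (z * conj z) := by
      rw [hzb, hz]
      push_cast
      simp only [P.gi_eq p hp, Fin.sum_univ_four, l2, t2]
      simp
      ring
    rw [Complex.mul_conj] at e
    have e' : ∑ i, ∑ j, (S.g p)⁻¹ i j * t i * t j = 2 * Complex.normSq z := by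
      exact_mod_cast e
    rw [e'] at en
    exact Complex.normSq_eq_zero.1 (le_antisymm (by linarith) (Complex.normSq_nonneg z))
  by_cases ha2 : a = 2
  · rw [ha2]; exact r22
  have ta : (t a : ℂ) = 0 := by
    have h0 : (t a : ℂ) = ∑ c, (t c : ℂ) * ∑ d, (((S.g p)⁻¹ c d : ℝ) : ℂ) * (S.g p d a : ℂ) := by
      have h1 : ∀ c, ∑ d, (((S.g p)⁻¹ c d : ℝ) : ℂ) * (S.g p d a : ℂ) = if c = a then 1 else 0 := by
        intro c
        have := congrFun (congrFun (Matrix.nonsing_inv_mul _ (P.unit p hp)) c) a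
        rw [Matrix.mul_apply, Matrix.one_apply] at this
        have h' := congrArg (fun x : ℝ => (x : ℂ)) this
        push_cast at h'
        exact h'.trans (by split_ifs <;> simp)
      simp [h1]
    have g2a : S.g p 2 a = 0 := P.null x hx v hv a ha
    have g3a : S.g p 3 a = 0 := by rw [P.g3 p hp, if_neg ha2]
    have e : (t a : ℂ) = z * (∑ d, S.mbar p d * S.g p d a) + conj z * (∑ d, S.m p d * S.g p d a) := by
      rw [h0, hzb, hz]
      simp only [P.gi_eq p hp, Fin.sum_univ_four, l2, t2, g2a, g3a]
      simp
      ring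
    rw [e, hz0]; simp
  have := hE a ha
  rw [show t a = 0 by exact_mod_cast ta] at this
  linarith

theorem con_comm {R : Type*} [CommRing R] {f : Fin 4 → Fin 4 → R} (hf : ∀ a b, f a b = f b a)
    (u w : Fin 4 → R) : con f u w = con f w u := by
  rw [con, con, Finset.sum_comm]
  exact Finset.sum_congr rfl fun i _ => Finset.sum_congr rfl fun j _ => by rw [hf j i]; ring

/-! ### Lowest order comparison of two frames -/

namespace NPFrame

variable {R : Type*} [CommRing R] {H : HDiff R} {kap : R} {B B' : Bondi H kap}
  {F : NPFrame B} {F' : NPFrame B'}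

theorem con_mem_sub {f : Fin 4 → Fin 4 → R} {u w u' w' : Fin 4 → R}
    (hu : ∀ a, u' a - u a ∈ H.I) (hw : ∀ a, w' a - w a ∈ H.I) : con f u' w' - con f u w ∈ H.I := by
  have e : con f u' w' - con f u w = ∑ i, ∑ j, f i j * (u' i * w' j - u i * w j) := by
    simp only [con, ← Finset.sum_sub_distrib]
    exact Finset.sum_congr rfl fun i _ => Finset.sum_congr rfl fun j _ => by ring
  rw [e]
  exact sum_mem fun i _ => sum_mem fun j _ =>
    H.I.mul_mem_left _ (Bondi.mul_sub_mem (hu i) (hw j))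

theorem con_D3_lead {u w u' w' : Fin 4 → R}
    (hu : ∀ a, u' a - u a ∈ H.I) (hw : ∀ a, w' a - w a ∈ H.I) :
    -H.half * con (fun a b => H.D 3 (B'.g a b)) u' w' - -H.half * con (fun a b => H.D 3 (B.g a b)) u w
      + H.half * con (fun a b => (H.D 3)^[1] (B'.g a b - B.g a b)) u w ∈ H.I := by
  have e : con (fun a b => (H.D 3)^[1] (B'.g a b - B.g a b)) u w
      = con (fun a b => H.D 3 (B'.g a b)) u w - con (fun a b => H.D 3 (B.g a b)) u w := by
    simp only [con, ← Finset.sum_sub_distrib]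
    refine Finset.sum_congr rfl fun i _ => Finset.sum_congr rfl fun j _ => ?_
    rw [Function.iterate_one, map_sub]; ring
  rw [e]
  convert H.I.mul_mem_left (-H.half) (con_mem_sub (f := fun a b => H.D 3 (B'.g a b)) hu hw) using 1
  ring

theorem npPi_lead (hMb : ∀ a, F'.Mb a - F.Mb a ∈ H.I) :
    F'.npPi - F.npPi + H.half * ((H.D 3)^[1] (B'.g 2 0 - B.g 2 0) * F.Mb 0
      + (H.D 3)^[1] (B'.g 2 1 - B.g 2 1) * F.Mb 1) ∈ H.I := by
  have h0 := H.I.mul_mem_left (H.half * H.D 3 (B'.g 2 0)) (hMb 0)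
  have h1 := H.I.mul_mem_left (H.half * H.D 3 (B'.g 2 1)) (hMb 1)
  rw [Function.iterate_one, map_sub, map_sub]
  convert H.I.sub_mem (H.I.sub_mem (H.I.sub_mem F'.npPi_eq F.npPi_eq) h0) h1 using 1
  ring

theorem mem_J_two {f : R} (h0 : f ∈ H.I) (h1 : (H.D 3)^[1] f ∈ H.I) : f ∈ H.J (0 + 2) :=
  H.mem_J_succ.2 ⟨h0, H.mem_J_one.2 h1⟩

theorem D3_g22_mem : (H.D 3)^[1] (B'.g 2 2 - B.g 2 2) ∈ H.I := by
  rw [Function.iterate_one, map_sub]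
  convert H.I.sub_mem B'.grav B.grav using 1
  ring

/-- Both metrics have `R_{a2} = 0` on the horizon, so `∂_r g_{2a}` is constant along the generators
for each of them. -/
theorem D2_D3_mem {a : Fin 4} (ha : a ≠ 3) (r : B.Ric a 2 ∈ H.I) (r' : B'.Ric a 2 ∈ H.I) :
    H.D 2 (H.D 3 (B'.g 2 a - B.g 2 a)) ∈ H.I := by
  have e := H.I.mul_mem_left 2 (H.I.sub_mem (H.I.sub_mem (B.Ric_2_mem a ha) r)
    (H.I.sub_mem (B'.Ric_2_mem a ha) r'))
  rw [map_sub, map_sub]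
  convert H.I.neg_mem e using 1
  linear_combination (-H.D 2 (H.D 3 (B'.g 2 a)) + H.D 2 (H.D 3 (B.g 2 a))) * H.two_half

/-- On the horizon the inverse metric is a polynomial in the frame, and inversion is controlled by
`g_sub`. -/
theorem metric_mem (hM : ∀ a, F'.M a - F.M a ∈ H.I) (hMb : ∀ a, F'.Mb a - F.Mb a ∈ H.I)
    (a b : Fin 4) : B'.g a b - B.g a b ∈ H.I := by
  rw [Bondi.g_sub]
  refine H.I.neg_mem (sum_mem fun c _ => sum_mem fun d _ =>
    H.I.mul_mem_right _ (H.I.mul_mem_left _ ?_))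
  rw [F.gi_eq, F'.gi_eq]
  have hL : ∀ a, F'.L a - F.L a ∈ H.I := by
    intro a
    convert H.I.sub_mem (F'.L_hor a) (F.L_hor a) using 1; ring
  have hi : ∀ (q : Prop) [Decidable q] (a : Fin 4),
      (if q then F'.L a else 0) - (if q then F.L a else 0) ∈ H.I := by
    intro q _ a
    split_ifs
    · exact hL a
    · rw [sub_self]; exact zero_mem _
  convert H.I.add_mem (H.I.add_mem (Bondi.mul_sub_mem (hM c) (hMb d))
    (Bondi.mul_sub_mem (hMb c) (hM d))) (H.I.add_mem (hi (c = 3) d) (hi (d = 3) c)) using 1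
  ring

/-- `R/4 - 2Φ₁₁` is `R(m, m̄)` on the horizon, and its difference is given by the transport operator
with rate `κ`. This serves to determine the trace of `∂_r g_{AB}`. -/
theorem phi11_tangential (hM : ∀ a, F'.M a - F.M a ∈ H.I) (hMb : ∀ a, F'.Mb a - F.Mb a ∈ H.I)
    (hg : ∀ a b, B'.g a b - B.g a b ∈ H.J (0 + 1)) (hg2 : ∀ a, B'.g 2 a - B.g 2 a ∈ H.J (0 + 2)) :
    H.half * H.half * (B'.Scal - B.Scal) - 2 * (F'.Phi11 - F.Phi11)
      + con (fun a b => H.D 2 ((H.D 3)^[0 + 1] (B'.g a b - B.g a b))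
        + ((0 : ℕ) + 1) * kap * (H.D 3)^[0 + 1] (B'.g a b - B.g a b)) F.M F.Mb ∈ H.I := by
  have h1 := con_Ric_tangential hg hg2 F.M_2 F.Mb_2 F.M_3 F.Mb_3
    (dM_mem (F := F) (F' := F') hM hg) (dMb_mem (F := F) (F' := F') hMb hg)
  convert H.I.add_mem h1 (H.I.sub_mem F'.scal_phi11 F.scal_phi11) using 1
  rw [Function.iterate_zero, id]
  ring

end NPFrame

/-! ### Uniqueness of the jets of metric and frame. -/

section Uniqueness

variable {U : Set (Fin 2 → ℝ)} {I : Set ℝ} {G Lam v₀ : ℝ} {n : ℕ} {D : Data} {S S' : Nbhd}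

namespace Realizes

variable (hU : IsOpen U) (hI : IsOpen I) (R : Realizes U I G Lam v₀ n D S)
  (R' : Realizes U I G Lam v₀ n D S')
  (Ω : TopologicalSpace.Opens Pt) (hΩS : (Ω : Set Pt) ⊆ S.dom) (hΩS' : (Ω : Set Pt) ⊆ S'.dom)
  (hΩ : ∀ x ∈ U, ∀ v ∈ I, hpt x v ∈ Ω)

theorem m_unique (hI' : I.OrdConnected) (hv₀ : v₀ ∈ I) (a : Fin 4) :
    (R'.neh.pre.toFrame Ω hΩS' hU hI hΩ).M a - (R.neh.pre.toFrame Ω hΩS hU hI hΩ).M a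
      ∈ (SmAlg.hdiff Ω hU hI hΩ).I := by
  refine SmAlg.transport_mem hI' hv₀ (c := 0) (cv := 0) (fun p => rfl) ?_ ?_
  · rw [map_sub, zero_mul, add_zero]
    exact Ideal.sub_mem _ ((R'.neh.pre.toFrame Ω hΩS' hU hI hΩ).stat_M a)
      ((R.neh.pre.toFrame Ω hΩS hU hI hΩ).stat_M a)
  · intro x hx
    rw [← SmAlg.ev_apply, map_sub, sub_eq_zero]
    change S'.m (hpt x v₀) a = S.m (hpt x v₀) a
    fin_cases a
    · exact (R'.m x hx 0).trans (R.m x hx 0).symm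
    · exact (R'.m x hx 1).trans (R.m x hx 1).symm
    · exact (R'.neh.pre.m_2 _ (R'.neh.pre.horizon_mem x hx v₀ hv₀)).trans
        (R.neh.pre.m_2 _ (R.neh.pre.horizon_mem x hx v₀ hv₀)).symm
    · exact (R'.neh.pre.m_3 x hx v₀ hv₀).trans (R.neh.pre.m_3 x hx v₀ hv₀).symm

theorem mb_unique (hI' : I.OrdConnected) (hv₀ : v₀ ∈ I) (a : Fin 4) :
    (R'.neh.pre.toFrame Ω hΩS' hU hI hΩ).Mb a - (R.neh.pre.toFrame Ω hΩS hU hI hΩ).Mb a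
      ∈ (SmAlg.hdiff Ω hU hI hΩ).I := by
  intro x hx v hv
  have h := R.m_unique hU hI R' Ω hΩS hΩS' hΩ hI' hv₀ a x hx v hv
  rw [← SmAlg.ev_apply, map_sub, sub_eq_zero] at h ⊢
  exact congrArg conj h

theorem Ric_2_mem (hG : 0 < G) (a : Fin 4) (ha : a ≠ 3) :
    (R.neh.pre.toBondi Ω hΩS hU hI hΩ).Ric a 2 ∈ (SmAlg.hdiff Ω hU hI hΩ).I := by
  intro x hx v hv
  rw [R.neh.pre.Ric_val Ω hΩS hU hI hΩ, R.neh.ric_2_eq_zero hG hU hI hx hv a ha,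
    Complex.ofReal_zero]

/-- Equal `∂_r^k Φ₂₀` make `X(m̄, m̄)` a solution of the homogeneous transport equation with zero
initial value, so it vanishes. With its conjugate and the trace condition `hmm`, the whole
tangential block of the leading coefficient is zero. -/
theorem lead_transport (hI' : I.OrdConnected) (hv₀ : v₀ ∈ I) (k : ℕ)
    (hg : ∀ a b, (R'.neh.pre.toBondi Ω hΩS' hU hI hΩ).g a b
      - (R.neh.pre.toBondi Ω hΩS hU hI hΩ).g a b ∈ (SmAlg.hdiff Ω hU hI hΩ).J (k + 1))
    (hg2 : ∀ a, (R'.neh.pre.toBondi Ω hΩS' hU hI hΩ).g 2 a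
      - (R.neh.pre.toBondi Ω hΩS hU hI hΩ).g 2 a ∈ (SmAlg.hdiff Ω hU hI hΩ).J (k + 2))
    (hkn : k + 1 ≤ n)
    (hmm : con (Pre.lead R.neh.pre R'.neh.pre Ω hΩS hΩS' hU hI hΩ (k + 1))
      (R.neh.pre.toFrame Ω hΩS hU hI hΩ).M (R.neh.pre.toFrame Ω hΩS hU hI hΩ).Mb
      ∈ (SmAlg.hdiff Ω hU hI hΩ).I)
    (h0 : ∀ x, ∀ hx : x ∈ U, (con (Pre.lead R.neh.pre R'.neh.pre Ω hΩS hΩS' hU hI hΩ (k + 1))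
      (R.neh.pre.toFrame Ω hΩS hU hI hΩ).Mb (R.neh.pre.toFrame Ω hΩS hU hI hΩ).Mb).1
        ⟨hpt x v₀, hΩ x hx v₀ hv₀⟩ = 0) (a b : Fin 4) :
    (R'.neh.pre.toBondi Ω hΩS' hU hI hΩ).g a b
      - (R.neh.pre.toBondi Ω hΩS hU hI hΩ).g a b ∈ (SmAlg.hdiff Ω hU hI hΩ).J (k + 2) := by
  have h1 := NPFrame.phi20_tangential (F := R.neh.pre.toFrame Ω hΩS hU hI hΩ)
    (F' := R'.neh.pre.toFrame Ω hΩS' hU hI hΩ)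
    (R.mb_unique hU hI R' Ω hΩS hΩS' hΩ hI' hv₀) hg hg2
  have h2 := SmAlg.iter_mem_of_eq (hI := hI) (hU := hU) (hΩ := hΩ) (k := k)
      (R.neh.pre.Phi20_val Ω hΩS hU hI hΩ)
      (R'.neh.pre.Phi20_val Ω hΩS' hU hI hΩ)
      fun x hx v hv => by rw [R'.phi20 k hkn x hx v hv, R.phi20 k hkn x hx v hv]
  have h3 := Ideal.mul_mem_left _ 2 (Ideal.sub_mem _ h2 h1)
  rw [sub_sub_cancel, ← mul_assoc, (SmAlg.hdiff Ω hU hI hΩ).two_half, one_mul] at h3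
  have h4 := Pre.lead_con_transport R.neh.pre R'.neh.pre Ω hΩS hΩS' hU hI hΩ hI' hv₀
    (NPFrame.stat_Mb _) (NPFrame.stat_Mb _) h3 h0
  by_cases ha : a = 2
  · rw [ha]; exact hg2 b
  by_cases hb : b = 2
  · rw [hb, Bondi.symm, Bondi.symm (R.neh.pre.toBondi Ω hΩS hU hI hΩ)]; exact hg2 a
  exact HDiff.mem_J_succ' _ (hg a b)
    (Pre.lead_mem R.neh.pre R'.neh.pre Ω hΩS hΩS' hU hI hΩ h4 hmm a b ha hb)

theorem eq_zero_of_half {a b : SmAlg Ω} {x : Fin 2 → ℝ} (hx : x ∈ U) {v : ℝ} (hv : v ∈ I)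
    (h' : a + (SmAlg.hdiff Ω hU hI hΩ).half * b ∈ (SmAlg.hdiff Ω hU hI hΩ).I)
    (ha : a.1 ⟨hpt x v, hΩ x hx v hv⟩ = 0) : b.1 ⟨hpt x v, hΩ x hx v hv⟩ = 0 := by
  have h := h' x hx v hv
  rw [← SmAlg.ev_apply, map_add, map_mul, SmAlg.ev_apply, ha, zero_add] at h
  refine (mul_eq_zero.1 h).resolve_left ?_
  change (1 / 2 : ℂ) ≠ 0
  norm_num

theorem sub_val_eq_zero {a b : SmAlg Ω} {p : Ω} (h : a.1 p = b.1 p) : (a - b).1 p = 0 := by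
  rw [← SmAlg.ev_apply, map_sub, SmAlg.ev_apply, SmAlg.ev_apply, h, sub_self]

/-- At first order no curvature datum fixes the shift: `∂_r g_{22}` is fixed by `κ`, while `∂_r
g_{2A}` is transported trivially from the slice, where `π` determines it. -/
theorem metric_unique_2 (hI' : I.OrdConnected) (hv₀ : v₀ ∈ I) (hG : 0 < G) (a : Fin 4) :
    (R'.neh.pre.toBondi Ω hΩS' hU hI hΩ).g 2 a
      - (R.neh.pre.toBondi Ω hΩS hU hI hΩ).g 2 a ∈ (SmAlg.hdiff Ω hU hI hΩ).J (0 + 2) := by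
  have hM := R.m_unique hU hI R' Ω hΩS hΩS' hΩ hI' hv₀
  have hMb := R.mb_unique hU hI R' Ω hΩS hΩS' hΩ hI' hv₀
  have h0 := NPFrame.metric_mem hM hMb 2 a
  refine NPFrame.mem_J_two h0 ?_
  by_cases ha2 : a = 2
  · rw [ha2]; exact NPFrame.D3_g22_mem
  have hc : ∀ a, a ≠ 3 → (SmAlg.hdiff Ω hU hI hΩ).D 2
      (Pre.lead R.neh.pre R'.neh.pre Ω hΩS hΩS' hU hI hΩ 1 2 a) ∈ (SmAlg.hdiff Ω hU hI hΩ).I :=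
    fun a ha => NPFrame.D2_D3_mem (B := R.neh.pre.toBondi Ω hΩS hU hI hΩ)
      (B' := R'.neh.pre.toBondi Ω hΩS' hU hI hΩ) ha (R.Ric_2_mem hU hI Ω hΩS hΩ hG a ha)
      (R'.Ric_2_mem hU hI Ω hΩS' hΩ hG a ha)
  refine Pre.lead_2_mem R.neh.pre R'.neh.pre Ω hΩS hΩS' hU hI hΩ (k := 1) ?_ a ha2
  refine SmAlg.transport_mem hI' hv₀ (c := 0) (cv := 0) (fun p => rfl) ?_ ?_
  · rw [zero_mul, add_zero, map_add, HDiff.D_mul, HDiff.D_mul]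
    exact Ideal.add_mem _ (Ideal.add_mem _ (Ideal.mul_mem_right _ _ (hc 0 (by decide)))
      (Ideal.mul_mem_left _ _ (NPFrame.stat_Mb _ 0)))
      (Ideal.add_mem _ (Ideal.mul_mem_right _ _ (hc 1 (by decide)))
      (Ideal.mul_mem_left _ _ (NPFrame.stat_Mb _ 1)))
  · intro x hx
    refine eq_zero_of_half hU hI Ω hΩ hx hv₀ (NPFrame.npPi_lead hMb) (sub_val_eq_zero Ω ?_)
    refine (R'.neh.pre.npPi_val Ω hΩS' hU hI hΩ ⟨hpt x v₀, hΩ x hx v₀ hv₀⟩).trans ?_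
    exact ((R'.pi x hx).trans (R.pi x hx).symm).trans
      (R.neh.pre.npPi_val Ω hΩS hU hI hΩ ⟨hpt x v₀, hΩ x hx v₀ hv₀⟩).symm

/-- Two transport equations at first order: the trace from `R` and `Φ₁₁` with initial value from
`μ`, the part `X(m̄, m̄)` from `Φ₂₀` with initial value from `λ`. The hypothesis `2 ≤ n` puts `R`
itself among the data. -/
theorem metric_unique_1 (hI' : I.OrdConnected) (hv₀ : v₀ ∈ I) (hG : 0 < G) (hn : 2 ≤ n)
    (a b : Fin 4) : (R'.neh.pre.toBondi Ω hΩS' hU hI hΩ).g a b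
      - (R.neh.pre.toBondi Ω hΩS hU hI hΩ).g a b ∈ (SmAlg.hdiff Ω hU hI hΩ).J (0 + 2) := by
  have hM := R.m_unique hU hI R' Ω hΩS hΩS' hΩ hI' hv₀
  have hMb := R.mb_unique hU hI R' Ω hΩS hΩS' hΩ hI' hv₀
  have g1 := fun a b => (HDiff.mem_J_one _).2 (NPFrame.metric_mem hM hMb a b)
  have g2 := R.metric_unique_2 hU hI R' Ω hΩS hΩS' hΩ hI' hv₀ hG
  refine R.lead_transport hU hI R' Ω hΩS hΩS' hΩ hI' hv₀ 0 g1 g2 (by omega) ?_ ?_ a b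
  · have h1 := NPFrame.phi11_tangential hM hMb g1 g2
    have s0 : ∀ x ∈ U, ∀ v ∈ I, dr 0 (NEH.scal S'.g) (hpt x v) = dr 0 (NEH.scal S.g) (hpt x v) :=
      fun x hx v hv => by rw [R'.scal 0 hn x hx v hv, R.scal 0 hn x hx v hv]
    have hs := SmAlg.iter_mem_of_eq_real (hU := hU) (hI := hI) (hΩ := hΩ) (k := 0)
      (R.neh.pre.Scal_val Ω hΩS hU hI hΩ) (R'.neh.pre.Scal_val Ω hΩS' hU hI hΩ) s0
    have hp := SmAlg.iter_mem_of_eq (hU := hU) (hI := hI) (hΩ := hΩ) (k := 0)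
      (R.neh.pre.Phi11_val Ω hΩS hU hI hΩ)
      (R'.neh.pre.Phi11_val Ω hΩS' hU hI hΩ) fun x hx v hv =>
        (R'.phi11 x hx v hv).trans (R.phi11 x hx v hv).symm
    have h2 := Ideal.sub_mem _ h1 (Ideal.sub_mem _ (Ideal.mul_mem_left _
      ((SmAlg.hdiff Ω hU hI hΩ).half * (SmAlg.hdiff Ω hU hI hΩ).half) hs)
      (Ideal.mul_mem_left _ 2 hp))
    simp only [Function.iterate_zero, id, add_sub_cancel_left] at h2
    refine Pre.lead_con_transport R.neh.pre R'.neh.pre Ω hΩS hΩS' hU hI hΩ hI' hv₀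
      (NPFrame.stat_M _) (NPFrame.stat_Mb _) h2 ?_
    intro x hx
    have e := eq_zero_of_half hU hI Ω hΩ hx hv₀ (NPFrame.con_D3_lead hMb hM)
      (sub_val_eq_zero Ω (by
        refine (R'.neh.pre.npMu_val Ω hΩS' hU hI hΩ ⟨hpt x v₀, hΩ x hx v₀ hv₀⟩).trans ?_
        exact ((R'.mu x hx).trans (R.mu x hx).symm).trans
          (R.neh.pre.npMu_val Ω hΩS hU hI hΩ ⟨hpt x v₀, hΩ x hx v₀ hv₀⟩).symm))
    rw [con_comm (Pre.lead_symm R.neh.pre R'.neh.pre Ω hΩS hΩS' hU hI hΩ _)]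
    unfold Pre.lead
    exact e
  · intro x hx
    unfold Pre.lead
    exact eq_zero_of_half hU hI Ω hΩ hx hv₀ (NPFrame.con_D3_lead hMb hMb)
      (sub_val_eq_zero Ω (by
        refine (R'.neh.pre.npLam_val Ω hΩS' hU hI hΩ ⟨hpt x v₀, hΩ x hx v₀ hv₀⟩).trans ?_
        exact ((R'.lam x hx).trans (R.lam x hx).symm).trans
          (R.neh.pre.npLam_val Ω hΩS hU hI hΩ ⟨hpt x v₀, hΩ x hx v₀ hv₀⟩).symm))

/-- The data `Φ₂₁`, `Φ₂₂`, `R` of order `k` fix the components `2a` and the trace of `∂_r^{k+2} g`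
on the whole horizon. The rest is fixed on the slice by `∂_r^k Ψ₄` and propagated by `∂_r^{k+1}
Φ₂₀`; hence the index shift between these data. -/
theorem metric_unique_succ (hI' : I.OrdConnected) (hv₀ : v₀ ∈ I) (k : ℕ) (hk : k + 2 ≤ n)
    (hg : ∀ a b, (R'.neh.pre.toBondi Ω hΩS' hU hI hΩ).g a b
      - (R.neh.pre.toBondi Ω hΩS hU hI hΩ).g a b ∈ (SmAlg.hdiff Ω hU hI hΩ).J (k + 2))
    (a b : Fin 4) : (R'.neh.pre.toBondi Ω hΩS' hU hI hΩ).g a b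
      - (R.neh.pre.toBondi Ω hΩS hU hI hΩ).g a b ∈ (SmAlg.hdiff Ω hU hI hΩ).J (k + 1 + 2) := by
  have hMb := R.mb_unique hU hI R' Ω hΩS hΩS' hΩ hI' hv₀
  have th := (SmAlg.hdiff Ω hU hI hΩ).two_half
  have h21 := NPFrame.phi21_lead (F := R.neh.pre.toFrame Ω hΩS hU hI hΩ)
    (F' := R'.neh.pre.toFrame Ω hΩS' hU hI hΩ) hMb hg
  have d21 := SmAlg.iter_mem_of_eq (hU := hU) (hI := hI) (hΩ := hΩ) (k := k)
    (R.neh.pre.Phi21_val Ω hΩS hU hI hΩ) (R'.neh.pre.Phi21_val Ω hΩS' hU hI hΩ)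
      fun x hx v hv => by rw [R'.phi21 k hk x hx v hv, R.phi21 k hk x hx v hv]
  have h22 := NPFrame.phi22_lead (F := R.neh.pre.toFrame Ω hΩS hU hI hΩ)
    (F' := R'.neh.pre.toFrame Ω hΩS' hU hI hΩ) hg
  have d22 := SmAlg.iter_mem_of_eq (hU := hU) (hI := hI) (hΩ := hΩ) (k := k)
    (R.neh.pre.Phi22_val Ω hΩS hU hI hΩ) (R'.neh.pre.Phi22_val Ω hΩS' hU hI hΩ)
      fun x hx v hv => by rw [R'.phi22 k hk x hx v hv, R.phi22 k hk x hx v hv]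
  have hs := HDiff.iter_mem_I _ (Bondi.dScal_lead hg)
  have ds := SmAlg.iter_mem_of_eq_real (hU := hU) (hI := hI) (hΩ := hΩ) (k := k)
    (R.neh.pre.Scal_val Ω hΩS hU hI hΩ) (R'.neh.pre.Scal_val Ω hΩS' hU hI hΩ)
      fun x hx v hv => by rw [R'.scal k hk x hx v hv, R.scal k hk x hx v hv]
  have h4 := NPFrame.psi4_lead (F := R.neh.pre.toFrame Ω hΩS hU hI hΩ)
    (F' := R'.neh.pre.toFrame Ω hΩS' hU hI hΩ) hMb hg
  have e21 := Ideal.mul_mem_left _ 4 (Ideal.sub_mem _ d21 h21)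
  have e22 := Ideal.mul_mem_left _ 2 (Ideal.sub_mem _ d22 h22)
  rw [HDiff.iter_sub] at hs
  have es := Ideal.sub_mem _ ds hs
  rw [sub_sub_cancel] at e21 e22 es
  rw [← mul_assoc, ← mul_assoc, show (4 : SmAlg Ω) * (SmAlg.hdiff Ω hU hI hΩ).half
    * (SmAlg.hdiff Ω hU hI hΩ).half = 1 by
      linear_combination (2 * (SmAlg.hdiff Ω hU hI hΩ).half + 1) * th, one_mul] at e21
  rw [← mul_assoc, th, one_mul] at e22
  have key : ∀ a, Pre.lead R.neh.pre R'.neh.pre Ω hΩS hΩS' hU hI hΩ (k + 2) 2 a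
      ∈ (SmAlg.hdiff Ω hU hI hΩ).I := by
    intro a
    by_cases ha : a = 2
    · rw [ha]; exact es
    · exact Pre.lead_2_mem R.neh.pre R'.neh.pre Ω hΩS hΩS' hU hI hΩ e21 a ha
  refine R.lead_transport hU hI R' Ω hΩS hΩS' hΩ hI' hv₀ (k + 1) hg
    (fun a => HDiff.mem_J_succ' _ (hg 2 a) (key a)) (by omega) e22 ?_ a b
  intro x hx
  rw [sub_eq_add_neg, neg_mul_eq_mul_neg] at h4
  have d4 : (((SmAlg.hdiff Ω hU hI hΩ).D 3)^[k] ((R'.neh.pre.toFrame Ω hΩS' hU hI hΩ).Psi4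
      - (R.neh.pre.toFrame Ω hΩS hU hI hΩ).Psi4)).1 ⟨hpt x v₀, hΩ x hx v₀ hv₀⟩ = 0 := by
    rw [HDiff.iter_sub]
    refine sub_val_eq_zero Ω ?_
    exact (SmAlg.iter_val (R'.neh.pre.Psi4_val Ω hΩS' hU hI hΩ) k ⟨_, hΩ x hx v₀ hv₀⟩).trans
      (((R'.psi4 k hk x hx).trans (R.psi4 k hk x hx).symm).trans
      (SmAlg.iter_val (R.neh.pre.Psi4_val Ω hΩS hU hI hΩ) k ⟨_, hΩ x hx v₀ hv₀⟩).symm)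
  have h6 := eq_zero_of_half hU hI Ω hΩ hx hv₀ h4 d4
  rw [← SmAlg.ev_apply, map_neg, neg_eq_zero] at h6
  exact h6

theorem metric_unique (hI' : I.OrdConnected) (hv₀ : v₀ ∈ I) (hG : 0 < G) (hn : 2 ≤ n)
    (k : ℕ) (hk : k + 1 ≤ n) : ∀ a b, (R'.neh.pre.toBondi Ω hΩS' hU hI hΩ).g a b
      - (R.neh.pre.toBondi Ω hΩS hU hI hΩ).g a b ∈ (SmAlg.hdiff Ω hU hI hΩ).J (k + 2) := by
  induction k with
  | zero =>
    exact R.metric_unique_1 hU hI R' Ω hΩS hΩS' hΩ hI' hv₀ hG hn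
  | succ k ih =>
    exact R.metric_unique_succ hU hI R' Ω hΩS hΩS' hΩ hI' hv₀ k (by omega)
      (ih (by omega))

end Realizes

/-- The data determine the jets of the frame. -/
theorem frame_unique (hU : IsOpen U) (hI : IsOpen I) (hI' : I.OrdConnected) (hv₀ : v₀ ∈ I)
    (hG : 0 < G) (hn : 2 ≤ n) (R : Realizes U I G Lam v₀ n D S) (R' : Realizes U I G Lam v₀ n D S')
    (k : ℕ) (hk : k ≤ n) (x : Fin 2 → ℝ) (hx : x ∈ U) (v : ℝ) (hv : v ∈ I) (a i : Fin 4) :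
    dr k (fun q => S.frame a q i) (hpt x v) = dr k (fun q => S'.frame a q i) (hpt x v) := by
  set Ω : TopologicalSpace.Opens Pt :=
    ⟨S.dom ∩ S'.dom, R.neh.pre.isOpen.inter R'.neh.pre.isOpen⟩
  have hΩS : (Ω : Set Pt) ⊆ S.dom := Set.inter_subset_left
  have hΩS' : (Ω : Set Pt) ⊆ S'.dom := Set.inter_subset_right
  have hΩ : ∀ x ∈ U, ∀ v ∈ I, hpt x v ∈ Ω := fun x hx v hv =>
    ⟨R.neh.pre.horizon_mem x hx v hv, R'.neh.pre.horizon_mem x hx v hv⟩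
  have hM := R.m_unique hU hI R' Ω hΩS hΩS' hΩ hI' hv₀
  have hMb := R.mb_unique hU hI R' Ω hΩS hΩS' hΩ hI' hv₀
  have hg : ∀ a b, (R'.neh.pre.toBondi Ω hΩS' hU hI hΩ).g a b
      - (R.neh.pre.toBondi Ω hΩS hU hI hΩ).g a b ∈ (SmAlg.hdiff Ω hU hI hΩ).J (n + 1) := by
    intro a b
    -- Agreement through order `n` is membership in `J (n + 1)`, reached at the last admissible step
    -- `k = n - 1`.
    have := R.metric_unique hU hI R' Ω hΩS hΩS' hΩ hI' hv₀ hG hn (n - 1) (by omega) a b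
    rwa [show n - 1 + 2 = n + 1 by omega] at this
  have fin : ∀ {f f' : SmAlg Ω} {F F' : Pt → ℂ}, (∀ p : Ω, f.1 p = F p) →
      (∀ p : Ω, f'.1 p = F' p) → f' - f ∈ (SmAlg.hdiff Ω hU hI hΩ).J (n + 1) →
      dr k F (hpt x v) = dr k F' (hpt x v) := by
    intro f f' F F' hf hf' h
    have h1 := (HDiff.mem_J_iff _).1 h k (by omega) x hx v hv
    rw [HDiff.iter_sub, ← SmAlg.ev_apply, map_sub, sub_eq_zero] at h1
    exact ((SmAlg.iter_val hf k ⟨_, hΩ x hx v hv⟩).symm.trans h1.symm).trans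
      (SmAlg.iter_val hf' k ⟨_, hΩ x hx v hv⟩)
  fin_cases a
  · exact fin (fun _ => rfl) (fun _ => rfl) (NPFrame.dM_mem hM hg i)
  · exact fin (fun _ => rfl) (fun _ => rfl) (NPFrame.dMb_mem hMb hg i)
  · rfl
  · exact fin (fun _ => rfl) (fun _ => rfl) (NPFrame.dL_mem (F := R.neh.pre.toFrame Ω hΩS hU hI hΩ)
      (F' := R'.neh.pre.toFrame Ω hΩS' hU hI hΩ) hg i)

end Uniqueness

/-! ### Integrals with smooth parameters -/

section Integrals

variable {P F : Type*} [NormedAddCommGroup P] [NormedSpace ℝ P] [NormedAddCommGroup F]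
  [NormedSpace ℝ F]

theorem deriv_smoothTransition_eq_zero {t : ℝ} (ht : t ∉ Set.Icc (0 : ℝ) 1) :
    deriv Real.smoothTransition t = 0 := by
  rw [Set.mem_Icc, not_and_or, not_le, not_le] at ht
  rcases ht with h | h
  · have : Real.smoothTransition =ᶠ[nhds t] fun _ => 0 := by
      filter_upwards [gt_mem_nhds h] with s hs using Real.smoothTransition.zero_of_nonpos hs.le
    rw [this.deriv_eq, deriv_const]
  · have : Real.smoothTransition =ᶠ[nhds t] fun _ => 1 := by
      filter_upwards [lt_mem_nhds h] with s hs using Real.smoothTransition.one_of_one_le hs.le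
    rw [this.deriv_eq, deriv_const]

theorem smoothTransition_mem (t : ℝ) : Real.smoothTransition t ∈ Set.Icc (0 : ℝ) 1 :=
  ⟨Real.smoothTransition.nonneg t, Real.smoothTransition.le_one t⟩

/-- The integral of a smooth function along a smooth family of curves is smooth. -/
theorem contDiffOn_integral_curve {s : Set P} (hs : IsOpen s) {f : P → F}
    (hf : ContDiffOn ℝ ∞ f s) {c : P → ℝ → P} (hc : ContDiff ℝ ∞ fun q : P × ℝ => c q.1 q.2)
    (hcs : ∀ p ∈ s, ∀ t ∈ Set.Icc (0 : ℝ) 1, c p t ∈ s) :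
    ContDiffOn ℝ ∞ (fun p => ∫ t in (0 : ℝ)..1, f (c p t)) s := by
  set φ := Real.smoothTransition
  have hφ : ContDiff ℝ ∞ φ := Real.smoothTransition.contDiff
  have hφ' : ContDiff ℝ ∞ (deriv φ) := (contDiff_infty_iff_deriv.1 hφ).2
  -- The substitution `t = φ(s)` with a smooth step `φ` turns the integral over `[0, 1]` into one
  -- over the line with compactly supported integrand. Its value is the convolution with the
  -- constant `1` at `0`, whence the reflection `-x` and the support in `[-1, 0]`.
  set g : P → ℝ → F := fun p x => deriv φ (-x) • f (c p (φ (-x)))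
  have hsupp : ∀ p, ∀ x, p ∈ s → x ∉ Set.Icc (-1 : ℝ) 0 → g p x = 0 := by
    intro p x _ hx
    have : -x ∉ Set.Icc (0 : ℝ) 1 := fun h => hx ⟨by linarith [h.2], by linarith [h.1]⟩
    simp only [g, φ, deriv_smoothTransition_eq_zero this, zero_smul]
  have hg : ContDiffOn ℝ ∞ (Function.uncurry g) (s ×ˢ Set.univ) := by
    have h1 : ContDiff ℝ ∞ fun q : P × ℝ => c q.1 (φ (-q.2)) :=
      hc.comp (contDiff_fst.prodMk (hφ.comp contDiff_snd.neg))
    have h2 : ContDiffOn ℝ ∞ (fun q : P × ℝ => f (c q.1 (φ (-q.2)))) (s ×ˢ Set.univ) :=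
      hf.comp h1.contDiffOn fun q hq => hcs _ hq.1 _ (smoothTransition_mem _)
    exact ((hφ'.comp contDiff_snd.neg).contDiffOn).smul h2
  have key := MeasureTheory.contDiffOn_convolution_right_with_param_comp (n := ⊤) (μ := MeasureTheory.volume)
    (ContinuousLinearMap.lsmul ℝ ℝ) (v := fun _ : P => (0 : ℝ)) contDiffOn_const
    (f := fun _ : ℝ => (1 : ℝ)) hs (isCompact_Icc (a := (-1 : ℝ)) (b := 0)) hsupp
    (MeasureTheory.locallyIntegrable_const 1) hg
  refine ContDiffOn.congr key fun p hp => ?_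
  rw [MeasureTheory.convolution]
  simp only [ContinuousLinearMap.lsmul_apply, one_smul, zero_sub, g, neg_neg]
  have h1 : ∫ t in (0 : ℝ)..1, deriv φ t • f (c p (φ t)) = ∫ t in (φ 0)..(φ 1), f (c p t) := by
    refine intervalIntegral.integral_deriv_smul_comp' (f := φ) (g := fun t => f (c p t))
      (fun t _ => (hφ.differentiable (by simp) t).hasDerivAt) hφ'.continuous.continuousOn ?_
    have hcp : Continuous fun t => c p t := hc.continuous.comp (Continuous.prodMk_right p)
    refine hf.continuousOn.comp hcp.continuousOn ?_
    rintro _ ⟨t, -, rfl⟩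
    exact hcs p hp _ (smoothTransition_mem t)
  simp only [φ, Real.smoothTransition.zero, Real.smoothTransition.one] at h1
  rw [← h1, intervalIntegral.integral_of_le zero_le_one, ← MeasureTheory.integral_Icc_eq_integral_Ioc]
  refine MeasureTheory.setIntegral_eq_integral_of_forall_compl_eq_zero fun t ht => ?_
  rw [deriv_smoothTransition_eq_zero ht, zero_smul]

theorem hasDerivAt_primitive [CompleteSpace F] {O : Set ℝ} (hO : IsOpen O) {g : ℝ → F}
    (hg : ContinuousOn g O) {a b : ℝ} (hab : Set.uIcc a b ⊆ O) :
    HasDerivAt (fun u => ∫ s in a..u, g s) (g b) b :=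
  intervalIntegral.integral_hasDerivAt_right (hg.mono hab).intervalIntegrable
    (hg.stronglyMeasurableAtFilter hO b (hab Set.right_mem_uIcc))
    (hg.continuousAt (hO.mem_nhds (hab Set.right_mem_uIcc)))

end Integrals

/-! ### Radial quadrature -/

/-- The points of the radial segment of `p`. -/
def rseg (p : Pt) (t : ℝ) : Pt := ![p 0, p 1, p 2, t * p 3]

/-- The radial primitive that vanishes on the horizon. -/
noncomputable def rad {F : Type*} [NormedAddCommGroup F] [NormedSpace ℝ F] (f : Pt → F) : Pt → F :=
  fun p => p 3 • ∫ t in (0 : ℝ)..1, f (rseg p t)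

theorem rseg_smooth : ContDiff ℝ ∞ fun q : Pt × ℝ => rseg q.1 q.2 := by
  rw [contDiff_pi]
  intro i
  have h : ∀ j : Fin 4, ContDiff ℝ ∞ fun q : Pt × ℝ => q.1 j := fun j =>
    (contDiff_apply ℝ ℝ j).comp contDiff_fst
  fin_cases i
  · exact h 0
  · exact h 1
  · exact h 2
  · exact contDiff_snd.mul (h 3)

section Rad

variable {F : Type*} [NormedAddCommGroup F] [NormedSpace ℝ F] {Ω : Set Pt} {f : Pt → F}

theorem rad_smooth (hΩ : IsOpen Ω) (hr : ∀ p ∈ Ω, ∀ t ∈ Set.Icc (0 : ℝ) 1, rseg p t ∈ Ω)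
    (hf : ContDiffOn ℝ ∞ f Ω) : ContDiffOn ℝ ∞ (rad f) Ω :=
  ((contDiff_apply ℝ ℝ (3 : Fin 4)).contDiffOn).smul
    (contDiffOn_integral_curve hΩ hf rseg_smooth hr)

theorem rad_hpt (x : Fin 2 → ℝ) (v : ℝ) : rad f (hpt x v) = 0 := by
  simp [rad, hpt]

/-- On a radial line the scaled integral is `∫_0^u f`, so this is the fundamental theorem of
calculus; the segment condition keeps the integrand inside `Ω`. -/
theorem pd_rad [CompleteSpace F] (hΩ : IsOpen Ω)
    (hr : ∀ p ∈ Ω, ∀ t ∈ Set.Icc (0 : ℝ) 1, rseg p t ∈ Ω)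
    (hf : ContDiffOn ℝ ∞ f Ω) {p : Pt} (hp : p ∈ Ω) : pd 3 (rad f) p = f p := by
  have hline : ∀ u : ℝ, HasDerivAt (fun u : ℝ => (![p 0, p 1, p 2, u] : Pt)) (Pi.single 3 1) u := by
    intro u
    rw [hasDerivAt_pi]
    intro i
    fin_cases i
    · simpa using hasDerivAt_const u (p 0)
    · simpa using hasDerivAt_const u (p 1)
    · simpa using hasDerivAt_const u (p 2)
    · simpa using hasDerivAt_id' u
  have hpe : (![p 0, p 1, p 2, p 3] : Pt) = p := by
    ext i; fin_cases i <;> rfl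
  have h1 : HasDerivAt (fun u : ℝ => rad f ![p 0, p 1, p 2, u]) (pd 3 (rad f) p) (p 3) := by
    have hd := (differentiableAt_of_smooth hΩ (rad_smooth hΩ hr hf) hp).hasFDerivAt
    rw [← hpe] at hd
    have := hd.comp_hasDerivAt (p 3) (hline (p 3))
    rw [hpe] at this
    exact this
  have h2 : ∀ u : ℝ, rad f ![p 0, p 1, p 2, u] = ∫ s in (0 : ℝ)..u, f ![p 0, p 1, p 2, s] := by
    intro u
    have := intervalIntegral.smul_integral_comp_mul_right (a := 0) (b := 1)
      (fun s => f ![p 0, p 1, p 2, s]) u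
    rw [zero_mul, one_mul] at this
    rw [← this]
    rfl
  simp_rw [h2] at h1
  have hc : Continuous fun u : ℝ => (![p 0, p 1, p 2, u] : Pt) :=
    continuous_iff_continuousAt.2 fun u => (hline u).continuousAt
  have h3 := hasDerivAt_primitive (hΩ.preimage hc) (g := fun s => f ![p 0, p 1, p 2, s])
    (hf.continuousOn.comp hc.continuousOn fun _ h => h) (a := 0) (b := p 3) (by
      intro s hs
      rw [← segment_eq_uIcc] at hs
      obtain ⟨a, b, ha, hb, hab, rfl⟩ := hs
      have := hr p hp b ⟨hb, by linarith⟩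
      simpa [rseg] using this)
  rw [hpe] at h3
  exact h1.unique h3

end Rad

/-! ### Transport along the generators -/

/-- Variation of constants, `s = e^{-c(v - v₀)} (s₀ + ∫ e^{c(t - v₀)} σ)`. The integral is rescaled
to `[0, 1]` so that smoothness in `(x, v)` follows from `contDiffOn_integral_curve`; order
connectedness keeps the path from `v₀` to `v` in `I`. -/
theorem exists_transport {F : Type*} [NormedAddCommGroup F] [NormedSpace ℝ F] [CompleteSpace F]
    {U : Set (Fin 2 → ℝ)} (hU : IsOpen U) {I : Set ℝ} (hI : IsOpen I) (hI' : I.OrdConnected)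
    {v₀ : ℝ} (hv₀ : v₀ ∈ I) (c : ℝ) {σ : (Fin 2 → ℝ) × ℝ → F} (hσ : ContDiffOn ℝ ∞ σ (U ×ˢ I))
    {s₀ : (Fin 2 → ℝ) → F} (hs₀ : ContDiffOn ℝ ∞ s₀ U) :
    ∃ s : (Fin 2 → ℝ) × ℝ → F, ContDiffOn ℝ ∞ s (U ×ˢ I) ∧ (∀ x ∈ U, s (x, v₀) = s₀ x) ∧
      ∀ x ∈ U, ∀ v ∈ I, HasDerivAt (fun w => s (x, w)) (σ (x, v) - c • s (x, v)) v := by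
  set f : (Fin 2 → ℝ) × ℝ → F := fun q => Real.exp (c * (q.2 - v₀)) • σ q
  have hexp : ∀ c : ℝ, ContDiff ℝ ∞ fun q : (Fin 2 → ℝ) × ℝ => Real.exp (c * (q.2 - v₀)) :=
    fun c => (contDiff_const.mul (contDiff_snd.sub contDiff_const)).exp
  have hf : ContDiffOn ℝ ∞ f (U ×ˢ I) := (hexp c).contDiffOn.smul hσ
  set γ : (Fin 2 → ℝ) × ℝ → ℝ → (Fin 2 → ℝ) × ℝ := fun q t => (q.1, t * (q.2 - v₀) + v₀)
  have hγ : ContDiff ℝ ∞ fun q : ((Fin 2 → ℝ) × ℝ) × ℝ => γ q.1 q.2 := by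
    refine (contDiff_fst.comp contDiff_fst).prodMk ?_
    exact (contDiff_snd.mul ((contDiff_snd.comp contDiff_fst).sub contDiff_const)).add
      contDiff_const
  have hγI : ∀ p ∈ U ×ˢ I, ∀ t ∈ Set.Icc (0 : ℝ) 1, γ p t ∈ U ×ˢ I := by
    intro p hp t ht
    refine ⟨hp.1, hI'.convex.segment_subset hv₀ hp.2 ⟨1 - t, t, by linarith [ht.2], ht.1, by ring, ?_⟩⟩
    simp only [smul_eq_mul]; ring
  have hint := contDiffOn_integral_curve (hU.prod hI) hf hγ hγI
  set s : (Fin 2 → ℝ) × ℝ → F := fun q => Real.exp (-c * (q.2 - v₀)) •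
    (s₀ q.1 + (q.2 - v₀) • ∫ t in (0 : ℝ)..1, f (γ q t))
  refine ⟨s, ?_, fun x _ => by simp [s], ?_⟩
  · refine (hexp (-c)).contDiffOn.smul ((hs₀.comp contDiffOn_fst fun q hq => hq.1).add ?_)
    exact (contDiff_snd.sub contDiff_const).contDiffOn.smul hint
  · intro x hx v hv
    have hs : ∀ w, s (x, w) = Real.exp (-c * (w - v₀)) • (s₀ x + ∫ t in v₀..w, f (x, t)) := by
      intro w
      have := intervalIntegral.smul_integral_comp_mul_add (a := 0) (b := 1)
        (fun t => f (x, t)) (w - v₀) v₀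
      rw [mul_zero, mul_one, zero_add, sub_add_cancel] at this
      simp only [s, γ, ← this]
      simp only [mul_comm]
    have h1 := hasDerivAt_primitive hI (g := fun t => f (x, t))
      (hf.continuousOn.comp (Continuous.prodMk_right x).continuousOn fun w hw => ⟨hx, hw⟩)
      (hI'.uIcc_subset hv₀ hv)
    have h2 : HasDerivAt (fun w : ℝ => Real.exp (-c * (w - v₀)))
        (Real.exp (-c * (v - v₀)) * -c) v := by
      have : HasDerivAt (fun w : ℝ => -c * (w - v₀)) (-c) v := by
        simpa using ((hasDerivAt_id v).sub_const v₀).const_mul (-c)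
      exact this.exp
    have h3 := h2.smul (h1.const_add (s₀ x))
    simp_rw [hs]
    refine h3.congr_deriv ?_
    simp only [f, smul_smul]
    rw [← Real.exp_add, show -c * (v - v₀) + c * (v - v₀) = 0 by ring, Real.exp_zero, one_smul,
      mul_comm (Real.exp _) (-c), neg_mul, neg_smul, ← sub_eq_add_neg]

/-! ### The algebra of the null frame of a coframe -/

section FrameAlgebra

variable {R : Type*} [CommRing R]

/-- The metric with the coframe `(w, b)` of the slices, the shift `h` and `g(∂_v, ∂_v) = W`. -/
def gmat (w b h : Fin 2 → R) (W : R) : Fin 4 → Fin 4 → R :=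
  ![![w 0 * b 0 + b 0 * w 0, w 0 * b 1 + b 0 * w 1, h 0, 0],
    ![w 1 * b 0 + b 1 * w 0, w 1 * b 1 + b 1 * w 1, h 1, 0],
    ![h 0, h 1, W, 1], ![0, 0, 1, 0]]

/-- The frame vector `m` with the tangential part `M`. -/
def mvec (h M : Fin 2 → R) (Z : R) : Fin 4 → R :=
  ![M 0, M 1, 0, -(h 0 * M 0 + h 1 * M 1) - Z]

/-- The frame vector `ℓ` with the tangential part `L`. -/
def lvec (h L : Fin 2 → R) (W half ZZ : R) : Fin 4 → R :=
  ![L 0, L 1, 1, -half * (W + 2 * (h 0 * L 0 + h 1 * L 1) + 2 * ZZ)]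

/-- Duality of the coframe `(w, b)` and the frame `(N, M)`. -/
structure IsDual (w b M N : Fin 2 → R) : Prop where
  wM : w 0 * M 0 + w 1 * M 1 = 0
  wN : w 0 * N 0 + w 1 * N 1 = 1
  bM : b 0 * M 0 + b 1 * M 1 = 1
  bN : b 0 * N 0 + b 1 * N 1 = 0
  c00 : M 0 * b 0 + N 0 * w 0 = 1
  c01 : M 0 * b 1 + N 0 * w 1 = 0
  c10 : M 1 * b 0 + N 1 * w 0 = 0
  c11 : M 1 * b 1 + N 1 * w 1 = 1

namespace IsDual

variable {w b M N : Fin 2 → R} (hd : IsDual w b M N) (h : Fin 2 → R) (W Z Zb half : R)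

include hd in
theorem symm : IsDual b w N M where
  wM := hd.bN
  wN := hd.bM
  bM := hd.wN
  bN := hd.wM
  c00 := by linear_combination hd.c00
  c01 := by linear_combination hd.c01
  c10 := by linear_combination hd.c10
  c11 := by linear_combination hd.c11

include hd in
theorem con_mm : con (gmat w b h W) (mvec h M Z) (mvec h M Z) = 0 := by
  simp only [con, gmat, mvec, Fin.sum_univ_four, Matrix.cons_val]
  linear_combination 2 * (b 0 * M 0 + b 1 * M 1) * hd.wM

include hd in
theorem con_mn : con (gmat w b h W) (mvec h M Z) (mvec h N Zb) = 1 := by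
  simp only [con, gmat, mvec, Fin.sum_univ_four, Matrix.cons_val]
  linear_combination (b 0 * N 0 + b 1 * N 1) * hd.wM + (b 0 * M 0 + b 1 * M 1) * hd.wN + hd.bM

include hd in
theorem con_ml (ZZ : R) : con (gmat w b h W) (mvec h M Z)
    (lvec h (fun A => Zb * M A + Z * N A) W half ZZ) = 0 := by
  simp only [con, gmat, mvec, lvec, Fin.sum_univ_four, Matrix.cons_val]
  linear_combination (2 * Zb * (b 0 * M 0 + b 1 * M 1) + Z * (b 0 * N 0 + b 1 * N 1)) * hd.wM
    + Z * (b 0 * M 0 + b 1 * M 1) * hd.wN + Z * hd.bM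

include hd in
theorem con_ll (th : 2 * half = 1) : con (gmat w b h W)
    (lvec h (fun A => Zb * M A + Z * N A) W half (Z * Zb))
    (lvec h (fun A => Zb * M A + Z * N A) W half (Z * Zb)) = 0 := by
  simp only [con, gmat, lvec, Fin.sum_univ_four, Matrix.cons_val]
  linear_combination (2 * Zb * (Zb * (b 0 * M 0 + b 1 * M 1) + Z * (b 0 * N 0 + b 1 * N 1))) * hd.wM
    + 2 * Z * (Zb * (b 0 * M 0 + b 1 * M 1) + Z * (b 0 * N 0 + b 1 * N 1)) * hd.wN
    + 2 * Z * Zb * hd.bM + 2 * Z * Z * hd.bN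
    - (W + 2 * (h 0 * (Zb * M 0 + Z * N 0) + h 1 * (Zb * M 1 + Z * N 1)) + 2 * (Z * Zb)) * th

variable (d : Derivation ℤ R R)

theorem d_mul (d : Derivation ℤ R R) (x y : R) : d (x * y) = x * d y + y * d x := d.leibniz x y

include hd in
-- Differentiate `b(M) = 1` and `w(M) = 0` and solve with the completeness relations. It expresses
-- the derivative of the dual frame by that of the coframe.
theorem parallel_tangent (A : Fin 2) : d (M A) = -(M A * (d (b 0) * M 0 + d (b 1) * M 1)
    + N A * (d (w 0) * M 0 + d (w 1) * M 1)) := by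
  have e1 := congrArg d hd.bM
  have e2 := congrArg d hd.wM
  simp only [map_add, d_mul, map_zero, Derivation.map_one_eq_zero] at e1 e2
  fin_cases A
  · simp only [Fin.zero_eta]
    linear_combination M 0 * e1 + N 0 * e2 - d (M 0) * hd.c00 - d (M 1) * hd.c01
  · simp only [Fin.mk_one]
    linear_combination M 1 * e1 + N 1 * e2 - d (M 0) * hd.c10 - d (M 1) * hd.c11

/-- The radial derivative of the metric of the slices. -/
def dq (d : Derivation ℤ R R) (w b u v : Fin 2 → R) : R :=
  (d (w 0) * u 0 + d (w 1) * u 1) * (b 0 * v 0 + b 1 * v 1)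
    + (w 0 * u 0 + w 1 * u 1) * (d (b 0) * v 0 + d (b 1) * v 1)
    + (d (b 0) * u 0 + d (b 1) * u 1) * (w 0 * v 0 + w 1 * v 1)
    + (b 0 * u 0 + b 1 * u 1) * (d (w 0) * v 0 + d (w 1) * v 1)

theorem con_dg (u v : Fin 4 → R) : con (fun i j => d (gmat w b h W i j)) u v
    = dq d w b ![u 0, u 1] ![v 0, v 1] + (d (h 0) * u 0 + d (h 1) * u 1) * v 2
      + u 2 * (d (h 0) * v 0 + d (h 1) * v 1) + d W * u 2 * v 2 := by
  simp only [con, gmat, dq, Fin.sum_univ_four, Matrix.cons_val, map_add, d_mul, map_zero,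
    Derivation.map_one_eq_zero]
  ring

/-- The gauge condition that fixes the phase of `m` along `∂ᵣ`. -/
def Gauge (d : Derivation ℤ R R) (w b M N : Fin 2 → R) : Prop :=
  d (b 0) * M 0 + d (b 1) * M 1 = d (w 0) * N 0 + d (w 1) * N 1

include hd in
-- With the inverse metric expanded in the frame, `-Γ^a_{3b} m^b` is a combination of contractions
-- of `∂_r g`. The gauge condition makes the tangential part agree with `parallel_tangent`, and the
-- `3`-component is the equation for `Z`. The parameter `ZZ` is free here: it only enters `ℓ³`,
-- which meets `∂_r g_{3b} = 0`.
theorem parallel_m (th : 2 * half = 1) (hg : Gauge d w b M N)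
    (dZ : d Z = -half * (d (h 0) * M 0 + d (h 1) * M 1)) (ZZ : R) (a : Fin 4) :
    d (mvec h M Z a) = -half * (mvec h M Z a *
        con (fun i j => d (gmat w b h W i j)) (mvec h N Zb) (mvec h M Z)
      + mvec h N Zb a * con (fun i j => d (gmat w b h W i j)) (mvec h M Z) (mvec h M Z)
      + if a = 3 then con (fun i j => d (gmat w b h W i j))
        (lvec h (fun A => Zb * M A + Z * N A) W half ZZ) (mvec h M Z) else 0) := by
  have e0 := hd.parallel_tangent d 0
  have e1 := hd.parallel_tangent d 1
  obtain ⟨wM, wN, bM, bN, -, -, -, -⟩ := hd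
  rw [con_dg, con_dg, con_dg]
  simp only [Gauge] at hg
  set α := d (w 0) * N 0 + d (w 1) * N 1 with hα
  set β := d (w 0) * M 0 + d (w 1) * M 1 with hβ
  rw [hg] at e0 e1
  have hα' : dq d w b ![N 0, N 1] ![M 0, M 1] = 2 * α := by
    simp only [dq, Matrix.cons_val_zero, Matrix.cons_val_one, wM, wN, bM, bN]
    linear_combination hg
  have hβ' : dq d w b ![M 0, M 1] ![M 0, M 1] = 2 * β := by
    simp only [dq, Matrix.cons_val_zero, Matrix.cons_val_one, wM, bM]
    linear_combination 2 * hβ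
  have hl : dq d w b ![Zb * M 0 + Z * N 0, Zb * M 1 + Z * N 1] ![M 0, M 1]
      = 2 * Zb * β + 2 * Z * α := by
    have : dq d w b ![Zb * M 0 + Z * N 0, Zb * M 1 + Z * N 1] ![M 0, M 1]
        = Zb * dq d w b ![M 0, M 1] ![M 0, M 1] + Z * dq d w b ![N 0, N 1] ![M 0, M 1] := by
      simp only [dq, Matrix.cons_val_zero, Matrix.cons_val_one]
      ring
    rw [this, hα', hβ']; ring
  simp only [mvec, lvec, Matrix.cons_val, hα', hβ', hl]
  fin_cases a
  · simp only [Fin.zero_eta, Matrix.cons_val, Fin.isValue, Fin.reduceEq, if_false]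
    linear_combination e0 + (M 0 * α + N 0 * β) * th
  · simp only [Fin.mk_one, Matrix.cons_val, Fin.isValue, Fin.reduceEq, if_false]
    linear_combination e1 + (M 1 * α + N 1 * β) * th
  · simp
  · simp only [Fin.reduceFinMk, Matrix.cons_val, Fin.isValue, if_true, map_sub, map_neg, map_add,
      d_mul]
    rw [dZ, e0, e1]
    linear_combination (d (h 0) * M 0 + d (h 1) * M 1) * th
      - (h 0 * (M 0 * α + N 0 * β) + h 1 * (M 1 * α + N 1 * β)) * th

include hd in
-- The tangential part `Zb M + Z N` is forced by orthogonality to `m` and `m̄`, and the term `Z Zb`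
-- in `ℓ³` by nullity. The same equation for `Z` and its conjugate then gives the transport of all
-- components.
theorem parallel_l (th : 2 * half = 1) (dh : d half = 0) (hg : Gauge d w b M N)
    (dZ : d Z = -half * (d (h 0) * M 0 + d (h 1) * M 1))
    (dZb : d Zb = -half * (d (h 0) * N 0 + d (h 1) * N 1)) (a : Fin 4) :
    d (lvec h (fun A => Zb * M A + Z * N A) W half (Z * Zb) a) = -half * (mvec h M Z a *
        con (fun i j => d (gmat w b h W i j)) (mvec h N Zb)
          (lvec h (fun A => Zb * M A + Z * N A) W half (Z * Zb))
      + mvec h N Zb a * con (fun i j => d (gmat w b h W i j)) (mvec h M Z)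
          (lvec h (fun A => Zb * M A + Z * N A) W half (Z * Zb))
      + if a = 3 then con (fun i j => d (gmat w b h W i j))
        (lvec h (fun A => Zb * M A + Z * N A) W half (Z * Zb))
        (lvec h (fun A => Zb * M A + Z * N A) W half (Z * Zb)) else 0) := by
  have e0 := hd.parallel_tangent d 0
  have e1 := hd.parallel_tangent d 1
  have f0 := hd.symm.parallel_tangent d 0
  have f1 := hd.symm.parallel_tangent d 1
  obtain ⟨wM, wN, bM, bN, -, -, -, -⟩ := hd
  rw [con_dg, con_dg, con_dg]
  simp only [Gauge] at hg
  rw [hg] at e0 e1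
  set α := d (w 0) * N 0 + d (w 1) * N 1 with hα
  set β := d (w 0) * M 0 + d (w 1) * M 1 with hβ
  set γ := d (b 0) * N 0 + d (b 1) * N 1 with hγ
  set η := d (h 0) * M 0 + d (h 1) * M 1 with hη
  set ζ := d (h 0) * N 0 + d (h 1) * N 1 with hζ
  have h1 : dq d w b ![N 0, N 1] ![Zb * M 0 + Z * N 0, Zb * M 1 + Z * N 1]
      = 2 * Zb * α + 2 * Z * γ := by
    simp only [dq, Matrix.cons_val_zero, Matrix.cons_val_one]
    linear_combination α * Zb * bM + α * Z * bN + (Zb * hg + Z * hγ) + (hγ * 0)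
      + (Zb * (d (b 0) * M 0 + d (b 1) * M 1) + Z * γ) * wN + γ * Zb * wM + γ * Z * wN
      + (Zb * β + Z * α) * bN
  have h2 : dq d w b ![M 0, M 1] ![Zb * M 0 + Z * N 0, Zb * M 1 + Z * N 1]
      = 2 * Zb * β + 2 * Z * α := by
    simp only [dq, Matrix.cons_val_zero, Matrix.cons_val_one]
    linear_combination β * Zb * bM + β * Z * bN
      + (Zb * (d (b 0) * M 0 + d (b 1) * M 1) + Z * γ) * wM
      + (d (b 0) * M 0 + d (b 1) * M 1) * (Zb * wM + Z * wN) + Z * hg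
      + (Zb * β + Z * α) * bM
  have h3 : dq d w b ![Zb * M 0 + Z * N 0, Zb * M 1 + Z * N 1]
      ![Zb * M 0 + Z * N 0, Zb * M 1 + Z * N 1]
      = Zb * (2 * Zb * β + 2 * Z * α) + Z * (2 * Zb * α + 2 * Z * γ) := by
    rw [← h1, ← h2]
    simp only [dq, Matrix.cons_val_zero, Matrix.cons_val_one]
    ring
  simp only [mvec, lvec, Matrix.cons_val, h1, h2, h3]
  have g0 : d (Zb * M 0 + Z * N 0) = -half * (M 0 * (2 * Zb * α + 2 * Z * γ + ζ)
      + N 0 * (2 * Zb * β + 2 * Z * α + η)) := by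
    rw [map_add, d_mul, d_mul, e0, f0, dZ, dZb]
    linear_combination (Zb * (M 0 * α + N 0 * β) + Z * (N 0 * α + M 0 * γ)) * th
  have g1 : d (Zb * M 1 + Z * N 1) = -half * (M 1 * (2 * Zb * α + 2 * Z * γ + ζ)
      + N 1 * (2 * Zb * β + 2 * Z * α + η)) := by
    rw [map_add, d_mul, d_mul, e1, f1, dZ, dZb]
    linear_combination (Zb * (M 1 * α + N 1 * β) + Z * (N 1 * α + M 1 * γ)) * th
  fin_cases a
  · simp only [Fin.zero_eta, Matrix.cons_val, Fin.isValue, Fin.reduceEq, if_false]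
    rw [g0]; ring
  · simp only [Fin.mk_one, Matrix.cons_val, Fin.isValue, Fin.reduceEq, if_false]
    rw [g1]; ring
  · simp
  · have d2 : d (2 : R) = 0 := by
      rw [← Nat.cast_ofNat, Derivation.map_natCast]
    obtain ⟨L0, hL0⟩ : ∃ x, x = Zb * M 0 + Z * N 0 := ⟨_, rfl⟩
    obtain ⟨L1, hL1⟩ : ∃ x, x = Zb * M 1 + Z * N 1 := ⟨_, rfl⟩
    rw [← hL0] at g0
    rw [← hL1] at g1
    rw [← hL0, ← hL1]
    simp only [Fin.reduceFinMk, Matrix.cons_val, Fin.isValue, if_true, map_neg, map_add,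
      d_mul, neg_mul, dh, d2]
    rw [g0, g1, dZ, dZb]
    linear_combination half * ((h 0 * M 0 + h 1 * M 1 + Z) * (2 * Zb * α + 2 * Z * γ + ζ)
      + (h 0 * N 0 + h 1 * N 1 + Zb) * (2 * Zb * β + 2 * Z * α + η)
      - Z * (2 * Zb * α + 2 * Z * γ) - Zb * (2 * Zb * β + 2 * Z * α)) * th

end IsDual

end FrameAlgebra

/-! ### Signature and radial connection in terms of a null frame. -/

/-- A symmetric bilinear form with a null frame is Lorentzian. -/
theorem isLorentz_of_frame {B : Matrix (Fin 4) (Fin 4) ℝ} (hs : ∀ a b, B a b = B b a)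
    {m : Fin 4 → ℂ} {n l : Fin 4 → ℝ} (mm : bil B m m = 0)
    (mmb : bil B m (fun i => conj (m i)) = 1)
    (mn : bil B m (fun i => (n i : ℂ)) = 0) (ml : bil B m (fun i => (l i : ℂ)) = 0)
    (ll : bil B (fun i => (l i : ℂ)) (fun i => (l i : ℂ)) = 0)
    (nl : bil B (fun i => (n i : ℂ)) (fun i => (l i : ℂ)) = -1)
    (nn : bil B (fun i => (n i : ℂ)) (fun i => (n i : ℂ)) = 0) : IsLorentz B := by
  refine ⟨Matrix.IsSymm.ext fun i j => hs j i, ?_⟩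
  set β := Matrix.toBilin' B with hβ
  set x : Fin 4 → ℝ := fun i => (m i).re with hx
  set y : Fin 4 → ℝ := fun i => (m i).im with hy
  have hsymm : ∀ u w, β u w = β w u := by
    intro u w
    rw [hβ, Matrix.toBilin'_apply, Matrix.toBilin'_apply, Finset.sum_comm]
    refine Finset.sum_congr rfl fun i _ => Finset.sum_congr rfl fun j _ => ?_
    rw [hs j i]; ring
  have key : ∀ u w u' w' : Fin 4 → ℝ,
      bil B (fun i => (u i : ℂ) + Complex.I * u' i) (fun i => (w i : ℂ) + Complex.I * w' i)
        = ((β u w - β u' w' : ℝ) : ℂ) + Complex.I * ((β u w' + β u' w : ℝ) : ℂ) := by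
    intro u w u' w'
    rw [hβ]
    simp only [Matrix.toBilin'_apply, bil]
    push_cast
    rw [← Finset.sum_sub_distrib, ← Finset.sum_add_distrib, Finset.mul_sum,
      ← Finset.sum_add_distrib]
    refine Finset.sum_congr rfl fun i _ => ?_
    rw [← Finset.sum_sub_distrib, ← Finset.sum_add_distrib, Finset.mul_sum,
      ← Finset.sum_add_distrib]
    refine Finset.sum_congr rfl fun j _ => ?_
    linear_combination (B i j : ℂ) * u' i * w' j * Complex.I_sq
  have hm : m = fun i => (x i : ℂ) + Complex.I * y i := by
    ext i; rw [mul_comm]; exact (Complex.re_add_im (m i)).symm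
  have hmb : (fun i => conj (m i)) = fun i => (x i : ℂ) + Complex.I * ((-y) i : ℝ) := by
    ext i
    apply Complex.ext <;> simp [hx, hy]
  have hr : ∀ u : Fin 4 → ℝ, (fun i => (u i : ℂ)) = fun i => (u i : ℂ) + Complex.I * ((0 : Fin 4 → ℝ) i : ℝ) := by
    intro u; ext i; simp
  rw [hmb] at mmb
  rw [hm] at mm mmb mn ml
  rw [hr] at mn ml ll nl nn
  rw [hr l] at nl
  rw [key] at mm mmb mn ml ll nl nn
  have re := fun {a b : ℝ} {z : ℂ} (h : (a : ℂ) + Complex.I * (b : ℂ) = z) => congrArg Complex.re h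
  have im := fun {a b : ℝ} {z : ℂ} (h : (a : ℂ) + Complex.I * (b : ℂ) = z) => congrArg Complex.im h
  have r1 := re mm; have i1 := im mm; have r2 := re mmb
  have r3 := re mn; have i3 := im mn; have r4 := re ml; have i4 := im ml
  have r5 := re ll; have r6 := re nl; have r7 := re nn
  simp at r1 i1 r2 r3 i3 r4 i4 r5 r6 r7
  have xy : β x y = 0 := by linarith [hsymm x y]
  have yx : β y x = 0 := by rw [hsymm, xy]
  have nx : β n x = 0 := by rw [hsymm, r3]
  have ny : β n y = 0 := by rw [hsymm, i3]
  have lx : β l x = 0 := by rw [hsymm, r4]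
  have ly : β l y = 0 := by rw [hsymm, i4]
  have ln : β l n = -1 := by rw [hsymm, r6]
  have xx : β x x = 1 / 2 := by linarith
  have yy : β y y = 1 / 2 := by linarith
  have s2 : √2 * √2 = (2 : ℝ) := Real.mul_self_sqrt (by norm_num)
  -- An orthonormal basis: `½ ℓ + n` is timelike because `g(n, ℓ) = -1`, and the factor `√2`
  -- compensates `g(Re m, Re m) = g(Im m, Im m) = ½`.
  set c : Fin 4 → Fin 4 → ℝ := ![(1 / 2 : ℝ) • l + n, (1 / 2 : ℝ) • l - n, √2 • x, √2 • y] with hc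
  set P : Matrix (Fin 4) (Fin 4) ℝ := Matrix.of fun i α => c α i with hP
  have e : P.transpose * B * P = Matrix.diagonal ![-1, 1, 1, 1] := by
    have h : ∀ α γ, (P.transpose * B * P) α γ = β (c α) (c γ) := by
      intro α γ
      simp only [Matrix.mul_apply, Matrix.transpose_apply, hβ, Matrix.toBilin'_apply,
        Finset.sum_mul, hP, Matrix.of_apply]
      rw [Finset.sum_comm]
    ext α γ
    rw [h]
    have s3 : √2 * (√2 * (1 / 2)) = (1 : ℝ) := by rw [← mul_assoc, s2]; norm_num
    fin_cases α <;> fin_cases γ <;>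
      simp [hc, xy, yx, nx, ny, lx, ly, ln, r3, i3, r4, i4, r5, r6, r7]
    · norm_num
    · norm_num
    · rw [xx]; exact s3
    · rw [yy]; exact s3
  refine ⟨P, ?_, e⟩
  have := congrArg Matrix.det e
  rw [Matrix.det_mul, Matrix.det_mul, Matrix.det_transpose, Matrix.det_diagonal] at this
  rw [isUnit_iff_ne_zero]
  intro h0
  rw [h0] at this
  simp [Fin.prod_univ_four] at this

theorem chr_3 {g : Field2} (hs : ∀ p a b, g p a b = g p b a)
    (h3 : ∀ p i, g p 3 i = if i = 2 then 1 else 0) (a b : Fin 4) (p : Pt) :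
    chr g a 3 b p = (1 / 2) * ∑ d, (g p)⁻¹ a d * pd 3 (fun q => g q d b) p := by
  have h1 : ∀ i d, pd i (fun q => g q d 3) p = 0 := by
    intro i d
    simp only [hs _ d 3, h3]
    simp [pd]
  have h2 : ∀ d b, pd d (fun q => g q 3 b) p = 0 := by
    intro d b
    simp only [h3]
    simp [pd]
  simp only [chr, h1, h2, add_zero, sub_zero]

theorem sum_chr_3 {g : Field2} (hs : ∀ p a b, g p a b = g p b a)
    (h3 : ∀ p i, g p 3 i = if i = 2 then 1 else 0) {p : Pt} {m n l : Fin 4 → ℂ}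
    (hgi : ∀ a b, (((g p)⁻¹ a b : ℝ) : ℂ) = m a * n b + n a * m b
      + ((if a = 3 then l b else 0) + if b = 3 then l a else 0)) (u : Fin 4 → ℂ) (a : Fin 4) :
    ∑ b, (chr g a 3 b p : ℂ) * u b
      = 1 / 2 * (m a * con (fun i j => ((pd 3 (fun q => g q i j) p : ℝ) : ℂ)) n u
        + n a * con (fun i j => ((pd 3 (fun q => g q i j) p : ℝ) : ℂ)) m u
        + if a = 3 then con (fun i j => ((pd 3 (fun q => g q i j) p : ℝ) : ℂ)) l u else 0) := by
  have h2 : ∀ b, pd 3 (fun q => g q 3 b) p = 0 := by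
    intro b
    simp only [h3]
    simp [pd]
  simp only [chr_3 hs h3]
  push_cast
  simp only [hgi, con, Fin.sum_univ_four, h2]
  by_cases ha : a = 3
  · simp [ha]; ring
  · simp [ha]; ring

theorem ofReal_two_re (z : ℂ) : ((2 * z.re : ℝ) : ℂ) = z + conj z := by
  rw [Complex.add_conj]

/-! ### Configurations and their explicit parallel frame. -/

/-- The coordinate cylinder over the horizon patch. -/
def cyl (U : Set (Fin 2 → ℝ)) (I : Set ℝ) : Set Pt := {p | ![p 0, p 1] ∈ U ∧ p 2 ∈ I}

theorem cyl_isOpen {U : Set (Fin 2 → ℝ)} {I : Set ℝ} (hU : IsOpen U) (hI : IsOpen I) :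
    IsOpen (cyl U I) := by
  have h1 : Continuous fun p : Pt => (![p 0, p 1] : Fin 2 → ℝ) := by
    refine continuous_pi fun i => ?_
    fin_cases i
    · exact continuous_apply (0 : Fin 4)
    · exact continuous_apply (1 : Fin 4)
  exact (hU.preimage h1).inter (hI.preimage (continuous_apply (2 : Fin 4)))

theorem hpt_mem_cyl {U : Set (Fin 2 → ℝ)} {I : Set ℝ} {x : Fin 2 → ℝ} (hx : x ∈ U) {v : ℝ}
    (hv : v ∈ I) : hpt x v ∈ cyl U I := by
  have : (![x 0, x 1] : Fin 2 → ℝ) = x := by ext j; fin_cases j <;> rfl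
  exact ⟨by simpa [hpt, this] using hx, hv⟩

theorem rseg_mem_cyl {U : Set (Fin 2 → ℝ)} {I : Set ℝ} {p : Pt} (hp : p ∈ cyl U I) (t : ℝ) :
    rseg p t ∈ cyl U I := hp

theorem rseg_one (p : Pt) : rseg p 1 = p := by
  ext i; fin_cases i <;> simp [rseg]

theorem rseg_rseg (p : Pt) (t s : ℝ) : rseg (rseg p t) s = rseg p (s * t) := by
  ext i; fin_cases i <;> simp [rseg, mul_assoc]

theorem rseg_hpt (x : Fin 2 → ℝ) (v t : ℝ) : rseg (hpt x v) t = hpt x v := by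
  ext i; fin_cases i <;> simp [rseg, hpt]

/-- A metric in Bondi-like coordinates, given by a complex coframe `w` of the surfaces of constant
`v` and `r`, the shift `h` and the component `W = g(∂_v, ∂_v)`. -/
structure Config where
  w : Fin 2 → Pt → ℂ
  h : Fin 2 → Pt → ℝ
  W : Pt → ℝ

namespace Config

variable (C : Config)

/-- The coordinate components of the metric. -/
noncomputable def g : Field2 := fun p => Matrix.of
  ![![2 * (C.w 0 p * conj (C.w 0 p)).re, 2 * (C.w 0 p * conj (C.w 1 p)).re, C.h 0 p, 0],
    ![2 * (C.w 1 p * conj (C.w 0 p)).re, 2 * (C.w 1 p * conj (C.w 1 p)).re, C.h 1 p, 0],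
    ![C.h 0 p, C.h 1 p, C.W p, 1], ![0, 0, 1, 0]]

theorem g_cast (p : Pt) (i j : Fin 4) : (C.g p i j : ℂ) = gmat (fun A => C.w A p)
    (fun A => conj (C.w A p)) (fun A => (C.h A p : ℂ)) (C.W p) i j := by
  have e : ∀ a b : ℂ, ((2 * (a * conj b).re : ℝ) : ℂ) = a * conj b + conj a * b := by
    intro a b
    rw [ofReal_two_re, map_mul, Complex.conj_conj]
  fin_cases i <;> fin_cases j <;>
    first
    | exact e _ _
    | rfl

theorem g_symm (p : Pt) (i j : Fin 4) : C.g p i j = C.g p j i := by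
  have : (C.g p i j : ℂ) = C.g p j i := by
    rw [g_cast, g_cast]
    fin_cases i <;> fin_cases j <;> simp [gmat] <;> ring
  exact_mod_cast this

theorem g_3 (p : Pt) (i : Fin 4) : C.g p 3 i = if i = 2 then 1 else 0 := by
  fin_cases i <;> simp [g]

/-- The determinant of the coframe. -/
noncomputable def del (p : Pt) : ℂ := C.w 0 p * conj (C.w 1 p) - conj (C.w 0 p) * C.w 1 p

/-- The frame dual to the coframe. -/
noncomputable def mh (A : Fin 2) (p : Pt) : ℂ := ![-C.w 1 p / C.del p, C.w 0 p / C.del p] A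

/-- The rate of rotation of the frame `mh` along `∂ᵣ`. -/
noncomputable def psi (p : Pt) : ℝ :=
  (conj (pd 3 (C.w 0) p) * C.mh 0 p + conj (pd 3 (C.w 1) p) * C.mh 1 p).im

/-- The phase of the parallel frame. -/
noncomputable def phase (p : Pt) : ℂ := Complex.exp (Complex.I * (rad C.psi p : ℝ))

/-- The parallel coframe of the surfaces. -/
noncomputable def pw (A : Fin 2) (p : Pt) : ℂ := C.phase p * C.w A p

/-- The tangential part of `m`. -/
noncomputable def mt (A : Fin 2) (p : Pt) : ℂ := C.phase p * C.mh A p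

/-- The tangential part of `ℓ` is `conj z • m + z • conj m`. -/
noncomputable def z (p : Pt) : ℂ :=
  -(1 / 2) * rad (fun q => pd 3 (C.h 0) q * C.mt 0 q + pd 3 (C.h 1) q * C.mt 1 q) p

/-- The tangential part of `ℓ`. -/
noncomputable def lt (A : Fin 2) (p : Pt) : ℝ := 2 * (conj (C.z p) * C.mt A p).re

noncomputable def m (p : Pt) : Fin 4 → ℂ :=
  mvec (fun A => (C.h A p : ℂ)) (fun A => C.mt A p) (C.z p)

noncomputable def l (p : Pt) : Fin 4 → ℝ :=
  lvec (fun A => C.h A p) (fun A => C.lt A p) (C.W p) (1 / 2) (Complex.normSq (C.z p))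

/-- The domain of the metric and its frame. -/
def dom (U : Set (Fin 2 → ℝ)) (I : Set ℝ) : Set Pt :=
  {p | ∀ t ∈ Set.Icc (0 : ℝ) 1, rseg p t ∈ cyl U I ∧ C.del (rseg p t) ≠ 0}

/-- The neighbourhood of the horizon. -/
noncomputable def nbhd (U : Set (Fin 2 → ℝ)) (I : Set ℝ) (G Lam : ℝ) : Nbhd where
  dom := C.dom U I
  g := C.g
  T := fun p => (8 * Real.pi * G)⁻¹ • (ric C.g p - (scal C.g p / 2) • C.g p + Lam • C.g p)
  m := C.m
  l := C.l

/-- The conditions on a configuration over the horizon: the frame at the horizon is `m₀`,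
and `η` is the radial derivative of the shift. -/
structure Good (U : Set (Fin 2 → ℝ)) (I : Set ℝ) (kappa : ℝ) (m₀ : (Fin 2 → ℝ) → Fin 2 → ℂ)
    (η : (Fin 2 → ℝ) → Fin 2 → ℝ) :
    Prop where
  smooth_w : ∀ A, ContDiffOn ℝ ∞ (C.w A) (cyl U I)
  smooth_h : ∀ A, ContDiffOn ℝ ∞ (C.h A) (cyl U I)
  smooth_W : ContDiffOn ℝ ∞ C.W (cyl U I)
  w_m : ∀ x ∈ U, ∀ v ∈ I, C.w 0 (hpt x v) * m₀ x 0 + C.w 1 (hpt x v) * m₀ x 1 = 0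
  w_mb : ∀ x ∈ U, ∀ v ∈ I,
    C.w 0 (hpt x v) * conj (m₀ x 0) + C.w 1 (hpt x v) * conj (m₀ x 1) = 1
  h_hor : ∀ A, ∀ x ∈ U, ∀ v ∈ I, C.h A (hpt x v) = 0
  h_grad : ∀ A, ∀ x ∈ U, ∀ v ∈ I, pd 3 (C.h A) (hpt x v) = η x A
  W_hor : ∀ x ∈ U, ∀ v ∈ I, C.W (hpt x v) = 0
  W_grav : ∀ x ∈ U, ∀ v ∈ I, pd 3 C.W (hpt x v) = -2 * kappa

theorem conj_del (p : Pt) : conj (C.del p) = -C.del p := by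
  simp only [del, map_sub, map_mul, Complex.conj_conj]; ring

theorem phase_mul_conj (p : Pt) : C.phase p * conj (C.phase p) = 1 := by
  rw [phase, ← Complex.exp_conj, ← Complex.exp_add]
  simp

theorem isDual_mh {p : Pt} (h : C.del p ≠ 0) : IsDual (fun A => C.w A p) (fun A => conj (C.w A p))
    (fun A => C.mh A p) (fun A => conj (C.mh A p)) := by
  have h0 : C.mh 0 p = -C.w 1 p / C.del p := rfl
  have h1 : C.mh 1 p = C.w 0 p / C.del p := rfl
  have c0 : conj (C.mh 0 p) = conj (C.w 1 p) / C.del p := by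
    rw [h0, map_div₀, map_neg, conj_del, neg_div_neg_eq]
  have c1 : conj (C.mh 1 p) = -conj (C.w 0 p) / C.del p := by
    rw [h1, map_div₀, conj_del, div_neg, neg_div]
  have hd : C.w 0 p * conj (C.w 1 p) - conj (C.w 0 p) * C.w 1 p = C.del p := rfl
  constructor <;> (try simp only [c0, c1]) <;> (try simp only [h0, h1]) <;> field_simp <;>
    first | ring1 | (rw [← hd]; ring1)

theorem isDual {p : Pt} (h : C.del p ≠ 0) : IsDual (fun A => C.pw A p) (fun A => conj (C.pw A p))
    (fun A => C.mt A p) (fun A => conj (C.mt A p)) := by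
  obtain ⟨wM, wN, bM, bN, c00, c01, c10, c11⟩ := C.isDual_mh h
  have e := C.phase_mul_conj p
  constructor <;> simp only [pw, mt, map_mul]
  · linear_combination C.phase p * C.phase p * wM
  · linear_combination C.phase p * conj (C.phase p) * wN + e
  · linear_combination C.phase p * conj (C.phase p) * bM + e
  · linear_combination conj (C.phase p) * conj (C.phase p) * bN
  · linear_combination C.phase p * conj (C.phase p) * c00 + e
  · linear_combination C.phase p * conj (C.phase p) * c01
  · linear_combination C.phase p * conj (C.phase p) * c10
  · linear_combination C.phase p * conj (C.phase p) * c11 + e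

theorem gmat_pw (p : Pt) (h : Fin 2 → ℂ) (W : ℂ) :
    gmat (fun A => C.w A p) (fun A => conj (C.w A p)) h W
      = gmat (fun A => C.pw A p) (fun A => conj (C.pw A p)) h W := by
  have e : ∀ a b, C.phase p * a * (conj (C.phase p) * b) = a * b := by
    intro a b
    linear_combination a * b * C.phase_mul_conj p
  have e' : ∀ a b, conj (C.phase p) * a * (C.phase p * b) = a * b := by
    intro a b
    linear_combination a * b * C.phase_mul_conj p
  simp only [gmat, pw, map_mul, e, e']

theorem g_cast' (p : Pt) (i j : Fin 4) : (C.g p i j : ℂ) = gmat (fun A => C.pw A p)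
    (fun A => conj (C.pw A p)) (fun A => (C.h A p : ℂ)) (C.W p) i j := by
  rw [g_cast, gmat_pw]

theorem bil_g (p : Pt) (u v : Fin 4 → ℂ) : bil (C.g p) u v = con (gmat (fun A => C.pw A p)
    (fun A => conj (C.pw A p)) (fun A => (C.h A p : ℂ)) (C.W p)) u v := by
  simp only [bil, con, g_cast']

theorem conj_m (p : Pt) : (fun i => conj (C.m p i)) =
    mvec (fun A => (C.h A p : ℂ)) (fun A => conj (C.mt A p)) (conj (C.z p)) := by
  ext i
  fin_cases i <;> simp [m, mvec]

theorem l_cast (p : Pt) : (fun i => (C.l p i : ℂ)) = lvec (fun A => (C.h A p : ℂ))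
    (fun A => conj (C.z p) * C.mt A p + C.z p * conj (C.mt A p)) (C.W p) (1 / 2)
      (C.z p * conj (C.z p)) := by
  have e : ∀ A, (C.lt A p : ℂ) = conj (C.z p) * C.mt A p + C.z p * conj (C.mt A p) := by
    intro A
    rw [lt, ofReal_two_re, map_mul, Complex.conj_conj]
  ext i
  fin_cases i <;> simp [l, lvec, e, Complex.mul_conj]

section Products

variable {p : Pt} (hp : C.del p ≠ 0)

include hp in
theorem mm : bil (C.g p) (C.m p) (C.m p) = 0 := by
  rw [bil_g]
  exact (C.isDual hp).con_mm _ _ _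

include hp in
theorem mmb : bil (C.g p) (C.m p) (fun i => conj (C.m p i)) = 1 := by
  rw [bil_g, conj_m]
  exact (C.isDual hp).con_mn _ _ _ _

include hp in
theorem ml : bil (C.g p) (C.m p) (fun i => (C.l p i : ℂ)) = 0 := by
  rw [bil_g, l_cast]
  exact (C.isDual hp).con_ml _ _ _ _ _ _

include hp in
theorem ll : bil (C.g p) (fun i => (C.l p i : ℂ)) (fun i => (C.l p i : ℂ)) = 0 := by
  rw [bil_g, l_cast]
  exact (C.isDual hp).con_ll _ _ _ _ _ (by norm_num)

theorem bil_nvec (u : Fin 4 → ℂ) : bil (C.g p) (nvec p) u = -u 2 := by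
  have h : ∀ i, C.g p 3 i = if i = 2 then 1 else 0 := C.g_3 p
  simp [bil, Fin.sum_univ_four, nvec, h]

theorem mn : bil (C.g p) (C.m p) (nvec p) = 0 := by
  rw [bil_symm (C.g_symm p), bil_nvec]
  simp [m, mvec]

theorem nl : bil (C.g p) (nvec p) (fun i => (C.l p i : ℂ)) = -1 := by
  rw [bil_nvec]
  simp [l, lvec]

theorem nn : bil (C.g p) (nvec p) (nvec p) = 0 := by
  rw [bil_nvec]
  simp [nvec]

include hp in
theorem lorentz : IsLorentz (C.g p) := by
  have e : nvec p = fun i => (((Pi.single 3 (-1) : Fin 4 → ℝ) i : ℝ) : ℂ) := by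
    ext i
    by_cases h : i = 3
    · subst h; simp [nvec]
    · simp [nvec, h]
  have mn := C.mn (p := p)
  have nl := C.nl (p := p)
  have nn := C.nn (p := p)
  rw [e] at mn nl nn
  exact isLorentz_of_frame (C.g_symm p) (C.mm hp) (C.mmb hp) mn (C.ml hp) (C.ll hp) nl nn

include hp in
theorem gi_eq (a b : Fin 4) : (((C.g p)⁻¹ a b : ℝ) : ℂ) = C.m p a * conj (C.m p b)
    + conj (C.m p a) * C.m p b
    + ((if a = 3 then (C.l p b : ℂ) else 0) + if b = 3 then (C.l p a : ℂ) else 0) :=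
  inverse_of_frame (C.lorentz hp).isUnit_det (C.g_symm p) p (by ext i; simp) (C.mm hp) (C.mmb hp)
    C.mn (C.ml hp) (C.ll hp) C.nl C.nn a b

end Products

section Domain

variable {C} {U : Set (Fin 2 → ℝ)} {I : Set ℝ} {kappa : ℝ} {m₀ : (Fin 2 → ℝ) → Fin 2 → ℂ}
  {η : (Fin 2 → ℝ) → Fin 2 → ℝ}
  (hC : C.Good U I kappa m₀ η)

theorem dom_sub_cyl : C.dom U I ⊆ cyl U I := fun p hp => by
  have := (hp 1 (by simp)).1
  rwa [rseg_one] at this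

theorem del_ne {p : Pt} (hp : p ∈ C.dom U I) : C.del p ≠ 0 := by
  have := (hp 1 (by simp)).2
  rwa [rseg_one] at this

theorem rseg_mem_dom {p : Pt} (hp : p ∈ C.dom U I) {t : ℝ} (ht : t ∈ Set.Icc (0 : ℝ) 1) :
    rseg p t ∈ C.dom U I := by
  intro s hs
  rw [rseg_rseg]
  exact hp _ ⟨mul_nonneg hs.1 ht.1, mul_le_one₀ hs.2 ht.1 ht.2⟩

include hC in
theorem smooth_del : ContDiffOn ℝ ∞ C.del (cyl U I) :=
  ((hC.smooth_w 0).mul (conj_smooth (hC.smooth_w 1))).sub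
    ((conj_smooth (hC.smooth_w 0)).mul (hC.smooth_w 1))

include hC in
-- The condition is an open one on each point of a compact radial segment, so it persists for nearby
-- segments.
theorem dom_isOpen (hU : IsOpen U) (hI : IsOpen I) : IsOpen (C.dom U I) := by
  have hV : IsOpen {p | p ∈ cyl U I ∧ C.del p ≠ 0} :=
    (smooth_del hC).continuousOn.isOpen_inter_preimage (cyl_isOpen hU hI) isOpen_ne
  rw [isOpen_iff_eventually]
  intro p hp
  refine isCompact_Icc.eventually_forall_of_forall_eventually fun t ht => ?_
  have hc : Continuous fun q : Pt × ℝ => rseg q.1 q.2 := rseg_smooth.continuous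
  exact (hc.continuousAt (x := (p, t))).preimage_mem_nhds (hV.mem_nhds (hp t ht))

include hC in
theorem hpt_mem_dom {x : Fin 2 → ℝ} (hx : x ∈ U) {v : ℝ} (hv : v ∈ I) : hpt x v ∈ C.dom U I := by
  intro t _
  rw [rseg_hpt]
  refine ⟨hpt_mem_cyl hx hv, fun h => ?_⟩
  have h1 := hC.w_m x hx v hv
  have h2 := hC.w_mb x hx v hv
  have h3 := congrArg conj h1
  have h4 := congrArg conj h2
  simp only [map_add, map_mul, map_zero, map_one, Complex.conj_conj] at h3 h4
  rw [del] at h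
  -- The coframe determinant times that of `m₀` and its conjugate is a unit by the duality
  -- relations, so it cannot vanish on the horizon.
  have : (1 : ℂ) = 0 := by
    linear_combination (-(m₀ x 0 * conj (m₀ x 1) - m₀ x 1 * conj (m₀ x 0))) * h
      + (C.w 0 (hpt x v) * conj (m₀ x 0) + C.w 1 (hpt x v) * conj (m₀ x 1)) * (- h4)
      - h2 + (conj (C.w 0 (hpt x v)) * conj (m₀ x 0) + conj (C.w 1 (hpt x v)) * conj (m₀ x 1)) * h1
  exact one_ne_zero this

include hC in
theorem mh_hor (A : Fin 2) {x : Fin 2 → ℝ} (hx : x ∈ U) {v : ℝ} (hv : v ∈ I) :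
    C.mh A (hpt x v) = m₀ x A := by
  have hd := del_ne (hpt_mem_dom hC hx hv)
  have h1 := hC.w_m x hx v hv
  have h2 := congrArg conj (hC.w_mb x hx v hv)
  simp only [map_add, map_mul, map_one, Complex.conj_conj] at h2
  fin_cases A
  · simp only [mh, Fin.zero_eta, Matrix.cons_val_zero]
    rw [div_eq_iff hd, del]
    linear_combination C.w 1 (hpt x v) * h2 - conj (C.w 1 (hpt x v)) * h1
  · simp only [mh, Fin.mk_one, Matrix.cons_val_one, Matrix.cons_val_fin_one]
    rw [div_eq_iff hd, del]
    linear_combination conj (C.w 0 (hpt x v)) * h1 - C.w 0 (hpt x v) * h2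

theorem phase_hor (x : Fin 2 → ℝ) (v : ℝ) : C.phase (hpt x v) = 1 := by
  simp [phase, rad_hpt]

theorem z_hor (x : Fin 2 → ℝ) (v : ℝ) : C.z (hpt x v) = 0 := by
  simp [z, rad_hpt]

include hC in
theorem mt_hor (A : Fin 2) {x : Fin 2 → ℝ} (hx : x ∈ U) {v : ℝ} (hv : v ∈ I) :
    C.mt A (hpt x v) = m₀ x A := by
  rw [mt, phase_hor, one_mul, mh_hor hC A hx hv]

include hC in
theorem m_hor {x : Fin 2 → ℝ} (hx : x ∈ U) {v : ℝ} (hv : v ∈ I) :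
    C.m (hpt x v) = ![m₀ x 0, m₀ x 1, 0, 0] := by
  ext i
  fin_cases i <;> simp [m, mvec, mt_hor hC _ hx hv, z_hor, hC.h_hor _ x hx v hv]

include hC in
theorem l_hor {x : Fin 2 → ℝ} (hx : x ∈ U) {v : ℝ} (hv : v ∈ I) (i : Fin 4) :
    C.l (hpt x v) i = if i = 2 then 1 else 0 := by
  fin_cases i <;> simp [l, lvec, lt, z_hor, hC.h_hor _ x hx v hv, hC.W_hor x hx v hv]

end Domain

end Config

/-! ### Smoothness and parallel transport of the frame of a configuration. -/

namespace Config

variable {C : Config} {U : Set (Fin 2 → ℝ)} {I : Set ℝ} {kappa : ℝ}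
  {m₀ : (Fin 2 → ℝ) → Fin 2 → ℂ}
  {η : (Fin 2 → ℝ) → Fin 2 → ℝ} (hC : C.Good U I kappa m₀ η) (hU : IsOpen U) (hI : IsOpen I)

theorem rseg_mem {p : Pt} (hp : p ∈ C.dom U I) :
    ∀ t ∈ Set.Icc (0 : ℝ) 1, rseg p t ∈ C.dom U I := fun _ ht => rseg_mem_dom hp ht

include hC in
theorem smooth_w' (A : Fin 2) : ContDiffOn ℝ ∞ (C.w A) (C.dom U I) :=
  (hC.smooth_w A).mono dom_sub_cyl

include hC in
theorem smooth_mh (A : Fin 2) : ContDiffOn ℝ ∞ (C.mh A) (C.dom U I) := by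
  have hd : ContDiffOn ℝ ∞ C.del (C.dom U I) := (smooth_del hC).mono dom_sub_cyl
  fin_cases A
  · exact ((smooth_w' hC 1).neg).mul (hd.inv fun p hp => del_ne hp)
  · exact (smooth_w' hC 0).mul (hd.inv fun p hp => del_ne hp)

include hC hU hI in
theorem smooth_pd_w (A : Fin 2) : ContDiffOn ℝ ∞ (pd 3 (C.w A)) (C.dom U I) :=
  pd_smooth (dom_isOpen hC hU hI) (smooth_w' hC A) 3

include hC hU hI in
theorem smooth_psi : ContDiffOn ℝ ∞ C.psi (C.dom U I) :=
  Complex.imCLM.contDiff.comp_contDiffOn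
    (((conj_smooth (smooth_pd_w hC hU hI 0)).mul (smooth_mh hC 0)).add
      ((conj_smooth (smooth_pd_w hC hU hI 1)).mul (smooth_mh hC 1)))

include hC hU hI in
theorem smooth_rad {F : Type*} [NormedAddCommGroup F] [NormedSpace ℝ F] {f : Pt → F}
    (hf : ContDiffOn ℝ ∞ f (C.dom U I)) : ContDiffOn ℝ ∞ (rad f) (C.dom U I) :=
  rad_smooth (dom_isOpen hC hU hI) (fun _ hp => rseg_mem hp) hf

include hC hU hI in
theorem pd_rad' {F : Type*} [NormedAddCommGroup F] [NormedSpace ℝ F] [CompleteSpace F] {f : Pt → F}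
    (hf : ContDiffOn ℝ ∞ f (C.dom U I)) {p : Pt} (hp : p ∈ C.dom U I) : pd 3 (rad f) p = f p :=
  pd_rad (dom_isOpen hC hU hI) (fun _ hp => rseg_mem hp) hf hp

include hC hU hI in
theorem smooth_phase : ContDiffOn ℝ ∞ C.phase (C.dom U I) :=
  (contDiffOn_const.mul (ofReal_smooth (smooth_rad hC hU hI (smooth_psi hC hU hI)))).cexp

include hC hU hI in
theorem smooth_pw (A : Fin 2) : ContDiffOn ℝ ∞ (C.pw A) (C.dom U I) :=
  (smooth_phase hC hU hI).mul (smooth_w' hC A)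

include hC hU hI in
theorem smooth_mt (A : Fin 2) : ContDiffOn ℝ ∞ (C.mt A) (C.dom U I) :=
  (smooth_phase hC hU hI).mul (smooth_mh hC A)

include hC in
theorem smooth_h' (A : Fin 2) : ContDiffOn ℝ ∞ (fun p => (C.h A p : ℂ)) (C.dom U I) :=
  ofReal_smooth ((hC.smooth_h A).mono dom_sub_cyl)

include hC hU hI in
theorem smooth_zrate : ContDiffOn ℝ ∞
    (fun q => pd 3 (C.h 0) q * C.mt 0 q + pd 3 (C.h 1) q * C.mt 1 q) (C.dom U I) :=
  have h : ∀ A, ContDiffOn ℝ ∞ (fun q => ((pd 3 (C.h A) q : ℝ) : ℂ)) (C.dom U I) := fun A =>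
    ofReal_smooth (pd_smooth (dom_isOpen hC hU hI) ((hC.smooth_h A).mono dom_sub_cyl) 3)
  ((h 0).mul (smooth_mt hC hU hI 0)).add ((h 1).mul (smooth_mt hC hU hI 1))

include hC hU hI in
theorem smooth_z : ContDiffOn ℝ ∞ C.z (C.dom U I) :=
  contDiffOn_const.mul (smooth_rad hC hU hI (smooth_zrate hC hU hI))

include hC hU hI in
theorem smooth_lt (A : Fin 2) : ContDiffOn ℝ ∞ (C.lt A) (C.dom U I) :=
  contDiffOn_const.mul (Complex.reCLM.contDiff.comp_contDiffOn
    ((conj_smooth (smooth_z hC hU hI)).mul (smooth_mt hC hU hI A)))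

include hC hU hI in
theorem smooth_m (i : Fin 4) : ContDiffOn ℝ ∞ (fun p => C.m p i) (C.dom U I) := by
  fin_cases i
  · exact smooth_mt hC hU hI 0
  · exact smooth_mt hC hU hI 1
  · exact contDiffOn_const
  · exact (((smooth_h' hC 0).mul (smooth_mt hC hU hI 0)).add
      ((smooth_h' hC 1).mul (smooth_mt hC hU hI 1))).neg.sub (smooth_z hC hU hI)

include hC hU hI in
theorem smooth_l (i : Fin 4) : ContDiffOn ℝ ∞ (fun p => C.l p i) (C.dom U I) := by
  have hh : ∀ A, ContDiffOn ℝ ∞ (C.h A) (C.dom U I) := fun A => (hC.smooth_h A).mono dom_sub_cyl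
  have hz : ContDiffOn ℝ ∞ (fun p => Complex.normSq (C.z p)) (C.dom U I) := by
    have h1 := Complex.reCLM.contDiff.comp_contDiffOn (smooth_z hC hU hI)
    have h2 := Complex.imCLM.contDiff.comp_contDiffOn (smooth_z hC hU hI)
    exact (h1.mul h1).add (h2.mul h2)
  fin_cases i
  · exact smooth_lt hC hU hI 0
  · exact smooth_lt hC hU hI 1
  · exact contDiffOn_const
  · exact contDiffOn_const.mul ((((hC.smooth_W.mono dom_sub_cyl)).add (contDiffOn_const.mul
      (((hh 0).mul (smooth_lt hC hU hI 0)).add ((hh 1).mul (smooth_lt hC hU hI 1))))).add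
      (contDiffOn_const.mul hz))

include hC in
theorem smooth_g (a b : Fin 4) : ContDiffOn ℝ ∞ (fun p => C.g p a b) (C.dom U I) := by
  have hq : ∀ A B : Fin 2, ContDiffOn ℝ ∞ (fun p => 2 * (C.w A p * conj (C.w B p)).re)
      (C.dom U I) := fun A B => contDiffOn_const.mul
    (Complex.reCLM.contDiff.comp_contDiffOn ((smooth_w' hC A).mul (conj_smooth (smooth_w' hC B))))
  have hh : ∀ A, ContDiffOn ℝ ∞ (C.h A) (C.dom U I) := fun A => (hC.smooth_h A).mono dom_sub_cyl
  fin_cases a <;> fin_cases b <;>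
    first
    | exact hq _ _
    | exact hh _
    | exact hC.smooth_W.mono dom_sub_cyl
    | exact contDiffOn_const

include hC hU hI in
theorem pd_phase {p : Pt} (hp : p ∈ C.dom U I) :
    pd 3 C.phase p = C.phase p * (Complex.I * C.psi p) := by
  have hr := smooth_rad hC hU hI (smooth_psi hC hU hI)
  have hd := (differentiableAt_of_smooth (dom_isOpen hC hU hI) hr hp).hasFDerivAt
  have h1 := ((Complex.ofRealCLM.hasFDerivAt.comp p hd).const_mul Complex.I).cexp
  have h2 := congrArg (fun T => T (Pi.single 3 1)) h1.fderiv
  have h3 : pd 3 (rad C.psi) p = C.psi p := pd_rad' hC hU hI (smooth_psi hC hU hI) hp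
  unfold pd at h3 ⊢
  refine h2.trans ?_
  simp [h3, phase]

include hC hU hI in
theorem pd_z {p : Pt} (hp : p ∈ C.dom U I) : pd 3 C.z p
    = -(1 / 2) * (pd 3 (C.h 0) p * C.mt 0 p + pd 3 (C.h 1) p * C.mt 1 p) := by
  have hr := smooth_rad hC hU hI (smooth_zrate hC hU hI)
  have hd := (differentiableAt_of_smooth (dom_isOpen hC hU hI) hr hp).hasFDerivAt
  have h2 := congrArg (fun T => T (Pi.single 3 1)) (hd.const_mul (-(1 / 2) : ℂ)).fderiv
  have h3 := pd_rad' hC hU hI (smooth_zrate hC hU hI) hp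
  rw [← h3]
  exact h2

include hC hU hI in
theorem pd_pw (A : Fin 2) {p : Pt} (hp : p ∈ C.dom U I) : pd 3 (C.pw A) p
    = C.phase p * (Complex.I * C.psi p * C.w A p + pd 3 (C.w A) p) := by
  have h1 := differentiableAt_of_smooth (dom_isOpen hC hU hI) (smooth_phase hC hU hI) hp
  have h2 := differentiableAt_of_smooth (dom_isOpen hC hU hI) (smooth_w' hC A) hp
  have h3 := pd_phase hC hU hI hp
  have h4 : pd 3 (C.pw A) p = C.phase p * pd 3 (C.w A) p + C.w A p * pd 3 C.phase p := by
    unfold pd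
    change fderiv ℝ (fun q => C.phase q * C.w A q) p _ = _
    rw [fderiv_fun_mul h1 h2]
    simp
  rw [h4, h3]; ring

include hC hU hI in
-- A phase with rate `ψ` shifts `∂_r w̄(m)` by `-iψ`. As `ψ` is defined as the imaginary part of
-- that quantity for the unrotated frame, the result is real, which is the gauge condition.
theorem gauge {p : Pt} (hp : p ∈ C.dom U I) :
    conj (pd 3 (C.pw 0) p) * C.mt 0 p + conj (pd 3 (C.pw 1) p) * C.mt 1 p
      = pd 3 (C.pw 0) p * conj (C.mt 0 p) + pd 3 (C.pw 1) p * conj (C.mt 1 p) := by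
  have hd := C.isDual_mh (del_ne hp)
  set s := conj (pd 3 (C.w 0) p) * C.mh 0 p + conj (pd 3 (C.w 1) p) * C.mh 1 p with hs
  have him : s - conj s = 2 * Complex.I * C.psi p := by
    rw [Complex.sub_conj]
    simp only [psi, ← hs]
    push_cast; ring
  have hs' : conj s = pd 3 (C.w 0) p * conj (C.mh 0 p) + pd 3 (C.w 1) p * conj (C.mh 1 p) := by
    simp [hs]
  rw [pd_pw hC hU hI 0 hp, pd_pw hC hU hI 1 hp]
  simp only [mt, map_mul, map_add, Complex.conj_I, Complex.conj_ofReal]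
  rw [hs'] at him
  linear_combination (C.phase p * conj (C.phase p)) * him
    - Complex.I * C.psi p * (C.phase p * conj (C.phase p)) * (hd.bM + hd.wN)



theorem ev_con {Ω : TopologicalSpace.Opens Pt} (p : Ω) (q : Fin 4 → Fin 4 → SmAlg Ω)
    (u v : Fin 4 → SmAlg Ω) : SmAlg.ev p (con q u v)
      = con (fun i j => SmAlg.ev p (q i j)) (fun i => SmAlg.ev p (u i)) fun i => SmAlg.ev p (v i) := by
  simp only [con, map_sum, map_mul]

include hC hU hI in
theorem parallel {p : Pt} (hp : p ∈ C.dom U I) (a : Fin 4) :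
    pd 3 (fun q => C.m q a) p = -∑ b, (chr C.g a 3 b p : ℂ) * C.m p b ∧
    pd 3 (fun q => (C.l q a : ℂ)) p = -∑ b, (chr C.g a 3 b p : ℂ) * C.l p b := by
  have hO := dom_isOpen hC hU hI
  let Ω : TopologicalSpace.Opens Pt := ⟨C.dom U I, hO⟩
  let w : Fin 2 → SmAlg Ω := fun A => SmAlg.mk (C.pw A) (smooth_pw hC hU hI A)
  let b : Fin 2 → SmAlg Ω := fun A =>
    SmAlg.mk (fun q => conj (C.pw A q)) (conj_smooth (smooth_pw hC hU hI A))
  let M : Fin 2 → SmAlg Ω := fun A => SmAlg.mk (C.mt A) (smooth_mt hC hU hI A)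
  let N : Fin 2 → SmAlg Ω := fun A =>
    SmAlg.mk (fun q => conj (C.mt A q)) (conj_smooth (smooth_mt hC hU hI A))
  let h : Fin 2 → SmAlg Ω := fun A => SmAlg.mk (fun q => (C.h A q : ℂ)) (smooth_h' hC A)
  let W : SmAlg Ω := SmAlg.mk (fun q => (C.W q : ℂ)) (ofReal_smooth (hC.smooth_W.mono dom_sub_cyl))
  let Z : SmAlg Ω := SmAlg.mk C.z (smooth_z hC hU hI)
  let Zb : SmAlg Ω := SmAlg.mk (fun q => conj (C.z q)) (conj_smooth (smooth_z hC hU hI))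
  let half : SmAlg Ω := SmAlg.mk (fun _ => 1 / 2) contDiffOn_const
  let d : Derivation ℤ (SmAlg Ω) (SmAlg Ω) := SmAlg.derivation 3
  have hdual : IsDual w b M N := by
    have hh := fun q : Ω => C.isDual (del_ne q.2)
    exact ⟨SmAlg.ext fun q => (hh q).wM, SmAlg.ext fun q => (hh q).wN, SmAlg.ext fun q => (hh q).bM,
      SmAlg.ext fun q => (hh q).bN, SmAlg.ext fun q => (hh q).c00, SmAlg.ext fun q => (hh q).c01,
      SmAlg.ext fun q => (hh q).c10, SmAlg.ext fun q => (hh q).c11⟩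
  have th : 2 * half = 1 := by
    ext q
    change (2 : ℂ) * (1 / 2) = 1
    norm_num
  have dh : d half = 0 := by
    ext q
    refine (SmAlg.derivation_val (F := fun _ => 1 / 2) (fun _ => rfl) 3 q).trans ?_
    simp [pd]; rfl
  have dw : ∀ A q, SmAlg.ev q (d (w A)) = pd 3 (C.pw A) q := fun A q =>
    SmAlg.derivation_val (F := C.pw A) (fun _ => rfl) 3 q
  have db : ∀ A q, SmAlg.ev q (d (b A)) = conj (pd 3 (C.pw A) q) := fun A q =>
    (SmAlg.derivation_val (F := fun q => conj (C.pw A q)) (fun _ => rfl) 3 q).trans (pd_conj 3 _ _)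
  have dhr : ∀ A q, SmAlg.ev q (d (h A)) = (pd 3 (C.h A) q : ℝ) := fun A q =>
    SmAlg.derivation_val_real (F := C.h A) (fun _ => rfl) 3 q
  have hg : IsDual.Gauge d w b M N := by
    refine SmAlg.ext fun q => ?_
    rw [← SmAlg.ev_apply, ← SmAlg.ev_apply]
    simp only [map_add, map_mul, dw, db]
    exact gauge hC hU hI q.2
  have dZ : d Z = -half * (d (h 0) * M 0 + d (h 1) * M 1) := by
    refine SmAlg.ext fun q => ?_
    refine (SmAlg.derivation_val (F := C.z) (fun _ => rfl) 3 q).trans ?_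
    rw [pd_z hC hU hI q.2, ← SmAlg.ev_apply]
    simp only [map_add, map_mul, map_neg, dhr]
    rfl
  have dZb : d Zb = -half * (d (h 0) * N 0 + d (h 1) * N 1) := by
    refine SmAlg.ext fun q => ?_
    refine (SmAlg.derivation_val (F := fun q => conj (C.z q)) (fun _ => rfl) 3 q).trans ?_
    rw [pd_conj, pd_z hC hU hI q.2, ← SmAlg.ev_apply]
    simp only [map_add, map_mul, map_neg, dhr, Complex.conj_ofReal, map_div₀, map_one, map_ofNat]
    rfl
  let P : Ω := ⟨p, hp⟩
  have vm : ∀ i (q : Ω), SmAlg.ev q (mvec h M Z i) = C.m q i := by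
    intro i q; fin_cases i <;> rfl
  have vmb : ∀ i (q : Ω), SmAlg.ev q (mvec h N Zb i) = conj (C.m q i) := by
    intro i q
    refine Eq.trans ?_ (congrFun (C.conj_m q) i).symm
    fin_cases i <;> rfl
  have vl : ∀ i (q : Ω), SmAlg.ev q (lvec h (fun A => Zb * M A + Z * N A) W half (Z * Zb) i)
      = C.l q i := by
    intro i q
    refine Eq.trans ?_ (congrFun (C.l_cast q) i).symm
    fin_cases i <;> rfl
  have vg : ∀ i j (q : Ω), (gmat w b h W i j).1 q = C.g q i j := by
    intro i j q
    refine Eq.trans ?_ (C.g_cast' q i j).symm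
    fin_cases i <;> fin_cases j <;> rfl
  have vdg : ∀ i j (q : Ω), SmAlg.ev q (d (gmat w b h W i j)) = (pd 3 (fun q => C.g q i j) q : ℝ) :=
    fun i j q => SmAlg.derivation_val_real (F := fun q => C.g q i j) (fun q => vg i j q) 3 q
  have key := sum_chr_3 C.g_symm C.g_3 (m := C.m p) (n := fun i => conj (C.m p i))
    (l := fun i => (C.l p i : ℂ)) (C.gi_eq (del_ne hp))
  have vh : ∀ q : Ω, SmAlg.ev q half = 1 / 2 := fun _ => rfl
  constructor
  · have e := congrArg (SmAlg.ev P) (hdual.parallel_m h W Z Zb half d th hg dZ (Z * Zb) a)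
    refine (SmAlg.derivation_val (F := fun q => C.m q a) (fun q => vm a q) 3 P).symm.trans
      (e.trans ?_)
    rw [key]
    simp only [map_mul, map_add, map_neg, apply_ite (SmAlg.ev P), map_zero, ev_con, vm, vmb, vl,
      vdg, vh]
    ring
  · have e := congrArg (SmAlg.ev P) (hdual.parallel_l h W Z Zb half d th dh hg dZ dZb a)
    refine (SmAlg.derivation_val (F := fun q => (C.l q a : ℂ)) (fun q => vl a q) 3 P).symm.trans
      (e.trans ?_)
    rw [key]
    simp only [map_mul, map_add, map_neg, apply_ite (SmAlg.ev P), map_zero, ev_con, vm, vmb, vl,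
      vdg, vh]
    ring

end Config

/-! ### The component conditions for a configuration. -/

namespace Config

variable {C : Config} {U : Set (Fin 2 → ℝ)} {I : Set ℝ} {kappa : ℝ}
  {m₀ : (Fin 2 → ℝ) → Fin 2 → ℂ}
  {η : (Fin 2 → ℝ) → Fin 2 → ℝ} (hC : C.Good U I kappa m₀ η) (hU : IsOpen U) (hI : IsOpen I)
  (G Lam : ℝ)

include hC hU hI in
theorem m_dragged {x : Fin 2 → ℝ} (hx : x ∈ U) {v : ℝ} (hv : v ∈ I) (i : Fin 4) :
    pd 2 (fun q => C.m q i) (hpt x v) = 0 := by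
  have h1 := hasDerivAt_hpt (differentiableAt_of_smooth (dom_isOpen hC hU hI)
    (smooth_m hC hU hI i) (hpt_mem_dom hC hx hv))
  have h2 : HasDerivAt (fun w => C.m (hpt x w) i) 0 v := by
    refine (hasDerivAt_const v ((![m₀ x 0, m₀ x 1, 0, 0] : Fin 4 → ℂ) i)).congr_of_eventuallyEq ?_
    filter_upwards [hI.mem_nhds hv] with w hw
    rw [m_hor hC hx hw]
  exact h1.unique h2

include hC hU hI in
theorem pre : Pre U I kappa (C.nbhd U I G Lam) where
  isOpen := dom_isOpen hC hU hI
  horizon_mem _ hx _ hv := hpt_mem_dom hC hx hv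
  smooth := smooth_g hC
  symm p _ := C.g_symm p
  unit p hp := (C.lorentz (del_ne hp)).isUnit_det
  g3 p _ := C.g_3 p
  null x hx v hv i hi := by
    fin_cases i
    · exact hC.h_hor 0 x hx v hv
    · exact hC.h_hor 1 x hx v hv
    · exact hC.W_hor x hx v hv
    · exact absurd rfl hi
  grav x hx v hv := hC.W_grav x hx v hv
  smooth_m := smooth_m hC hU hI
  smooth_l := smooth_l hC hU hI
  m_2 _ _ := rfl
  gi_eq p hp := C.gi_eq (del_ne hp)
  par_m p hp a := (parallel hC hU hI hp a).1
  par_l p hp a := (parallel hC hU hI hp a).2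
  m_3 x hx v hv := congrFun (m_hor hC hx hv) 3
  l_hor x hx v hv a := by
    refine (congrArg (fun r : ℝ => (r : ℂ)) (l_hor hC hx hv a)).trans ?_
    split_ifs <;> simp
  m_dragged x hx v hv i := m_dragged hC hU hI hx hv i
  null_m p hp := C.mm (del_ne hp)

end Config

/-! ### Connection and curvature on the horizon in coordinates. -/

section Horizon

variable {U : Set (Fin 2 → ℝ)} {I : Set ℝ} {kappa : ℝ} {S : Nbhd} (P : Pre U I kappa S)
  (hU : IsOpen U) (hI : IsOpen I)

namespace Pre

include P hU hI in
theorem chr_33 {p : Pt} (hp : p ∈ S.dom) (a : Fin 4) : chr S.g a 3 3 p = 0 := by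
  have h := P.Gam_val ⟨S.dom, P.isOpen⟩ le_rfl hU hI P.horizon_mem a 3 3 ⟨p, hp⟩
  rw [Bondi.Gam_33] at h
  exact Complex.ofReal_eq_zero.1 h.symm

include P hU hI in
theorem chr_22 {x : Fin 2 → ℝ} (hx : x ∈ U) {v : ℝ} (hv : v ∈ I) (a : Fin 4) :
    chr S.g a 2 2 (hpt x v) = if a = 2 then kappa else 0 := by
  have hv' := fun a => P.Gam_val ⟨S.dom, P.isOpen⟩ le_rfl hU hI P.horizon_mem a 2 2
    ⟨hpt x v, P.horizon_mem x hx v hv⟩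
  set B := P.toBondi ⟨S.dom, P.isOpen⟩ le_rfl hU hI P.horizon_mem with hB
  have h0 : ∀ a, B.Gam a 2 2 ∈ (SmAlg.hdiff ⟨S.dom, P.isOpen⟩ hU hI P.horizon_mem).I →
      chr S.g a 2 2 (hpt x v) = 0 := by
    intro a ha
    have := (hv' a).symm.trans (ha x hx v hv)
    exact_mod_cast this
  fin_cases a
  · exact h0 0 (B.Gam_C2_mem 0 2 (by decide) (by decide) (by decide))
  · exact h0 1 (B.Gam_C2_mem 1 2 (by decide) (by decide) (by decide))
  · have h := hv' 2
    rw [Bondi.Gam_2, ← SmAlg.ev_apply, map_neg, map_mul] at h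
    have h1 : SmAlg.ev ⟨hpt x v, P.horizon_mem x hx v hv⟩
        ((SmAlg.hdiff ⟨S.dom, P.isOpen⟩ hU hI P.horizon_mem).D 3 (B.g 2 2))
        = (pd 3 (fun q => S.g q 2 2) (hpt x v) : ℝ) :=
      SmAlg.derivation_val_real (F := fun q => S.g q 2 2) (fun _ => rfl) 3 _
    rw [h1, P.grav x hx v hv] at h
    have h2 : SmAlg.ev ⟨hpt x v, P.horizon_mem x hx v hv⟩
        (SmAlg.hdiff ⟨S.dom, P.isOpen⟩ hU hI P.horizon_mem).half = 1 / 2 := rfl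
    rw [h2] at h
    have h3 : (chr S.g 2 2 2 (hpt x v) : ℂ) = (kappa : ℝ) := by
      rw [← h]; push_cast; ring
    simpa using (show chr S.g 2 2 2 (hpt x v) = kappa by exact_mod_cast h3)
  · exact h0 3 (B.Gam_3_mem 2 2 (by decide) (by decide))

include P hU hI in
theorem pd_2_g {x : Fin 2 → ℝ} (hx : x ∈ U) {v : ℝ} (hv : v ∈ I) (a b : Fin 4) :
    pd 2 (fun q => S.g q a b) (hpt x v) = 0 := by
  have h := P.stat_gR ⟨S.dom, P.isOpen⟩ le_rfl hU hI P.horizon_mem a b x hx v hv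
  have h1 := SmAlg.derivation_val_real (f := P.gR ⟨S.dom, P.isOpen⟩ le_rfl a b)
    (F := fun q => S.g q a b) (fun _ => rfl) 2 ⟨hpt x v, P.horizon_mem x hx v hv⟩
  have := h1.symm.trans h
  exact_mod_cast this

include P hU hI in
/-- The components `R_{a2}` on the horizon. -/
theorem ric_2_hor {x : Fin 2 → ℝ} (hx : x ∈ U) {v : ℝ} (hv : v ∈ I) (a : Fin 4) (ha : a ≠ 3) :
    ric S.g (hpt x v) a 2 = -(1 / 2) * pd 2 (pd 3 (fun q => S.g q 2 a)) (hpt x v) := by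
  have h := (P.toBondi ⟨S.dom, P.isOpen⟩ le_rfl hU hI P.horizon_mem).Ric_2_mem a ha x hx v hv
  rw [← SmAlg.ev_apply, map_add, map_mul, SmAlg.ev_apply, Ric_val] at h
  have h1 : SmAlg.ev ⟨hpt x v, P.horizon_mem x hx v hv⟩
      ((SmAlg.hdiff ⟨S.dom, P.isOpen⟩ hU hI P.horizon_mem).D 2
        ((SmAlg.hdiff ⟨S.dom, P.isOpen⟩ hU hI P.horizon_mem).D 3
        ((P.toBondi ⟨S.dom, P.isOpen⟩ le_rfl hU hI P.horizon_mem).g 2 a)))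
      = (pd 2 (pd 3 (fun q => S.g q 2 a)) (hpt x v) : ℝ) :=
    SmAlg.derivation_val_real (SmAlg.derivation_val_real (F := fun q => S.g q 2 a)
      (fun _ => rfl) 3) 2 _
  have h2 : SmAlg.ev ⟨hpt x v, P.horizon_mem x hx v hv⟩
      (SmAlg.hdiff ⟨S.dom, P.isOpen⟩ hU hI P.horizon_mem).half = 1 / 2 := rfl
  rw [h1, h2] at h
  have h3 : ((ric S.g (hpt x v) a 2 : ℝ) : ℂ)
      = ((-(1 / 2) * pd 2 (pd 3 (fun q => S.g q 2 a)) (hpt x v) : ℝ) : ℂ) := by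
    push_cast
    linear_combination h
  exact_mod_cast h3

include P hU hI in
theorem scal_hor {x : Fin 2 → ℝ} (hx : x ∈ U) {v : ℝ} (hv : v ∈ I) :
    scal S.g (hpt x v) = 2 * ric S.g (hpt x v) 2 3
      + 2 * (bil (ric S.g (hpt x v)) (S.m (hpt x v)) (S.mbar (hpt x v))).re := by
  have h := (P.toFrame ⟨S.dom, P.isOpen⟩ le_rfl hU hI P.horizon_mem).scal_mem x hx v hv
  rw [← SmAlg.ev_apply, map_sub, map_sub, map_mul, map_mul, map_ofNat, SmAlg.ev_apply,
    SmAlg.ev_apply, SmAlg.ev_apply, Ric_val, Scal_val,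
    con_val _ _ _ (P.Ric_val ⟨S.dom, P.isOpen⟩ le_rfl hU hI P.horizon_mem)] at h
  change _ - _ - 2 * bil (ric S.g (hpt x v)) (S.m (hpt x v)) (S.mbar (hpt x v)) = 0 at h
  have := congrArg Complex.re h
  simp at this
  linarith

include P hU hI in
theorem ric_symm {p : Pt} (hp : p ∈ S.dom) (a b : Fin 4) : ric S.g p a b = ric S.g p b a := by
  have h := congrArg (SmAlg.ev ⟨p, hp⟩)
    ((P.toBondi ⟨S.dom, P.isOpen⟩ le_rfl hU hI P.horizon_mem).Ric_symm a b)
  rw [SmAlg.ev_apply, SmAlg.ev_apply, Ric_val, Ric_val] at h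
  exact_mod_cast h

end Pre

end Horizon

/-! ### The Einstein equation and the energy condition for a configuration. -/

namespace Config

variable {C : Config} {U : Set (Fin 2 → ℝ)} {I : Set ℝ} {kappa : ℝ}
  {m₀ : (Fin 2 → ℝ) → Fin 2 → ℂ}
  {η : (Fin 2 → ℝ) → Fin 2 → ℝ} (hC : C.Good U I kappa m₀ η) (hU : IsOpen U) (hI : IsOpen I)
  {G Lam : ℝ} (hG : 0 < G)

theorem g_norm (p : Pt) (X : Fin 4 → ℝ) (h3 : X 3 = 0) (h0 : ∀ A, C.h A p = 0) (hW : C.W p = 0) :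
    ∑ i, ∑ j, C.g p i j * X i * X j = 2 * Complex.normSq (C.w 0 p * X 0 + C.w 1 p * X 1) := by
  simp [Fin.sum_univ_four, g, h3, h0, hW, Complex.normSq_apply]
  ring

include hG in
theorem einstein {p : Pt} : ric C.g p - (scal C.g p / 2) • C.g p + Lam • C.g p
    = (8 * Real.pi * G) • (C.nbhd U I G Lam).T p := by
  have : 8 * Real.pi * G ≠ 0 := by positivity
  rw [nbhd, smul_smul, mul_inv_cancel₀ this, one_smul]

include hC hU hI in
-- For `a ≠ 3` both `g_{a2}` and `R_{a2}` vanish, the latter because the configuration has `∂_r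
-- g_{2a}` independent of `v`. For `a = 3`, `R = 2R_{23} + 2R(m, m̄)` leaves `R(m, m̄) - Λ` alone.
theorem T_2 {x : Fin 2 → ℝ} (hx : x ∈ U) {v : ℝ} (hv : v ∈ I) (a : Fin 4) :
    (C.nbhd U I G Lam).T (hpt x v) a 2 = if a = 3 then -(8 * Real.pi * G)⁻¹ *
      ((bil (ric C.g (hpt x v)) (C.m (hpt x v)) (fun i => conj (C.m (hpt x v) i))).re - Lam)
      else 0 := by
  have P := pre hC hU hI G Lam
  have hp := P.horizon_mem x hx v hv
  have hT : (C.nbhd U I G Lam).T (hpt x v) a 2 = (8 * Real.pi * G)⁻¹ * (ric C.g (hpt x v) a 2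
      - (scal C.g (hpt x v) / 2) * C.g (hpt x v) a 2 + Lam * C.g (hpt x v) a 2) := rfl
  rw [hT]
  have hn : a ≠ 3 → C.g (hpt x v) a 2 = 0 := fun ha =>
    (C.g_symm _ _ _).trans (P.null x hx v hv a ha)
  have hr := P.ric_2_hor hU hI hx hv a
  change a ≠ 3 → ric C.g (hpt x v) a 2 = _ at hr
  by_cases ha : a = 3
  · subst ha
    have hs := P.scal_hor hU hI hx hv
    have hy := P.ric_symm hU hI hp 3 2
    change scal C.g _ = 2 * ric C.g _ 2 3 + 2 * (bil (ric C.g _) (C.m _)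
      (fun i => conj (C.m (hpt x v) i))).re at hs
    change ric C.g _ 3 2 = ric C.g _ 2 3 at hy
    rw [if_pos rfl, hs, hy, C.g_3]
    simp only [if_true]
    ring
  · rw [if_neg ha, hn ha, hr ha]
    have : pd 2 (pd 3 (fun q => C.g q 2 a)) (hpt x v) = 0 := by
      have h1 := hasDerivAt_hpt (differentiableAt_of_smooth (dom_isOpen hC hU hI)
          (pd_smooth (dom_isOpen hC hU hI) (smooth_g hC 2 a) 3) hp)
      have hc : ∀ c : ℝ, (∀ w ∈ I, pd 3 (fun q => C.g q 2 a) (hpt x w) = c) →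
          pd 2 (pd 3 (fun q => C.g q 2 a)) (hpt x v) = 0 := fun c h => by
        refine h1.unique ((hasDerivAt_const v c).congr_of_eventuallyEq ?_)
        filter_upwards [hI.mem_nhds hv] with w hw
        exact h w hw
      fin_cases a
      · exact hc _ fun w hw => hC.h_grad 0 x hx w hw
      · exact hc _ fun w hw => hC.h_grad 1 x hx w hw
      · exact hc _ fun w hw => hC.W_grav x hx w hw
      · exact absurd rfl ha
    change (8 * Real.pi * G)⁻¹ * (-(1 / 2) * pd 2 (pd 3 (fun q => C.g q 2 a)) (hpt x v) - _ + _) = 0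
    rw [this]; ring

include hC hU hI hG in
/-- The neighbourhood of a configuration that satisfies the energy condition. -/
theorem isNEHNbhd (hE : ∀ x ∈ U, ∀ v ∈ I, Lam ≤ (bil (ric C.g (hpt x v)) (C.m (hpt x v))
    (fun i => conj (C.m (hpt x v) i))).re) : (C.nbhd U I G Lam).IsNEHNbhd U I G Lam kappa := by
  have P := pre hC hU hI G Lam
  refine ⟨⟨P.isOpen, P.horizon_mem, ?_, P.smooth, fun p hp => C.lorentz (del_ne hp),
    fun p hp => einstein hG⟩, ⟨P.null, ?_, ?_, ?_⟩, ⟨?_, ?_⟩, ?_⟩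
  · exact fun p hp => ⟨(dom_sub_cyl hp).1, (dom_sub_cyl hp).2, fun t ht => rseg_mem_dom hp ht⟩
  · intro x hx v hv
    refine Finset.sum_eq_zero fun A _ => Finset.sum_eq_zero fun B _ => ?_
    rw [P.pd_2_g hU hI hx hv, mul_zero]
  · intro x hx v hv X h3 hn hX
    have hp := P.horizon_mem x hx v hv
    change ∑ i, ∑ j, C.g (hpt x v) i j * X i * X j = 0 at hn
    change FutureCausal (C.g (hpt x v)) _ _ at hX
    change FutureCausal (C.g (hpt x v)) _
      (-((C.g (hpt x v))⁻¹.mulVec (((C.nbhd U I G Lam).T (hpt x v)).mulVec X)))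
    have hh := fun A => hC.h_hor A x hx v hv
    have hW := hC.W_hor x hx v hv
    rw [g_norm _ X h3 hh hW] at hn
    -- On the horizon the norm of a tangent vector is `2 |w(X)|²`. Hence a null tangent vector is
    -- annihilated by `w` and its conjugate, and nondegeneracy leaves only the `∂_v` component.
    have hz : C.w 0 (hpt x v) * X 0 + C.w 1 (hpt x v) * X 1 = 0 := by
      rw [← Complex.normSq_eq_zero]; linarith
    have hzb := congrArg conj hz
    simp only [map_add, map_mul, Complex.conj_ofReal, map_zero] at hzb
    have hd := del_ne hp
    have x0 : X 0 = 0 := by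
      have : C.del (hpt x v) * X 0 = 0 := by
        rw [del]; linear_combination conj (C.w 1 (hpt x v)) * hz - C.w 1 (hpt x v) * hzb
      exact_mod_cast (mul_eq_zero.1 this).resolve_left hd
    have x1 : X 1 = 0 := by
      have : C.del (hpt x v) * X 1 = 0 := by
        rw [del]; linear_combination C.w 0 (hpt x v) * hzb - conj (C.w 0 (hpt x v)) * hz
      exact_mod_cast (mul_eq_zero.1 this).resolve_left hd
    have x2 : 0 ≤ X 2 := by
      have := hX.2
      simp [Fin.sum_univ_four, g, h3, hh, hW] at this
      linarith
    set e := (bil (ric C.g (hpt x v)) (C.m (hpt x v))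
      (fun i => conj (C.m (hpt x v) i))).re - Lam with he
    -- The current is a multiple of `∂_v`, with sign that of `R(m, m̄) - Λ`; the hypothesis `hE` is
    -- therefore what makes it future oriented.
    have hTX : ((C.nbhd U I G Lam).T (hpt x v)).mulVec X
        = (C.g (hpt x v)).mulVec (Pi.single 2 (-(8 * Real.pi * G)⁻¹ * e * X 2)) := by
      ext a
      simp only [Matrix.mulVec, dotProduct, Fin.sum_univ_four, x0, x1, h3, T_2 hC hU hI hx hv]
      have := P.null x hx v hv a
      change a ≠ 3 → C.g (hpt x v) 2 a = 0 at this
      rw [C.g_symm _ a 2]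
      by_cases ha : a = 3
      · subst ha
        have g23 : C.g (hpt x v) 2 3 = 1 := by rw [C.g_symm, C.g_3]; simp
        simp [he, g23]
      · simp [ha, this ha]
    rw [hTX, Matrix.mulVec_mulVec, Matrix.nonsing_inv_mul _ (C.lorentz hd).isUnit_det,
      Matrix.one_mulVec]
    have hc : 0 ≤ (8 * Real.pi * G)⁻¹ * e * X 2 := by
      have := hE x hx v hv
      have h8 : 0 < 8 * Real.pi * G := by positivity
      refine mul_nonneg (mul_nonneg (inv_nonneg.2 h8.le) ?_) x2
      rw [he]; linarith
    constructor
    · simp [Fin.sum_univ_four, g, hW]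
    · simp [Fin.sum_univ_four, g, hh, hW] at hc ⊢
      exact hc
  · intro x hx v hv
    ext a
    have hc := P.chr_22 hU hI hx hv a
    have : ∀ b a, pd b (fun q => dv q a) (hpt x v) = 0 := by intro b a; simp [pd, dv]
    simp only [cov, this]
    by_cases ha : a = 2
    · subst ha; simp [dv, Fin.sum_univ_four, hc]
    · simp [dv, Fin.sum_univ_four, hc, ha]
  · exact fun x _ v _ i => C.g_3 _ i
  · intro p hp
    ext a
    rw [Pre.cov_n]
    simp [Fin.sum_univ_four, nvec, P.chr_33 hU hI hp]
  · refine ⟨P.smooth_m, P.smooth_l, P.null_m, fun p hp => C.mmb (del_ne hp), fun p hp => C.mn,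
      fun p hp => C.ml (del_ne hp), fun p hp => C.ll (del_ne hp), fun p hp => C.nl, ?_,
      fun x hx v hv => ⟨rfl, P.m_3 x hx v hv⟩, P.m_dragged, ?_, ?_⟩
    · intro x hx v hv
      ext a
      rw [P.l_hor x hx v hv]
      by_cases h : a = 2
      · subst h; simp [dv]
      · simp [dv, h]
    · intro p hp
      ext a
      have := P.par_m p hp a
      simp only [Fin.sum_univ_four] at this
      simp [cov, nvec, Fin.sum_univ_four, this]
      ring
    · intro p hp
      ext a
      have := P.par_l p hp a
      simp only [Fin.sum_univ_four] at this
      simp [cov, nvec, Fin.sum_univ_four, this]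
      ring

end Config

/-! ### The change of the curvature under a change of the jet of the metric -/

/-- The difference of the `k`-th radial derivatives of the metrics of two neighbourhoods. -/
noncomputable def Nbhd.jetDiff (S S' : Nbhd) (k : ℕ) : Field2 := fun p => Matrix.of fun a b =>
  dr k (fun q => S'.g q a b) p - dr k (fun q => S.g q a b) p

/-- The metrics of two neighbourhoods have the same radial derivatives of order less than `k` on
the horizon, and their frames agree there. -/
structure Agree (U : Set (Fin 2 → ℝ)) (I : Set ℝ) (S S' : Nbhd) (k : ℕ) : Prop where
  m : ∀ x ∈ U, ∀ v ∈ I, S'.m (hpt x v) = S.m (hpt x v)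
  jet : ∀ i < k, ∀ x ∈ U, ∀ v ∈ I, S.jetDiff S' i (hpt x v) = 0

theorem Agree.mono {U : Set (Fin 2 → ℝ)} {I : Set ℝ} {S S' : Nbhd} {k l : ℕ}
    (h : Agree U I S S' k) (hl : l ≤ k) : Agree U I S S' l :=
  ⟨h.m, fun i hi => h.jet i (by omega)⟩

theorem bil_zero (u w : Fin 4 → ℂ) : bil 0 u w = 0 := by simp [bil]

namespace Pre

variable {U : Set (Fin 2 → ℝ)} {I : Set ℝ} {kappa : ℝ} {S S' : Nbhd} (P : Pre U I kappa S)
  (P' : Pre U I kappa S') (hU : IsOpen U) (hI : IsOpen I)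

theorem con_Ric_val (Ω : TopologicalSpace.Opens Pt) (hΩS : (Ω : Set Pt) ⊆ S.dom)
    (hΩ : ∀ x ∈ U, ∀ v ∈ I, hpt x v ∈ Ω) (p : Ω) :
    (con (P.toBondi Ω hΩS hU hI hΩ).Ric (P.toFrame Ω hΩS hU hI hΩ).M
      (P.toFrame Ω hΩS hU hI hΩ).Mb).1 p = bil (ric S.g p) (S.m p) (S.mbar p) := by
  rw [con_val Ω _ _ (P.Ric_val Ω hΩS hU hI hΩ)]
  rfl

/-- The common domain of two neighbourhoods. -/
def inter (P : Pre U I kappa S) (P' : Pre U I kappa S') : TopologicalSpace.Opens Pt :=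
  ⟨S.dom ∩ S'.dom, P.isOpen.inter P'.isOpen⟩

theorem inter_left : (inter P P' : Set Pt) ⊆ S.dom := Set.inter_subset_left

theorem inter_right : (inter P P' : Set Pt) ⊆ S'.dom := Set.inter_subset_right

theorem hpt_mem_inter : ∀ x ∈ U, ∀ v ∈ I, hpt x v ∈ inter P P' := fun x hx v hv =>
  ⟨P.horizon_mem x hx v hv, P'.horizon_mem x hx v hv⟩

/-- The metric of the first neighbourhood over the functions on the common domain. -/
noncomputable abbrev B₁ := P.toBondi (inter P P') (inter_left P P') hU hI (hpt_mem_inter P P')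

/-- The metric of the second neighbourhood over the functions on the common domain. -/
noncomputable abbrev B₂ := P'.toBondi (inter P P') (inter_right P P') hU hI (hpt_mem_inter P P')

/-- The frame of the first neighbourhood. -/
noncomputable abbrev F₁ := P.toFrame (inter P P') (inter_left P P') hU hI (hpt_mem_inter P P')

/-- The frame of the second neighbourhood. -/
noncomputable abbrev F₂ := P'.toFrame (inter P P') (inter_right P P') hU hI (hpt_mem_inter P P')

/-- The smooth functions on the common domain. -/
noncomputable abbrev HH := SmAlg.hdiff (inter P P') hU hI (hpt_mem_inter P P')

variable {P P'}

theorem agree_mem {k : ℕ} (h : Agree U I S S' k) (a b : Fin 4) :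
    (B₂ P P' hU hI).g a b - (B₁ P P' hU hI).g a b ∈ (HH P P' hU hI).J k := by
  rw [HDiff.mem_J_iff]
  intro i hi x hx v hv
  have h1 := congrFun (congrFun (h.jet i hi x hx v hv) a) b
  exact (dg_val P P' _ (inter_left P P') (inter_right P P') hU hI (hpt_mem_inter P P') i a b _).trans
    (Complex.ofReal_eq_zero.2 h1)

theorem agree_Mb {k : ℕ} (h : Agree U I S S' k) (a : Fin 4) :
    (F₂ P P' hU hI).Mb a - (F₁ P P' hU hI).Mb a ∈ (HH P P' hU hI).I := by
  intro x hx v hv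
  rw [← SmAlg.ev_apply, map_sub, sub_eq_zero]
  exact congrArg conj (congrFun (h.m x hx v hv) a)

theorem agree_M {k : ℕ} (h : Agree U I S S' k) (a : Fin 4) :
    (F₂ P P' hU hI).M a - (F₁ P P' hU hI).M a ∈ (HH P P' hU hI).I := by
  intro x hx v hv
  rw [← SmAlg.ev_apply, map_sub, sub_eq_zero]
  exact congrFun (h.m x hx v hv) a

theorem con_jet_val (k : ℕ) (u w : Fin 4 → SmAlg (inter P P')) (p : inter P P') :
    (con (fun a b => ((HH P P' hU hI).D 3)^[k] ((B₂ P P' hU hI).g a b - (B₁ P P' hU hI).g a b))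
      u w).1 p = bil (S.jetDiff S' k p) (fun i => (u i).1 p) (fun i => (w i).1 p) :=
  con_val (inter P P') _ (S.jetDiff S' k) (fun a b p =>
    dg_val P P' _ (inter_left P P') (inter_right P P') hU hI (hpt_mem_inter P P') k a b p) u w p

theorem half_eval (p : inter P P') : SmAlg.ev p (HH P P' hU hI).half = 1 / 2 := rfl

section Eval

variable {x : Fin 2 → ℝ} (hx : x ∈ U) {v : ℝ} (hv : v ∈ I)

theorem iter_diff {f f' : SmAlg (inter P P')} {F F' : Pt → ℂ} (hf : ∀ p : inter P P', f.1 p = F p)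
    (hf' : ∀ p : inter P P', f'.1 p = F' p) (k : ℕ) (p : inter P P') :
    (((HH P P' hU hI).D 3)^[k] (f' - f)).1 p = dr k F' p - dr k F p := by
  rw [HDiff.iter_sub, ← SmAlg.ev_apply, map_sub]
  exact congrArg₂ (· - ·) (SmAlg.iter_val hf' k p) (SmAlg.iter_val hf k p)

include hx hv in
theorem eq_of_sub_half {a b : SmAlg (inter P P')} {A B : ℂ}
    (h : a - (HH P P' hU hI).half * b ∈ (HH P P' hU hI).I)
    (ha : a.1 ⟨hpt x v, hpt_mem_inter P P' x hx v hv⟩ = A)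
    (hb : b.1 ⟨hpt x v, hpt_mem_inter P P' x hx v hv⟩ = B) : A = 1 / 2 * B := by
  have e := h x hx v hv
  rw [← SmAlg.ev_apply, map_sub, map_mul, half_eval, SmAlg.ev_apply, SmAlg.ev_apply, ha, hb] at e
  exact sub_eq_zero.1 e

include hx hv in
theorem eq_of_add_half {a b : SmAlg (inter P P')} {A B : ℂ}
    (h : a + (HH P P' hU hI).half * b ∈ (HH P P' hU hI).I)
    (ha : a.1 ⟨hpt x v, hpt_mem_inter P P' x hx v hv⟩ = A)
    (hb : b.1 ⟨hpt x v, hpt_mem_inter P P' x hx v hv⟩ = B) : A + 1 / 2 * B = 0 := by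
  have e := h x hx v hv
  rwa [← SmAlg.ev_apply, map_add, map_mul, half_eval, SmAlg.ev_apply, SmAlg.ev_apply, ha, hb] at e

theorem jet_2_mem {k : ℕ} (h : Agree U I S S' (k + 1))
    (h2 : ∀ x ∈ U, ∀ v ∈ I, ∀ a, S.jetDiff S' (k + 1) (hpt x v) 2 a = 0) (a : Fin 4) :
    (B₂ P P' hU hI).g 2 a - (B₁ P P' hU hI).g 2 a ∈ (HH P P' hU hI).J (k + 2) := by
  refine HDiff.mem_J_succ' _ (agree_mem hU hI h 2 a) ?_
  intro x hx v hv
  exact (dg_val P P' _ (inter_left P P') (inter_right P P') hU hI (hpt_mem_inter P P')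
    (k + 1) 2 a _).trans (Complex.ofReal_eq_zero.2 (h2 x hx v hv a))

include P P' hU hI hx hv

theorem phi22_diff {k : ℕ} (h : Agree U I S S' (k + 2)) :
    dr k S'.Phi22 (hpt x v) - dr k S.Phi22 (hpt x v)
      = 1 / 2 * bil (S.jetDiff S' (k + 2) (hpt x v)) (S.m (hpt x v)) (S.mbar (hpt x v)) :=
  eq_of_sub_half hU hI hx hv (NPFrame.phi22_lead (F := F₁ P P' hU hI) (F' := F₂ P P' hU hI)
    (agree_mem hU hI h))
    (iter_diff hU hI (P.Phi22_val _ (inter_left P P') hU hI (hpt_mem_inter P P'))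
      (P'.Phi22_val _ (inter_right P P') hU hI (hpt_mem_inter P P')) k _)
    (con_jet_val hU hI (k + 2) (F₁ P P' hU hI).M (F₁ P P' hU hI).Mb _)

theorem phi21_diff {k : ℕ} (h : Agree U I S S' (k + 2)) :
    dr k S'.Phi21 (hpt x v) - dr k S.Phi21 (hpt x v)
      = 1 / 2 * (1 / 2 * (S.jetDiff S' (k + 2) (hpt x v) 2 0 * S.mbar (hpt x v) 0
        + S.jetDiff S' (k + 2) (hpt x v) 2 1 * S.mbar (hpt x v) 1)) := by
  have e := NPFrame.phi21_lead (F := F₁ P P' hU hI) (F' := F₂ P P' hU hI)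
    (agree_Mb hU hI h) (agree_mem hU hI h)
  rw [mul_assoc] at e
  refine eq_of_sub_half hU hI hx hv e
    (iter_diff hU hI (P.Phi21_val _ (inter_left P P') hU hI (hpt_mem_inter P P'))
      (P'.Phi21_val _ (inter_right P P') hU hI (hpt_mem_inter P P')) k _) ?_
  have e3 := fun b => dg_val P P' _ (inter_left P P') (inter_right P P') hU hI
    (hpt_mem_inter P P') (k + 2) 2 b ⟨hpt x v, hpt_mem_inter P P' x hx v hv⟩
  rw [← SmAlg.ev_apply, map_mul, map_add, map_mul, map_mul, half_eval, SmAlg.ev_apply,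
    SmAlg.ev_apply, SmAlg.ev_apply, SmAlg.ev_apply]
  simp only [e3]
  rfl

theorem psi4_diff {k : ℕ} (h : Agree U I S S' (k + 2)) :
    dr k S'.Psi4 (hpt x v) - dr k S.Psi4 (hpt x v)
      = 1 / 2 * bil (S.jetDiff S' (k + 2) (hpt x v)) (S.mbar (hpt x v)) (S.mbar (hpt x v)) :=
  eq_of_sub_half hU hI hx hv (NPFrame.psi4_lead (F := F₁ P P' hU hI) (F' := F₂ P P' hU hI)
    (agree_Mb hU hI h) (agree_mem hU hI h))
    (iter_diff hU hI (P.Psi4_val _ (inter_left P P') hU hI (hpt_mem_inter P P'))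
      (P'.Psi4_val _ (inter_right P P') hU hI (hpt_mem_inter P P')) k _)
    (con_jet_val hU hI (k + 2) (F₁ P P' hU hI).Mb (F₁ P P' hU hI).Mb _)

theorem scal_diff {k : ℕ} (h : Agree U I S S' (k + 2)) :
    dr k (scal S'.g) (hpt x v) - dr k (scal S.g) (hpt x v)
      = S.jetDiff S' (k + 2) (hpt x v) 2 2 := by
  have e := HDiff.iter_mem_I _ (Bondi.dScal_lead (B := B₁ P P' hU hI) (B' := B₂ P P' hU hI)
    (agree_mem hU hI h)) x hx v hv
  rw [HDiff.iter_sub, HDiff.iter_sub, ← SmAlg.ev_apply, map_sub, map_sub] at e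
  have e1 := SmAlg.iter_val_real (P.Scal_val (inter P P') (inter_left P P') hU hI
    (hpt_mem_inter P P')) k ⟨hpt x v, hpt_mem_inter P P' x hx v hv⟩
  have e2 := SmAlg.iter_val_real (P'.Scal_val (inter P P') (inter_right P P') hU hI
    (hpt_mem_inter P P')) k ⟨hpt x v, hpt_mem_inter P P' x hx v hv⟩
  have e3 := dg_val P P' _ (inter_left P P') (inter_right P P') hU hI
    (hpt_mem_inter P P') (k + 2) 2 2 ⟨hpt x v, hpt_mem_inter P P' x hx v hv⟩
  rw [← Function.iterate_succ_apply, ← Function.iterate_succ_apply] at e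
  simp only [SmAlg.ev_apply] at e
  have e4 : ((dr k (scal S'.g) (hpt x v) : ℝ) : ℂ) - (dr k (scal S.g) (hpt x v) : ℝ)
      - (S.jetDiff S' (k + 2) (hpt x v) 2 2 : ℝ) = 0 := by
    refine Eq.trans ?_ e
    exact congrArg₂ (· - ·) (congrArg₂ (· - ·) e2.symm e1.symm) e3.symm
  have e5 : dr k (scal S'.g) (hpt x v) - dr k (scal S.g) (hpt x v)
      - S.jetDiff S' (k + 2) (hpt x v) 2 2 = 0 := by exact_mod_cast e4
  linarith

/-- The operator acts on components of `X`, whereas the applications know only the scalar `X(u, w)`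
along a generator. As `u, w` are stationary on the horizon, `D2_con` allows one to contract first
and differentiate the resulting function `s`. -/
theorem con_jet_transport {k : ℕ} {u w : Fin 4 → SmAlg (inter P P')}
    (hu : ∀ a, (HH P P' hU hI).D 2 (u a) ∈ (HH P P' hU hI).I)
    (hw : ∀ a, (HH P P' hU hI).D 2 (w a) ∈ (HH P P' hU hI).I) {s : ℝ → ℂ} {s' : ℂ}
    (hs : ∀ v' (hv' : v' ∈ I), (con (fun a b => ((HH P P' hU hI).D 3)^[k + 1]
      ((B₂ P P' hU hI).g a b - (B₁ P P' hU hI).g a b)) u w).1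
        ⟨hpt x v', hpt_mem_inter P P' x hx v' hv'⟩ = s v')
    (hd : HasDerivAt s s' v) :
    (con (fun a b => (HH P P' hU hI).D 2 (((HH P P' hU hI).D 3)^[k + 1]
        ((B₂ P P' hU hI).g a b - (B₁ P P' hU hI).g a b))
      + ((k : SmAlg (inter P P')) + 1) * SmAlg.mk (fun _ => (kappa : ℂ)) contDiffOn_const
        * ((HH P P' hU hI).D 3)^[k + 1] ((B₂ P P' hU hI).g a b - (B₁ P P' hU hI).g a b)) u w).1
      ⟨hpt x v, hpt_mem_inter P P' x hx v hv⟩ = s' + (k + 1) * kappa * s v := by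
  have e := NPFrame.D2_con (X := fun a b => ((HH P P' hU hI).D 3)^[k + 1]
      ((B₂ P P' hU hI).g a b - (B₁ P P' hU hI).g a b)) hu hw
    (((k : SmAlg (inter P P')) + 1) * SmAlg.mk (fun _ => (kappa : ℂ)) contDiffOn_const) x hx v hv
  set f := con (fun a b => ((HH P P' hU hI).D 3)^[k + 1]
      ((B₂ P P' hU hI).g a b - (B₁ P P' hU hI).g a b)) u w with hf
  have h1 := hasDerivAt_hpt (SmAlg.differentiableAt_extd f
    ⟨hpt x v, hpt_mem_inter P P' x hx v hv⟩)
  have h2 : ((HH P P' hU hI).D 2 f).1 ⟨hpt x v, hpt_mem_inter P P' x hx v hv⟩ = s' := by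
    refine (SmAlg.deriv_val (SmAlg.extd_val f) 2 _).trans (h1.unique
      (hd.congr_of_eventuallyEq ?_))
    filter_upwards [hI.mem_nhds hv] with w hw
    exact (SmAlg.extd_val f ⟨hpt x w, hpt_mem_inter P P' x hx w hw⟩).symm.trans (hs w hw)
  have h3 : SmAlg.ev ⟨hpt x v, hpt_mem_inter P P' x hx v hv⟩
      (SmAlg.mk (Ω := inter P P') (fun _ => (kappa : ℂ)) contDiffOn_const) = kappa := rfl
  rw [← SmAlg.ev_apply, map_sub, map_add, map_mul, map_mul, map_add, map_natCast, map_one, h3,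
    SmAlg.ev_apply, SmAlg.ev_apply, SmAlg.ev_apply, h2, hs v hv] at e
  exact (sub_eq_zero.1 e).symm

theorem phi20_diff {k : ℕ} (h : Agree U I S S' (k + 1))
    (h2 : ∀ x ∈ U, ∀ v ∈ I, ∀ a, S.jetDiff S' (k + 1) (hpt x v) 2 a = 0) {s : ℝ → ℂ} {s' : ℂ}
    (hs : ∀ v ∈ I, bil (S.jetDiff S' (k + 1) (hpt x v)) (S.mbar (hpt x v)) (S.mbar (hpt x v)) = s v)
    (hd : HasDerivAt s s' v) :
    dr k S'.Phi20 (hpt x v) - dr k S.Phi20 (hpt x v) = 1 / 2 * (s' + (k + 1) * kappa * s v) :=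
  eq_of_sub_half hU hI hx hv (NPFrame.phi20_tangential (F := F₁ P P' hU hI) (F' := F₂ P P' hU hI)
    (agree_Mb hU hI h) (agree_mem hU hI h) (jet_2_mem hU hI h h2))
    (iter_diff hU hI (P.Phi20_val _ (inter_left P P') hU hI (hpt_mem_inter P P'))
      (P'.Phi20_val _ (inter_right P P') hU hI (hpt_mem_inter P P')) k _)
    (con_jet_transport hU hI hx hv (NPFrame.stat_Mb (F₁ P P' hU hI))
      (NPFrame.stat_Mb (F₁ P P' hU hI)) (fun v' hv' =>
      (con_jet_val hU hI (k + 1) (F₁ P P' hU hI).Mb (F₁ P P' hU hI).Mb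
        ⟨hpt x v', hpt_mem_inter P P' x hx v' hv'⟩).trans (hs v' hv')) hd)

theorem con_jet_transport_M {k : ℕ} {s : ℝ → ℂ} {s' : ℂ}
    (hs : ∀ v ∈ I, bil (S.jetDiff S' (k + 1) (hpt x v)) (S.m (hpt x v)) (S.mbar (hpt x v)) = s v)
    (hd : HasDerivAt s s' v) :
    (con (fun a b => (HH P P' hU hI).D 2 (((HH P P' hU hI).D 3)^[k + 1]
        ((B₂ P P' hU hI).g a b - (B₁ P P' hU hI).g a b))
      + ((k : SmAlg (inter P P')) + 1) * SmAlg.mk (fun _ => (kappa : ℂ)) contDiffOn_const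
        * ((HH P P' hU hI).D 3)^[k + 1] ((B₂ P P' hU hI).g a b - (B₁ P P' hU hI).g a b))
        (F₁ P P' hU hI).M (F₁ P P' hU hI).Mb).1
      ⟨hpt x v, hpt_mem_inter P P' x hx v hv⟩ = s' + (k + 1) * kappa * s v :=
  con_jet_transport hU hI hx hv (NPFrame.stat_M (F₁ P P' hU hI))
    (NPFrame.stat_Mb (F₁ P P' hU hI)) (fun v' hv' =>
      (con_jet_val hU hI (k + 1) (F₁ P P' hU hI).M (F₁ P P' hU hI).Mb
        ⟨hpt x v', hpt_mem_inter P P' x hx v' hv'⟩).trans (hs v' hv')) hd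

theorem iter_ric_diff {k : ℕ} (h : Agree U I S S' (k + 1))
    (h2 : ∀ x ∈ U, ∀ v ∈ I, ∀ a, S.jetDiff S' (k + 1) (hpt x v) 2 a = 0) {s : ℝ → ℂ} {s' : ℂ}
    (hs : ∀ v ∈ I, bil (S.jetDiff S' (k + 1) (hpt x v)) (S.m (hpt x v)) (S.mbar (hpt x v)) = s v)
    (hd : HasDerivAt s s' v) :
    dr k (fun p => bil (ric S'.g p) (S'.m p) (S'.mbar p)) (hpt x v)
      - dr k (fun p => bil (ric S.g p) (S.m p) (S.mbar p)) (hpt x v)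
      = -(s' + (k + 1) * kappa * s v) := by
  have hg := agree_mem (P := P) (P' := P') hU hI h
  have e := NPFrame.con_Ric_tangential (B := B₁ P P' hU hI) (B' := B₂ P P' hU hI) (k := k)
    (u := (F₁ P P' hU hI).M) (u' := (F₂ P P' hU hI).M) (w := (F₁ P P' hU hI).Mb)
    (w' := (F₂ P P' hU hI).Mb) hg (jet_2_mem (P := P) (P' := P') hU hI h h2)
    (F₁ P P' hU hI).M_2 (F₁ P P' hU hI).Mb_2 (F₁ P P' hU hI).M_3 (F₁ P P' hU hI).Mb_3
    (NPFrame.dM_mem (F := F₁ P P' hU hI) (F' := F₂ P P' hU hI) (agree_M hU hI h) hg)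
    (NPFrame.dMb_mem (F := F₁ P P' hU hI) (F' := F₂ P P' hU hI) (agree_Mb hU hI h) hg)
    x hx v hv
  have e3 := con_jet_transport_M (P := P) (P' := P') hU hI hx hv hs hd
  have e4 := iter_diff (P := P) (P' := P') hU hI
    (F := fun p => bil (ric S.g p) (S.m p) (S.mbar p))
    (F' := fun p => bil (ric S'.g p) (S'.m p) (S'.mbar p))
    (P.con_Ric_val hU hI (inter P P') (inter_left P P') (hpt_mem_inter P P'))
    (P'.con_Ric_val hU hI (inter P P') (inter_right P P') (hpt_mem_inter P P')) k
    ⟨hpt x v, hpt_mem_inter P P' x hx v hv⟩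
  rw [← SmAlg.ev_apply, map_add] at e
  have aux : ∀ {a c A C : ℂ}, a + c = 0 → a = A → c = C → A = -C := by
    rintro a c _ _ h rfl rfl
    exact eq_neg_of_add_eq_zero_left h
  exact aux e e4 e3

theorem ric_diff (h : Agree U I S S' 1)
    (h2 : ∀ x ∈ U, ∀ v ∈ I, ∀ a, S.jetDiff S' 1 (hpt x v) 2 a = 0) {s : ℝ → ℂ} {s' : ℂ}
    (hs : ∀ v ∈ I, bil (S.jetDiff S' 1 (hpt x v)) (S.m (hpt x v)) (S.mbar (hpt x v)) = s v)
    (hd : HasDerivAt s s' v) :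
    bil (ric S'.g (hpt x v)) (S'.m (hpt x v)) (S'.mbar (hpt x v))
      - bil (ric S.g (hpt x v)) (S.m (hpt x v)) (S.mbar (hpt x v)) = -(s' + kappa * s v) := by
  have := iter_ric_diff (P := P) (P' := P') (k := 0) hU hI hx hv h h2 hs hd
  rw [Nat.cast_zero, zero_add, one_mul] at this
  exact this

theorem mu_diff (h : Agree U I S S' 1) : S'.npMu (hpt x v) - S.npMu (hpt x v)
    + 1 / 2 * bil (S.jetDiff S' 1 (hpt x v)) (S.mbar (hpt x v)) (S.m (hpt x v)) = 0 := by
  refine eq_of_add_half hU hI hx hv (a := (F₂ P P' hU hI).npMu - (F₁ P P' hU hI).npMu)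
    (NPFrame.con_D3_lead (B := B₁ P P' hU hI) (B' := B₂ P P' hU hI) (agree_Mb hU hI h)
      (agree_M hU hI h)) ?_ (con_jet_val hU hI 1 (F₁ P P' hU hI).Mb (F₁ P P' hU hI).M _)
  rw [← SmAlg.ev_apply, map_sub]
  exact congrArg₂ (· - ·) (P'.npMu_val _ (inter_right P P') hU hI (hpt_mem_inter P P') _)
    (P.npMu_val _ (inter_left P P') hU hI (hpt_mem_inter P P') _)

theorem lam_diff (h : Agree U I S S' 1) : S'.npLam (hpt x v) - S.npLam (hpt x v)
    + 1 / 2 * bil (S.jetDiff S' 1 (hpt x v)) (S.mbar (hpt x v)) (S.mbar (hpt x v)) = 0 := by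
  refine eq_of_add_half hU hI hx hv (a := (F₂ P P' hU hI).npLam - (F₁ P P' hU hI).npLam)
    (NPFrame.con_D3_lead (B := B₁ P P' hU hI) (B' := B₂ P P' hU hI) (agree_Mb hU hI h)
      (agree_Mb hU hI h)) ?_ (con_jet_val hU hI 1 (F₁ P P' hU hI).Mb (F₁ P P' hU hI).Mb _)
  rw [← SmAlg.ev_apply, map_sub]
  exact congrArg₂ (· - ·) (P'.npLam_val _ (inter_right P P') hU hI (hpt_mem_inter P P') _)
    (P.npLam_val _ (inter_left P P') hU hI (hpt_mem_inter P P') _)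

end Eval

end Pre

/-! ### Radial Taylor coefficients on the horizon. -/

section Taylor

variable {V : Set Pt} (hV : IsOpen V)

include hV in
theorem dr_congr {F : Type*} [NormedAddCommGroup F] [NormedSpace ℝ F] {f g : Pt → F} (k : ℕ)
    (h : Set.EqOn f g V) : Set.EqOn (dr k f) (dr k g) V := by
  induction k generalizing f g with
  | zero => exact h
  | succ k ih =>
    simp only [dr, Function.iterate_succ_apply]
    exact ih fun p hp => pd_congr hV h 3 hp

include hV in
theorem dr_add {f g : Pt → ℝ} (hf : ContDiffOn ℝ ∞ f V) (hg : ContDiffOn ℝ ∞ g V) (k : ℕ) {p : Pt}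
    (hp : p ∈ V) : dr k (fun q => f q + g q) p = dr k f p + dr k g p := by
  induction k generalizing f g with
  | zero => rfl
  | succ k ih =>
    have e : Set.EqOn (pd 3 fun q => f q + g q) (fun q => pd 3 f q + pd 3 g q) V := by
      intro q hq
      unfold pd
      rw [fderiv_fun_add (differentiableAt_of_smooth hV hf hq) (differentiableAt_of_smooth hV hg hq)]
      rfl
    simp only [dr, Function.iterate_succ_apply]
    exact (dr_congr hV k e hp).trans (ih (pd_smooth hV hf 3) (pd_smooth hV hg 3))

/-- The monomial `r ^ j / j!`. -/
noncomputable def rho (j : ℕ) (p : Pt) : ℝ := p 3 ^ j / j.factorial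

theorem rho_smooth (j : ℕ) : ContDiffOn ℝ ∞ (rho j) V :=
  ((contDiff_apply ℝ ℝ (3 : Fin 4)).pow j).contDiffOn.div_const _

theorem rho_hpt {j : ℕ} (hj : j ≠ 0) (x : Fin 2 → ℝ) (v : ℝ) : rho j (hpt x v) = 0 := by
  simp [rho, hpt, hj]

theorem pd_rho (j : ℕ) (p : Pt) : pd 3 (rho (j + 1)) p = rho j p := by
  have h : HasFDerivAt (fun q : Pt => q 3) (ContinuousLinearMap.proj (R := ℝ) (3 : Fin 4)) p :=
    hasFDerivAt_apply (3 : Fin 4) p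
  have h1 := (h.pow (j + 1)).mul_const ((j + 1).factorial : ℝ)⁻¹
  have h2 : rho (j + 1) = fun q => q 3 ^ (j + 1) * ((j + 1).factorial : ℝ)⁻¹ := by
    ext q; rw [rho, div_eq_mul_inv]
  unfold pd
  rw [h2, h1.fderiv]
  have hf : (j.factorial : ℝ) ≠ 0 := by positivity
  have hj : (j : ℝ) + 1 ≠ 0 := by positivity
  simp [rho, Nat.factorial_succ]
  field_simp

include hV in
-- Adding `r^j / j!` times a smooth function changes no radial derivative below order `j` and
-- changes the one of order `j` by its value.
theorem dr_rho_mul {j i : ℕ} (hi : i ≤ j) {f : Pt → ℝ} (hf : ContDiffOn ℝ ∞ f V) {x : Fin 2 → ℝ}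
    {v : ℝ} (hp : hpt x v ∈ V) :
    dr i (fun q => rho j q * f q) (hpt x v) = if i = j then f (hpt x v) else 0 := by
  induction j generalizing i f with
  | zero =>
    obtain rfl : i = 0 := by omega
    simp [dr, rho]
  | succ j ih =>
    rcases i with _ | i
    · simp [dr, rho_hpt]
    -- One radial derivative of `r^{j+1}/(j+1)! · f` is again a normalized monomial times a smooth
    -- function, `f + r/(j+1) ∂_r f`, which equals `f` on the horizon. So the induction runs over
    -- general `f`.
    set f' : Pt → ℝ := fun q => f q + (q 3 / (j + 1)) * pd 3 f q with hf'
    have e : Set.EqOn (pd 3 fun q => rho (j + 1) q * f q) (fun q => rho j q * f' q) V := by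
      intro q hq
      have h1 := pd_rho j q
      have h2 : pd 3 (fun q => rho (j + 1) q * f q) q
          = rho (j + 1) q * pd 3 f q + f q * pd 3 (rho (j + 1)) q := by
        unfold pd
        rw [fderiv_fun_mul (differentiableAt_of_smooth hV (rho_smooth (j + 1)) hq)
          (differentiableAt_of_smooth hV hf hq)]
        simp
      have hfac : (j.factorial : ℝ) ≠ 0 := by positivity
      have hj : (j : ℝ) + 1 ≠ 0 := by positivity
      rw [h2, h1, hf']
      simp only [rho, Nat.factorial_succ]
      push_cast
      field_simp
      ring
    have hs : ContDiffOn ℝ ∞ f' V := hf.add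
      (((contDiff_apply ℝ ℝ (3 : Fin 4)).contDiffOn.div_const _).mul (pd_smooth hV hf 3))
    have := (dr_congr hV i e hp).trans (ih (by omega) hs)
    rw [dr, Function.iterate_succ_apply]
    refine this.trans ?_
    simp [hf', hpt]

end Taylor

/-- The coordinates `(x, v)` of a point. -/
def proj (p : Pt) : (Fin 2 → ℝ) × ℝ := (![p 0, p 1], p 2)

theorem proj_hpt (x : Fin 2 → ℝ) (v : ℝ) : proj (hpt x v) = (x, v) := by
  refine Prod.ext ?_ rfl
  ext j; fin_cases j <;> rfl

theorem lift_smooth {U : Set (Fin 2 → ℝ)} {I : Set ℝ} {F : Type*} [NormedAddCommGroup F]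
    [NormedSpace ℝ F] {f : (Fin 2 → ℝ) × ℝ → F} (hf : ContDiffOn ℝ ∞ f (U ×ˢ I)) :
    ContDiffOn ℝ ∞ (fun p => f (proj p)) (cyl U I) := by
  have h : ContDiff ℝ ∞ proj := by
    refine ContDiff.prodMk (contDiff_pi.2 fun i => ?_) (contDiff_apply ℝ ℝ (2 : Fin 4))
    fin_cases i
    · exact contDiff_apply ℝ ℝ (0 : Fin 4)
    · exact contDiff_apply ℝ ℝ (1 : Fin 4)
  exact hf.comp h.contDiffOn fun p hp => hp

/-! ### Change of a configuration at a given radial order. -/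

namespace Config

variable (C : Config) (j : ℕ) (a : (Fin 2 → ℝ) × ℝ → ℝ) (b c : (Fin 2 → ℝ) × ℝ → ℂ)
  (e : (Fin 2 → ℝ) × ℝ → ℝ)

/-- The coefficient of the change of the coframe. -/
noncomputable def dw (A : Fin 2) (p : Pt) : ℂ :=
  a (proj p) * C.w A (rseg p 0) + b (proj p) * conj (C.w A (rseg p 0))

/-- The change of a configuration at order `j`. -/
noncomputable def modify : Config where
  w A p := C.w A p + rho j p * C.dw a b A p
  h A p := C.h A p + rho j p * (2 * (c (proj p) * C.w A (rseg p 0)).re)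
  W p := C.W p + rho j p * e (proj p)

/-- The coefficients of the change of the metric. -/
noncomputable def coeff : Field2 := fun p =>
  let q : Fin 2 → Fin 2 → ℝ := fun A B => 2 * (C.dw a b A p * conj (C.w B p)
    + C.w A p * conj (C.dw a b B p) + rho j p * (C.dw a b A p * conj (C.dw a b B p))).re
  let h : Fin 2 → ℝ := fun A => 2 * (c (proj p) * C.w A (rseg p 0)).re
  Matrix.of ![![q 0 0, q 0 1, h 0, 0], ![q 1 0, q 1 1, h 1, 0], ![h 0, h 1, e (proj p), 0],
    ![0, 0, 0, 0]]

/-- The difference is an exact multiple of `r^j / j!`, quadratic term in the coframe change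
included, so `dr_rho_mul` gives all jets up to order `j`. -/
theorem modify_g (p : Pt) (i k : Fin 4) :
    (C.modify j a b c e).g p i k = C.g p i k + rho j p * C.coeff j a b c e p i k := by
  have key : ∀ A B, 2 * ((C.w A p + rho j p * C.dw a b A p)
      * conj (C.w B p + rho j p * C.dw a b B p)).re = 2 * (C.w A p * conj (C.w B p)).re
      + rho j p * (2 * (C.dw a b A p * conj (C.w B p)
    + C.w A p * conj (C.dw a b B p) + rho j p * (C.dw a b A p * conj (C.dw a b B p))).re) := by
    intro A B
    simp
    ring
  fin_cases i <;> fin_cases k <;>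
    first
    | exact key _ _
    | rfl
    | simp [g, coeff]

variable {C j a b c e} {U : Set (Fin 2 → ℝ)} {I : Set ℝ} {kappa : ℝ}
  {m₀ : (Fin 2 → ℝ) → Fin 2 → ℂ} {η : (Fin 2 → ℝ) → Fin 2 → ℝ} (hC : C.Good U I kappa m₀ η)
  (hU : IsOpen U) (hI : IsOpen I)
  (ha : ContDiffOn ℝ ∞ a (U ×ˢ I)) (hb : ContDiffOn ℝ ∞ b (U ×ˢ I))
  (hc : ContDiffOn ℝ ∞ c (U ×ˢ I)) (he : ContDiffOn ℝ ∞ e (U ×ˢ I))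

include hC in
theorem smooth_w0 (A : Fin 2) : ContDiffOn ℝ ∞ (fun p => C.w A (rseg p 0)) (cyl U I) := by
  have h : ContDiff ℝ ∞ fun p => rseg p 0 := rseg_smooth.comp (contDiff_id.prodMk contDiff_const)
  exact (hC.smooth_w A).comp h.contDiffOn fun p hp => rseg_mem_cyl hp 0

include hC ha hb in
theorem smooth_dw (A : Fin 2) : ContDiffOn ℝ ∞ (C.dw a b A) (cyl U I) :=
  ((ofReal_smooth (lift_smooth ha)).mul (smooth_w0 hC A)).add
    ((lift_smooth hb).mul (conj_smooth (smooth_w0 hC A)))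

include hC hc in
theorem smooth_dh (A : Fin 2) :
    ContDiffOn ℝ ∞ (fun p => 2 * (c (proj p) * C.w A (rseg p 0)).re) (cyl U I) :=
  contDiffOn_const.mul (Complex.reCLM.contDiff.comp_contDiffOn
    ((lift_smooth hc).mul (smooth_w0 hC A)))

include hC ha hb hc he in
theorem smooth_coeff (i k : Fin 4) :
    ContDiffOn ℝ ∞ (fun p => C.coeff j a b c e p i k) (cyl U I) := by
  have hq : ∀ A B : Fin 2, ContDiffOn ℝ ∞ (fun p => 2 * (C.dw a b A p * conj (C.w B p)
    + C.w A p * conj (C.dw a b B p) + rho j p * (C.dw a b A p * conj (C.dw a b B p))).re)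
      (cyl U I) := fun A B => contDiffOn_const.mul (Complex.reCLM.contDiff.comp_contDiffOn
    ((((smooth_dw hC ha hb A).mul (conj_smooth (hC.smooth_w B))).add
      ((hC.smooth_w A).mul (conj_smooth (smooth_dw hC ha hb B)))).add
      ((ofReal_smooth (rho_smooth j)).mul
        ((smooth_dw hC ha hb A).mul (conj_smooth (smooth_dw hC ha hb B))))))
  have hh := smooth_dh hC hc
  fin_cases i <;> fin_cases k <;>
    first
    | exact hq _ _
    | exact hh _
    | exact lift_smooth he
    | exact contDiffOn_const

include hU hI in
theorem pd_add_rho {f k : Pt → ℝ} (hf : ContDiffOn ℝ ∞ f (cyl U I))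
    (hk : ContDiffOn ℝ ∞ k (cyl U I)) (hj : j ≠ 0) {x : Fin 2 → ℝ} (hx : x ∈ U) {v : ℝ}
    (hv : v ∈ I) (h : j = 1 → k (hpt x v) = 0) :
    pd 3 (fun p => f p + rho j p * k p) (hpt x v) = pd 3 f (hpt x v) := by
  have hV := cyl_isOpen hU hI
  have e1 := dr_add hV hf ((rho_smooth j).mul hk) 1 (hpt_mem_cyl hx hv)
  have e2 := dr_rho_mul hV (i := 1) (j := j) (by omega) hk (hpt_mem_cyl hx hv)
  simp only [dr, Function.iterate_one] at e1 e2
  rw [e1, e2]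
  split_ifs with h1
  · rw [h h1.symm, add_zero]
  · rw [add_zero]

include hC hU hI ha hb hc he in
-- For `j ≥ 2` a change touches neither horizon values nor first derivatives. For `j = 1` the shift
-- and `W` must stay fixed, since their slopes are `π` and `κ`.
theorem good_modify (hj : j ≠ 0) (h1 : j = 1 → c = 0 ∧ e = 0) :
    (C.modify j a b c e).Good U I kappa m₀ η where
  smooth_w A := (hC.smooth_w A).add ((ofReal_smooth (rho_smooth j)).mul (smooth_dw hC ha hb A))
  smooth_h A := (hC.smooth_h A).add ((rho_smooth j).mul (smooth_dh hC hc A))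
  smooth_W := hC.smooth_W.add ((rho_smooth j).mul (lift_smooth he))
  w_m x hx v hv := by
    simpa [modify, rho_hpt hj] using hC.w_m x hx v hv
  w_mb x hx v hv := by
    simpa [modify, rho_hpt hj] using hC.w_mb x hx v hv
  h_hor A x hx v hv := by
    simpa [modify, rho_hpt hj] using hC.h_hor A x hx v hv
  h_grad A x hx v hv := by
    refine (pd_add_rho hU hI (hC.smooth_h A) (smooth_dh hC hc A) hj hx hv fun h => ?_).trans
      (hC.h_grad A x hx v hv)
    simp [(h1 h).1]
  W_hor x hx v hv := by
    simpa [modify, rho_hpt hj] using hC.W_hor x hx v hv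
  W_grav x hx v hv := by
    refine (pd_add_rho hU hI hC.smooth_W (lift_smooth he) hj hx hv fun h => ?_).trans
      (hC.W_grav x hx v hv)
    simp [(h1 h).2]

variable (G Lam : ℝ)

include hC hU hI ha hb hc he in
theorem jet_modify {i : ℕ} (hi : i ≤ j) {x : Fin 2 → ℝ} (hx : x ∈ U) {v : ℝ} (hv : v ∈ I) :
    (C.nbhd U I G Lam).jetDiff ((C.modify j a b c e).nbhd U I G Lam) i (hpt x v)
      = if i = j then C.coeff j a b c e (hpt x v) else 0 := by
  ext k l
  have hV := dom_isOpen hC hU hI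
  have hp := hpt_mem_dom hC hx hv
  have hk := (smooth_coeff (j := j) hC ha hb hc he k l).mono (dom_sub_cyl (C := C))
  have e1 := dr_add hV (smooth_g hC k l) ((rho_smooth j).mul hk) i hp
  have e2 := dr_rho_mul hV hi hk hp
  have e3 : (fun q => (C.modify j a b c e).g q k l)
      = fun q => C.g q k l + rho j q * C.coeff j a b c e q k l := by
    ext q; exact C.modify_g j a b c e q k l
  change dr i (fun q => (C.modify j a b c e).g q k l) (hpt x v)
    - dr i (fun q => C.g q k l) (hpt x v) = _
  rw [e3, e1, e2, add_sub_cancel_left]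
  split_ifs <;> rfl

include hC hU hI ha hb hc he in
theorem agree_modify (hj : j ≠ 0) (h1 : j = 1 → c = 0 ∧ e = 0) :
    Agree U I (C.nbhd U I G Lam) ((C.modify j a b c e).nbhd U I G Lam) j where
  m x hx v hv := (m_hor (good_modify hC hU hI ha hb hc he hj h1) hx hv).trans
    (m_hor hC hx hv).symm
  jet i hi x hx v hv := by
    rw [jet_modify hC hU hI ha hb hc he G Lam hi.le hx hv, if_neg hi.ne]

/-- The quadratic term carries an extra `r^j` and drops out on the horizon, which makes the response
to `a` and `b` linear. -/
theorem bil_coeff (hj : j ≠ 0) (x : Fin 2 → ℝ) (v : ℝ) {u w : Fin 4 → ℂ} (hu : u 2 = 0)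
    (hw : w 2 = 0) : bil (C.coeff j a b c e (hpt x v)) u w
      = (C.dw a b 0 (hpt x v) * u 0 + C.dw a b 1 (hpt x v) * u 1)
          * (conj (C.w 0 (hpt x v)) * w 0 + conj (C.w 1 (hpt x v)) * w 1)
        + (conj (C.dw a b 0 (hpt x v)) * u 0 + conj (C.dw a b 1 (hpt x v)) * u 1)
          * (C.w 0 (hpt x v) * w 0 + C.w 1 (hpt x v) * w 1)
        + (C.w 0 (hpt x v) * u 0 + C.w 1 (hpt x v) * u 1)
          * (conj (C.dw a b 0 (hpt x v)) * w 0 + conj (C.dw a b 1 (hpt x v)) * w 1)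
        + (conj (C.w 0 (hpt x v)) * u 0 + conj (C.w 1 (hpt x v)) * u 1)
          * (C.dw a b 0 (hpt x v) * w 0 + C.dw a b 1 (hpt x v) * w 1) := by
  have h : ∀ A B, ((2 * (C.dw a b A (hpt x v) * conj (C.w B (hpt x v))
    + C.w A (hpt x v) * conj (C.dw a b B (hpt x v)) + rho j (hpt x v) * (C.dw a b A (hpt x v)
      * conj (C.dw a b B (hpt x v)))).re : ℝ) : ℂ) = C.dw a b A (hpt x v) * conj (C.w B (hpt x v))
    + C.w A (hpt x v) * conj (C.dw a b B (hpt x v))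
    + (conj (C.dw a b A (hpt x v)) * C.w B (hpt x v)
    + conj (C.w A (hpt x v)) * C.dw a b B (hpt x v)) := by
    intro A B
    rw [ofReal_two_re, rho_hpt hj]
    simp
  simp only [bil, Fin.sum_univ_four, hu, hw, mul_zero, zero_mul, add_zero, coeff, Matrix.of_apply,
    Matrix.cons_val, h]
  simp only [Complex.ofReal_zero]
  ring

section Leading

variable {x : Fin 2 → ℝ} (hx : x ∈ U) {v : ℝ} (hv : v ∈ I) (hj : j ≠ 0)

include hC hx hv in
theorem w_frame : C.w 0 (hpt x v) * m₀ x 0 + C.w 1 (hpt x v) * m₀ x 1 = 0 ∧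
    C.w 0 (hpt x v) * conj (m₀ x 0) + C.w 1 (hpt x v) * conj (m₀ x 1) = 1 ∧
    conj (C.w 0 (hpt x v)) * m₀ x 0 + conj (C.w 1 (hpt x v)) * m₀ x 1 = 1 ∧
    conj (C.w 0 (hpt x v)) * conj (m₀ x 0) + conj (C.w 1 (hpt x v)) * conj (m₀ x 1) = 0 := by
  have h1 := hC.w_m x hx v hv
  have h2 := hC.w_mb x hx v hv
  have h3 := congrArg conj h1
  have h4 := congrArg conj h2
  simp only [map_add, map_mul, map_zero, map_one, Complex.conj_conj] at h3 h4
  exact ⟨h1, h2, h4, h3⟩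

theorem dw_hpt (A : Fin 2) : C.dw a b A (hpt x v)
    = a (x, v) * C.w A (hpt x v) + b (x, v) * conj (C.w A (hpt x v)) := by
  rw [dw, proj_hpt, rseg_hpt]

include hC hx hv in
theorem dw_frame : C.dw a b 0 (hpt x v) * m₀ x 0 + C.dw a b 1 (hpt x v) * m₀ x 1 = b (x, v) ∧
    C.dw a b 0 (hpt x v) * conj (m₀ x 0) + C.dw a b 1 (hpt x v) * conj (m₀ x 1) = a (x, v) ∧
    conj (C.dw a b 0 (hpt x v)) * m₀ x 0 + conj (C.dw a b 1 (hpt x v)) * m₀ x 1 = a (x, v) ∧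
    conj (C.dw a b 0 (hpt x v)) * conj (m₀ x 0) + conj (C.dw a b 1 (hpt x v)) * conj (m₀ x 1)
      = conj (b (x, v)) := by
  obtain ⟨h1, h2, h3, h4⟩ := w_frame hC hx hv
  simp only [dw_hpt, map_add, map_mul, Complex.conj_conj, Complex.conj_ofReal]
  refine ⟨?_, ?_, ?_, ?_⟩
  · linear_combination (a (x, v) : ℂ) * h1 + b (x, v) * h3
  · linear_combination (a (x, v) : ℂ) * h2 + b (x, v) * h4
  · linear_combination (a (x, v) : ℂ) * h3 + conj (b (x, v)) * h1
  · linear_combination (a (x, v) : ℂ) * h4 + conj (b (x, v)) * h2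

include hC hx hv hj

theorem coeff_m_mb : bil (C.coeff j a b c e (hpt x v)) ((C.nbhd U I G Lam).m (hpt x v))
    ((C.nbhd U I G Lam).mbar (hpt x v)) = 2 * a (x, v) := by
  obtain ⟨h1, h2, h3, h4⟩ := w_frame hC hx hv
  obtain ⟨d1, d2, d3, d4⟩ := dw_frame (a := a) (b := b) hC hx hv
  have hm : ∀ i, (C.nbhd U I G Lam).m (hpt x v) i = (![m₀ x 0, m₀ x 1, 0, 0] : Fin 4 → ℂ) i :=
    fun i => congrFun (m_hor hC hx hv) i
  rw [bil_coeff hj x v (hm 2) ((congrArg conj (hm 2)).trans (map_zero _))]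
  simp only [Nbhd.mbar, hm, Matrix.cons_val_zero, Matrix.cons_val_one, h1, h2, h3, h4, d1, d2, d3,
    d4]
  ring

theorem coeff_mb_m : bil (C.coeff j a b c e (hpt x v)) ((C.nbhd U I G Lam).mbar (hpt x v))
    ((C.nbhd U I G Lam).m (hpt x v)) = 2 * a (x, v) := by
  obtain ⟨h1, h2, h3, h4⟩ := w_frame hC hx hv
  obtain ⟨d1, d2, d3, d4⟩ := dw_frame (a := a) (b := b) hC hx hv
  have hm : ∀ i, (C.nbhd U I G Lam).m (hpt x v) i = (![m₀ x 0, m₀ x 1, 0, 0] : Fin 4 → ℂ) i :=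
    fun i => congrFun (m_hor hC hx hv) i
  rw [bil_coeff hj x v ((congrArg conj (hm 2)).trans (map_zero _)) (hm 2)]
  simp only [Nbhd.mbar, hm, Matrix.cons_val_zero, Matrix.cons_val_one, h1, h2, h3, h4, d1, d2, d3,
    d4]
  ring

theorem coeff_mb_mb : bil (C.coeff j a b c e (hpt x v)) ((C.nbhd U I G Lam).mbar (hpt x v))
    ((C.nbhd U I G Lam).mbar (hpt x v)) = 2 * conj (b (x, v)) := by
  obtain ⟨h1, h2, h3, h4⟩ := w_frame hC hx hv
  obtain ⟨d1, d2, d3, d4⟩ := dw_frame (a := a) (b := b) hC hx hv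
  have hm : ∀ i, (C.nbhd U I G Lam).m (hpt x v) i = (![m₀ x 0, m₀ x 1, 0, 0] : Fin 4 → ℂ) i :=
    fun i => congrFun (m_hor hC hx hv) i
  rw [bil_coeff hj x v ((congrArg conj (hm 2)).trans (map_zero _))
    ((congrArg conj (hm 2)).trans (map_zero _))]
  simp only [Nbhd.mbar, hm, Matrix.cons_val_zero, Matrix.cons_val_one, h2, h4, d2, d4]
  ring

omit hj in
theorem coeff_2_mb : (C.coeff j a b c e (hpt x v) 2 0 : ℂ) * (C.nbhd U I G Lam).mbar (hpt x v) 0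
    + (C.coeff j a b c e (hpt x v) 2 1 : ℂ) * (C.nbhd U I G Lam).mbar (hpt x v) 1 = c (x, v) := by
  obtain ⟨h1, h2, h3, h4⟩ := w_frame hC hx hv
  have hm : ∀ i, (C.nbhd U I G Lam).m (hpt x v) i = (![m₀ x 0, m₀ x 1, 0, 0] : Fin 4 → ℂ) i :=
    fun i => congrFun (m_hor hC hx hv) i
  have hk : ∀ A, ((2 * (c (x, v) * C.w A (hpt x v)).re : ℝ) : ℂ)
      = c (x, v) * C.w A (hpt x v) + conj (c (x, v)) * conj (C.w A (hpt x v)) := by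
    intro A; rw [ofReal_two_re, map_mul]
  simp only [Nbhd.mbar, hm, coeff, Matrix.of_apply, Matrix.cons_val, proj_hpt, rseg_hpt, hk]
  linear_combination c (x, v) * h2 + conj (c (x, v)) * h4

end Leading

theorem coeff_2 (hc : c = 0) (he : e = 0) (p : Pt) (k : Fin 4) :
    C.coeff j a b c e p 2 k = 0 := by
  subst hc he
  fin_cases k <;> simp [coeff]

theorem coeff_2_2 (x : Fin 2 → ℝ) (v : ℝ) : C.coeff j a b c e (hpt x v) 2 2 = e (x, v) := by
  simp [coeff, proj_hpt]

end Config

/-! ### Restrictions to the horizon -/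

theorem hpt_smooth : ContDiff ℝ ∞ fun q : (Fin 2 → ℝ) × ℝ => hpt q.1 q.2 := by
  refine contDiff_pi.2 fun i => ?_
  fin_cases i
  · exact (contDiff_apply ℝ ℝ (0 : Fin 2)).comp contDiff_fst
  · exact (contDiff_apply ℝ ℝ (1 : Fin 2)).comp contDiff_fst
  · exact contDiff_snd
  · exact contDiff_const

theorem SmAlg.dr_hpt_smooth {Ω : TopologicalSpace.Opens Pt} {U : Set (Fin 2 → ℝ)} {I : Set ℝ}
    (hΩ : ∀ x ∈ U, ∀ v ∈ I, hpt x v ∈ Ω) {f : SmAlg Ω} {F : Pt → ℂ} (h : ∀ p : Ω, f.1 p = F p)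
    (k : ℕ) : ContDiffOn ℝ ∞ (fun q => dr k F (hpt q.1 q.2)) (U ×ˢ I) :=
  ((extd_smooth ((derivation 3)^[k] f)).comp hpt_smooth.contDiffOn fun q hq =>
    hΩ q.1 hq.1 q.2 hq.2).congr fun q hq =>
      (iter_val h k ⟨_, hΩ q.1 hq.1 q.2 hq.2⟩).symm.trans (extd_val _ _)

namespace Pre

variable {U : Set (Fin 2 → ℝ)} {I : Set ℝ} {kappa : ℝ} {S : Nbhd} (P : Pre U I kappa S)
  (hU : IsOpen U) (hI : IsOpen I)

include P hU hI

theorem phi20_smooth (k : ℕ) : ContDiffOn ℝ ∞ (fun q => dr k S.Phi20 (hpt q.1 q.2)) (U ×ˢ I) :=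
  SmAlg.dr_hpt_smooth P.horizon_mem
    (P.Phi20_val ⟨S.dom, P.isOpen⟩ le_rfl hU hI P.horizon_mem) k

theorem phi21_smooth (k : ℕ) : ContDiffOn ℝ ∞ (fun q => dr k S.Phi21 (hpt q.1 q.2)) (U ×ˢ I) :=
  SmAlg.dr_hpt_smooth P.horizon_mem
    (P.Phi21_val ⟨S.dom, P.isOpen⟩ le_rfl hU hI P.horizon_mem) k

theorem phi22_smooth (k : ℕ) : ContDiffOn ℝ ∞ (fun q => dr k S.Phi22 (hpt q.1 q.2)) (U ×ˢ I) :=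
  SmAlg.dr_hpt_smooth P.horizon_mem
    (P.Phi22_val ⟨S.dom, P.isOpen⟩ le_rfl hU hI P.horizon_mem) k

theorem psi4_smooth (k : ℕ) : ContDiffOn ℝ ∞ (fun q => dr k S.Psi4 (hpt q.1 q.2)) (U ×ˢ I) :=
  SmAlg.dr_hpt_smooth P.horizon_mem
    (P.Psi4_val ⟨S.dom, P.isOpen⟩ le_rfl hU hI P.horizon_mem) k

theorem mu_smooth : ContDiffOn ℝ ∞ (fun q => S.npMu (hpt q.1 q.2)) (U ×ˢ I) :=
  SmAlg.dr_hpt_smooth P.horizon_mem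
    (P.npMu_val ⟨S.dom, P.isOpen⟩ le_rfl hU hI P.horizon_mem) 0

theorem lam_smooth : ContDiffOn ℝ ∞ (fun q => S.npLam (hpt q.1 q.2)) (U ×ˢ I) :=
  SmAlg.dr_hpt_smooth P.horizon_mem
    (P.npLam_val ⟨S.dom, P.isOpen⟩ le_rfl hU hI P.horizon_mem) 0

theorem ric_smooth : ContDiffOn ℝ ∞ (fun q => bil (ric S.g (hpt q.1 q.2)) (S.m (hpt q.1 q.2))
    (S.mbar (hpt q.1 q.2))) (U ×ˢ I) :=
  SmAlg.dr_hpt_smooth (F := fun p => bil (ric S.g p) (S.m p) (S.mbar p)) P.horizon_mem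
    (P.con_Ric_val hU hI ⟨S.dom, P.isOpen⟩ le_rfl P.horizon_mem) 0

theorem scal_smooth (k : ℕ) :
    ContDiffOn ℝ ∞ (fun q => dr k (scal S.g) (hpt q.1 q.2)) (U ×ˢ I) := by
  have hv := P.Scal_val ⟨S.dom, P.isOpen⟩ le_rfl hU hI P.horizon_mem
  refine (Complex.reCLM.contDiff.comp_contDiffOn
    (SmAlg.dr_hpt_smooth (F := fun p => ((scal S.g p : ℝ) : ℂ)) P.horizon_mem hv k)).congr
      fun q hq => ?_
  have h1 := SmAlg.iter_val (F := fun p => ((scal S.g p : ℝ) : ℂ)) hv k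
    ⟨hpt q.1 q.2, P.horizon_mem q.1 hq.1 q.2 hq.2⟩
  rw [SmAlg.iter_val_real hv k] at h1
  exact congrArg Complex.re h1

/-- The correction of `Φ₂₂` uses a real function `a`, so its imaginary part has to vanish
beforehand. The lemmas `ric_im` and `mu_im` serve the same end. -/
theorem phi22_im (k : ℕ) {p : Pt} (hp : p ∈ S.dom) : (dr k S.Phi22 p).im = 0 := by
  have hv := P.Phi22_val ⟨S.dom, P.isOpen⟩ le_rfl hU hI P.horizon_mem
  have hv' : ∀ q : (⟨S.dom, P.isOpen⟩ : TopologicalSpace.Opens Pt),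
      ((P.toFrame ⟨S.dom, P.isOpen⟩ le_rfl hU hI P.horizon_mem).Phi22).1 q
        = ((-(1 / 2) * ric S.g q 3 3 : ℝ) : ℂ) := by
    intro q
    rw [hv, Nbhd.Phi22]
    simp [bil, nvec, Fin.sum_univ_four]
  have h1 := SmAlg.iter_val hv k ⟨p, hp⟩
  rw [SmAlg.iter_val_real (F := fun p => -(1 / 2) * ric S.g p 3 3) hv' k] at h1
  rw [← h1]
  exact Complex.ofReal_im _

omit P hU hI in
theorem bil_m_mbar_im {B : Matrix (Fin 4) (Fin 4) ℝ} (hB : ∀ a b, B a b = B b a) (u : Fin 4 → ℂ) :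
    (bil B u fun i => conj (u i)).im = 0 := by
  rw [← Complex.conj_eq_iff_im, ← bil_conj, bil_symm hB]
  simp only [Complex.conj_conj]

theorem ric_im {p : Pt} (hp : p ∈ S.dom) : (bil (ric S.g p) (S.m p) (S.mbar p)).im = 0 :=
  bil_m_mbar_im (P.ric_symm hU hI hp) _

theorem mu_im {p : Pt} (hp : p ∈ S.dom) : (S.npMu p).im = 0 := by
  have h := P.npMu_val ⟨S.dom, P.isOpen⟩ le_rfl hU hI P.horizon_mem ⟨p, hp⟩
  have e : S.npMu p = -(1 / 2) * bil (Matrix.of fun a b => pd 3 (fun q => S.g q a b) p)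
      (S.mbar p) (S.m p) := by
    refine h.symm.trans ?_
    have hc := con_val ⟨S.dom, P.isOpen⟩ (fun a b => (SmAlg.hdiff ⟨S.dom, P.isOpen⟩ hU hI
        P.horizon_mem).D 3 ((P.toBondi ⟨S.dom, P.isOpen⟩ le_rfl hU hI P.horizon_mem).g a b))
      (fun p => Matrix.of fun a b => pd 3 (fun q => S.g q a b) p) (fun a b p =>
        SmAlg.derivation_val_real (F := fun q => S.g q a b) (fun _ => rfl) 3 p)
      (P.toFrame ⟨S.dom, P.isOpen⟩ le_rfl hU hI P.horizon_mem).Mb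
      (P.toFrame ⟨S.dom, P.isOpen⟩ le_rfl hU hI P.horizon_mem).M ⟨p, hp⟩
    rw [← SmAlg.ev_apply, NPFrame.npMu, map_mul, map_neg]
    exact congrArg (fun z : ℂ => -(1 / 2) * z) hc
  have hs : ∀ a b, pd 3 (fun q => S.g q a b) p = pd 3 (fun q => S.g q b a) p := fun a b =>
    pd_congr P.isOpen (fun q hq => P.symm q hq a b) 3 hp
  have h2 := bil_m_mbar_im (B := Matrix.of fun a b => pd 3 (fun q => S.g q a b) p) hs (S.m p)
  rw [bil_symm (B := Matrix.of fun a b => pd 3 (fun q => S.g q a b) p) hs] at h2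
  rw [e, show (-(1 / 2) : ℂ) = ((-(1 / 2) : ℝ) : ℂ) by norm_num, Complex.im_ofReal_mul]
  exact mul_eq_zero_of_right _ h2

theorem pi_hor {x : Fin 2 → ℝ} (hx : x ∈ U) {v : ℝ} (hv : v ∈ I) : S.npPi (hpt x v)
    = -(1 / 2) * (pd 3 (fun q => S.g q 2 0) (hpt x v) * S.mbar (hpt x v) 0
      + pd 3 (fun q => S.g q 2 1) (hpt x v) * S.mbar (hpt x v) 1) := by
  have h := (P.toFrame ⟨S.dom, P.isOpen⟩ le_rfl hU hI P.horizon_mem).npPi_eq x hx v hv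
  have h1 : ∀ a, SmAlg.ev ⟨hpt x v, P.horizon_mem x hx v hv⟩
      ((SmAlg.hdiff ⟨S.dom, P.isOpen⟩ hU hI P.horizon_mem).D 3
        ((P.toBondi ⟨S.dom, P.isOpen⟩ le_rfl hU hI P.horizon_mem).g 2 a))
      = (pd 3 (fun q => S.g q 2 a) (hpt x v) : ℝ) := fun a =>
    SmAlg.derivation_val_real (F := fun q => S.g q 2 a) (fun _ => rfl) 3 _
  have h2 := P.npPi_val ⟨S.dom, P.isOpen⟩ le_rfl hU hI P.horizon_mem
    ⟨hpt x v, P.horizon_mem x hx v hv⟩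
  rw [← SmAlg.ev_apply, map_add, map_mul, map_add, map_mul, map_mul, h1, h1, SmAlg.ev_apply] at h
  have aux : ∀ {a b A : ℂ}, a + 1 / 2 * b = 0 → a = A → A = -(1 / 2) * b := by
    rintro a b _ h rfl
    linear_combination h
  exact aux h h2

end Pre

/-! ### Quantities unchanged by a change of the metric of higher order -/

namespace Agree

variable {U : Set (Fin 2 → ℝ)} {I : Set ℝ} {kappa : ℝ} {S S' : Nbhd} (P : Pre U I kappa S)
  (P' : Pre U I kappa S') (hU : IsOpen U) (hI : IsOpen I) {K : ℕ} (h : Agree U I S S' K)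
  {x : Fin 2 → ℝ} (hx : x ∈ U) {v : ℝ} (hv : v ∈ I)

include P P' hU hI h hx hv

theorem phi22_eq {i : ℕ} (hi : i + 2 < K) :
    dr i S'.Phi22 (hpt x v) = dr i S.Phi22 (hpt x v) := by
  have e := Pre.phi22_diff (P := P) (P' := P') hU hI hx hv (k := i) (h.mono hi.le)
  rwa [h.jet _ hi x hx v hv, bil_zero, mul_zero, sub_eq_zero] at e

theorem phi21_eq {i : ℕ} (hi : i + 2 < K) :
    dr i S'.Phi21 (hpt x v) = dr i S.Phi21 (hpt x v) := by
  have e := Pre.phi21_diff (P := P) (P' := P') hU hI hx hv (k := i) (h.mono hi.le)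
  rw [h.jet _ hi x hx v hv] at e
  simpa [sub_eq_zero] using e

theorem scal_eq {i : ℕ} (hi : i + 2 < K) :
    dr i (scal S'.g) (hpt x v) = dr i (scal S.g) (hpt x v) := by
  have e := Pre.scal_diff (P := P) (P' := P') hU hI hx hv (k := i) (h.mono hi.le)
  rw [h.jet _ hi x hx v hv] at e
  simpa [sub_eq_zero] using e

theorem psi4_eq {i : ℕ} (hi : i + 2 < K) :
    dr i S'.Psi4 (hpt x v) = dr i S.Psi4 (hpt x v) := by
  have e := Pre.psi4_diff (P := P) (P' := P') hU hI hx hv (k := i) (h.mono hi.le)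
  rwa [h.jet _ hi x hx v hv, bil_zero, mul_zero, sub_eq_zero] at e

theorem phi20_eq {i : ℕ} (hi : i + 1 < K) :
    dr i S'.Phi20 (hpt x v) = dr i S.Phi20 (hpt x v) := by
  have e := Pre.phi20_diff (P := P) (P' := P') hU hI hx hv (k := i) (s := fun _ => 0) (s' := 0)
    (h.mono hi.le) (fun y hy w hw a => by rw [h.jet _ hi y hy w hw]; rfl)
    (fun w hw => by rw [h.jet _ hi x hx w hw, bil_zero]) (hasDerivAt_const v 0)
  rwa [mul_zero, add_zero, mul_zero, sub_eq_zero] at e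

theorem ric_eq (hK : 1 < K) : bil (ric S'.g (hpt x v)) (S'.m (hpt x v)) (S'.mbar (hpt x v))
    = bil (ric S.g (hpt x v)) (S.m (hpt x v)) (S.mbar (hpt x v)) := by
  have e := Pre.ric_diff (P := P) (P' := P') hU hI hx hv (s := fun _ => 0) (s' := 0)
    (h.mono hK.le) (fun y hy w hw a => by rw [h.jet _ hK y hy w hw]; rfl)
    (fun w hw => by rw [h.jet _ hK x hx w hw, bil_zero]) (hasDerivAt_const v 0)
  rwa [mul_zero, add_zero, neg_zero, sub_eq_zero] at e

theorem mu_eq (hK : 1 < K) : S'.npMu (hpt x v) = S.npMu (hpt x v) := by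
  have e := Pre.mu_diff (P := P) (P' := P') hU hI hx hv (h.mono hK.le)
  rwa [h.jet _ hK x hx v hv, bil_zero, mul_zero, add_zero, sub_eq_zero] at e

theorem lam_eq (hK : 1 < K) : S'.npLam (hpt x v) = S.npLam (hpt x v) := by
  have e := Pre.lam_diff (P := P) (P' := P') hU hI hx hv (h.mono hK.le)
  rwa [h.jet _ hK x hx v hv, bil_zero, mul_zero, add_zero, sub_eq_zero] at e

end Agree

/-! ### The initial configuration of the data. -/

namespace Data

variable (D : Data)

/-- The coframe dual to the frame of the slice. -/
noncomputable def coframe (A : Fin 2) (x : Fin 2 → ℝ) : ℂ :=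
  ![-D.m x 1, D.m x 0] A / (D.m x 0 * conj (D.m x 1) - D.m x 1 * conj (D.m x 0))

/-- The radial derivative of the shift on the horizon. -/
noncomputable def shift (x : Fin 2 → ℝ) (A : Fin 2) : ℝ := 2 * (-2 * D.pi x * D.coframe A x).re

/-- The configuration with the least radial dependence that has the given `m`, `π` and `κ`. -/
noncomputable def base : Config where
  w A p := D.coframe A (proj p).1
  h A p := p 3 * D.shift (proj p).1 A
  W p := p 3 * (-2 * D.kappa)

variable {D} {U : Set (Fin 2 → ℝ)} {I : Set ℝ} {Lam : ℝ} (hD : D.IsAdmissible U I Lam)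
  (hU : IsOpen U) (hI : IsOpen I)

namespace IsAdmissible

include hD

theorem den_ne {x : Fin 2 → ℝ} (hx : x ∈ U) :
    D.m x 0 * conj (D.m x 1) - D.m x 1 * conj (D.m x 0) ≠ 0 := by
  intro h
  refine hD.m_indep x hx ?_
  have := congrArg Complex.im h
  simp at this
  simp
  linarith

theorem smooth_m (A : Fin 2) : ContDiffOn ℝ ∞ (fun x => D.m x A) U :=
  contDiffOn_pi.1 hD.m A

theorem smooth_coframe (A : Fin 2) : ContDiffOn ℝ ∞ (D.coframe A) U := by
  have c : ∀ A, ContDiffOn ℝ ∞ (fun x => conj (D.m x A)) U := fun A =>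
    Complex.conjCLE.contDiff.comp_contDiffOn (hD.smooth_m A)
  have h := (((hD.smooth_m 0).mul (c 1)).sub ((hD.smooth_m 1).mul (c 0))).inv
    fun x hx => hD.den_ne hx
  refine (ContDiffOn.mul ?_ h).congr fun x _ => div_eq_mul_inv _ _
  fin_cases A
  · exact (hD.smooth_m 1).neg
  · exact hD.smooth_m 0

theorem smooth_shift (A : Fin 2) : ContDiffOn ℝ ∞ (fun x => D.shift x A) U :=
  contDiffOn_const.mul (Complex.reCLM.contDiff.comp_contDiffOn
    ((contDiffOn_const.mul hD.pi).mul (hD.smooth_coframe A)))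

theorem coframe_m {x : Fin 2 → ℝ} (hx : x ∈ U) :
    D.coframe 0 x * D.m x 0 + D.coframe 1 x * D.m x 1 = 0 := by
  have := hD.den_ne hx
  simp only [coframe, Matrix.cons_val_zero, Matrix.cons_val_one]
  field_simp
  ring

theorem coframe_mb {x : Fin 2 → ℝ} (hx : x ∈ U) :
    D.coframe 0 x * conj (D.m x 0) + D.coframe 1 x * conj (D.m x 1) = 1 := by
  have := hD.den_ne hx
  simp only [coframe, Matrix.cons_val_zero, Matrix.cons_val_one]
  field_simp
  ring

omit hD in
theorem smooth_lift {F : Type*} [NormedAddCommGroup F] [NormedSpace ℝ F] {f : (Fin 2 → ℝ) → F}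
    (hf : ContDiffOn ℝ ∞ f U) : ContDiffOn ℝ ∞ (fun p => f (proj p).1) (cyl U I) :=
  lift_smooth (hf.comp contDiff_fst.contDiffOn fun _ hq => hq.1)

include hU hI

omit hD in
theorem pd_mul_lift {f : (Fin 2 → ℝ) → ℝ} (hf : ContDiffOn ℝ ∞ f U) {x : Fin 2 → ℝ} (hx : x ∈ U)
    {v : ℝ} (hv : v ∈ I) : pd 3 (fun p => p 3 * f (proj p).1) (hpt x v) = f x := by
  have h := dr_rho_mul (cyl_isOpen hU hI) (i := 1) le_rfl (smooth_lift hf) (hpt_mem_cyl hx hv)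
  simpa [rho, dr, proj_hpt] using h

theorem base_good : D.base.Good U I D.kappa D.m D.shift where
  smooth_w A := smooth_lift (hD.smooth_coframe A)
  smooth_h A := (contDiff_apply ℝ ℝ (3 : Fin 4)).contDiffOn.mul (smooth_lift (hD.smooth_shift A))
  smooth_W := (contDiff_apply ℝ ℝ (3 : Fin 4)).contDiffOn.mul contDiffOn_const
  w_m x hx v _ := by
    simpa only [base, proj_hpt] using hD.coframe_m hx
  w_mb x hx v _ := by
    simpa only [base, proj_hpt] using hD.coframe_mb hx
  h_hor A x _ v _ := by simp [base, hpt]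
  h_grad A x hx v hv := pd_mul_lift hU hI (hD.smooth_shift A) hx hv
  W_hor x _ v _ := by simp [base, hpt]
  W_grav x hx v hv := pd_mul_lift hU hI (f := fun _ => -2 * D.kappa) contDiffOn_const hx hv

/-- Every configuration over the given data has the given `π`. -/
theorem pi_eq {C : Config} (hC : C.Good U I D.kappa D.m D.shift) (G : ℝ) {x : Fin 2 → ℝ}
    (hx : x ∈ U) {v : ℝ} (hv : v ∈ I) : (C.nbhd U I G Lam).npPi (hpt x v) = D.pi x := by
  rw [(Config.pre hC hU hI G Lam).pi_hor hU hI hx hv]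
  have hg : ∀ A, ((pd 3 (C.h A) (hpt x v) : ℝ) : ℂ) = -2 * D.pi x * D.coframe A x
      + conj (-2 * D.pi x * D.coframe A x) := fun A => by
    rw [hC.h_grad A x hx v hv, shift, ofReal_two_re]
  have hm : ∀ i, (C.nbhd U I G Lam).m (hpt x v) i = (![D.m x 0, D.m x 1, 0, 0] : Fin 4 → ℂ) i :=
    fun i => congrFun (Config.m_hor hC hx hv) i
  change -(1 / 2) * (((pd 3 (C.h 0) (hpt x v) : ℝ) : ℂ) * _
    + ((pd 3 (C.h 1) (hpt x v) : ℝ) : ℂ) * _) = _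
  have h1 := congrArg conj (hD.coframe_m hx)
  simp only [map_add, map_mul, map_zero] at h1
  simp only [Nbhd.mbar, hm, hg, Matrix.cons_val_zero, Matrix.cons_val_one, map_mul, map_neg,
    map_ofNat]
  -- The shift is `-2π w_A` plus its conjugate. Contraction with `m̄` keeps only the first term,
  -- since `w(m̄) = 1` and `w̄(m̄) = 0`; hence the factor `-2` against the `-½` in `π`.
  linear_combination D.pi x * hD.coframe_mb hx + conj (D.pi x) * h1

end IsAdmissible

end Data

/-! ### The effect of a change of a configuration on the data -/

namespace Config

section Modify

variable {C : Config} {a : (Fin 2 → ℝ) × ℝ → ℝ} {b c : (Fin 2 → ℝ) × ℝ → ℂ}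
  {e : (Fin 2 → ℝ) × ℝ → ℝ} {U : Set (Fin 2 → ℝ)} {I : Set ℝ} {kappa : ℝ}
  {m₀ : (Fin 2 → ℝ) → Fin 2 → ℂ} {η : (Fin 2 → ℝ) → Fin 2 → ℝ} (hC : C.Good U I kappa m₀ η)
  (hU : IsOpen U) (hI : IsOpen I)
  (ha : ContDiffOn ℝ ∞ a (U ×ˢ I)) (hb : ContDiffOn ℝ ∞ b (U ×ˢ I))
  (hc : ContDiffOn ℝ ∞ c (U ×ˢ I)) (he : ContDiffOn ℝ ∞ e (U ×ˢ I)) (G Lam : ℝ)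
  {x : Fin 2 → ℝ} (hx : x ∈ U) {v : ℝ} (hv : v ∈ I) (k : ℕ)

include hC hU hI ha hb hc he

theorem pre_modify {j : ℕ} (hj : j ≠ 0) (h1 : j = 1 → c = 0 ∧ e = 0) :
    Pre U I kappa ((C.modify j a b c e).nbhd U I G Lam) :=
  pre (good_modify hC hU hI ha hb hc he hj h1) hU hI G Lam

theorem jet_modify_self {j : ℕ} {y : Fin 2 → ℝ} (hy : y ∈ U) {w : ℝ} (hw : w ∈ I) :
    (C.nbhd U I G Lam).jetDiff ((C.modify j a b c e).nbhd U I G Lam) j (hpt y w)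
      = C.coeff j a b c e (hpt y w) :=
  (jet_modify hC hU hI ha hb hc he G Lam le_rfl hy hw).trans (if_pos rfl)

include hx hv

theorem modify_phi22 : dr k ((C.modify (k + 2) a b c e).nbhd U I G Lam).Phi22 (hpt x v)
    = dr k (C.nbhd U I G Lam).Phi22 (hpt x v) + a (x, v) := by
  have h := Pre.phi22_diff (P := pre hC hU hI G Lam)
    (P' := pre_modify hC hU hI ha hb hc he G Lam (j := k + 2) (by omega) (by omega)) hU hI hx hv
    (agree_modify hC hU hI ha hb hc he G Lam (by omega) (by omega))
  rw [jet_modify_self hC hU hI ha hb hc he G Lam hx hv,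
    coeff_m_mb hC G Lam hx hv (by omega)] at h
  linear_combination h

theorem modify_phi21 : dr k ((C.modify (k + 2) a b c e).nbhd U I G Lam).Phi21 (hpt x v)
    = dr k (C.nbhd U I G Lam).Phi21 (hpt x v) + 1 / 4 * c (x, v) := by
  have h := Pre.phi21_diff (P := pre hC hU hI G Lam)
    (P' := pre_modify hC hU hI ha hb hc he G Lam (j := k + 2) (by omega) (by omega)) hU hI hx hv
    (agree_modify hC hU hI ha hb hc he G Lam (by omega) (by omega))
  rw [jet_modify_self hC hU hI ha hb hc he G Lam hx hv, coeff_2_mb hC G Lam hx hv] at h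
  linear_combination h

theorem modify_scal : dr k (scal ((C.modify (k + 2) a b c e).nbhd U I G Lam).g) (hpt x v)
    = dr k (scal (C.nbhd U I G Lam).g) (hpt x v) + e (x, v) := by
  have h := Pre.scal_diff (P := pre hC hU hI G Lam)
    (P' := pre_modify hC hU hI ha hb hc he G Lam (j := k + 2) (by omega) (by omega)) hU hI hx hv
    (agree_modify hC hU hI ha hb hc he G Lam (by omega) (by omega))
  rw [jet_modify_self hC hU hI ha hb hc he G Lam hx hv, coeff_2_2] at h
  linear_combination h

theorem modify_psi4 : dr k ((C.modify (k + 2) a b c e).nbhd U I G Lam).Psi4 (hpt x v)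
    = dr k (C.nbhd U I G Lam).Psi4 (hpt x v) + conj (b (x, v)) := by
  have h := Pre.psi4_diff (P := pre hC hU hI G Lam)
    (P' := pre_modify hC hU hI ha hb hc he G Lam (j := k + 2) (by omega) (by omega)) hU hI hx hv
    (agree_modify hC hU hI ha hb hc he G Lam (by omega) (by omega))
  rw [jet_modify_self hC hU hI ha hb hc he G Lam hx hv,
    coeff_mb_mb hC G Lam hx hv (by omega)] at h
  linear_combination h

theorem modify_phi20 (hc0 : c = 0) (he0 : e = 0) {b' : ℂ}
    (hd : HasDerivAt (fun w => conj (b (x, w))) b' v) :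
    dr k ((C.modify (k + 1) a b c e).nbhd U I G Lam).Phi20 (hpt x v)
      = dr k (C.nbhd U I G Lam).Phi20 (hpt x v) + (b' + (k + 1) * kappa * conj (b (x, v))) := by
  have h := Pre.phi20_diff (P := pre hC hU hI G Lam)
    (P' := pre_modify hC hU hI ha hb hc he G Lam (j := k + 1) (by omega) fun _ => ⟨hc0, he0⟩)
    hU hI hx hv (agree_modify hC hU hI ha hb hc he G Lam (by omega) fun _ => ⟨hc0, he0⟩)
    (s := fun w => 2 * conj (b (x, w)))
    (fun y hy w hw i => by
      rw [jet_modify_self hC hU hI ha hb hc he G Lam hy hw, coeff_2 hc0 he0])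
    (fun w hw => by
      rw [jet_modify_self hC hU hI ha hb hc he G Lam hx hw,
        coeff_mb_mb hC G Lam hx hw (by omega)])
    (hd.const_mul 2)
  linear_combination h

theorem modify_ric (hc0 : c = 0) (he0 : e = 0) {a' : ℝ}
    (hd : HasDerivAt (fun w => a (x, w)) a' v) :
    bil (ric ((C.modify 1 a b c e).nbhd U I G Lam).g (hpt x v))
        (((C.modify 1 a b c e).nbhd U I G Lam).m (hpt x v))
        (((C.modify 1 a b c e).nbhd U I G Lam).mbar (hpt x v))
      = bil (ric (C.nbhd U I G Lam).g (hpt x v)) ((C.nbhd U I G Lam).m (hpt x v))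
        ((C.nbhd U I G Lam).mbar (hpt x v)) - 2 * (a' + kappa * a (x, v)) := by
  have h := Pre.ric_diff (P := pre hC hU hI G Lam)
    (P' := pre_modify hC hU hI ha hb hc he G Lam (j := 1) (by omega) fun _ => ⟨hc0, he0⟩)
    hU hI hx hv (agree_modify hC hU hI ha hb hc he G Lam (by omega) fun _ => ⟨hc0, he0⟩)
    (s := fun w => 2 * (a (x, w) : ℂ))
    (fun y hy w hw i => by
      rw [jet_modify_self hC hU hI ha hb hc he G Lam hy hw, coeff_2 hc0 he0])
    (fun w hw => by
      rw [jet_modify_self hC hU hI ha hb hc he G Lam hx hw,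
        coeff_m_mb hC G Lam hx hw (by omega)])
    (hd.ofReal_comp.const_mul 2)
  linear_combination h

theorem modify_mu (hc0 : c = 0) (he0 : e = 0) :
    ((C.modify 1 a b c e).nbhd U I G Lam).npMu (hpt x v)
      = (C.nbhd U I G Lam).npMu (hpt x v) - a (x, v) := by
  have h := Pre.mu_diff (P := pre hC hU hI G Lam)
    (P' := pre_modify hC hU hI ha hb hc he G Lam (j := 1) (by omega) fun _ => ⟨hc0, he0⟩)
    hU hI hx hv (agree_modify hC hU hI ha hb hc he G Lam (by omega) fun _ => ⟨hc0, he0⟩)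
  rw [jet_modify_self hC hU hI ha hb hc he G Lam hx hv,
    coeff_mb_m hC G Lam hx hv (by omega)] at h
  linear_combination h

theorem modify_lam (hc0 : c = 0) (he0 : e = 0) :
    ((C.modify 1 a b c e).nbhd U I G Lam).npLam (hpt x v)
      = (C.nbhd U I G Lam).npLam (hpt x v) - conj (b (x, v)) := by
  have h := Pre.lam_diff (P := pre hC hU hI G Lam)
    (P' := pre_modify hC hU hI ha hb hc he G Lam (j := 1) (by omega) fun _ => ⟨hc0, he0⟩)
    hU hI hx hv (agree_modify hC hU hI ha hb hc he G Lam (by omega) fun _ => ⟨hc0, he0⟩)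
  rw [jet_modify_self hC hU hI ha hb hc he G Lam hx hv,
    coeff_mb_mb hC G Lam hx hv (by omega)] at h
  linear_combination h

end Modify

end Config

/-! ### Matching the data order by order. -/

/-- The configuration matches the data that involve the metric up to order `k + 1`. -/
structure Config.Matches (U : Set (Fin 2 → ℝ)) (I : Set ℝ) (v₀ G Lam : ℝ) (D : Data) (k : ℕ)
    (C : Config) : Prop where
  good : C.Good U I D.kappa D.m D.shift
  ric : ∀ x ∈ U, ∀ v ∈ I, bil (ric (C.nbhd U I G Lam).g (hpt x v)) ((C.nbhd U I G Lam).m (hpt x v))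
    ((C.nbhd U I G Lam).mbar (hpt x v)) = (D.scal 0 (x, v) / 4 - 2 * D.phi11 (x, v) : ℝ)
  mu : ∀ x ∈ U, (C.nbhd U I G Lam).npMu (hpt x v₀) = D.mu x
  lam : ∀ x ∈ U, (C.nbhd U I G Lam).npLam (hpt x v₀) = D.lam x
  psi4 : ∀ i < k, ∀ x ∈ U, dr i (C.nbhd U I G Lam).Psi4 (hpt x v₀) = D.psi4 i x
  phi21 : ∀ i < k, ∀ x ∈ U, ∀ v ∈ I,
    dr i (C.nbhd U I G Lam).Phi21 (hpt x v) = D.phi21 i (x, v)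
  phi22 : ∀ i < k, ∀ x ∈ U, ∀ v ∈ I,
    dr i (C.nbhd U I G Lam).Phi22 (hpt x v) = D.phi22 i (x, v)
  scal : ∀ i < k, ∀ x ∈ U, ∀ v ∈ I,
    dr i (NEH.scal (C.nbhd U I G Lam).g) (hpt x v) = D.scal i (x, v)
  phi20 : ∀ i ≤ k, ∀ x ∈ U, ∀ v ∈ I,
    dr i (C.nbhd U I G Lam).Phi20 (hpt x v) = D.phi20 i (x, v)

namespace Config

variable {C C' : Config} {U : Set (Fin 2 → ℝ)} {I : Set ℝ} {v₀ G Lam : ℝ} {D : Data} {k : ℕ}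
  (hD : D.IsAdmissible U I Lam) (hU : IsOpen U) (hI : IsOpen I) (hI' : I.OrdConnected)
  (hv₀ : v₀ ∈ I)

include hU hI hv₀ in
-- The quantities matched at stage `k` depend on the metric only through order `k + 1`, so a change
-- at order `k + 2` preserves them.
theorem Matches.of_agree (M : C.Matches U I v₀ G Lam D k) (g : C'.Good U I D.kappa D.m D.shift)
    (h : Agree U I (C.nbhd U I G Lam) (C'.nbhd U I G Lam) (k + 2)) :
    C'.Matches U I v₀ G Lam D k := by
  have P := pre M.good hU hI G Lam
  have P' := pre g hU hI G Lam
  exact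
  { good := g
    ric := fun x hx v hv => (h.ric_eq P P' hU hI hx hv (by omega)).trans (M.ric x hx v hv)
    mu := fun x hx => (h.mu_eq P P' hU hI hx hv₀ (by omega)).trans (M.mu x hx)
    lam := fun x hx => (h.lam_eq P P' hU hI hx hv₀ (by omega)).trans (M.lam x hx)
    psi4 := fun i hi x hx =>
      (h.psi4_eq P P' hU hI hx hv₀ (i := i) (by omega)).trans (M.psi4 i hi x hx)
    phi21 := fun i hi x hx v hv =>
      (h.phi21_eq P P' hU hI hx hv (i := i) (by omega)).trans (M.phi21 i hi x hx v hv)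
    phi22 := fun i hi x hx v hv =>
      (h.phi22_eq P P' hU hI hx hv (i := i) (by omega)).trans (M.phi22 i hi x hx v hv)
    scal := fun i hi x hx v hv =>
      (h.scal_eq P P' hU hI hx hv (i := i) (by omega)).trans (M.scal i hi x hx v hv)
    phi20 := fun i hi x hx v hv =>
      (h.phi20_eq P P' hU hI hx hv (i := i) (by omega)).trans (M.phi20 i hi x hx v hv) }

theorem horizon_slice {F : Type*} [NormedAddCommGroup F] [NormedSpace ℝ F]
    {f : (Fin 2 → ℝ) × ℝ → F} (hf : ContDiffOn ℝ ∞ f (U ×ˢ I)) (hv₀ : v₀ ∈ I) :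
    ContDiffOn ℝ ∞ (fun x => f (x, v₀)) U :=
  hf.comp (contDiff_id.prodMk contDiff_const).contDiffOn fun _ hx => ⟨hx, hv₀⟩

include hD hU hI hI' hv₀ in
theorem exists_matches_zero : ∃ C : Config, C.Matches U I v₀ G Lam D 0 := by
  have hC := hD.base_good hU hI
  have P := pre hC hU hI G Lam
  set S := D.base.nbhd U I G Lam with hS
  -- A first-order change lowers `R(m, m̄)` by `2 (a' + κ a)` and `μ` by `a`. So `a` solves a
  -- transport equation with half the excess of `R(m, m̄)` as source and the excess of `μ` as
  -- initial value.
  obtain ⟨a, ha, ha0, had⟩ := exists_transport hU hI hI' hv₀ D.kappa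
    (σ := fun q => 1 / 2 * ((bil (NEH.ric S.g (hpt q.1 q.2)) (S.m (hpt q.1 q.2))
      (S.mbar (hpt q.1 q.2))).re - (D.scal 0 q / 4 - 2 * D.phi11 q)))
    (contDiffOn_const.mul ((Complex.reCLM.contDiff.comp_contDiffOn (P.ric_smooth hU hI)).sub
      (((hD.scal 0).div_const 4).sub (contDiffOn_const.mul hD.phi11))))
    (s₀ := fun x => (S.npMu (hpt x v₀)).re - D.mu x)
    ((Complex.reCLM.contDiff.comp_contDiffOn (horizon_slice (P.mu_smooth hU hI) hv₀)).sub hD.mu)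
  -- Here `β = b̄`: the change adds `β' + κ β` to `Φ₂₀` and subtracts `β` from `λ`.
  obtain ⟨β, hβ, hβ0, hβd⟩ := exists_transport hU hI hI' hv₀ D.kappa
    (σ := fun q => D.phi20 0 q - dr 0 S.Phi20 (hpt q.1 q.2))
    ((hD.phi20 0).sub (P.phi20_smooth hU hI 0))
    (s₀ := fun x => S.npLam (hpt x v₀) - D.lam x)
    ((horizon_slice (P.lam_smooth hU hI) hv₀).sub hD.lam)
  have hb : ContDiffOn ℝ ∞ (fun q => conj (β q)) (U ×ˢ I) :=
    Complex.conjCLE.contDiff.comp_contDiffOn hβ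
  have z1 : ContDiffOn ℝ ∞ (0 : (Fin 2 → ℝ) × ℝ → ℂ) (U ×ˢ I) := contDiffOn_const
  have z2 : ContDiffOn ℝ ∞ (0 : (Fin 2 → ℝ) × ℝ → ℝ) (U ×ˢ I) := contDiffOn_const
  refine ⟨D.base.modify 1 a (fun q => conj (β q)) 0 0,
    good_modify hC hU hI ha hb z1 z2 one_ne_zero fun _ => ⟨rfl, rfl⟩, ?_, ?_, ?_, ?_, ?_, ?_, ?_, ?_⟩
  · intro x hx v hv
    rw [modify_ric hC hU hI ha hb z1 z2 G Lam hx hv rfl rfl (had x hx v hv), ← hS]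
    have him := P.ric_im hU hI (P.horizon_mem x hx v hv)
    have hre := (Complex.re_add_im (bil (NEH.ric S.g (hpt x v)) (S.m (hpt x v))
      (S.mbar (hpt x v)))).symm
    rw [him] at hre
    rw [hre]
    simp only [smul_eq_mul]
    push_cast
    simp
  · intro x hx
    rw [modify_mu hC hU hI ha hb z1 z2 G Lam hx hv₀ rfl rfl, ← hS, ha0 x hx]
    have him := P.mu_im hU hI (P.horizon_mem x hx v₀ hv₀)
    have hre := (Complex.re_add_im (S.npMu (hpt x v₀))).symm
    rw [him] at hre
    rw [hre]
    simp
  · intro x hx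
    rw [modify_lam hC hU hI ha hb z1 z2 G Lam hx hv₀ rfl rfl, ← hS, Complex.conj_conj, hβ0 x hx]
    ring
  · intro i hi; omega
  · intro i hi; omega
  · intro i hi; omega
  · intro i hi; omega
  · intro i hi x hx v hv
    obtain rfl : i = 0 := by omega
    have hd := hβd x hx v hv
    rw [← show (fun w => conj (conj (β (x, w)))) = fun w => β (x, w) from
      funext fun _ => Complex.conj_conj _] at hd
    rw [modify_phi20 hC hU hI ha hb z1 z2 G Lam hx hv 0 rfl rfl hd, ← hS, Complex.conj_conj]
    simp only [Complex.real_smul]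
    push_cast
    ring

include hD hU hI hI' hv₀ in
-- Two changes at order `k + 2`. The first corrects `Φ₂₂`, `Φ₂₁` and `R` algebraically, but may
-- disturb `∂_r^{k+1} Φ₂₀`. The second, with `a = c = e = 0`, leaves these three alone and uses the
-- one remaining function `b` for `Ψ₄` on the slice and `Φ₂₀` along the generators.
theorem Matches.exists_succ (M : C.Matches U I v₀ G Lam D k) :
    ∃ C' : Config, C'.Matches U I v₀ G Lam D (k + 1) := by
  have hC := M.good
  have P := pre hC hU hI G Lam
  have z1 : ContDiffOn ℝ ∞ (0 : (Fin 2 → ℝ) × ℝ → ℂ) (U ×ˢ I) := contDiffOn_const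
  have z2 : ContDiffOn ℝ ∞ (0 : (Fin 2 → ℝ) × ℝ → ℝ) (U ×ˢ I) := contDiffOn_const
  set S := C.nbhd U I G Lam with hS
  set a : (Fin 2 → ℝ) × ℝ → ℝ := fun q => D.phi22 k q - (dr k S.Phi22 (hpt q.1 q.2)).re with ha'
  -- The factor `4` undoes the coefficient `¼` with which `c` enters `Φ₂₁`.
  set c : (Fin 2 → ℝ) × ℝ → ℂ := fun q => 4 * (D.phi21 k q - dr k S.Phi21 (hpt q.1 q.2)) with hc'
  set e : (Fin 2 → ℝ) × ℝ → ℝ := fun q => D.scal k q - dr k (NEH.scal S.g) (hpt q.1 q.2) with he'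
  have ha : ContDiffOn ℝ ∞ a (U ×ˢ I) :=
    (hD.phi22 k).sub (Complex.reCLM.contDiff.comp_contDiffOn (P.phi22_smooth hU hI k))
  have hc : ContDiffOn ℝ ∞ c (U ×ˢ I) :=
    contDiffOn_const.mul ((hD.phi21 k).sub (P.phi21_smooth hU hI k))
  have he : ContDiffOn ℝ ∞ e (U ×ˢ I) := (hD.scal k).sub (P.scal_smooth hU hI k)
  set C₁ := C.modify (k + 2) a 0 c e with hC₁
  have g₁ : C₁.Good U I D.kappa D.m D.shift :=
    good_modify hC hU hI ha z1 hc he (by omega) (by omega)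
  have M₁ : C₁.Matches U I v₀ G Lam D k := M.of_agree hU hI hv₀ g₁
    (agree_modify hC hU hI ha z1 hc he G Lam (by omega) (by omega))
  have P₁ := pre g₁ hU hI G Lam
  have e22 : ∀ x ∈ U, ∀ v ∈ I,
      dr k (C₁.nbhd U I G Lam).Phi22 (hpt x v) = D.phi22 k (x, v) := by
    intro x hx v hv
    rw [hC₁, modify_phi22 hC hU hI ha z1 hc he G Lam hx hv, ← hS]
    have hre := (Complex.re_add_im (dr k S.Phi22 (hpt x v))).symm
    rw [P.phi22_im hU hI k (P.horizon_mem x hx v hv)] at hre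
    rw [hre]
    simp [ha']
  have e21 : ∀ x ∈ U, ∀ v ∈ I,
      dr k (C₁.nbhd U I G Lam).Phi21 (hpt x v) = D.phi21 k (x, v) := by
    intro x hx v hv
    rw [hC₁, modify_phi21 hC hU hI ha z1 hc he G Lam hx hv, ← hS]
    simp only [hc']
    ring
  have es : ∀ x ∈ U, ∀ v ∈ I,
      dr k (NEH.scal (C₁.nbhd U I G Lam).g) (hpt x v) = D.scal k (x, v) := by
    intro x hx v hv
    rw [hC₁, modify_scal hC hU hI ha z1 hc he G Lam hx hv, ← hS]
    simp only [he']
    ring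
  set S₁ := C₁.nbhd U I G Lam with hS₁
  -- The change is at order `k + 2 = (k + 1) + 1`, so `∂_r^{k+1} Φ₂₀` responds with the rate `(k +
  -- 2) κ`. The initial value is the defect of `Ψ₄`.
  obtain ⟨β, hβ, hβ0, hβd⟩ := exists_transport hU hI hI' hv₀ (((k + 1 : ℕ) + 1) * D.kappa)
    (σ := fun q => D.phi20 (k + 1) q - dr (k + 1) S₁.Phi20 (hpt q.1 q.2))
    ((hD.phi20 (k + 1)).sub (P₁.phi20_smooth hU hI (k + 1)))
    (s₀ := fun x => D.psi4 k x - dr k S₁.Psi4 (hpt x v₀))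
    ((hD.psi4 k).sub (horizon_slice (P₁.psi4_smooth hU hI k) hv₀))
  have hb : ContDiffOn ℝ ∞ (fun q => conj (β q)) (U ×ˢ I) :=
    Complex.conjCLE.contDiff.comp_contDiffOn hβ
  have M₂ : (C₁.modify (k + 2) 0 (fun q => conj (β q)) 0 0).Matches U I v₀ G Lam D k :=
    M₁.of_agree hU hI hv₀ (good_modify g₁ hU hI z2 hb z1 z2 (by omega) (by omega))
      (agree_modify g₁ hU hI z2 hb z1 z2 G Lam (by omega) (by omega))
  refine ⟨C₁.modify (k + 2) 0 (fun q => conj (β q)) 0 0,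
    M₂.good, M₂.ric, M₂.mu, M₂.lam, ?_, ?_, ?_, ?_, ?_⟩
  · intro i hi x hx
    rcases Nat.lt_succ_iff_lt_or_eq.1 hi with hi | rfl
    · exact M₂.psi4 i hi x hx
    rw [modify_psi4 g₁ hU hI z2 hb z1 z2 G Lam hx hv₀, ← hS₁, Complex.conj_conj, hβ0 x hx]
    ring
  · intro i hi x hx v hv
    rcases Nat.lt_succ_iff_lt_or_eq.1 hi with hi | rfl
    · exact M₂.phi21 i hi x hx v hv
    rw [modify_phi21 g₁ hU hI z2 hb z1 z2 G Lam hx hv, ← hS₁, e21 x hx v hv]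
    simp
  · intro i hi x hx v hv
    rcases Nat.lt_succ_iff_lt_or_eq.1 hi with hi | rfl
    · exact M₂.phi22 i hi x hx v hv
    rw [modify_phi22 g₁ hU hI z2 hb z1 z2 G Lam hx hv, ← hS₁, e22 x hx v hv]
    simp
  · intro i hi x hx v hv
    rcases Nat.lt_succ_iff_lt_or_eq.1 hi with hi | rfl
    · exact M₂.scal i hi x hx v hv
    rw [modify_scal g₁ hU hI z2 hb z1 z2 G Lam hx hv, ← hS₁, es x hx v hv]
    simp
  · intro i hi x hx v hv
    rcases Nat.le_succ_iff.1 hi with hi | rfl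
    · exact M₂.phi20 i hi x hx v hv
    have hd := hβd x hx v hv
    rw [← show (fun w => conj (conj (β (x, w)))) = fun w => β (x, w) from
      funext fun _ => Complex.conj_conj _] at hd
    have h := modify_phi20 g₁ hU hI z2 hb z1 z2 G Lam hx hv (k + 1) rfl rfl hd
    rw [Complex.conj_conj, ← hS₁] at h
    refine h.trans ?_
    simp only [Complex.real_smul]
    push_cast
    ring

include hD hU hI hI' hv₀ in
theorem exists_matches (k : ℕ) : ∃ C : Config, C.Matches U I v₀ G Lam D k := by
  induction k with
  | zero => exact exists_matches_zero hD hU hI hI' hv₀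
  | succ k ih => exact ih.elim fun C M => M.exists_succ hD hU hI hI' hv₀

end Config

/-! ### Conclusion of the existence half. -/

/-- The data are free. -/
theorem Data.IsAdmissible.exists_realizes {U : Set (Fin 2 → ℝ)} {I : Set ℝ} {v₀ G Lam : ℝ}
    {D : Data} (hD : D.IsAdmissible U I Lam) (hU : IsOpen U) (hI : IsOpen I) (hI' : I.OrdConnected)
    (hv₀ : v₀ ∈ I) (hG : 0 < G) {n : ℕ} (hn : 2 ≤ n) :
    ∃ S : Nbhd, Realizes U I G Lam v₀ n D S := by
  -- Stage `n - 1` matches `Φ₂₀` through order `n - 1` and the other radial derivatives through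
  -- order `n - 2`.
  obtain ⟨C, M⟩ := Config.exists_matches (G := G) hD hU hI hI' hv₀ (n - 1)
  have P := Config.pre M.good hU hI G Lam
  have hE : ∀ x ∈ U, ∀ v ∈ I, Lam ≤ (bil (ric C.g (hpt x v)) (C.m (hpt x v))
      (fun i => conj (C.m (hpt x v) i))).re := by
    intro x hx v hv
    exact (hD.energy x hx v hv).trans_eq (congrArg Complex.re (M.ric x hx v hv)).symm
  refine ⟨C.nbhd U I G Lam, Config.isNEHNbhd M.good hU hI hG hE, ?_,
    fun x hx => hD.pi_eq hU hI M.good G hx hv₀, M.mu, M.lam,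
    fun k hk => M.psi4 k (by omega), ?_, fun k hk => M.phi21 k (by omega),
    fun k hk => M.phi22 k (by omega), fun k hk => M.scal k (by omega),
    fun k hk => M.phi20 k (by omega)⟩
  · intro x hx A
    have h := Config.m_hor M.good hx hv₀
    fin_cases A
    · exact congrFun h 0
    · exact congrFun h 1
  · intro x hx v hv
    have h := (P.toFrame ⟨_, P.isOpen⟩ le_rfl hU hI P.horizon_mem).scal_phi11 x hx v hv
    have h1 := P.con_Ric_val hU hI ⟨_, P.isOpen⟩ le_rfl P.horizon_mem
      ⟨hpt x v, P.horizon_mem x hx v hv⟩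
    have h2 := P.Scal_val ⟨_, P.isOpen⟩ le_rfl hU hI P.horizon_mem
      ⟨hpt x v, P.horizon_mem x hx v hv⟩
    have h3 := P.Phi11_val ⟨_, P.isOpen⟩ le_rfl hU hI P.horizon_mem
      ⟨hpt x v, P.horizon_mem x hx v hv⟩
    rw [← SmAlg.ev_apply, map_sub, map_sub, map_mul, map_mul, map_mul, map_ofNat] at h
    -- The construction prescribed `R(m, m̄)` instead of `Φ₁₁`. Once `R` is matched as well, which
    -- needs `n ≥ 2`, the identity `R/4 - 2Φ₁₁ = R(m, m̄)` returns the given `Φ₁₁`.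
    have aux : ∀ {s f r S F R : ℂ}, 1 / 2 * (1 / 2) * s - 2 * f - r = 0 → s = S → f = F → r = R →
        F = 1 / 2 * (S / 4 - R) := by
      rintro s f r _ _ _ h rfl rfl rfl
      linear_combination (-1 / 2) * h
    have h4 := aux h h2 h3 (h1.trans (M.ric x hx v hv))
    refine h4.trans ?_
    have h5 := M.scal 0 (by omega) x hx v hv
    change NEH.scal (C.nbhd U I G Lam).g (hpt x v) = _ at h5
    rw [h5]
    push_cast
    ring

end NEH

theorem mainTheorem6 (U : Set (Fin 2 → ℝ)) (hU : IsOpen U) (I : Set ℝ) (hI : IsOpen I)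
    (hI' : I.OrdConnected) (v₀ : ℝ) (hv₀ : v₀ ∈ I) (G Lam : ℝ) (hG : 0 < G)
    (n : ℕ) (hn : 2 ≤ n) :
    (∀ (D : NEH.Data) (S S' : NEH.Nbhd),
      NEH.Realizes U I G Lam v₀ n D S → NEH.Realizes U I G Lam v₀ n D S' →
      ∀ k ≤ n, ∀ x ∈ U, ∀ v ∈ I, ∀ a i : Fin 4,
        NEH.dr k (fun q => S.frame a q i) (NEH.hpt x v)
          = NEH.dr k (fun q => S'.frame a q i) (NEH.hpt x v)) ∧
    (∀ D : NEH.Data, D.IsAdmissible U I Lam →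
      ∃ S : NEH.Nbhd, NEH.Realizes U I G Lam v₀ n D S) := by
  exact ⟨fun D S S' R R' k hk x hx v hv a i =>
      NEH.frame_unique hU hI hI' hv₀ hG hn R R' k hk x hx v hv a i,
    fun D hD => hD.exists_realizes hU hI hI' hv₀ hG hn⟩
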